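/- Let $k$ be an algebraically closed field of characteristic $p>0$ and let $E$ be an elliptic curve over $k$. Let $F_2$ be a rank two vector bundle on $E$ given by a non-split extension $0\to\mathcal O_E\to F_2\to\mathcal O_E\to 0$. Then there exist an integral scheme $S$, a smooth projective morphism $g\colon S\to\mathbb A^1_k$ of relative dimension $2$ with integral fibers $S_t$, effective $\mathbb Q$-divisors $\Delta$ and $\Theta$ on $S$ whose restrictions $\Delta_t,\Theta_t$ to the fibers over all $t\in k=\mathbb A^1(k)$ are defined, and a morphism of $k$-schemes $\pi\colon S\to E$, such that: 1. for every $t\in k$ the pair $(S_t,\Delta_t+\Theta_t)$ is terminal; 2. $K_S+\Delta$ is $g$-semiample and numerically trivial on the fibers of $g$; 3. $K_S+\Delta+\Theta$ is $g$-semiample and has Kodaira dimension $1$, both relative to $g$ and on every fiber: $\kappa(S_t,K_{S_t}+\Delta_t+\Theta_t)=1$ for every $t\in k$; 4. all large plurigenera jump at $t=0$: there is an $m_0$ such that for all $m\ge m_0$ and all $t\in k\setminus\{0\}$ $$h^0\bigl(S_0,\omega_{S_0}^m(\lfloor m\Delta_0+m\Theta_0\rfloor)\bigr)>h^0\bigl(S_t,\omega_{S_t}^m(\lfloor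 m\Delta_t+m\Theta_t\rfloor)\bigr);$$ 5. the family degenerates the projectivized Atiyah bundle to a product: via $\pi$, for every $t\in k\setminus\{0\}$ the surface $S_t$ is isomorphic over $E$ to the projectivization $\mathbb P(F_2)$, and $S_0$ is isomorphic over $E$ to $E\times\mathbb P^1$. -/

import Mathlib

universe u

open CategoryTheory AlgebraicGeometry Limits
open scoped KaehlerDifferential

namespace PlurigeneraJump

noncomputable section

/-! ### Rational functions on an integral scheme -/

section RationalFunctions

variable {X : Scheme.{u}} [IsIntegral X]

/-- The rational function `φ` is regular at `x`, i.e. it lies in the local ring of `X` at `x`. -/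
def RegularAt (x : X) (φ : X.functionField) : Prop :=
  ∃ a : X.presheaf.stalk x, algebraMap (X.presheaf.stalk x) X.functionField a = φ

/-- The rational function `φ` is regular and invertible at `x`. -/
def UnitAt (x : X) (φ : X.functionField) : Prop :=
  ∃ a : X.presheaf.stalk x,
    IsUnit a ∧ algebraMap (X.presheaf.stalk x) X.functionField a = φ

/-- `ψ = φ ∘ ν`: the rational function `φ` is regular at the image of the generic point of `Y`,
and its pullback along `ν` is the rational function `ψ` on `Y`. -/
def IsPullbackFunction {Y : Scheme.{u}} [IsIntegral Y] (ν : Y ⟶ X)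
    (φ : X.functionField) (ψ : Y.functionField) : Prop :=
  ∃ a : X.presheaf.stalk (ν (genericPoint Y)),
    algebraMap (X.presheaf.stalk (ν (genericPoint Y))) X.functionField a = φ ∧
      (ν.stalkMap (genericPoint Y)).hom a = ψ

variable {R : Type u} [CommRing R]

/-- The ring homomorphism `R → K(X)` given by the structure morphism of an `R`-scheme `X`. -/
def baseMap (f : X ⟶ Spec (.of R)) : R →+* X.functionField :=
  ((Scheme.ΓSpecIso (.of R)).inv ≫ f.appTop ≫
    X.presheaf.germ ⊤ (genericPoint X) trivial).hom

/-- The function field of the `R`-scheme `f : X ⟶ Spec R`, regarded as an `R`-algebra. -/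
def FunctionField (_f : X ⟶ Spec (.of R)) : Type u := X.functionField

instance (f : X ⟶ Spec (.of R)) : Field (FunctionField f) :=
  inferInstanceAs (Field X.functionField)

instance (f : X ⟶ Spec (.of R)) : Algebra R (FunctionField f) := (baseMap f).toAlgebra

end RationalFunctions

section RegularLemmas

variable {X : Scheme.{u}} [IsIntegral X]

theorem RegularAt.add {x : X} {φ ψ : X.functionField} (h₁ : RegularAt x φ)
    (h₂ : RegularAt x ψ) : RegularAt x (φ + ψ) := by
  obtain ⟨a, rfl⟩ := h₁
  obtain ⟨b, rfl⟩ := h₂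
  exact ⟨a + b, map_add _ _ _⟩

theorem RegularAt.mul {x : X} {φ ψ : X.functionField} (h₁ : RegularAt x φ)
    (h₂ : RegularAt x ψ) : RegularAt x (φ * ψ) := by
  obtain ⟨a, rfl⟩ := h₁
  obtain ⟨b, rfl⟩ := h₂
  exact ⟨a * b, map_mul _ _ _⟩

theorem regularAt_baseMap {R : Type u} [CommRing R] (f : X ⟶ Spec (.of R)) (x : X) (r : R) :
    RegularAt x (baseMap f r) := by
  have : Nonempty (⊤ : X.Opens) := ⟨⟨genericPoint X, trivial⟩⟩
  exact ⟨X.presheaf.germ ⊤ x trivial (f.appTop ((Scheme.ΓSpecIso (.of R)).inv r)),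
    Scheme.algebraMap_germ_eq_germToFunctionField X (U := ⊤) trivial _⟩

end RegularLemmas

/-! ### Divisors -/

/-- Weil `ℚ`-divisors: locally finite `ℚ`-combinations of points of codimension one. -/
def QDivisor (X : Scheme.{u}) : AddSubgroup (AlgebraicCycle X ℚ) where
  carrier := {D | ∀ x, D x ≠ 0 → Order.coheight x = 1}
  zero_mem' := fun x h => absurd rfl h
  add_mem' := by
    intro D D' h h' x hx
    by_contra hc
    have h1 : D x = 0 := by
      by_contra h0
      exact hc (h x h0)
    have h2 : D' x = 0 := by
      by_contra h0
      exact hc (h' x h0)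
    apply hx
    simp [h1, h2]
  neg_mem' := by
    intro D h x hx
    apply h x
    intro h0
    apply hx
    simp [h0]

/-- The divisor has nonnegative coefficients. -/
def IsEffective {X : Scheme.{u}} (D : QDivisor X) : Prop := ∀ x, 0 ≤ D.1 x

section Divisors

variable {X : Scheme.{u}} [IsIntegral X] [IsLocallyNoetherian X]

/-- `h` is a local equation at `x` of the Weil divisor with coefficients `D`: the divisors `D` and
`div h` have the same coefficient along every prime divisor passing through `x`. -/
def IsLocalEquation (D : X → ℚ) (x : X) (h : X.functionField) : Prop :=
  h ≠ 0 ∧ ∀ y : X, Order.coheight y = 1 → y ⤳ x → (Scheme.ord h y : ℚ) = D y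

/-- A positive multiple of `D` is Cartier near every point. -/
def IsQCartier (D : QDivisor X) : Prop :=
  ∀ x : X, ∃ N : ℕ, 0 < N ∧ ∃ h, IsLocalEquation (fun y => N * D.1 y) x h

/-- `q` is the coefficient along the prime divisor of `Y` with generic point `y` of the pullback
along `ν : Y ⟶ X` of the `ℚ`-Cartier divisor with coefficients `D`. For this the image of `ν` may
not lie in the support of `D`. -/
def IsPullbackCoeff {Y : Scheme.{u}} [IsIntegral Y] [IsLocallyNoetherian Y] (ν : Y ⟶ X)
    (D : X → ℚ) (y : Y) (q : ℚ) : Prop :=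
  ∃ N : ℕ, 0 < N ∧ ∃ (φ : X.functionField) (ψ : Y.functionField),
    IsLocalEquation (fun x => N * D x) (ν y) φ ∧ IsPullbackFunction ν φ ψ ∧ ψ ≠ 0 ∧
      (Scheme.ord ψ y : ℚ) = N * q

/-- `D'` is the pullback of the `ℚ`-Cartier divisor with coefficients `D` along `ν : Y ⟶ X`. -/
def IsPullbackDivisor {Y : Scheme.{u}} [IsIntegral Y] [IsLocallyNoetherian Y] (ν : Y ⟶ X)
    (D : X → ℚ) (D' : QDivisor Y) : Prop :=
  ∀ y : Y, Order.coheight y = 1 → IsPullbackCoeff ν D y (D'.1 y)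

/-- The degree of the `ℚ`-Cartier divisor `L` on the proper curve `ν : C ⟶ X` over an algebraically
closed field is `q`: some `ℚ`-divisor `L + (1/N) div h` linearly equivalent to `L` and not
containing the image of `C` pulls back to a divisor of degree `q` on `C`. (Closed points of `C` have
residue degree one.) -/
def HasDegreeOn {C : Scheme.{u}} [IsIntegral C] [IsLocallyNoetherian C] (ν : C ⟶ X)
    (L : QDivisor X) (q : ℚ) : Prop :=
  ∃ N : ℕ, 0 < N ∧ ∃ h : X.functionField, h ≠ 0 ∧ ∃ D : QDivisor C,
    IsPullbackDivisor ν (fun x => L.1 x + (Scheme.ord h x : ℚ) / N) D ∧ ∑ᶠ y : C, D.1 y = q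

variable {R : Type u} [CommRing R]

/-- `H⁰(X, 𝒪_X(D))` for an integral Weil divisor `D` on a normal `R`-scheme `X`: the rational
functions `s` such that, at each point `x` of codimension one, `s` times a local equation of `D` is
regular. -/
def sections (f : X ⟶ Spec (.of R)) (D : X → ℤ) : Submodule R (FunctionField f) where
  carrier := {s | ∀ x : X, Order.coheight x = 1 → ∀ h : X.functionField, h ≠ 0 →
    Scheme.ord h x = D x → RegularAt (X := X) x ((show X.functionField from s) * h)}
  zero_mem' := fun x _ h _ _ => ⟨0, by rw [map_zero]; exact (zero_mul h).symm⟩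
  add_mem' := by
    intro s t hs ht x hx h h0 hD
    have := (hs x hx h h0 hD).add (ht x hx h h0 hD)
    rw [← add_mul] at this
    exact this
  smul_mem' := by
    intro r s hs x hx h h0 hD
    have := (regularAt_baseMap f x r).mul (hs x hx h h0 hD)
    rw [← mul_assoc] at this
    exact this

/-- `⌊m L⌋`. If `L = K_X + Δ` with `K_X` a canonical divisor, then `𝒪_X(⌊m L⌋)` is
`ω_X^m(⌊m Δ⌋)`. -/
def roundDown (m : ℕ) (L : QDivisor X) : X → ℤ := fun x => ⌊(m : ℚ) * L.1 x⌋

/-- The dimension `h⁰(X, 𝒪_X(⌊m L⌋))` for a scheme `X` over a field. -/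
def h0 {k : Type u} [Field k] (f : X ⟶ Spec (.of k)) (m : ℕ) (L : QDivisor X) : Cardinal.{u} :=
  Module.rank k (sections f (roundDown m L))

/-- `L` is semiample relative to the affine base `Spec R`: for some `N > 0` the divisor `N L` is
Cartier and the line bundle `𝒪_X(N L)` is generated by its global sections. -/
def IsSemiample (f : X ⟶ Spec (.of R)) (L : QDivisor X) : Prop :=
  ∃ N : ℕ, 0 < N ∧ ∀ x : X, ∃ h : X.functionField, IsLocalEquation (fun y => N * L.1 y) x h ∧
    ∃ s ∈ sections f (roundDown N L), UnitAt (X := X) x ((show X.functionField from s) * h)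

/-- The ratios of sections of `𝒪_X(⌊m L⌋)`; these are the rational functions that generate the
function field of the image of the rational map given by the sections of `𝒪_X(⌊m L⌋)`. -/
def sectionRatios (f : X ⟶ Spec (.of R)) (m : ℕ) (L : QDivisor X) : Set (FunctionField f) :=
  {r | ∃ s ∈ sections f (roundDown m L), ∃ t ∈ sections f (roundDown m L), t ≠ 0 ∧ r = s / t}

/-- The Kodaira (Iitaka) dimension of `L` relative to `Spec R` is the number `d ≥ 0`: the largest
relative dimension of the images of the rational maps given by the sections of `𝒪_X(⌊m L⌋)`,
`m > 0`, is `d`. -/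
def HasKodairaDim (f : X ⟶ Spec (.of R)) (L : QDivisor X) (d : ℕ) : Prop :=
  IsGreatest {c : Cardinal.{u} | ∃ m : ℕ, 0 < m ∧ sections f (roundDown m L) ≠ ⊥ ∧
    c = Algebra.trdeg R (Algebra.adjoin R (sectionRatios f m L))} (d : Cardinal.{u})

/-! ### Canonical divisors -/

/-- The rational differential form `d x₁ ∧ ⋯ ∧ d xₙ` on the `R`-scheme `X`. -/
def wedge {X : Scheme.{u}} [IsIntegral X] (f : X ⟶ Spec (.of R)) (n : ℕ)
    (x : Fin n → FunctionField f) : ⋀[FunctionField f]^n (Ω[FunctionField f⁄R]) :=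
  exteriorPower.ιMulti (FunctionField f) n (fun i => KaehlerDifferential.D R (FunctionField f) (x i))

/-- The rational `n`-form `φ d x₁ ∧ ⋯ ∧ d xₙ` has order `v` along the prime divisor with generic
point `y`: it is `c` times a generator `d a₁ ∧ ⋯ ∧ d aₙ` of the module of regular `n`-forms at `y`,
where `c` has order `v`. -/
def HasFormOrder (f : X ⟶ Spec (.of R)) (n : ℕ) (φ : FunctionField f)
    (x : Fin n → FunctionField f) (y : X) (v : ℤ) : Prop :=
  ∃ a : Fin n → FunctionField f, (∀ i, RegularAt (X := X) y (a i)) ∧ wedge f n a ≠ 0 ∧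
    (∀ b : Fin n → FunctionField f, (∀ i, RegularAt (X := X) y (b i)) →
      ∃ r : FunctionField f, RegularAt (X := X) y r ∧ wedge f n b = r • wedge f n a) ∧
    ∃ c : FunctionField f, c ≠ 0 ∧ φ • wedge f n x = c • wedge f n a ∧
      Scheme.ord (X := X) c y = v

/-- `K` is the divisor of the nonzero rational `n`-form `φ d x₁ ∧ ⋯ ∧ d xₙ`. -/
def IsDivisorOfForm (f : X ⟶ Spec (.of R)) (n : ℕ) (φ : FunctionField f)
    (x : Fin n → FunctionField f) (K : QDivisor X) : Prop :=
  φ • wedge f n x ≠ 0 ∧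
    ∀ y : X, Order.coheight y = 1 → ∃ v : ℤ, HasFormOrder f n φ x y v ∧ K.1 y = v

/-- `K` is a canonical divisor of the `n`-dimensional variety `X`. -/
def IsCanonicalDivisor (f : X ⟶ Spec (.of R)) (n : ℕ) (K : QDivisor X) : Prop :=
  ∃ φ x, IsDivisorOfForm f n φ x K

end Divisors

/-! ### Terminal pairs -/

/-- All local rings are integrally closed. -/
def IsNormalScheme (X : Scheme.{u}) [IsIntegral X] : Prop :=
  ∀ x : X, IsIntegrallyClosed (X.presheaf.stalk x)

/-- `b` maps the generic point to the generic point and induces an isomorphism of function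
fields. -/
def IsBirationalMorphism {Y X : Scheme.{u}} [IsIntegral Y] [IsIntegral X] (b : Y ⟶ X) : Prop :=
  b (genericPoint Y) = genericPoint X ∧
    Function.Bijective (b.stalkMap (genericPoint Y)).hom

/-- The pair `(X, Δ)`, with `X` a variety of dimension `n` over the field `k`, is terminal:
`X` is normal, `K_X + Δ` is `ℚ`-Cartier, and for every birational morphism `b : Y ⟶ X` of finite
type with `Y` normal and every `b`-exceptional prime divisor `e` of `Y` the discrepancy
`ord_e (K_Y - b^*(K_X + Δ))` is positive. Here `K_X` is the divisor of a rational `n`-form on `X`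
and `K_Y` the divisor of the pullback of this form. -/
def IsTerminalPair {k : Type u} [Field k] {X : Scheme.{u}} [IsIntegral X]
    [IsLocallyNoetherian X] (f : X ⟶ Spec (.of k)) (n : ℕ) (Δ : QDivisor X) : Prop :=
  IsNormalScheme X ∧
  ∃ (φ : FunctionField f) (x : Fin n → FunctionField f) (K : QDivisor X),
    IsDivisorOfForm f n φ x K ∧ IsQCartier (K + Δ) ∧
    ∀ (Y : Scheme.{u}) [IsIntegral Y] [IsLocallyNoetherian Y] (b : Y ⟶ X),
      LocallyOfFiniteType b → IsNormalScheme Y → IsBirationalMorphism b →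
      ∀ (φ' : FunctionField (b ≫ f)) (x' : Fin n → FunctionField (b ≫ f)),
        IsPullbackFunction b φ φ' → (∀ i, IsPullbackFunction b (x i) (x' i)) →
        ∀ e : Y, Order.coheight e = 1 → Order.coheight (b e) ≠ 1 →
          ∀ (v : ℤ) (q : ℚ), HasFormOrder (b ≫ f) n φ' x' e v →
            IsPullbackCoeff b (K + Δ).1 e q → 0 < (v : ℚ) - q

/-! ### Projective space, the affine line, fibers -/

attribute [local instance] MvPolynomial.gradedAlgebra

/-- Projective `n`-space over `R`. -/
def ProjSpace (R : Type u) [CommRing R] (n : ℕ) : Scheme.{u} :=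
  Proj (MvPolynomial.homogeneousSubmodule (Fin (n + 1)) R)

/-- The structure morphism of projective space. -/
def ProjSpace.toSpec (R : Type u) [CommRing R] (n : ℕ) : ProjSpace R n ⟶ Spec (.of R) :=
  Proj.toSpecZero (MvPolynomial.homogeneousSubmodule (Fin (n + 1)) R) ≫
    Spec.map (CommRingCat.ofHom
      (algebraMap R (MvPolynomial.homogeneousSubmodule (Fin (n + 1)) R 0)))

/-- `X` is a closed subscheme of a projective space over the affine base `Spec R`. -/
def IsProjective {R : Type u} [CommRing R] {X : Scheme.{u}} (f : X ⟶ Spec (.of R)) : Prop :=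
  ∃ (n : ℕ) (i : X ⟶ ProjSpace R n), IsClosedImmersion i ∧ i ≫ ProjSpace.toSpec R n = f

section Field

variable (k : Type u) [Field k]

/-- The affine line over `k`. -/
abbrev AffineLine : Scheme.{u} := Spec (.of (Polynomial k))

/-- The structure morphism of the affine line. -/
def AffineLine.toSpec : AffineLine k ⟶ Spec (.of k) :=
  Spec.map (CommRingCat.ofHom Polynomial.C)

variable {k}

/-- The closed point `t` of the affine line. -/
def AffineLine.point (t : k) : Spec (.of k) ⟶ AffineLine k :=
  Spec.map (CommRingCat.ofHom (Polynomial.evalRingHom t))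

variable {S : Scheme.{u}} (g : S ⟶ AffineLine k)

/-- The fiber `S_t`. -/
def fiber (t : k) : Scheme.{u} := pullback g (AffineLine.point t)

/-- The inclusion of the fiber `S_t` in `S`. -/
def fiberι (t : k) : fiber g t ⟶ S := pullback.fst g (AffineLine.point t)

/-- The structure morphism of the fiber `S_t`. -/
def fiberToSpec (t : k) : fiber g t ⟶ Spec (.of k) := pullback.snd g (AffineLine.point t)

/-- `L` has degree zero on every integral proper curve contained in a fiber of `g`
(`k` algebraically closed, `g` proper). -/
def IsNumericallyTrivial [IsIntegral S] [IsLocallyNoetherian S] (L : QDivisor S) : Prop :=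
  ∀ (t : k) (C : Scheme.{u}) [IsIntegral C] [IsLocallyNoetherian C] (ν : C ⟶ fiber g t),
    IsClosedImmersion ν → topologicalKrullDim C = 1 → HasDegreeOn (ν ≫ fiberι g t) L 0

/-! ### Elliptic curves, self-extensions of the structure sheaf, projectivization -/

/-- The integral `k`-scheme `E` is the smooth proper curve that contains the affine Weierstrass
curve `W` as an open subscheme. -/
def IsSmoothProperModel (W : WeierstrassCurve k) {E : Scheme.{u}} (e : E ⟶ Spec (.of k)) : Prop :=
  IsIntegral E ∧ IsProper e ∧ SmoothOfRelativeDimension 1 e ∧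
    ∃ j : Spec (.of W.toAffine.CoordinateRing) ⟶ E, IsOpenImmersion j ∧
      j ≫ e = Spec.map (CommRingCat.ofHom (algebraMap k W.toAffine.CoordinateRing))

end Field

/-- A vector bundle `F` of rank two on `E` with an exact sequence `0 → 𝒪_E → F → 𝒪_E → 0`, given by
gluing: `F` has frames on the members of an open cover, with transition matrices
`!![1, a i j; 0, 1]`, where the `a i j` are regular on `U i ∩ U j` and form a `1`-cocycle. -/
structure SelfExtension (E : Scheme.{u}) [IsIntegral E] where
  /-- The index set of the cover. -/
  ι : Type
  /-- The members of the cover. -/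
  U : ι → E.Opens
  nonempty : ∀ i, (U i : Set E).Nonempty
  cover : ∀ x : E, ∃ i, x ∈ U i
  /-- The upper right entries of the transition matrices. -/
  a : ι → ι → E.functionField
  regular : ∀ i j, ∀ x ∈ U i, x ∈ U j → RegularAt x (a i j)
  cocycle : ∀ i j l, a i j + a j l = a i l

/-- The extension splits, i.e. its class in `H¹(E, 𝒪_E)` is zero: the cocycle is a coboundary. -/
def SelfExtension.IsSplit {E : Scheme.{u}} [IsIntegral E] (F : SelfExtension E) : Prop :=
  ∃ b : F.ι → E.functionField, (∀ i, ∀ x ∈ F.U i, RegularAt x (b i)) ∧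
    ∀ i j, F.a i j = b i - b j

section ProjectiveLine

variable (k : Type u) [Field k]

/-- The open subscheme `X₀ ≠ 0` of the projective line. -/
def P1Chart : (ProjSpace k 1).Opens :=
  Proj.basicOpen (MvPolynomial.homogeneousSubmodule (Fin 2) k) (MvPolynomial.X 0)

/-- The inhomogeneous coordinate `X₁ / X₀` on the projective line. -/
def P1Coord : Γ(ProjSpace k 1, P1Chart k) :=
  (Proj.awayToSection (MvPolynomial.homogeneousSubmodule (Fin 2) k) (MvPolynomial.X 0)).hom
    (HomogeneousLocalization.Away.mk (MvPolynomial.homogeneousSubmodule (Fin 2) k)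
      (MvPolynomial.isHomogeneous_X k 0) 1 (MvPolynomial.X 1) (MvPolynomial.isHomogeneous_X k 1))

variable {k}

/-- For a morphism `q` from an open subscheme `V` of the integral scheme `P` to the projective line,
`y` is the pullback of the inhomogeneous coordinate, as a rational function on `P`. -/
def IsPullbackOfCoord {P : Scheme.{u}} [IsIntegral P] {V : P.Opens}
    (q : V.toScheme ⟶ ProjSpace k 1) (y : P.functionField) : Prop :=
  ∃ (hV : genericPoint P ∈ V) (hq : q ⟨genericPoint P, hV⟩ ∈ P1Chart k),
    y = (V.stalkIso ⟨genericPoint P, hV⟩).hom.hom ((q.stalkMap ⟨genericPoint P, hV⟩).hom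
      ((ProjSpace k 1).presheaf.germ (P1Chart k) (q ⟨genericPoint P, hV⟩) hq (P1Coord k)))

/-- `π : P ⟶ E` is the projectivization of the rank two bundle `F`: over each `U i` it is the
trivial bundle `U i × ℙ¹` (via the projections `π` and `q i`), and the inhomogeneous fiber
coordinates `y i` are transformed by the transition matrices of `F`, i.e. `y i = y j + a i j`. -/
def IsProjectivization {E : Scheme.{u}} [IsIntegral E] (e : E ⟶ Spec (.of k))
    (F : SelfExtension E) {P : Scheme.{u}} [IsIntegral P] (π : P ⟶ E) : Prop :=
  ∃ (q : ∀ i, (π ⁻¹ᵁ F.U i).toScheme ⟶ ProjSpace k 1) (y : F.ι → P.functionField),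
    (∀ i, ∃ hq : (π ∣_ F.U i) ≫ (F.U i).ι ≫ e = q i ≫ ProjSpace.toSpec k 1,
      IsIso (pullback.lift (f := (F.U i).ι ≫ e) (g := ProjSpace.toSpec k 1)
        (π ∣_ F.U i) (q i) hq)) ∧
    (∀ i, IsPullbackOfCoord (q i) (y i)) ∧
    ∀ i j, ∃ c : P.functionField, IsPullbackFunction π (F.a i j) c ∧ y i = y j + c

end ProjectiveLine

end

end PlurigeneraJump

open PlurigeneraJump

open CategoryTheory AlgebraicGeometry Limits
open scoped KaehlerDifferential

namespace PlurigeneraJump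
noncomputable section

/-- The morphism of affine schemes given by a ring homomorphism. -/
notation "specMap" φ:max => Spec.map (CommRingCat.ofHom φ)

section Charts

variable {X : Scheme.{u}} {C : Type u} [CommRing C] (j : Spec (.of C) ⟶ X) [IsOpenImmersion j]

/-- The section of `X` over the image of the chart `j` given by `a`. -/
def chartSec : C →+* Γ(X, j.opensRange) :=
  ((Scheme.ΓSpecIso (.of C)).inv ≫ (j.appIso ⊤).inv ≫
    X.presheaf.map (eqToHom j.image_top_eq_opensRange.symm).op).hom

theorem le_preimage_opensRange : ⊤ ≤ j ⁻¹ᵁ j.opensRange := fun x _ => ⟨x, rfl⟩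

theorem appLE_chartSec (a : C) :
    (j.appLE j.opensRange ⊤ (le_preimage_opensRange j)) (chartSec j a) =
      (Scheme.ΓSpecIso (.of C)).inv a := by
  have : (Scheme.ΓSpecIso (.of C)).inv ≫ (j.appIso ⊤).inv ≫
    X.presheaf.map (eqToHom j.image_top_eq_opensRange.symm).op ≫
      j.appLE j.opensRange ⊤ (le_preimage_opensRange j) = (Scheme.ΓSpecIso (.of C)).inv := by
    rw [Scheme.Hom.map_appLE, Scheme.Hom.appIso_inv_appLE]
    simp
  exact ConcreteCategory.congr_hom this a

theorem appLE_opensRange_injective :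
    Function.Injective (j.appLE j.opensRange ⊤ (le_preimage_opensRange j)) := by
  have : IsIso (X.presheaf.map (eqToHom j.image_top_eq_opensRange.symm).op ≫
      j.appLE j.opensRange ⊤ (le_preimage_opensRange j)) := by
    rw [Scheme.Hom.map_appLE, ← Scheme.Hom.appIso_hom']
    infer_instance
  have : IsIso (j.appLE j.opensRange ⊤ (le_preimage_opensRange j)) :=
    IsIso.of_isIso_comp_left (X.presheaf.map (eqToHom j.image_top_eq_opensRange.symm).op) _
  exact (ConcreteCategory.bijective_of_isIso _).1

/-- The germ at `x` of the section of `X` given by `a`. -/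
def chartGerm (x : X) (hx : x ∈ j.opensRange) : C →+* X.presheaf.stalk x :=
  (X.presheaf.germ j.opensRange x hx).hom.comp (chartSec j)

theorem appLE_hom_congr {Y Z : Scheme.{u}} {f g : Y ⟶ Z} (h : f = g) (U V)
    (e : V ≤ f ⁻¹ᵁ U) (e' : V ≤ g ⁻¹ᵁ U) : f.appLE U V e = g.appLE U V e' := by
  subst h
  rfl

theorem stalkMap_chartGerm {Y : Scheme.{u}} {C' : Type u} [CommRing C']
    (j' : Spec (.of C') ⟶ Y) [IsOpenImmersion j'] (ν : Y ⟶ X) (ρ : C →+* C')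
    (h : j' ≫ ν = specMap ρ ≫ j) (y : Y) (hy : y ∈ j'.opensRange)
    (hx : ν y ∈ j.opensRange) (a : C) :
    (ν.stalkMap y).hom (chartGerm j (ν y) hx a) = chartGerm j' y hy (ρ a) := by
  have hle : j'.opensRange ≤ ν ⁻¹ᵁ j.opensRange := by
    rintro _ ⟨q, rfl⟩
    change ν (j' q) ∈ j.opensRange
    rw [← Scheme.Hom.comp_apply, h, Scheme.Hom.comp_apply]
    exact ⟨_, rfl⟩
  have key : ν.appLE j.opensRange j'.opensRange hle (chartSec j a) = chartSec j' (ρ a) := by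
    apply appLE_opensRange_injective j'
    have e0 : ν.appLE j.opensRange j'.opensRange hle ≫
        j'.appLE j'.opensRange ⊤ (le_preimage_opensRange j') =
        j.appLE j.opensRange ⊤ (le_preimage_opensRange j) ≫
          (specMap ρ).appLE ⊤ ⊤ le_top := by
      rw [Scheme.Hom.appLE_comp_appLE]
      refine (appLE_hom_congr h _ _ _ ?_).trans (Scheme.Hom.appLE_comp_appLE ..).symm
      exact fun x _ => ⟨(specMap ρ) x, rfl⟩
    have e1 := ConcreteCategory.congr_hom e0 (chartSec j a)
    simp only [CommRingCat.comp_apply] at e1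
    rw [appLE_chartSec] at e1 ⊢
    rw [e1]
    have h2 := ConcreteCategory.congr_hom
      (Scheme.ΓSpecIso_inv_naturality (CommRingCat.ofHom ρ)) a
    refine Eq.trans ?_ h2.symm
    rw [Scheme.Hom.appTop, Scheme.Hom.app_eq_appLE]
    rfl
  simp only [chartGerm, RingHom.comp_apply]
  rw [← key]
  erw [Scheme.Hom.germ_stalkMap_apply]
  rw [Scheme.Hom.appLE, CommRingCat.comp_apply]
  erw [TopCat.Presheaf.germ_res_apply]

theorem stalkMap_chartGerm_self (q : Spec (.of C)) (a : C) :
    (j.stalkMap q).hom (chartGerm j (j q) ⟨q, rfl⟩ a) = StructureSheaf.toStalk C q a := by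
  simp only [chartGerm, RingHom.comp_apply]
  erw [Scheme.Hom.germ_stalkMap_apply]
  have := appLE_chartSec j a
  rw [Scheme.Hom.appLE, CommRingCat.comp_apply] at this
  have h2 := congrArg ((Spec (.of C)).presheaf.germ ⊤ q trivial) this
  erw [TopCat.Presheaf.germ_res_apply] at h2
  exact h2

theorem exists_chartGerm (q : Spec (.of C)) (s : X.presheaf.stalk (j q)) :
    ∃ a b : C, b ∉ q.asIdeal ∧
      s * chartGerm j (j q) ⟨q, rfl⟩ b = chartGerm j (j q) ⟨q, rfl⟩ a := by
  let q' : PrimeSpectrum C := q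
  let _ : Algebra C ((Spec (.of C)).presheaf.stalk q) := StructureSheaf.stalkAlgebra C q
  have : IsLocalization.AtPrime ((Spec (.of C)).presheaf.stalk q) q'.asIdeal :=
    StructureSheaf.IsLocalization.to_stalk C q
  obtain ⟨⟨a, b⟩, hab⟩ := IsLocalization.surj q'.asIdeal.primeCompl ((j.stalkMap q).hom s)
  refine ⟨a, b, b.2, (ConcreteCategory.bijective_of_isIso (j.stalkMap q)).1 ?_⟩
  erw [map_mul]
  erw [stalkMap_chartGerm_self, stalkMap_chartGerm_self]
  exact hab

theorem isUnit_chartGerm_iff (q : Spec (.of C)) (b : C) :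
    IsUnit (chartGerm j (j q) ⟨q, rfl⟩ b) ↔ b ∉ q.asIdeal := by
  let q' : PrimeSpectrum C := q
  let _ : Algebra C ((Spec (.of C)).presheaf.stalk q) := StructureSheaf.stalkAlgebra C q
  have : IsLocalization.AtPrime ((Spec (.of C)).presheaf.stalk q) q'.asIdeal :=
    StructureSheaf.IsLocalization.to_stalk C q
  have e : IsUnit ((j.stalkMap q).hom (chartGerm j (j q) ⟨q, rfl⟩ b)) ↔
      IsUnit (chartGerm j (j q) ⟨q, rfl⟩ b) :=
    ⟨fun h => by
      have := h.map (inv (j.stalkMap q)).hom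
      simpa [← CommRingCat.comp_apply] using this, fun h => h.map _⟩
  rw [← e, stalkMap_chartGerm_self]
  exact IsLocalization.AtPrime.isUnit_to_map_iff (R := C) _ q'.asIdeal b

section Integral

variable [IsIntegral X]

theorem RegularAt.zero (x : X) : RegularAt x (0 : X.functionField) := ⟨0, map_zero _⟩
theorem RegularAt.one (x : X) : RegularAt x (1 : X.functionField) := ⟨1, map_one _⟩

theorem RegularAt.neg {x : X} {φ : X.functionField} (h : RegularAt x φ) : RegularAt x (-φ) := by
  obtain ⟨a, rfl⟩ := h
  exact ⟨-a, map_neg _ _⟩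

theorem RegularAt.sub {x : X} {φ ψ : X.functionField} (h₁ : RegularAt x φ)
    (h₂ : RegularAt x ψ) : RegularAt x (φ - ψ) := by
  rw [sub_eq_add_neg]
  exact h₁.add h₂.neg

theorem RegularAt.pow {x : X} {φ : X.functionField} (h : RegularAt x φ) (n : ℕ) :
    RegularAt x (φ ^ n) := by
  obtain ⟨a, rfl⟩ := h
  exact ⟨a ^ n, map_pow _ _ _⟩

theorem unitAt_iff {x : X} {φ : X.functionField} :
    UnitAt x φ ↔ φ ≠ 0 ∧ RegularAt x φ ∧ RegularAt x φ⁻¹ := by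
  constructor
  · rintro ⟨a, ha, rfl⟩
    obtain ⟨b, hb⟩ := ha.exists_right_inv
    have h := congrArg (algebraMap (X.presheaf.stalk x) X.functionField) hb
    rw [map_mul, map_one] at h
    exact ⟨left_ne_zero_of_mul_eq_one h, ⟨a, rfl⟩, ⟨b, eq_inv_of_mul_eq_one_right h⟩⟩
  · rintro ⟨h0, ⟨a, rfl⟩, ⟨b, hb⟩⟩
    refine ⟨a, ?_, rfl⟩
    apply IsUnit.of_mul_eq_one b
    apply IsFractionRing.injective (X.presheaf.stalk x) X.functionField
    rw [map_mul, map_one, hb, mul_inv_cancel₀ h0]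

theorem UnitAt.mul {x : X} {φ ψ : X.functionField} (h₁ : UnitAt x φ) (h₂ : UnitAt x ψ) :
    UnitAt x (φ * ψ) := by
  obtain ⟨a, ha, rfl⟩ := h₁
  obtain ⟨b, hb, rfl⟩ := h₂
  exact ⟨a * b, ha.mul hb, map_mul _ _ _⟩

theorem UnitAt.inv {x : X} {φ : X.functionField} (h : UnitAt x φ) : UnitAt x φ⁻¹ := by
  rw [unitAt_iff] at h ⊢
  simpa [inv_inv] using ⟨h.1, h.2.2, h.2.1⟩

theorem UnitAt.one (x : X) : UnitAt x (1 : X.functionField) := ⟨1, isUnit_one, map_one _⟩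

theorem UnitAt.pow {x : X} {φ : X.functionField} (h : UnitAt x φ) (n : ℕ) :
    UnitAt x (φ ^ n) := by
  obtain ⟨a, ha, rfl⟩ := h
  exact ⟨a ^ n, ha.pow n, map_pow _ _ _⟩

theorem UnitAt.regularAt {x : X} {φ : X.functionField} (h : UnitAt x φ) : RegularAt x φ :=
  (unitAt_iff.1 h).2.1

theorem UnitAt.ne_zero {x : X} {φ : X.functionField} (h : UnitAt x φ) : φ ≠ 0 :=
  (unitAt_iff.1 h).1

/-- Of an element of the local ring at `x` and of its difference to one, one is a unit. -/
theorem RegularAt.unitAt_or {x : X} {φ ψ : X.functionField} (h₁ : RegularAt x φ)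
    (h₂ : RegularAt x ψ) (h : UnitAt x (φ + ψ)) : UnitAt x φ ∨ UnitAt x ψ := by
  obtain ⟨a, rfl⟩ := h₁
  obtain ⟨b, rfl⟩ := h₂
  obtain ⟨c, hc, e⟩ := h
  rw [← map_add] at e
  rw [IsFractionRing.injective (X.presheaf.stalk x) X.functionField e] at hc
  exact (IsLocalRing.isUnit_or_isUnit_of_isUnit_add hc).imp (⟨a, ·, rfl⟩) (⟨b, ·, rfl⟩)

variable [IsDomain C]

/-- The generic point of the spectrum of a domain. -/
def specBot (C : Type u) [CommRing C] [IsDomain C] : Spec (.of C) := (⊥ : PrimeSpectrum C)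

/-- The ring of functions of the chart `j`, as rational functions. -/
def toK : C →+* X.functionField :=
  (algebraMap (X.presheaf.stalk (j (specBot C))) X.functionField).comp
    (chartGerm j (j (specBot C)) ⟨specBot C, rfl⟩)

theorem toK_eq (x : X) (hx : x ∈ j.opensRange) (a : C) :
    algebraMap (X.presheaf.stalk x) X.functionField (chartGerm j x hx a) = toK j a := by
  have : Nonempty j.opensRange := ⟨⟨x, hx⟩⟩
  simp only [toK, chartGerm, RingHom.comp_apply]
  erw [Scheme.algebraMap_germ_eq_germToFunctionField, Scheme.algebraMap_germ_eq_germToFunctionField]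

theorem chart_bot : j (specBot C) = genericPoint X := by
  rw [← genericPoint_eq_of_isOpenImmersion j, genericPoint_eq_bot_of_affine]
  rfl

theorem regularAt_toK {x : X} (hx : x ∈ j.opensRange) (a : C) : RegularAt x (toK j a) :=
  ⟨_, toK_eq j x hx a⟩

theorem toK_injective : Function.Injective (toK j) := by
  rw [injective_iff_map_eq_zero]
  intro a ha
  rw [← toK_eq j (j (specBot C)) ⟨_, rfl⟩] at ha
  have h0 := (map_eq_zero_iff _ (IsFractionRing.injective _ X.functionField)).1 ha
  by_contra h
  have := (isUnit_chartGerm_iff j (specBot C) a).2 h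
  rw [h0] at this
  exact not_isUnit_zero this

theorem toK_ne_zero {a : C} (h : a ≠ 0) : toK j a ≠ 0 :=
  (map_ne_zero_iff _ (toK_injective j)).2 h

theorem unitAt_toK_iff (q : Spec (.of C)) (a : C) : UnitAt (j q) (toK j a) ↔ a ∉ q.asIdeal := by
  rw [← isUnit_chartGerm_iff j, ← toK_eq j (j q) ⟨q, rfl⟩]
  refine ⟨fun ⟨b, hb, e⟩ => ?_, fun h => ⟨_, h, rfl⟩⟩
  rwa [← IsFractionRing.injective _ X.functionField e]

theorem regularAt_chart_iff (q : Spec (.of C)) (φ : X.functionField) :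
    RegularAt (j q) φ ↔ ∃ a b : C, b ∉ q.asIdeal ∧ φ = toK j a / toK j b := by
  constructor
  · rintro ⟨s, rfl⟩
    obtain ⟨a, b, hb, h⟩ := exists_chartGerm j q s
    have hb' := ((unitAt_toK_iff j q b).2 hb).ne_zero
    refine ⟨a, b, hb, eq_div_of_mul_eq hb' ?_⟩
    rw [← toK_eq j (j q) ⟨q, rfl⟩, ← toK_eq j (j q) ⟨q, rfl⟩, ← h, map_mul]
  · rintro ⟨a, b, hb, rfl⟩
    rw [div_eq_mul_inv]
    exact (regularAt_toK j ⟨q, rfl⟩ a).mul ((unitAt_toK_iff j q b).2 hb).inv.regularAt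

theorem regularAt_genericPoint (φ : X.functionField) : RegularAt (genericPoint X) φ :=
  ⟨φ, by simp only [RingHom.algebraMap_toAlgebra]; rw [TopCat.Presheaf.stalkSpecializes_refl]; rfl⟩

theorem exists_toK_div (φ : X.functionField) : ∃ a b : C, b ≠ 0 ∧ φ = toK j a / toK j b := by
  have := regularAt_genericPoint φ
  rw [← chart_bot j, regularAt_chart_iff] at this
  exact this

theorem isPullbackFunction_toK {Y : Scheme.{u}} [IsIntegral Y] {C' : Type u} [CommRing C']
    [IsDomain C'] (j' : Spec (.of C') ⟶ Y) [IsOpenImmersion j'] (ν : Y ⟶ X) (ρ : C →+* C')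
    (h : j' ≫ ν = specMap ρ ≫ j) (a : C) :
    IsPullbackFunction ν (toK j a) (toK j' (ρ a)) := by
  have hy : genericPoint Y ∈ j'.opensRange := ⟨_, chart_bot j'⟩
  have hx : ν (genericPoint Y) ∈ j.opensRange := by
    obtain ⟨q, hq⟩ := hy
    rw [← hq, ← Scheme.Hom.comp_apply, h, Scheme.Hom.comp_apply]
    exact ⟨_, rfl⟩
  refine ⟨chartGerm j _ hx a, toK_eq j _ hx a, ?_⟩
  rw [stalkMap_chartGerm j j' ν ρ h _ hy hx, ← toK_eq j' _ hy]
  simp only [RingHom.algebraMap_toAlgebra]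
  rw [TopCat.Presheaf.stalkSpecializes_refl]
  rfl

theorem IsPullbackFunction.unique {Y : Scheme.{u}} [IsIntegral Y] {ν : Y ⟶ X}
    {φ : X.functionField} {ψ ψ' : Y.functionField} (h : IsPullbackFunction ν φ ψ)
    (h' : IsPullbackFunction ν φ ψ') : ψ = ψ' := by
  obtain ⟨a, ha, rfl⟩ := h
  obtain ⟨b, hb, rfl⟩ := h'
  rw [IsFractionRing.injective _ X.functionField (ha.trans hb.symm)]

theorem IsPullbackFunction.mul {Y : Scheme.{u}} [IsIntegral Y] {ν : Y ⟶ X}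
    {φ φ' : X.functionField} {ψ ψ' : Y.functionField} (h : IsPullbackFunction ν φ ψ)
    (h' : IsPullbackFunction ν φ' ψ') : IsPullbackFunction ν (φ * φ') (ψ * ψ') := by
  obtain ⟨a, rfl, rfl⟩ := h
  obtain ⟨b, rfl, rfl⟩ := h'
  exact ⟨a * b, map_mul _ _ _, map_mul _ _ _⟩

theorem baseMap_eq_toK {R : Type u} [CommRing R] (f : X ⟶ Spec (.of R)) (ρ : R →+* C)
    (h : j ≫ f = specMap ρ) (r : R) : baseMap f r = toK j (ρ r) := by
  have hx : genericPoint X ∈ j.opensRange := ⟨_, chart_bot j⟩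
  have : chartSec j (ρ r) =
      X.presheaf.map (homOfLE le_top).op (f.appTop ((Scheme.ΓSpecIso (.of R)).inv r)) := by
    apply appLE_opensRange_injective j
    rw [appLE_chartSec]
    have e0 : f.appTop ≫ X.presheaf.map (homOfLE (le_top : j.opensRange ≤ ⊤)).op ≫
        j.appLE j.opensRange ⊤ (le_preimage_opensRange j) =
          (specMap ρ).appTop := by
      rw [← h, Scheme.Hom.comp_appTop]
      congr 1
      rw [Scheme.Hom.map_appLE]
      exact Scheme.Hom.appLE_eq_app _
    have h1 := ConcreteCategory.congr_hom e0 ((Scheme.ΓSpecIso (.of R)).inv r)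
    have h2 := ConcreteCategory.congr_hom
      (Scheme.ΓSpecIso_inv_naturality (CommRingCat.ofHom ρ)) r
    exact Eq.trans h2 h1.symm
  rw [← toK_eq j _ hx]
  simp only [chartGerm, RingHom.comp_apply, this]
  erw [TopCat.Presheaf.germ_res_apply]
  simp only [RingHom.algebraMap_toAlgebra]
  rw [TopCat.Presheaf.stalkSpecializes_refl]
  rfl

end Integral

end Charts

section FromSpecStalk

variable {X : Scheme.{u}} {C : Type u} [CommRing C] (j : Spec (.of C) ⟶ X) [IsOpenImmersion j]

theorem specMap_chartGerm (x : X) (hx : x ∈ j.opensRange) :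
    specMap (chartGerm j x hx) ≫ j = X.fromSpecStalk x := by
  obtain ⟨q, rfl⟩ := hx
  rw [← cancel_epi (Spec.map (j.stalkMap q)), Scheme.SpecMap_stalkMap_fromSpecStalk,
    ← Spec.map_comp_assoc, Spec.fromSpecStalk_eq']
  congr 2
  ext a
  exact stalkMap_chartGerm_self j q a

variable [IsIntegral X]

theorem specMap_toK [IsDomain C] :
    specMap (toK j) ≫ j = X.fromSpecStalk (genericPoint X) := by
  rw [← Scheme.SpecMap_stalkSpecializes_fromSpecStalk
    (genericPoint_specializes (j (specBot C))), ← specMap_chartGerm j _ ⟨specBot C, rfl⟩,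
    ← Spec.map_comp_assoc]
  rfl

theorem isDominant_of_apply_eq_genericPoint {W : Scheme.{u}} (η : W ⟶ X) (w : W)
    (h : η w = genericPoint X) : IsDominant η := by
  rw [isDominant_iff]
  refine dense_iff_closure_eq.2 (Set.univ_subset_iff.1 ?_)
  rw [← (genericPoint_spec X).def]
  exact closure_mono (Set.singleton_subset_iff.2 ⟨w, h⟩)

theorem IsPullbackFunction.regularAt {Y : Scheme.{u}} [IsIntegral Y] {ν : Y ⟶ X}
    {φ : X.functionField} {ψ : Y.functionField} (h : IsPullbackFunction ν φ ψ) {y : Y}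
    (hφ : RegularAt (ν y) φ) : RegularAt y ψ := by
  obtain ⟨a, ha, rfl⟩ := h
  obtain ⟨b, hb⟩ := hφ
  have hs := genericPoint_specializes y
  have hab : X.presheaf.stalkSpecializes (hs.map ν.continuous) b
      = a := by
    apply IsFractionRing.injective (X.presheaf.stalk (ν (genericPoint Y))) X.functionField
    rw [ha, ← hb]
    simp only [RingHom.algebraMap_toAlgebra]
    rw [← CommRingCat.comp_apply, TopCat.Presheaf.stalkSpecializes_comp]
  refine ⟨ν.stalkMap y b, ?_⟩
  rw [← hab]
  exact (ConcreteCategory.congr_hom (ν.stalkSpecializes_stalkMap _ _ hs) b).symm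

theorem IsPullbackFunction.unitAt {Y : Scheme.{u}} [IsIntegral Y] {ν : Y ⟶ X}
    {φ : X.functionField} {ψ : Y.functionField} (h : IsPullbackFunction ν φ ψ) {y : Y}
    (hφ : UnitAt (ν y) φ) : UnitAt y ψ := by
  obtain ⟨a, ha, rfl⟩ := h
  obtain ⟨b, hu, hb⟩ := hφ
  have hs := genericPoint_specializes y
  have hab : X.presheaf.stalkSpecializes (hs.map ν.continuous) b = a := by
    apply IsFractionRing.injective (X.presheaf.stalk (ν (genericPoint Y))) X.functionField
    rw [ha, ← hb]
    simp only [RingHom.algebraMap_toAlgebra]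
    rw [← CommRingCat.comp_apply, TopCat.Presheaf.stalkSpecializes_comp]
  refine ⟨ν.stalkMap y b, hu.map _, ?_⟩
  rw [← hab]
  exact (ConcreteCategory.congr_hom (ν.stalkSpecializes_stalkMap _ _ hs) b).symm

/-- On a separated scheme a point lies in a chart as soon as all functions of the chart are
regular there. -/
theorem mem_range_of_regularAt [X.IsSeparated] [IsDomain C] (x : X)
    (h : ∀ a, RegularAt x (toK j a)) : x ∈ j.opensRange := by
  let A := X.presheaf.stalk x
  have hinj := IsFractionRing.injective A X.functionField
  let ψ : C →+* A :=
    { toFun a := (h a).choose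
      map_one' := hinj (by rw [(h 1).choose_spec, map_one, map_one])
      map_mul' a b := hinj (by
        rw [(h _).choose_spec, map_mul, map_mul, (h _).choose_spec, (h _).choose_spec])
      map_zero' := hinj (by rw [(h 0).choose_spec, map_zero, map_zero])
      map_add' a b := hinj (by
        rw [(h _).choose_spec, map_add, map_add, (h _).choose_spec, (h _).choose_spec]) }
  have hψ : (algebraMap A X.functionField).comp ψ = toK j := by
    ext a
    exact (h a).choose_spec
  let ι : Spec X.functionField ⟶ Spec A :=
    Spec.map (X.presheaf.stalkSpecializes (genericPoint_specializes x))
  have hι : IsDominant ι := by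
    have : IsDomain A := inferInstance
    refine isDominant_of_apply_eq_genericPoint ι (specBot X.functionField) ?_
    rw [genericPoint_eq_bot_of_affine]
    refine PrimeSpectrum.ext (Ideal.ext fun a => ?_)
    exact map_eq_zero_iff _ hinj
  have key : specMap ψ ≫ j = X.fromSpecStalk x := by
    refine ext_of_isDominant ι ?_
    rw [Scheme.SpecMap_stalkSpecializes_fromSpecStalk, ← specMap_toK j, ← hψ]
    rw [← Spec.map_comp_assoc]
    rfl
  refine ⟨(specMap ψ) (IsLocalRing.closedPoint A), ?_⟩
  have h2 := Scheme.fromSpecStalk_closedPoint (x := x)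
  rw [← key] at h2
  exact h2

end FromSpecStalk

theorem exists_ringHom_comp_eq {A F K : Type*} [CommRing A] [IsDomain A] [Field F] [Field K]
    {θ : A →+* F} (hθ : Function.Injective θ)
    (h₀ : ∀ φ : F, ∃ a b : A, θ b ≠ 0 ∧ φ = θ a / θ b) {φ : A →+* K}
    (hφ : Function.Injective φ) : ∃ ρ : F →+* K, ρ.comp θ = φ := by
  let _ : Algebra A F := θ.toAlgebra
  have : FaithfulSMul A F := (faithfulSMul_iff_algebraMap_injective _ _).2 hθ
  have : IsFractionRing A F := IsFractionRing.of_field _ _ fun φ =>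
    let ⟨a, b, _, h⟩ := h₀ φ
    ⟨a, b, h⟩
  exact ⟨IsFractionRing.lift hφ, RingHom.ext fun a => IsFractionRing.lift_algebraMap hφ a⟩

/-- An open cover of `X` by spectra of rings `C c`, with homomorphisms `θ c` to a field that give
one and the same point of `X`. -/
structure Atlas (X : Scheme.{u}) (𝕂 : Type u) [Field 𝕂] {I : Type} (C : I → Type u)
    [∀ c, CommRing (C c)] (θ : ∀ c, C c →+* 𝕂) where
  /-- The charts. -/
  chart : ∀ c, Spec (.of (C c)) ⟶ X
  isOpenImmersion : ∀ c, IsOpenImmersion (chart c)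
  covers : ∀ x, ∃ c, x ∈ (chart c).opensRange
  /-- The common point. -/
  pt : Spec (.of 𝕂) ⟶ X
  pt_eq : ∀ c, specMap (θ c) ≫ chart c = pt

namespace Atlas

attribute [instance] Atlas.isOpenImmersion

variable {X : Scheme.{u}} {𝕂 : Type u} [Field 𝕂] {I : Type} {C : I → Type u}
    [∀ c, CommRing (C c)] [∀ c, IsDomain (C c)] {θ : ∀ c, C c →+* 𝕂} (H : Atlas X 𝕂 C θ)
    (hθ : ∀ c, Function.Injective (θ c))

/-- The open cover of an atlas. -/
def cover : X.OpenCover :=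
  Scheme.Cover.mkOfCovers I (fun c => Spec (.of (C c))) H.chart
    (fun x => let ⟨c, q, h⟩ := H.covers x; ⟨c, q, h⟩) (fun c => H.isOpenImmersion c)

include hθ in
theorem specMap_apply_specBot (c : I) :
    (specMap (θ c)) (specBot 𝕂) = specBot (C c) :=
  PrimeSpectrum.ext (Ideal.ext fun _ => map_eq_zero_iff _ (hθ c))

include hθ in
theorem chart_specBot (c : I) : H.chart c (specBot (C c)) = H.pt (specBot 𝕂) := by
  rw [← H.pt_eq c, Scheme.Hom.comp_apply, specMap_apply_specBot hθ]

include H hθ in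
theorem isIntegral [Nonempty I] : IsIntegral X := by
  have h1 : IsReduced X := by
    have h (i : I) : IsReduced (Spec (.of (C i))) := inferInstance
    have : ∀ i, IsReduced (H.cover.X i) := h
    exact IsReduced.of_openCover X H.cover
  have h2 : IrreducibleSpace X := by
    rw [irreducibleSpace_def]
    have : closure {H.pt (specBot 𝕂)} = Set.univ := by
      refine Set.eq_univ_of_forall fun x => ?_
      obtain ⟨c, q, rfl⟩ := H.covers x
      rw [← H.chart_specBot hθ c, ← specializes_iff_mem_closure]
      have : specBot (C c) ⤳ q :=
        (PrimeSpectrum.le_iff_specializes (⊥ : PrimeSpectrum (C c)) q).1 bot_le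
      exact this.map (H.chart c).continuous
    change IsIrreducible Set.univ
    rw [← this]
    exact isIrreducible_singleton.closure
  exact isIntegral_of_irreducibleSpace_of_isReduced X

include hθ in
/-- Morphisms on the charts to a separated scheme that agree at the common point glue. -/
theorem exists_glue {T : Scheme.{u}} [T.IsSeparated] (m : ∀ c, Spec (.of (C c)) ⟶ T)
    (η : Spec (.of 𝕂) ⟶ T) (h : ∀ c, specMap (θ c) ≫ m c = η) :
    ∃ f : X ⟶ T, ∀ c, H.chart c ≫ f = m c := by
  have key (c c' : I) : pullback.fst (H.chart c) (H.chart c') ≫ m c =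
      pullback.snd (H.chart c) (H.chart c') ≫ m c' := by
    let η' : Spec (.of 𝕂) ⟶ pullback (H.chart c) (H.chart c') :=
      pullback.lift _ _ ((H.pt_eq c).trans (H.pt_eq c').symm)
    have : Nonempty ↥(pullback (H.chart c) (H.chart c')) := ⟨η' (specBot 𝕂)⟩
    have hO : IsIntegral (pullback (H.chart c) (H.chart c')) :=
      isIntegral_of_isOpenImmersion (pullback.fst (H.chart c) (H.chart c'))
    have : IsDominant η' := by
      refine isDominant_of_apply_eq_genericPoint η' (specBot 𝕂) ?_
      apply (pullback.fst (H.chart c) (H.chart c')).isOpenEmbedding.injective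
      rw [genericPoint_eq_of_isOpenImmersion, genericPoint_eq_bot_of_affine,
        ← Scheme.Hom.comp_apply, pullback.lift_fst, specMap_apply_specBot hθ]
      rfl
    refine ext_of_isDominant η' ?_
    rw [pullback.lift_fst_assoc, pullback.lift_snd_assoc, h, h]
  exact ⟨Scheme.Cover.glueMorphisms H.cover m key, fun c =>
    Scheme.Cover.ι_glueMorphisms H.cover m _ c⟩

omit [∀ c, IsDomain (C c)] in
theorem hom_ext {T : Scheme.{u}} {f f' : X ⟶ T} (h : ∀ c, H.chart c ≫ f = H.chart c ≫ f') :
    f = f' :=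
  Scheme.Cover.hom_ext H.cover _ _ h

section FunctionField

variable [IsIntegral X] {c₀ : I} (h₀ : ∀ φ : 𝕂, ∃ a b : C c₀, θ c₀ b ≠ 0 ∧ φ = θ c₀ a / θ c₀ b)

include hθ h₀ in
/-- The field of an atlas is the function field. -/
theorem exists_fieldHom :
    ∃ ρ : 𝕂 →+* X.functionField, ∀ c a, ρ (θ c a) = toK (H.chart c) a := by
  obtain ⟨ρ, hρ⟩ := exists_ringHom_comp_eq (hθ c₀) h₀ (toK_injective (H.chart c₀))
  have key : specMap ρ ≫ H.pt = X.fromSpecStalk (genericPoint X) := by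
    rw [← H.pt_eq c₀, ← Category.assoc, ← Spec.map_comp, ← CommRingCat.ofHom_comp, hρ]
    exact specMap_toK (H.chart c₀)
  refine ⟨ρ, fun c a => ?_⟩
  have : CommRingCat.ofHom (θ c) ≫ CommRingCat.ofHom ρ = CommRingCat.ofHom (toK (H.chart c)) := by
    apply Spec.map_injective
    rw [← cancel_mono (H.chart c), Spec.map_comp, Category.assoc, H.pt_eq]
    exact key.trans (specMap_toK (H.chart c)).symm
  exact ConcreteCategory.congr_hom this a

end FunctionField

end Atlas

/-- A surjective morphism from a separated integral scheme to an integral scheme that is an open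
immersion on every chart is an isomorphism. -/
theorem isIso_of_charts {X Z : Scheme.{u}} [IsIntegral X] [X.IsSeparated] [IsIntegral Z]
    (f : X ⟶ Z) {I : Type} (C : I → Type u) [∀ c, CommRing (C c)] [∀ c, IsDomain (C c)]
    (j : ∀ c, Spec (.of (C c)) ⟶ X) [∀ c, IsOpenImmersion (j c)]
    (hj : ∀ x, ∃ c, x ∈ (j c).opensRange) [∀ c, IsOpenImmersion (j c ≫ f)]
    (hf : Function.Surjective f) : IsIso f := by
  have hinj : Function.Injective f := by
    intro x y hxy
    obtain ⟨c, q, rfl⟩ := hj y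
    have hx : x ∈ (j c).opensRange := by
      refine mem_range_of_regularAt (j c) x fun a => ?_
      have h1 : IsPullbackFunction f (toK (j c ≫ f) a) (toK (j c) a) :=
        isPullbackFunction_toK (j c ≫ f) (j c) f (RingHom.id _) (by
          rw [CommRingCat.ofHom_id, Spec.map_id, Category.id_comp]) a
      refine h1.regularAt ?_
      rw [hxy]
      exact regularAt_toK (j c ≫ f) ⟨q, rfl⟩ a
    obtain ⟨q', rfl⟩ := hx
    rw [← Scheme.Hom.comp_apply, ← Scheme.Hom.comp_apply] at hxy
    rw [(j c ≫ f).isOpenEmbedding.injective hxy]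
  have hloc : ∀ x, ∃ c, ∃ q, j c q = x := fun x => let ⟨c, q, h⟩ := hj x; ⟨c, q, h⟩
  have hopen : IsOpenMap f := by
    rw [isOpenMap_iff_nhds_le]
    intro x
    obtain ⟨c, q, rfl⟩ := hloc x
    have := (j c ≫ f).isOpenEmbedding.isOpenMap.nhds_le q
    rw [Scheme.Hom.comp_apply] at this
    refine this.trans ?_
    rw [Scheme.Hom.comp_base, TopCat.coe_comp, ← Filter.map_map]
    exact Filter.map_mono ((j c).continuous.tendsto q)
  have hst : ∀ x, IsIso (f.stalkMap x) := by
    intro x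
    obtain ⟨c, q, rfl⟩ := hloc x
    have h2 : IsIso ((j c ≫ f).stalkMap q) := inferInstance
    rw [Scheme.Hom.stalkMap_comp] at h2
    have h3 : IsIso (f.stalkMap (j c q) ≫ (j c).stalkMap q) := h2
    exact IsIso.of_isIso_comp_right _ ((j c).stalkMap q)
  have : IsOpenImmersion f := by
    rw [IsOpenImmersion.iff_isIso_stalkMap]
    exact ⟨.of_continuous_injective_isOpenMap f.continuous hinj hopen, hst⟩
  rw [isIso_iff_isOpenImmersion_and_surjective]
  exact ⟨this, ⟨hf⟩⟩


section Image

variable {A C K : Type u} [CommRing A] [CommRing C] [Field K]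

theorem specMap_appLE_fromSpec_opensRange {P : Scheme.{u}} (j : Spec (.of A) ⟶ P)
    [IsOpenImmersion j] :
    Spec.map (j.appLE j.opensRange ⊤ (le_preimage_opensRange j) ≫
      (Scheme.ΓSpecIso (.of A)).hom) ≫ (isAffineOpen_opensRange j).fromSpec = j := by
  rw [Spec.map_comp, Category.assoc,
    IsAffineOpen.SpecMap_appLE_fromSpec j _ (isAffineOpen_top _), IsAffineOpen.fromSpec_top,
    Scheme.isoSpec_Spec]
  simp

theorem exists_chart_image {P : Scheme.{u}} (j : Spec (.of A) ⟶ P) [IsOpenImmersion j]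
    (φ : Spec (.of K) ⟶ P) (α : A →+* C) (hα : Function.Surjective α) (θ : C →+* K)
    (hθ : Function.Injective θ)
    (h : specMap (θ.comp α) ≫ j = φ) :
    ∃ (c : Spec (.of C) ⟶ Scheme.Hom.image φ) (_ : IsOpenImmersion c),
      c.opensRange = Scheme.Hom.imageι φ ⁻¹ᵁ j.opensRange ∧
      c ≫ Scheme.Hom.imageι φ = specMap α ≫ j ∧
      specMap θ ≫ c = Scheme.Hom.toImage φ := by
  let U : P.affineOpens := ⟨j.opensRange, isAffineOpen_opensRange j⟩
  let β : Γ(P, j.opensRange) ⟶ .of A :=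
    j.appLE j.opensRange ⊤ (le_preimage_opensRange j) ≫ (Scheme.ΓSpecIso (.of A)).hom
  have hβi : IsIso β := by
    have : IsIso (j.appLE j.opensRange ⊤ (le_preimage_opensRange j)) := by
      have : IsIso (P.presheaf.map (eqToHom j.image_top_eq_opensRange.symm).op ≫
          j.appLE j.opensRange ⊤ (le_preimage_opensRange j)) := by
        rw [Scheme.Hom.map_appLE, ← Scheme.Hom.appIso_hom']
        infer_instance
      exact IsIso.of_isIso_comp_left
        (P.presheaf.map (eqToHom j.image_top_eq_opensRange.symm).op) _
    infer_instance
  have hβ : Spec.map β ≫ U.2.fromSpec = j := specMap_appLE_fromSpec_opensRange j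
  let γ : Γ(P, j.opensRange) →+* C := α.comp β.hom
  have hγ : Function.Surjective γ := hα.comp (ConcreteCategory.bijective_of_isIso β).2
  have hker : φ.ker.ideal U = RingHom.ker γ := by
    rw [Scheme.Hom.ker_apply]
    have htop : (⊤ : (Spec (.of K)).Opens) ≤ φ ⁻¹ᵁ j.opensRange := by
      intro x _
      subst h
      exact ⟨_, rfl⟩
    have e : φ ⁻¹ᵁ j.opensRange = ⊤ := top_le_iff.1 htop
    have h1 : φ.app j.opensRange ≫ (Spec (.of K)).presheaf.map (homOfLE htop).op ≫
        (Scheme.ΓSpecIso (.of K)).hom = CommRingCat.ofHom (θ.comp γ) := by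
      have h2 : φ.app j.opensRange ≫ (Spec (.of K)).presheaf.map (homOfLE htop).op =
        φ.appLE j.opensRange ⊤ htop := rfl
      rw [← Category.assoc, h2]
      have h3 : φ.appLE j.opensRange ⊤ htop = j.appLE j.opensRange ⊤ (le_preimage_opensRange j) ≫
          (specMap (θ.comp α)).appTop := by
        subst h
        have h5 := Scheme.Hom.appLE_comp_appLE (specMap (θ.comp α)) j
          j.opensRange ⊤ ⊤ (le_preimage_opensRange j) le_top
        rw [← h5, Scheme.Hom.appTop, Scheme.Hom.app_eq_appLE]
        rfl
      rw [h3, Category.assoc, Scheme.ΓSpecIso_naturality, ← Category.assoc]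
      rfl
    have hi : IsIso ((Spec (.of K)).presheaf.map (homOfLE htop).op) := by
      have : homOfLE htop = eqToHom e.symm := rfl
      rw [this, eqToHom_op]
      infer_instance
    have hi' : Function.Injective ((Spec (.of K)).presheaf.map (homOfLE htop).op ≫
        (Scheme.ΓSpecIso (.of K)).hom).hom := (ConcreteCategory.bijective_of_isIso _).1
    ext a
    have h4 := ConcreteCategory.congr_hom h1 a
    rw [RingHom.mem_ker, RingHom.mem_ker, ← hθ.eq_iff, ← hi'.eq_iff, map_zero, map_zero]
    exact iff_of_eq (congrArg (· = 0) h4)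
  let ε : (Γ(P, j.opensRange) ⧸ φ.ker.ideal U) ≃+* C :=
    (Ideal.quotEquivOfEq hker).trans (RingHom.quotientKerEquivOfSurjective hγ)
  have hε : ε.toRingHom.comp (Ideal.Quotient.mk _) = γ := by
    ext a
    rfl
  have hiso : IsIso (CommRingCat.ofHom ε.toRingHom) := ε.toCommRingCatIso.isIso_hom
  let F : Spec (.of (Γ(P, j.opensRange) ⧸ φ.ker.ideal U)) ⟶ Scheme.Hom.image φ :=
    φ.ker.subschemeCover.f U
  have hFo : IsOpenImmersion F :=
    φ.ker.subschemeCover.map_prop U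
  have hF : F ≫ Scheme.Hom.imageι φ =
      specMap (Ideal.Quotient.mk (φ.ker.ideal U)) ≫ U.2.fromSpec :=
    (φ.ker.subschemeCover_map_subschemeι U).trans (φ.ker.glueDataObjι_ι U)
  have hFr : F.opensRange = Scheme.Hom.imageι φ ⁻¹ᵁ j.opensRange :=
    φ.ker.opensRange_subschemeCover_map U
  let c : Spec (.of C) ⟶ Scheme.Hom.image φ := specMap ε.toRingHom ≫ F
  have hc : c ≫ Scheme.Hom.imageι φ = specMap α ≫ j := by
    have h6 : CommRingCat.ofHom (Ideal.Quotient.mk (φ.ker.ideal U)) ≫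
        CommRingCat.ofHom ε.toRingHom = β ≫ CommRingCat.ofHom α := by
      rw [← CommRingCat.ofHom_comp, hε]
      rfl
    rw [Category.assoc, hF, ← Category.assoc, ← Spec.map_comp, h6, Spec.map_comp,
      Category.assoc, hβ]
  have hco : IsOpenImmersion c := inferInstance
  refine ⟨c, hco, ?_, hc, ?_⟩
  · rw [← hFr]
    exact Scheme.Hom.opensRange_comp_of_isIso _ _
  · rw [← cancel_mono (Scheme.Hom.imageι φ), Category.assoc, hc, Scheme.Hom.toImage_imageι,
      ← Category.assoc, ← Spec.map_comp, ← CommRingCat.ofHom_comp, h]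

end Image

section ProjectiveImage

open MvPolynomial HomogeneousLocalization

attribute [local instance] MvPolynomial.gradedAlgebra

local notation "𝒮" => homogeneousSubmodule

theorem iSup_basicOpen_X_eq_top (R : Type u) [CommRing R] (n : ℕ) :
    ⨆ i, Proj.basicOpen (𝒮 (Fin (n + 1)) R)
      (X i) = ⊤ := by
  refine Proj.iSup_basicOpen_eq_top _ _ ?_
  rw [HomogeneousIdeal.irrelevant_eq_span, Ideal.span_le]
  intro a ha
  obtain ⟨d, hd⟩ := Set.mem_iUnion.1 ha
  obtain ⟨hd, ha⟩ := Set.mem_iUnion.1 hd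
  rw [← Set.image_univ, SetLike.mem_coe, mem_ideal_span_X_image]
  intro m hm
  by_contra! hc
  have : m = 0 := Finsupp.ext fun i => hc i trivial
  subst this
  have h1 := (mem_homogeneousSubmodule d a).1 ha (mem_support_iff.1 hm)
  simp at h1
  omega

variable {R K : Type u} [CommRing R] [Field K] [Algebra R K] {n : ℕ} (s : Fin (n + 1) → K)

theorem aeval_div_pow (c : K) {d : ℕ} {a : MvPolynomial (Fin (n + 1)) R}
    (ha : a.IsHomogeneous d) :
    aeval s a / c ^ d = aeval (fun i => s i / c) a := by
  rw [aeval_def, aeval_def, eval₂_eq',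
    eval₂_eq', Finset.sum_div]
  refine Finset.sum_congr rfl fun m hm => ?_
  rw [mul_div_assoc]
  congr 1
  simp only [div_pow]
  rw [Finset.prod_div_distrib, Finset.prod_pow_eq_pow_sum]
  congr 2
  have h1 := ha (mem_support_iff.1 hm)
  rw [← h1, Finsupp.weight_apply, Finsupp.sum_fintype _ _ (by simp)]
  simp

/-- The homomorphism from the ring of fractions of degree zero with denominators powers of `f`
given by a point with coordinates `s`. -/
def evalAway (f : MvPolynomial (Fin (n + 1)) R) (hf : aeval s f ≠ 0) :
    Away (𝒮 (Fin (n + 1)) R) f →+* K :=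
  (IsLocalization.Away.lift (S := Localization.Away f) f
    (g := (aeval s : _ →ₐ[R] K).toRingHom) hf.isUnit).comp
    (algebraMap _ (Localization.Away f))

theorem evalAway_mk {f : MvPolynomial (Fin (n + 1)) R} (hf : aeval s f ≠ 0) {d : ℕ}
    (hd : f ∈ 𝒮 (Fin (n + 1)) R d) (m : ℕ)
    (a : MvPolynomial (Fin (n + 1)) R)
    (ha : a ∈ 𝒮 (Fin (n + 1)) R (m • d)) :
    evalAway s f hf (Away.mk _ hd m a ha) =
      aeval s a / aeval s f ^ m := by
  rw [evalAway, RingHom.comp_apply, HomogeneousLocalization.algebraMap_apply,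
    Away.val_mk, eq_div_iff (pow_ne_zero _ hf)]
  set l := IsLocalization.Away.lift (S := Localization.Away f) f
    (g := (aeval s : _ →ₐ[R] K).toRingHom) hf.isUnit
  have hl (x) : l (algebraMap _ _ x) = aeval s x := IsLocalization.Away.lift_eq _ _ x
  rw [← hl, ← hl, ← map_pow, ← map_mul, ← map_pow]
  congr 1
  rw [mul_comm]
  exact IsLocalization.mk'_spec' (Localization.Away f) a (⟨f ^ m, m, rfl⟩ : Submonoid.powers f)
    |>.symm ▸ (by rw [Localization.mk_eq_mk'])

theorem evalAway_comp_awayMap {f g : MvPolynomial (Fin (n + 1)) R}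
    (hf : aeval s f ≠ 0) {d e : ℕ}
    (hd : f ∈ 𝒮 (Fin (n + 1)) R d)
    (he : g ∈ 𝒮 (Fin (n + 1)) R e)
    {x : MvPolynomial (Fin (n + 1)) R} (hx : x = f * g) (hfg : aeval s x ≠ 0) :
    (evalAway s x hfg).comp (awayMap _ he hx) = evalAway s f hf := by
  subst hx
  ext a
  obtain ⟨m, a, ha, rfl⟩ := Away.mk_surjective _ hd a
  have hg : aeval s g ≠ 0 := by
    rw [map_mul] at hfg
    exact right_ne_zero_of_mul hfg
  rw [RingHom.comp_apply, awayMap_mk, evalAway_mk, evalAway_mk]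
  simp only [map_mul, map_pow]
  rw [mul_pow, mul_div_mul_right _ _ (pow_ne_zero _ hg)]

theorem evalAway_fromZero {f : MvPolynomial (Fin (n + 1)) R} (hf : aeval s f ≠ 0)
    {d : ℕ} (hd : f ∈ 𝒮 (Fin (n + 1)) R d) (r : R) :
    evalAway s f hf (fromZeroRingHom _ _
      (algebraMap R (𝒮 (Fin (n + 1)) R 0) r)) =
      algebraMap R K r := by
  have h0 : algebraMap R (MvPolynomial (Fin (n + 1)) R) r ∈
      𝒮 (Fin (n + 1)) R (0 • d) := by
    rw [zero_smul]
    exact isHomogeneous_C _ r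
  have : fromZeroRingHom _ (Submonoid.powers f)
      (algebraMap R (𝒮 (Fin (n + 1)) R 0) r) =
      Away.mk _ hd 0 (algebraMap R _ r) h0 := by
    apply val_injective
    rw [Away.val_mk]
    rw [fromZeroRingHom]
    simp
    rfl
  rw [this, evalAway_mk]
  simp

theorem X_mem_deg_one (R : Type u) [CommRing R] {n : ℕ} (i : Fin (n + 1)) :
    X i ∈ 𝒮 (Fin (n + 1)) R 1 :=
  isHomogeneous_X R i

/-- The inclusion of the affine open subset of projective space where the coordinate `X i` does not
vanish. -/
abbrev coordι (R : Type u) [CommRing R] (n : ℕ) (i : Fin (n + 1)) :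
    Spec (.of (Away
      (𝒮 (Fin (n + 1)) R) (X i))) ⟶ ProjSpace R n :=
  Proj.awayι (𝒮 (Fin (n + 1)) R) (X i)
    (X_mem_deg_one R i) one_pos

instance (R : Type u) [CommRing R] (n : ℕ) (i : Fin (n + 1)) : IsOpenImmersion (coordι R n i) :=
  inferInstanceAs (IsOpenImmersion (Proj.awayι
    (𝒮 (Fin (n + 1)) R) (X i)
    (X_mem_deg_one R i) one_pos))

theorem opensRange_coordι (R : Type u) [CommRing R] (n : ℕ) (i : Fin (n + 1)) :
    (coordι R n i).opensRange =
      Proj.basicOpen (𝒮 (Fin (n + 1)) R) (X i) :=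
  Proj.opensRange_awayι _ _ _ _

theorem coordι_mem_basicOpen_X_iff (R : Type u) [CommRing R] (n : ℕ) (i l : Fin (n + 1)) (q) :
    coordι R n i q ∈
        Proj.basicOpen (𝒮 (Fin (n + 1)) R) (X l) ↔
      Away.mk _ (X_mem_deg_one R i) 1
        (X l) (X_mem_deg_one R l) ∉ q.asIdeal := by
  have h := Proj.awayι_preimage_basicOpen (𝒮 (Fin (n + 1)) R)
    (X_mem_deg_one R i) one_pos (X_mem_deg_one R l) one_pos
  have h1 : q ∈ coordι R n i ⁻¹ᵁ Proj.basicOpen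
    (𝒮 (Fin (n + 1)) R) (X l) ↔ q ∈
      PrimeSpectrum.basicOpen (Away.isLocalizationElem
        (X_mem_deg_one R i) (X_mem_deg_one R l)) :=
    iff_of_eq (congrArg (q ∈ ·) h)
  have h2 : Away.isLocalizationElem
      (X_mem_deg_one R i) (X_mem_deg_one R l) =
      Away.mk _ (X_mem_deg_one R i) 1
        (X l) (X_mem_deg_one R l) := by
    apply val_injective
    rw [Away.val_mk, Away.val_mk]
    simp
  rw [← h2]
  exact h1

theorem coordι_toSpec (R : Type u) [CommRing R] (n : ℕ) (i : Fin (n + 1)) :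
    coordι R n i ≫ ProjSpace.toSpec R n = specMap ((fromZeroRingHom _ (Submonoid.powers (X i))).comp
      (algebraMap R (𝒮 (Fin (n + 1)) R 0))) := by
  have h := Proj.awayι_toSpecZero (𝒮 (Fin (n + 1)) R)
    (X i) (X_mem_deg_one R i) one_pos
  rw [CommRingCat.ofHom_comp, Spec.map_comp, ← h, Category.assoc]
  rfl

variable (R) in
theorem aeval_X_ne_zero (hs : ∀ i, s i ≠ 0) (i : Fin (n + 1)) :
    aeval (R := R) s (X i) ≠ 0 := by
  rw [aeval_X]
  exact hs i

theorem evalAway_coordι_eq (hs : ∀ i, s i ≠ 0) (i j : Fin (n + 1)) :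
    specMap (evalAway s _ (aeval_X_ne_zero R s hs i)) ≫ coordι R n i =
      specMap (evalAway s _ (aeval_X_ne_zero R s hs j)) ≫ coordι R n j := by
  have key (i j : Fin (n + 1)) (x : MvPolynomial (Fin (n + 1)) R)
      (hx : x = X i * X j) (hij : aeval (R := R) s x ≠ 0)
      (hm : x ∈ 𝒮 (Fin (n + 1)) R 2) :
      specMap (evalAway s _ (aeval_X_ne_zero R s hs i)) ≫ coordι R n i =
      specMap (evalAway s _ hij) ≫
        Proj.awayι (𝒮 (Fin (n + 1)) R) x hm two_pos := by
    rw [← evalAway_comp_awayMap s _ (X_mem_deg_one R i)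
      (X_mem_deg_one R j) hx hij, CommRingCat.ofHom_comp, Spec.map_comp,
      Category.assoc]
    congr 1
    exact Proj.SpecMap_awayMap_awayι _ _ one_pos _ hx
  have hij : aeval (R := R) s (X i * X j) ≠ 0 := by
    rw [map_mul]
    exact mul_ne_zero (aeval_X_ne_zero R s hs i) (aeval_X_ne_zero R s hs j)
  have hm := SetLike.mul_mem_graded (X_mem_deg_one R i)
    (X_mem_deg_one R j)
  rw [key i j _ rfl hij hm, key j i _ (mul_comm _ _) hij hm]

/-- The image of a point of projective space with nonvanishing homogeneous coordinates `s i`: if the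
ring `C c` is generated by the quotients `s i / s (l c)` and the open subsets where the coordinates
`l c` do not vanish cover the image, then these rings form an atlas. -/
theorem exists_atlas_projective (hs : ∀ i, s i ≠ 0) {I : Type} (C : I → Type u)
    [∀ c, CommRing (C c)] [∀ c, Algebra R (C c)] (θ : ∀ c, C c →+* K)
    (hθ : ∀ c, Function.Injective (θ c))
    (hθR : ∀ c r, θ c (algebraMap R (C c) r) = algebraMap R K r) (l : I → Fin (n + 1))
    (γ : ∀ c, Fin (n + 1) → C c) (hγ : ∀ c i, θ c (γ c i) = s i / s (l c))
    (hgen : ∀ c, Algebra.adjoin R (Set.range (γ c)) = ⊤)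
    (hcov : ∀ j (O : Subring K) (_ : ∀ r, algebraMap R K r ∈ O) (hO : ∀ i, s i / s j ∈ O)
      (F : Type u) [Field F] (v : O →+* F), ∃ c, v ⟨s (l c) / s j, hO _⟩ ≠ 0) :
    ∃ (X : Scheme.{u}) (ι : X ⟶ ProjSpace R n) (A : Atlas X K C θ), IsClosedImmersion ι ∧
      ∀ c, A.chart c ≫ ι ≫ ProjSpace.toSpec R n =
        specMap (algebraMap R (C c)) := by
  let ψ (j : Fin (n + 1)) := evalAway s _ (aeval_X_ne_zero R s hs j)
  let φ : Spec (.of K) ⟶ ProjSpace R n := specMap (ψ 0) ≫ coordι R n 0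
  have hφ (j) : specMap (ψ j) ≫ coordι R n j = φ :=
    evalAway_coordι_eq s hs j 0
  have hψR (j) (r : R) : ψ j (fromZeroRingHom _ _
      (algebraMap R (𝒮 (Fin (n + 1)) R 0) r)) =
      algebraMap R K r := evalAway_fromZero s _ (X_mem_deg_one R j) r
  have hX (i : Fin (n + 1)) : X i ∈
      𝒮 (Fin (n + 1)) R (1 • 1) :=
    X_mem_deg_one R i
  have hψX (i j) : ψ j (Away.mk _ (X_mem_deg_one R j) 1
      (X i) (hX i)) = s i / s j := by
    simp only [ψ]
    rw [evalAway_mk]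
    simp
  have hψ (j) (a) : ψ j a ∈ Algebra.adjoin R (Set.range fun i => s i / s j) := by
    obtain ⟨m, a, ha, rfl⟩ :=
      Away.mk_surjective _ (X_mem_deg_one R j) a
    simp only [ψ]
    rw [evalAway_mk, aeval_X]
    have ha' : a.IsHomogeneous m := by simpa using ha
    rw [aeval_div_pow s _ ha', Algebra.adjoin_range_eq_range_aeval]
    exact ⟨a, rfl⟩
  -- the homomorphisms onto the rings of the charts
  have hα (c) : ∃ α : Away
      (𝒮 (Fin (n + 1)) R) (X (l c)) →+* C c,
      (θ c).comp α = ψ (l c) := by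
    have hmem (a) : ψ (l c) a ∈ (θ c).range := by
      have h1 : Algebra.adjoin R (Set.range fun i => s i / s (l c)) ≤
          ({ θ c with commutes' := hθR c } : C c →ₐ[R] K).range := by
        rw [Algebra.adjoin_le_iff]
        rintro _ ⟨i, rfl⟩
        exact ⟨γ c i, hγ c i⟩
      exact h1 (hψ _ a)
    let e := RingEquiv.ofBijective (θ c).rangeRestrict
      ⟨fun a b h => hθ c (congrArg Subtype.val h), (θ c).rangeRestrict_surjective⟩
    refine ⟨e.symm.toRingHom.comp ((ψ (l c)).codRestrict _ hmem), RingHom.ext fun a => ?_⟩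
    exact congrArg Subtype.val (e.apply_symm_apply ((ψ (l c)).codRestrict _ hmem a))
  choose α hα using hα
  have hαR (c) (r : R) : α c (fromZeroRingHom _ _
      (algebraMap R (𝒮 (Fin (n + 1)) R 0) r)) =
      algebraMap R (C c) r := by
    apply hθ c
    rw [hθR, ← hψR (l c), ← hα]
    rfl
  have hαs (c) : Function.Surjective (α c) := by
    intro a
    have ha : a ∈ Algebra.adjoin R (Set.range (γ c)) := hgen c ▸ trivial
    induction ha using Algebra.adjoin_induction with
    | mem x hx =>
      obtain ⟨i, rfl⟩ := hx
      refine ⟨Away.mk _ (X_mem_deg_one R _) 1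
          (X i) (hX i), hθ c ?_⟩
      rw [hγ, ← hψX, ← hα]
      rfl
    | algebraMap r => exact ⟨_, hαR c r⟩
    | add x y _ _ hx hy =>
      obtain ⟨x, rfl⟩ := hx
      obtain ⟨y, rfl⟩ := hy
      exact ⟨x + y, map_add _ _ _⟩
    | mul x y _ _ hx hy =>
      obtain ⟨x, rfl⟩ := hx
      obtain ⟨y, rfl⟩ := hy
      exact ⟨x * y, map_mul _ _ _⟩
  have hch (c) := exists_chart_image (coordι R n (l c)) φ (α c) (hαs c) (θ c) (hθ c)
    (by rw [hα, hφ])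
  choose ch hch1 hch2 hch3 hch4 using hch
  have hcovers (x : Scheme.Hom.image φ) : ∃ c, x ∈ (ch c).opensRange := by
    have hx : Scheme.Hom.imageι φ x ∈ (⊤ : (ProjSpace R n).Opens) := trivial
    erw [← iSup_basicOpen_X_eq_top R n] at hx
    obtain ⟨j, hj⟩ := TopologicalSpace.Opens.mem_iSup.1 hx
    obtain ⟨d, hd1, hd2, hd3, -⟩ := exists_chart_image (coordι R n j) φ (ψ j).rangeRestrict
      (ψ j).rangeRestrict_surjective (ψ j).range.subtype Subtype.val_injective (hφ j)
    have hx : x ∈ d.opensRange := by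
      rw [hd2]
      change _ ∈ (coordι R n j).opensRange
      rw [opensRange_coordι]
      exact hj
    obtain ⟨q, rfl⟩ := hx
    have hO (i) : s i / s j ∈ (ψ j).range := ⟨_, hψX i j⟩
    have hq : q.asIdeal.IsPrime := PrimeSpectrum.isPrime q
    have hRO (r) : algebraMap R K r ∈ (ψ j).range := ⟨_, hψR j r⟩
    obtain ⟨c, hc⟩ := hcov j (ψ j).range hRO hO
      q.asIdeal.ResidueField (algebraMap (ψ j).range _)
    refine ⟨c, ?_⟩
    rw [hch2]
    change Scheme.Hom.imageι φ (d q) ∈ (coordι R n (l c)).opensRange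
    rw [opensRange_coordι, ← Scheme.Hom.comp_apply, hd3, Scheme.Hom.comp_apply]
    refine (coordι_mem_basicOpen_X_iff R n j (l c) _).2 fun h6 => ?_
    apply hc
    rw [Ideal.algebraMap_residueField_eq_zero]
    have h8 : (⟨s (l c) / s j, hO (l c)⟩ : (ψ j).range) = (ψ j).rangeRestrict
        (Away.mk _ (X_mem_deg_one R j) 1
        (X (l c)) (X_mem_deg_one R (l c))) :=
      Subtype.ext (hψX (l c) j).symm
    rw [h8]
    exact h6
  refine ⟨Scheme.Hom.image φ, Scheme.Hom.imageι φ,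
    ⟨ch, hch1, hcovers, Scheme.Hom.toImage φ, hch4⟩, inferInstance, fun c => ?_⟩
  have h7 : ch c ≫ Scheme.Hom.imageι φ = _ := hch3 c
  change ch c ≫ _ = _
  rw [← Category.assoc, h7, Category.assoc, coordι_toSpec, ← Spec.map_comp,
    ← CommRingCat.ofHom_comp]
  congr 2
  ext r
  exact hαR c r

end ProjectiveImage

section Smooth

open MvPolynomial

theorem isStandardSmooth_polynomial (B : Type u) [CommRing B] :
    Algebra.IsStandardSmoothOfRelativeDimension 1 B (Polynomial B) := by
  let v : PEmpty.{1} → MvPolynomial PUnit.{1} B := PEmpty.elim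
  let P := Algebra.PreSubmersivePresentation.naive (R := B) (v := v) (a := PEmpty.elim)
    (fun i => i.elim)
  have hP : IsUnit P.jacobian := by
    rw [Algebra.PreSubmersivePresentation.jacobian_eq_jacobiMatrix_det, Matrix.det_isEmpty,
      map_one]
    exact isUnit_one
  let P' : Algebra.SubmersivePresentation B _ PUnit.{1} PEmpty.{1} := ⟨P, hP⟩
  have h1 : Algebra.IsStandardSmoothOfRelativeDimension 1 B
      (MvPolynomial PUnit.{1} B ⧸ Ideal.span (Set.range v)) := by
    refine P'.isStandardSmoothOfRelativeDimension ?_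
    simp [Algebra.Presentation.dimension]
  have h2 : Ideal.span (Set.range v) = ⊥ := by
    rw [Set.range_eq_empty, Ideal.span_empty]
  let e : (MvPolynomial PUnit.{1} B ⧸ Ideal.span (Set.range v)) ≃ₐ[B] Polynomial B :=
    ((Ideal.quotientEquivAlgOfEq B h2).trans (AlgEquiv.quotientBot B _)).trans
      (uniqueAlgEquiv B PUnit.{1})
  exact Algebra.IsStandardSmoothOfRelativeDimension.of_algEquiv 1 e

variable {k : Type u} [Field k] {A : Type u} [CommRing A] [Algebra k A]
  {φ : MvPolynomial (Fin 2) k →ₐ[k] A} (hφ : Function.Surjective φ) {F : MvPolynomial (Fin 2) k}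
  (hF : RingHom.ker φ = Ideal.span {F})

include hφ hF in
/-- A plane curve is smooth where a partial derivative of its equation does not vanish. -/
theorem isStandardSmooth_away_pderiv (i : Fin 2) (B : Type u) [CommRing B] [Algebra k B]
    [Algebra A B] [IsScalarTower k A B] [IsLocalization.Away (φ (pderiv i F)) B] :
    Algebra.IsStandardSmoothOfRelativeDimension 1 k B := by
  let v : Unit → MvPolynomial (Fin 2) k := fun _ => F
  have hv : Ideal.span (Set.range v) = RingHom.ker φ := by
    rw [hF, Set.range_const]
  let e : (MvPolynomial (Fin 2) k ⧸ Ideal.span (Set.range v)) ≃ₐ[k] A :=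
    (Ideal.quotientEquivAlgOfEq k hv).trans (Ideal.quotientKerAlgEquivOfSurjective hφ)
  have hi : Function.Injective fun _ : Unit => i := fun _ _ _ => rfl
  let P₀ := Algebra.PreSubmersivePresentation.naive (R := k) (v := v) (a := fun _ => i) hi
  let P := P₀.ofAlgEquiv e
  have hPj : P.jacobian = φ (pderiv i F) := by
    rw [Algebra.PreSubmersivePresentation.jacobian_ofAlgEquiv,
      Algebra.PreSubmersivePresentation.jacobian_eq_jacobiMatrix_det]
    rw [Matrix.det_unique, Algebra.PreSubmersivePresentation.jacobiMatrix_naive (v := v)]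
    rfl
  let Q := Algebra.SubmersivePresentation.localizationAway B (φ (pderiv i F))
  let T : Algebra.SubmersivePresentation k B (Unit ⊕ Fin 2) (Unit ⊕ Unit) :=
    ⟨Q.toPreSubmersivePresentation.comp P, by
      rw [Algebra.PreSubmersivePresentation.comp_jacobian_eq_jacobian_smul_jacobian,
        Algebra.smul_def, IsUnit.mul_iff]
      refine ⟨?_, Q.jacobian_isUnit⟩
      rw [hPj]
      exact IsLocalization.Away.algebraMap_isUnit _⟩
  refine T.isStandardSmoothOfRelativeDimension ?_
  simp [Algebra.Presentation.dimension]

variable [IsAlgClosed k]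
  (hns : ∀ c : Fin 2 → k, eval c F = 0 →
    eval c (pderiv 0 F) = 0 →
    eval c (pderiv 1 F) ≠ 0)

include hφ in
/-- The points of a plane curve. -/
theorem exists_eval_of_isMaximal (m : Ideal A) [hm : m.IsMaximal] :
    ∃ c : Fin 2 → k, ∀ a, φ a ∈ m ↔ eval c a = 0 := by
  have h1 : (m.comap φ).IsMaximal := Ideal.comap_isMaximal_of_surjective φ hφ
  obtain ⟨c, hc⟩ := isMaximal_iff_eq_vanishingIdeal_singleton.1 h1
  refine ⟨c, fun a => ?_⟩
  rw [← Ideal.mem_comap, hc, mem_vanishingIdeal_singleton_iff]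
  rfl

include hφ hF hns in
theorem span_pderiv_eq_top :
    Ideal.span (Set.range fun i => φ (pderiv i F)) = ⊤ := by
  by_contra h
  obtain ⟨m, hm, hle⟩ := Ideal.exists_le_maximal _ h
  obtain ⟨c, hc⟩ := exists_eval_of_isMaximal hφ m
  have hd (i) : eval c (pderiv i F) = 0 :=
    (hc _).1 (hle (Ideal.subset_span ⟨i, rfl⟩))
  refine hns c ((hc _).1 ?_) (hd 0) (hd 1)
  have : F ∈ RingHom.ker φ := hF ▸ Ideal.mem_span_singleton_self F
  rw [RingHom.mem_ker.1 this]
  exact zero_mem m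

omit [IsAlgClosed k] in
theorem vanishing_eq_combination (c : Fin 2 → k) (a : MvPolynomial (Fin 2) k)
    (ha : eval c a = 0) : ∃ g₀ g₁ : MvPolynomial (Fin 2) k,
      a = (X 0 - C (c 0)) * g₀ +
        (X 1 - C (c 1)) * g₁ := by
  have key (a : MvPolynomial (Fin 2) k) : ∃ g₀ g₁ : MvPolynomial (Fin 2) k,
      a - C (eval c a) =
        (X 0 - C (c 0)) * g₀ +
        (X 1 - C (c 1)) * g₁ := by
    induction a using induction_on with
    | C r => exact ⟨0, 0, by simp⟩
    | add a b ha hb =>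
      obtain ⟨a₀, a₁, ha⟩ := ha
      obtain ⟨b₀, b₁, hb⟩ := hb
      exact ⟨a₀ + b₀, a₁ + b₁, by rw [map_add, map_add]; linear_combination ha + hb⟩
    | mul_X a i ha =>
      obtain ⟨a₀, a₁, ha⟩ := ha
      fin_cases i
      · refine ⟨a₀ * X 0 + C (eval c a),
          a₁ * X 0, ?_⟩
        simp only [Fin.zero_eta, map_mul, eval_X]
        linear_combination X 0 * ha
      · refine ⟨a₀ * X 1,
          a₁ * X 1 + C (eval c a), ?_⟩
        simp only [Fin.mk_one, map_mul, eval_X]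
        linear_combination X 1 * ha
  obtain ⟨g₀, g₁, h⟩ := key a
  rw [ha, map_zero, sub_zero] at h
  exact ⟨g₀, g₁, h⟩

include hφ hF hns in
/-- A nonsingular plane curve is normal. -/
theorem isIntegrallyClosed_of_nonsingular [IsDomain A] : IsIntegrallyClosed A := by
  have hN : IsNoetherianRing A := isNoetherianRing_of_surjective _ _ φ.toRingHom hφ
  refine IsIntegrallyClosed.of_localization_maximal fun m hm0 hm => ?_
  obtain ⟨c, hc⟩ := exists_eval_of_isMaximal hφ m
  have hFk : φ F = 0 := by
    have : F ∈ RingHom.ker φ := hF ▸ Ideal.mem_span_singleton_self F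
    exact this
  have hFc : eval c F = 0 := (hc F).1 (hFk ▸ zero_mem m)
  obtain ⟨g₀, g₁, hg⟩ := vanishing_eq_combination c F hFc
  have hd0 : eval c (pderiv 0 F) = eval c g₀ := by
    rw [hg]
    simp [Derivation.leibniz, pderiv_X]
  have hd1 : eval c (pderiv 1 F) = eval c g₁ := by
    rw [hg]
    simp [Derivation.leibniz, pderiv_X]
  set s := φ (X 0 - C (c 0)) with hs
  set t := φ (X 1 - C (c 1)) with ht
  have hst : s * φ g₀ + t * φ g₁ = 0 := by
    rw [hg, map_add, map_mul, map_mul] at hFk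
    exact hFk
  have hm' : m ≤ Ideal.span {s, t} := by
    intro a ha
    obtain ⟨a, rfl⟩ := hφ a
    obtain ⟨a₀, a₁, h⟩ := vanishing_eq_combination c a ((hc a).1 ha)
    rw [h, map_add, map_mul, map_mul, mul_comm, mul_comm _ (φ a₁)]
    exact Ideal.mem_span_pair.2 ⟨_, _, rfl⟩
  let Am := Localization.AtPrime m
  have hmax : IsLocalRing.maximalIdeal Am ≤
      Ideal.span {algebraMap A Am s, algebraMap A Am t} := by
    rw [← Localization.AtPrime.map_eq_maximalIdeal]
    refine (Ideal.map_mono hm').trans ?_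
    rw [Ideal.map_span, Set.image_pair]
  have hsm : s ∈ m := (hc _).2 (by simp)
  have htm : t ∈ m := (hc _).2 (by simp)
  have hmem (a : A) (ha : a ∈ m) : algebraMap A Am a ∈ IsLocalRing.maximalIdeal Am := by
    rw [← Localization.AtPrime.map_eq_maximalIdeal]
    exact Ideal.mem_map_of_mem _ ha
  have hst' : algebraMap A Am s * algebraMap A Am (φ g₀) +
      algebraMap A Am t * algebraMap A Am (φ g₁) = 0 := by
    rw [← map_mul (algebraMap A Am), ← map_mul (algebraMap A Am), ← map_add (algebraMap A Am),
      hst, map_zero]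
  have hprin : (IsLocalRing.maximalIdeal Am).IsPrincipal := by
    have hu (g : MvPolynomial (Fin 2) k) (hg : eval c g ≠ 0) :
        IsUnit (algebraMap A Am (φ g)) :=
      IsLocalization.map_units Am (⟨φ g, fun h => hg ((hc g).1 h)⟩ : m.primeCompl)
    by_cases h0 : eval c g₀ = 0
    · have h1 : eval c g₁ ≠ 0 := by
        rw [← hd1]
        exact hns c hFc (hd0.trans h0)
      obtain ⟨r, hr⟩ := hu g₁ h1
      refine ⟨algebraMap A Am s, le_antisymm (hmax.trans ?_) ?_⟩
      · rw [Ideal.span_le, Set.insert_subset_iff, Set.singleton_subset_iff]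
        refine ⟨Ideal.mem_span_singleton_self _, Ideal.mem_span_singleton'.2
          ⟨-(algebraMap A Am (φ g₀) * ↑r⁻¹), ?_⟩⟩
        have h5 : (r : Am) * ↑r⁻¹ = 1 := r.mul_inv
        rw [← hr] at hst'
        linear_combination -(↑r⁻¹ : Am) * hst' + algebraMap A Am t * h5
      · exact (Ideal.span_singleton_le_iff_mem _).2 (hmem s hsm)
    · obtain ⟨r, hr⟩ := hu g₀ h0
      refine ⟨algebraMap A Am t, le_antisymm (hmax.trans ?_) ?_⟩
      · rw [Ideal.span_le, Set.insert_subset_iff, Set.singleton_subset_iff]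
        refine ⟨Ideal.mem_span_singleton'.2
          ⟨-(algebraMap A Am (φ g₁) * ↑r⁻¹), ?_⟩, Ideal.mem_span_singleton_self _⟩
        have h5 : (r : Am) * ↑r⁻¹ = 1 := r.mul_inv
        rw [← hr] at hst'
        linear_combination -(↑r⁻¹ : Am) * hst' + algebraMap A Am s * h5
      · exact (Ideal.span_singleton_le_iff_mem _).2 (hmem t htm)
  have hN' : IsNoetherianRing Am := IsLocalization.isNoetherianRing m.primeCompl _ hN
  by_cases hf : IsField Am
  · let _ := hf.toField
    exact inferInstanceAs (IsIntegrallyClosed Am)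
  · have := ((IsDiscreteValuationRing.TFAE Am hf).out 0 4).2 hprin
    have : IsDiscreteValuationRing Am := this
    exact inferInstanceAs (IsIntegrallyClosed Am)

end Smooth

section WeierstrassCharts

open MvPolynomial (pderiv)

variable {k : Type u} [Field k] (W : WeierstrassCurve k)

/-- The function field of a Weierstrass curve. -/
abbrev CurveField : Type u := W.toAffine.FunctionField

/-- The coordinate `x`. -/
def xFun : CurveField W :=
  algebraMap W.toAffine.CoordinateRing _ (algebraMap (Polynomial k) _ Polynomial.X)

/-- The coordinate `y`. -/
def yFun : CurveField W :=
  algebraMap W.toAffine.CoordinateRing _ (WeierstrassCurve.Affine.CoordinateRing.mk W.toAffine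
    Polynomial.X)

theorem aeval_xFun (q : Polynomial k) : Polynomial.aeval (xFun W) q =
    algebraMap W.toAffine.CoordinateRing _ (algebraMap (Polynomial k) _ q) := by
  rw [xFun, Polynomial.aeval_algebraMap_apply, Polynomial.aeval_algebraMap_apply,
    Polynomial.aeval_X_left_apply]

theorem eq_zero_of_aeval_add_mul_yFun {q₀ q₁ : Polynomial k}
    (h : Polynomial.aeval (xFun W) q₀ + Polynomial.aeval (xFun W) q₁ * yFun W = 0) :
    q₀ = 0 ∧ q₁ = 0 := by
  rw [aeval_xFun, aeval_xFun, yFun, ← map_mul, ← map_add,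
    map_eq_zero_iff _ (IsFractionRing.injective _ _)] at h
  refine WeierstrassCurve.Affine.CoordinateRing.smul_basis_eq_zero (W' := W.toAffine) ?_
  rw [Algebra.smul_def, Algebra.smul_def, mul_one]
  exact h

theorem eq_of_aeval_add_mul_yFun {q₀ q₁ q₀' q₁' : Polynomial k}
    (h : Polynomial.aeval (xFun W) q₀ + Polynomial.aeval (xFun W) q₁ * yFun W =
      Polynomial.aeval (xFun W) q₀' + Polynomial.aeval (xFun W) q₁' * yFun W) :
    q₀ = q₀' ∧ q₁ = q₁' := by
  rw [← sub_eq_zero (a := q₀), ← sub_eq_zero (a := q₁)]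
  apply eq_zero_of_aeval_add_mul_yFun W
  rw [map_sub, map_sub]
  linear_combination h

theorem xFun_ne_zero : xFun W ≠ 0 := by
  intro h
  have := (eq_zero_of_aeval_add_mul_yFun W (q₀ := Polynomial.X) (q₁ := 0) (by simpa using h)).1
  exact Polynomial.X_ne_zero this

theorem yFun_ne_zero : yFun W ≠ 0 := by
  intro h
  have := (eq_zero_of_aeval_add_mul_yFun W (q₀ := 0) (q₁ := 1) (by simpa using h)).2
  exact one_ne_zero this

local notation "𝐚₁" => algebraMap k (CurveField W) W.a₁
local notation "𝐚₂" => algebraMap k (CurveField W) W.a₂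
local notation "𝐚₃" => algebraMap k (CurveField W) W.a₃
local notation "𝐚₄" => algebraMap k (CurveField W) W.a₄
local notation "𝐚₆" => algebraMap k (CurveField W) W.a₆

theorem weierstrass_equation : yFun W ^ 2 + 𝐚₁ * xFun W * yFun W + 𝐚₃ * yFun W =
    xFun W ^ 3 + 𝐚₂ * xFun W ^ 2 + 𝐚₄ * xFun W + 𝐚₆ := by
  have h : algebraMap W.toAffine.CoordinateRing (CurveField W)
      (WeierstrassCurve.Affine.CoordinateRing.mk W.toAffine (.X ^ 2 +
      .C (.C W.a₁ * .X + .C W.a₃) * .X -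
      .C (.X ^ 3 + .C W.a₂ * .X ^ 2 + .C W.a₄ * .X + .C W.a₆))) = 0 := by
    have h1 : WeierstrassCurve.Affine.CoordinateRing.mk W.toAffine W.toAffine.polynomial = 0 :=
      AdjoinRoot.mk_self
    exact (congrArg _ h1).trans (map_zero _)
  simp only [map_add, map_sub, map_mul, map_pow] at h
  have hC (q : Polynomial k) : algebraMap W.toAffine.CoordinateRing (CurveField W)
      (WeierstrassCurve.Affine.CoordinateRing.mk W.toAffine (Polynomial.C q)) =
      Polynomial.aeval (xFun W) q := (aeval_xFun W q).symm
  simp only [hC, Polynomial.aeval_C, Polynomial.aeval_X] at h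
  change yFun W ^ 2 + _ * yFun W - _ = 0 at h
  linear_combination h

/-- The coordinate `1 / x` at infinity. -/
def rFun : CurveField W := (xFun W)⁻¹

/-- The coordinate `y / x ^ 2` at infinity. -/
def vFun : CurveField W := yFun W / xFun W ^ 2

theorem weierstrass_equation_infinity : vFun W ^ 2 + 𝐚₁ * rFun W * vFun W +
    𝐚₃ * rFun W ^ 2 * vFun W =
      rFun W + 𝐚₂ * rFun W ^ 2 + 𝐚₄ * rFun W ^ 3 + 𝐚₆ * rFun W ^ 4 := by
  have h := weierstrass_equation W
  have hx := xFun_ne_zero W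
  rw [rFun, vFun]
  field_simp
  linear_combination h

/-- The coordinates on the two affine charts. -/
def coordFun (i : Fin 2) : Fin 2 → CurveField W :=
  if i = 0 then ![xFun W, yFun W] else ![rFun W, vFun W]

/-- The equations of the two affine charts. -/
def chartEqn (i : Fin 2) : MvPolynomial (Fin 2) k :=
  if i = 0 then .X 1 ^ 2 + .C W.a₁ * .X 0 * .X 1 + .C W.a₃ * .X 1 -
    (.X 0 ^ 3 + .C W.a₂ * .X 0 ^ 2 + .C W.a₄ * .X 0 + .C W.a₆)
  else .X 1 ^ 2 + .C W.a₁ * .X 0 * .X 1 + .C W.a₃ * .X 0 ^ 2 * .X 1 -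
    (.X 0 + .C W.a₂ * .X 0 ^ 2 + .C W.a₄ * .X 0 ^ 3 + .C W.a₆ * .X 0 ^ 4)

/-- The evaluation homomorphism on the polynomial ring in the coordinates of a chart. -/
def chartEval (i : Fin 2) : MvPolynomial (Fin 2) k →ₐ[k] CurveField W :=
  MvPolynomial.aeval (coordFun W i)

/-- The coordinate rings of the two affine charts. -/
def chartRing (i : Fin 2) : Subalgebra k (CurveField W) := (chartEval W i).range

theorem coordFun_mem (i l : Fin 2) : coordFun W i l ∈ chartRing W i :=
  ⟨.X l, MvPolynomial.aeval_X _ _⟩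

theorem xFun_mem : xFun W ∈ chartRing W 0 := coordFun_mem W 0 0
theorem yFun_mem : yFun W ∈ chartRing W 0 := coordFun_mem W 0 1
theorem rFun_mem : rFun W ∈ chartRing W 1 := coordFun_mem W 1 0
theorem vFun_mem : vFun W ∈ chartRing W 1 := coordFun_mem W 1 1

theorem chartEval_chartEqn (i : Fin 2) : chartEval W i (chartEqn W i) = 0 := by
  fin_cases i
  · simp only [chartEval, chartEqn, coordFun, Fin.zero_eta, if_true, map_sub, map_add, map_mul,
      map_pow, MvPolynomial.aeval_X, MvPolynomial.aeval_C]
    simp only [Matrix.cons_val_zero, Matrix.cons_val_one]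
    linear_combination weierstrass_equation W
  · simp only [chartEval, chartEqn, coordFun, Fin.mk_one, one_ne_zero, if_false, map_sub, map_add,
      map_mul, map_pow, MvPolynomial.aeval_X, MvPolynomial.aeval_C]
    simp only [Matrix.cons_val_zero, Matrix.cons_val_one]
    linear_combination weierstrass_equation_infinity W

/-- Reduction modulo the equation of a chart. -/
theorem exists_reduction (i : Fin 2) (a : MvPolynomial (Fin 2) k) :
    ∃ q₀ q₁ : Polynomial k, a - (Polynomial.aeval (.X 0) q₀ + Polynomial.aeval (.X 0) q₁ * .X 1) ∈
      Ideal.span {chartEqn W i} := by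
  obtain ⟨c, d, hF⟩ : ∃ c d : Polynomial k, chartEqn W i =
      .X 1 ^ 2 + Polynomial.aeval (.X 0) c * .X 1 - Polynomial.aeval (.X 0) d := by
    fin_cases i
    · refine ⟨.C W.a₁ * .X + .C W.a₃, .X ^ 3 + .C W.a₂ * .X ^ 2 + .C W.a₄ * .X + .C W.a₆, ?_⟩
      simp only [chartEqn, Fin.zero_eta, if_true, map_add, map_mul, map_pow, Polynomial.aeval_X,
        Polynomial.aeval_C, MvPolynomial.algebraMap_eq]
      ring
    · refine ⟨.C W.a₁ * .X + .C W.a₃ * .X ^ 2,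
        .X + .C W.a₂ * .X ^ 2 + .C W.a₄ * .X ^ 3 + .C W.a₆ * .X ^ 4, ?_⟩
      simp only [chartEqn, Fin.mk_one, one_ne_zero, if_false, map_add, map_mul, map_pow,
        Polynomial.aeval_X, Polynomial.aeval_C, MvPolynomial.algebraMap_eq]
      ring
  induction a using MvPolynomial.induction_on with
  | C r =>
    refine ⟨.C r, 0, ?_⟩
    simp
  | add a b ha hb =>
    obtain ⟨a₀, a₁, ha⟩ := ha
    obtain ⟨b₀, b₁, hb⟩ := hb
    refine ⟨a₀ + b₀, a₁ + b₁, ?_⟩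
    convert add_mem ha hb using 1
    rw [map_add, map_add]
    ring
  | mul_X a l ha =>
    obtain ⟨a₀, a₁, ha⟩ := ha
    fin_cases l
    · refine ⟨a₀ * .X, a₁ * .X, ?_⟩
      convert Ideal.mul_mem_left _ (.X 0) ha using 1
      simp only [Fin.zero_eta, map_mul, Polynomial.aeval_X]
      ring
    · refine ⟨a₁ * d, a₀ - a₁ * c, ?_⟩
      convert add_mem (Ideal.mul_mem_left _ (.X 1) ha) (Ideal.mul_mem_left _
        (Polynomial.aeval (.X 0) a₁) (Ideal.mem_span_singleton_self (chartEqn W i))) using 1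
      rw [hF]
      simp only [Fin.mk_one, map_mul, map_sub]
      ring

theorem chartEval_normalForm (i : Fin 2) (q₀ q₁ : Polynomial k) :
    chartEval W i (Polynomial.aeval (.X 0) q₀ + Polynomial.aeval (.X 0) q₁ * .X 1) =
      Polynomial.aeval (coordFun W i 0) q₀ +
        Polynomial.aeval (coordFun W i 0) q₁ * coordFun W i 1 := by
  have h (q : Polynomial k) : chartEval W i (Polynomial.aeval (.X 0) q) =
      Polynomial.aeval (coordFun W i 0) q := by
    rw [← Polynomial.aeval_algHom_apply, chartEval, MvPolynomial.aeval_X]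
  rw [map_add, map_mul, h, h]
  simp [chartEval]

theorem exists_normalForm (i : Fin 2) {b : CurveField W} (hb : b ∈ chartRing W i) :
    ∃ q₀ q₁ : Polynomial k, b = Polynomial.aeval (coordFun W i 0) q₀ +
      Polynomial.aeval (coordFun W i 0) q₁ * coordFun W i 1 := by
  obtain ⟨a, rfl⟩ := hb
  obtain ⟨q₀, q₁, h⟩ := exists_reduction W i a
  refine ⟨q₀, q₁, ?_⟩
  rw [← chartEval_normalForm, ← sub_eq_zero]
  obtain ⟨c, hc⟩ := Ideal.mem_span_singleton'.1 h
  change chartEval W i _ - _ = 0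
  rw [← map_sub, ← hc, map_mul, chartEval_chartEqn, mul_zero]

theorem aeval_rFun {N : ℕ} {q : Polynomial k} (hq : q.natDegree ≤ N) :
    xFun W ^ N * Polynomial.aeval (rFun W) q = Polynomial.aeval (xFun W) (q.reflect N) := by
  let _ : Invertible (xFun W) := invertibleOfNonzero (xFun_ne_zero W)
  have h := Polynomial.eval₂_reflect_mul_pow (algebraMap k (CurveField W)) (xFun W) N
    (q.reflect N) (Polynomial.natDegree_reflect_le.trans (max_le le_rfl hq))
  have h2 : (q.reflect N).reflect N = q := by
    ext j
    rw [Polynomial.coeff_reflect, Polynomial.coeff_reflect, Polynomial.revAt_invol]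
  rw [h2, invOf_eq_inv] at h
  rw [Polynomial.aeval_def, Polynomial.aeval_def, ← h, mul_comm]
  rfl

theorem eq_zero_of_aeval_add_mul_vFun {q₀ q₁ : Polynomial k}
    (h : Polynomial.aeval (rFun W) q₀ + Polynomial.aeval (rFun W) q₁ * vFun W = 0) :
    q₀ = 0 ∧ q₁ = 0 := by
  let N := q₀.natDegree + q₁.natDegree
  have h0 : q₀.natDegree ≤ N + 2 := by omega
  have h1 : q₁.natDegree ≤ N := by omega
  have hx := xFun_ne_zero W
  have key : Polynomial.aeval (xFun W) (q₀.reflect (N + 2)) +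
      Polynomial.aeval (xFun W) (q₁.reflect N) * yFun W = 0 := by
    rw [← aeval_rFun W h0, ← aeval_rFun W h1]
    have : yFun W = xFun W ^ 2 * vFun W := by
      rw [vFun]
      field_simp
    rw [this]
    linear_combination xFun W ^ (N + 2) * h
  obtain ⟨h2, h3⟩ := eq_zero_of_aeval_add_mul_yFun W key
  rw [Polynomial.reflect_eq_zero_iff] at h2 h3
  exact ⟨h2, h3⟩

theorem ker_chartEval (i : Fin 2) :
    RingHom.ker (chartEval W i) = Ideal.span {chartEqn W i} := by
  refine le_antisymm (fun a ha => ?_)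
    ((Ideal.span_singleton_le_iff_mem _).2 (chartEval_chartEqn W i))
  obtain ⟨q₀, q₁, h⟩ := exists_reduction W i a
  obtain ⟨c, hc⟩ := Ideal.mem_span_singleton'.1 h
  have h0 : chartEval W i (Polynomial.aeval (.X 0) q₀ + Polynomial.aeval (.X 0) q₁ * .X 1) = 0 := by
    have := congrArg (chartEval W i) hc
    rw [map_mul, chartEval_chartEqn, mul_zero, map_sub, RingHom.mem_ker.1 ha, zero_sub,
      zero_eq_neg] at this
    exact this
  rw [chartEval_normalForm] at h0
  have h1 : q₀ = 0 ∧ q₁ = 0 := by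
    fin_cases i
    · exact eq_zero_of_aeval_add_mul_yFun W h0
    · exact eq_zero_of_aeval_add_mul_vFun W h0
  rw [h1.1, h1.2] at h
  simpa using h

theorem chartRing_zero_inf_one {b : CurveField W} (h₀ : b ∈ chartRing W 0)
    (h₁ : b ∈ chartRing W 1) : ∃ c : k, b = algebraMap k _ c := by
  obtain ⟨q₀, q₁, rfl⟩ := exists_normalForm W 0 h₀
  obtain ⟨p₀, p₁, h⟩ := exists_normalForm W 1 h₁
  change Polynomial.aeval (xFun W) q₀ + Polynomial.aeval (xFun W) q₁ * yFun W =
    Polynomial.aeval (rFun W) p₀ + Polynomial.aeval (rFun W) p₁ * vFun W at h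
  let N := p₀.natDegree + p₁.natDegree
  have h0 : p₀.natDegree ≤ N + 2 := by omega
  have h1 : p₁.natDegree ≤ N := by omega
  have hx := xFun_ne_zero W
  have key : Polynomial.aeval (xFun W) (.X ^ (N + 2) * q₀) +
      Polynomial.aeval (xFun W) (.X ^ (N + 2) * q₁) * yFun W =
      Polynomial.aeval (xFun W) (p₀.reflect (N + 2)) +
      Polynomial.aeval (xFun W) (p₁.reflect N) * yFun W := by
    rw [← aeval_rFun W h0, ← aeval_rFun W h1]
    have : yFun W = xFun W ^ 2 * vFun W := by
      rw [vFun]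
      field_simp
    rw [this] at h ⊢
    simp only [map_mul, map_pow, Polynomial.aeval_X]
    linear_combination xFun W ^ (N + 2) * h
  obtain ⟨h2, h3⟩ := eq_of_aeval_add_mul_yFun W key
  have h4 : q₁ = 0 := by
    ext j
    have := congrArg (fun q => q.coeff (j + (N + 2))) h3
    simp only [Polynomial.coeff_X_pow_mul, Polynomial.coeff_reflect] at this
    rw [Polynomial.revAt_eq_self_of_lt (by omega),
      Polynomial.coeff_eq_zero_of_natDegree_lt (p := p₁) (by omega)] at this
    simpa using this
  have h5 : q₀ = .C (q₀.coeff 0) := by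
    ext j
    rcases j with _ | j
    · simp
    have := congrArg (fun q => q.coeff (j + 1 + (N + 2))) h2
    simp only [Polynomial.coeff_X_pow_mul, Polynomial.coeff_reflect] at this
    rw [Polynomial.revAt_eq_self_of_lt (by omega),
      Polynomial.coeff_eq_zero_of_natDegree_lt (p := p₀) (by omega)] at this
    rw [this, Polynomial.coeff_C_succ]
  refine ⟨q₀.coeff 0, ?_⟩
  conv_lhs => rw [h4, h5]
  simp [coordFun]

/-- The rational function whose class generates `H¹(E, 𝒪_E)`. -/
def atiyahFun : CurveField W := yFun W / xFun W

theorem atiyahFun_ne {b₀ b₁ : CurveField W} (h₀ : b₀ ∈ chartRing W 0) (h₁ : b₁ ∈ chartRing W 1) :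
    atiyahFun W ≠ b₀ + b₁ := by
  obtain ⟨q₀, q₁, rfl⟩ := exists_normalForm W 0 h₀
  obtain ⟨p₀, p₁, rfl⟩ := exists_normalForm W 1 h₁
  intro h
  change atiyahFun W = Polynomial.aeval (xFun W) q₀ + Polynomial.aeval (xFun W) q₁ * yFun W +
    (Polynomial.aeval (rFun W) p₀ + Polynomial.aeval (rFun W) p₁ * vFun W) at h
  let N := p₀.natDegree + p₁.natDegree
  have h0 : p₀.natDegree ≤ N + 2 := by omega
  have h1 : p₁.natDegree ≤ N := by omega
  have hx := xFun_ne_zero W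
  have key : Polynomial.aeval (xFun W) (0 : Polynomial k) + Polynomial.aeval (xFun W) (Polynomial.X ^ (N + 1) : Polynomial k) *
      yFun W =
      Polynomial.aeval (xFun W) (.X ^ (N + 2) * q₀ + p₀.reflect (N + 2)) +
      Polynomial.aeval (xFun W) (.X ^ (N + 2) * q₁ + p₁.reflect N) * yFun W := by
    rw [map_add, map_add, ← aeval_rFun W h0, ← aeval_rFun W h1]
    have h2 : yFun W = xFun W ^ 2 * vFun W := by
      rw [vFun]
      field_simp
    have h3 : atiyahFun W = xFun W * vFun W := by
      rw [atiyahFun, h2]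
      field_simp
    rw [h3, h2] at h
    rw [h2]
    simp only [map_mul, map_pow, Polynomial.aeval_X, map_zero]
    linear_combination xFun W ^ (N + 2) * h
  have h4 := congrArg (fun q : Polynomial k => q.coeff (N + 1)) (eq_of_aeval_add_mul_yFun W key).2
  simp only [Polynomial.coeff_add, Polynomial.coeff_X_pow_mul', Polynomial.coeff_reflect] at h4
  rw [Polynomial.revAt_eq_self_of_lt (by omega),
    Polynomial.coeff_eq_zero_of_natDegree_lt (p := p₁) (by omega), if_neg (by omega)] at h4
  simp at h4

/-- The class of `atiyahFun ^ n` in `H¹(E, 𝒪_E)` is a multiple of the class of `atiyahFun`. -/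
theorem exists_atiyahFun_pow (n : ℕ) : ∃ (c : k) (b₀ b₁ : CurveField W), b₀ ∈ chartRing W 0 ∧
    b₁ ∈ chartRing W 1 ∧ atiyahFun W ^ n = algebraMap k _ c * atiyahFun W + b₀ - b₁ := by
  let V : Submodule k (CurveField W) := Submodule.span k {atiyahFun W} ⊔
    (Subalgebra.toSubmodule (chartRing W 0) ⊔ Subalgebra.toSubmodule (chartRing W 1))
  have hx := xFun_ne_zero W
  have hV0 {b} (hb : b ∈ chartRing W 0) : b ∈ V :=
    Submodule.mem_sup_right (Submodule.mem_sup_left hb)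
  have hV1 {b} (hb : b ∈ chartRing W 1) : b ∈ V :=
    Submodule.mem_sup_right (Submodule.mem_sup_right hb)
  have h1 (j : ℕ) : xFun W ^ j / xFun W ^ n ∈ V := by
    rcases le_total n j with h | h
    · apply hV0
      rw [div_eq_mul_inv, ← pow_sub₀ _ hx h]
      exact pow_mem (xFun_mem W) _
    · apply hV1
      have : xFun W ^ j / xFun W ^ n = rFun W ^ (n - j) := by
        rw [rFun, inv_pow, div_eq_iff (pow_ne_zero _ hx), eq_comm,
          inv_mul_eq_iff_eq_mul₀ (pow_ne_zero _ hx), ← pow_add, Nat.sub_add_cancel h]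
      rw [this]
      exact pow_mem (rFun_mem W) _
  have h2 (j : ℕ) : xFun W ^ j * yFun W / xFun W ^ n ∈ V := by
    rcases lt_trichotomy n (j + 1) with h | h | h
    · apply hV0
      obtain ⟨d, rfl⟩ : ∃ d, j = n + d := ⟨j - n, by omega⟩
      have : xFun W ^ (n + d) * yFun W / xFun W ^ n = xFun W ^ d * yFun W := by
        field_simp
        ring
      rw [this]
      exact mul_mem (pow_mem (xFun_mem W) _) (yFun_mem W)
    · apply Submodule.mem_sup_left
      have : xFun W ^ j * yFun W / xFun W ^ n = atiyahFun W := by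
        rw [h, atiyahFun, pow_succ]
        field_simp
      rw [this]
      exact Submodule.mem_span_singleton_self _
    · apply hV1
      obtain ⟨d, rfl⟩ : ∃ d, n = j + 2 + d := ⟨n - (j + 2), by omega⟩
      have : xFun W ^ j * yFun W / xFun W ^ (j + 2 + d) = rFun W ^ d * vFun W := by
        rw [rFun, vFun, inv_pow, pow_add, pow_add]
        field_simp
      rw [this]
      exact mul_mem (pow_mem (rFun_mem W) _) (vFun_mem W)
  have h3 (q : Polynomial k) : Polynomial.aeval (xFun W) q / xFun W ^ n ∈ V := by
    rw [Polynomial.aeval_eq_sum_range, Finset.sum_div]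
    refine sum_mem fun j _ => ?_
    rw [smul_div_assoc]
    exact V.smul_mem _ (h1 j)
  have h4 (q : Polynomial k) : Polynomial.aeval (xFun W) q * yFun W / xFun W ^ n ∈ V := by
    rw [Polynomial.aeval_eq_sum_range, Finset.sum_mul, Finset.sum_div]
    refine sum_mem fun j _ => ?_
    rw [smul_mul_assoc, smul_div_assoc]
    exact V.smul_mem _ (h2 j)
  obtain ⟨q₀, q₁, h⟩ := exists_normalForm W 0 (pow_mem (yFun_mem W) n)
  have h5 : atiyahFun W ^ n ∈ V := by
    rw [atiyahFun, div_pow, h, add_div]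
    exact add_mem (h3 q₀) (h4 q₁)
  obtain ⟨_, hc, b, hb, h6⟩ := Submodule.mem_sup.1 h5
  obtain ⟨c, rfl⟩ := Submodule.mem_span_singleton.1 hc
  obtain ⟨b₀, h0, b₁, h1, rfl⟩ := Submodule.mem_sup.1 hb
  refine ⟨c, b₀, -b₁, h0, neg_mem h1, ?_⟩
  rw [← h6, Algebra.smul_def]
  ring

theorem algebraMap_coordinateRing_mem (a : W.toAffine.CoordinateRing) :
    algebraMap _ (CurveField W) a ∈ chartRing W 0 := by
  obtain ⟨p, q, rfl⟩ := WeierstrassCurve.Affine.CoordinateRing.exists_smul_basis_eq a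
  rw [Algebra.smul_def, Algebra.smul_def, mul_one, map_add, map_mul, ← aeval_xFun,
    ← aeval_xFun]
  have h2 (q) : Polynomial.aeval (xFun W) q ∈ chartRing W 0 :=
    Algebra.adjoin_le (Set.singleton_subset_iff.2 (xFun_mem W))
      (Polynomial.aeval_mem_adjoin_singleton k (xFun W))
  exact add_mem (h2 p) (mul_mem (h2 q) (yFun_mem W))

theorem exists_div_chartRing (i : Fin 2) (φ : CurveField W) :
    ∃ a b : chartRing W i, (b : CurveField W) ≠ 0 ∧ φ = a / b := by
  have h0 (φ : CurveField W) : ∃ a ∈ chartRing W 0, ∃ b ∈ chartRing W 0, b ≠ 0 ∧ φ = a / b := by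
    obtain ⟨a, b, hb, rfl⟩ := IsFractionRing.div_surjective (A := W.toAffine.CoordinateRing) φ
    exact ⟨_, algebraMap_coordinateRing_mem W a, _, algebraMap_coordinateRing_mem W b, IsFractionRing.to_map_ne_zero_of_mem_nonZeroDivisors hb, rfl⟩
  fin_cases i
  · obtain ⟨a, ha, b, hb, hb0, h⟩ := h0 φ
    exact ⟨⟨a, ha⟩, ⟨b, hb⟩, hb0, h⟩
  · have hx := xFun_ne_zero W
    have hr : rFun W ≠ 0 := inv_ne_zero hx
    have key (b : CurveField W) (hb : b ∈ chartRing W 0) :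
        ∃ n, ∀ m, n ≤ m → b * rFun W ^ m ∈ chartRing W 1 := by
      obtain ⟨q₀, q₁, rfl⟩ := exists_normalForm W 0 hb
      have h2 (q : Polynomial k) : ∀ m, q.natDegree ≤ m →
          Polynomial.aeval (xFun W) q * rFun W ^ m ∈ chartRing W 1 := by
        intro m hm
        rw [Polynomial.aeval_eq_sum_range, Finset.sum_mul]
        refine sum_mem fun j hj => ?_
        rw [smul_mul_assoc]
        refine Subalgebra.smul_mem _ ?_ _
        obtain ⟨d, rfl⟩ : ∃ d, m = j + d :=
          ⟨m - j, by have := Finset.mem_range.1 hj; omega⟩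
        have : xFun W ^ j * rFun W ^ (j + d) = rFun W ^ d := by
          rw [pow_add, ← mul_assoc, ← mul_pow, rFun, mul_inv_cancel₀ hx, one_pow, one_mul]
        rw [this]
        exact pow_mem (rFun_mem W) _
      refine ⟨q₀.natDegree + q₁.natDegree + 2, fun m hm => ?_⟩
      rw [add_mul]
      refine add_mem (h2 q₀ m (by omega)) ?_
      obtain ⟨d, rfl⟩ : ∃ d, m = d + 2 := ⟨m - 2, by omega⟩
      have : Polynomial.aeval (xFun W) q₁ * yFun W * rFun W ^ (d + 2) =
          Polynomial.aeval (xFun W) q₁ * rFun W ^ d * vFun W := by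
        rw [vFun, rFun, pow_add]
        field_simp
      change Polynomial.aeval (xFun W) q₁ * yFun W * rFun W ^ (d + 2) ∈ _
      rw [this]
      exact mul_mem (h2 q₁ d (by omega)) (vFun_mem W)
    obtain ⟨a, ha, b, hb, hb0, rfl⟩ := h0 φ
    obtain ⟨n, hn⟩ := key a ha
    obtain ⟨m, hm⟩ := key b hb
    refine ⟨⟨_, hn (n + m) (by omega)⟩, ⟨_, hm (n + m) (by omega)⟩,
      mul_ne_zero hb0 (pow_ne_zero _ hr), ?_⟩
    change a / b = a * _ / (b * _)
    rw [mul_div_mul_right _ _ (pow_ne_zero _ hr)]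

theorem nonsingular_chartEqn [W.IsElliptic] (i : Fin 2) (c : Fin 2 → k)
    (h : MvPolynomial.eval c (chartEqn W i) = 0)
    (h₀ : MvPolynomial.eval c (pderiv 0 (chartEqn W i)) = 0) :
    MvPolynomial.eval c (pderiv 1 (chartEqn W i)) ≠ 0 := by
  intro h₁
  have key (x y : k) (h : y ^ 2 + W.a₁ * x * y + W.a₃ * y =
      x ^ 3 + W.a₂ * x ^ 2 + W.a₄ * x + W.a₆)
      (h₀ : W.a₁ * y = 3 * x ^ 2 + 2 * W.a₂ * x + W.a₄) (h₁ : y = -y - W.a₁ * x - W.a₃) :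
      False := by
    have h2 : W.toAffine.Equation x y := (WeierstrassCurve.Affine.equation_iff x y).2 h
    have h3 := WeierstrassCurve.Affine.equation_iff_nonsingular.1 h2
    rcases ((WeierstrassCurve.Affine.nonsingular_iff x y).1 h3).2 with h4 | h4
    · exact h4 h₀
    · exact h4 h₁
  fin_cases i
  · simp [chartEqn, MvPolynomial.pderiv_X, Derivation.leibniz] at h h₀ h₁
    refine key (c 0) (c 1) (by linear_combination h) ?_ ?_
    · linear_combination h₀
    · linear_combination h₁
  · simp [chartEqn, MvPolynomial.pderiv_X, Derivation.leibniz] at h h₀ h₁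
    by_cases hr : c 0 = 0
    · rw [hr] at h h₀
      have : c 1 = 0 := by simpa using h
      simp [this] at h₀
    · refine key (c 0)⁻¹ (c 1 / c 0 ^ 2) ?_ ?_ ?_
      · field_simp
        linear_combination h
      · field_simp
        apply mul_left_cancel₀ hr
        linear_combination (-c 0) * h₀ + 4 * h - 2 * c 1 * h₁
      · field_simp
        linear_combination h₁

end WeierstrassCharts

section HeightOne

theorem height_le_one_of_dvd {A : Type u} [CommRing A] [IsNoetherianRing A] {P : Ideal A}
    [P.IsPrime] {t u : A} (ht : t ∈ P) (hu : u ∉ P) (h : ∀ y ∈ P, t ∣ u * y) : P.height ≤ 1 := by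
  refine Ideal.height_le_one_of_isPrincipal_of_mem_minimalPrimes (Ideal.span {t}) P
    ⟨⟨inferInstance, (Ideal.span_singleton_le_iff_mem _).2 ht⟩, fun Q hQ hle y hy => ?_⟩
  have h1 : u * y ∈ Q := hQ.2 (Ideal.mem_span_singleton.2 (h y hy))
  exact (hQ.1.mem_or_mem h1).resolve_left fun h2 => hu (hle h2)

/-- A normal Noetherian domain is the intersection of its localizations at the prime ideals of
height one. -/
theorem mem_range_of_height_one {A K : Type u} [CommRing A] [IsDomain A] [IsNoetherianRing A]
    [IsIntegrallyClosed A] [Field K] [Algebra A K] [IsFractionRing A K] (φ : K)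
    (h : ∀ P : Ideal A, P.IsPrime → P.height = 1 →
      ∃ a s, s ∉ P ∧ φ = algebraMap A K a / algebraMap A K s) : φ ∈ (algebraMap A K).range := by
  have hinj := IsFractionRing.injective A K
  obtain ⟨a, b, hb, rfl⟩ := IsFractionRing.div_surjective (A := A) φ
  have hb0 : b ≠ 0 := nonZeroDivisors.ne_zero hb
  have hbK : algebraMap A K b ≠ 0 := (map_ne_zero_iff _ hinj).2 hb0
  by_contra hφ
  have hab : ¬ b ∣ a := by
    rintro ⟨c, rfl⟩
    exact hφ ⟨c, by rw [map_mul, mul_div_cancel_left₀ _ hbK]⟩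
  have hne : Ideal.Quotient.mk (Ideal.span {b}) a ≠ 0 := by
    rwa [Ne, Ideal.Quotient.eq_zero_iff_mem, Ideal.mem_span_singleton]
  obtain ⟨P, hP, hle⟩ := exists_le_isAssociatedPrime_of_isNoetherianRing A
    (Ideal.Quotient.mk (Ideal.span {b}) a) hne
  obtain ⟨hPp, c', hc'⟩ := isAssociatedPrime_iff.1 hP
  obtain ⟨c, rfl⟩ := Ideal.Quotient.mk_surjective c'
  have key : ∀ y d : A, y ∈ (⊥ : Submodule A (A ⧸ Ideal.span {b})).colon
      {Ideal.Quotient.mk (Ideal.span {b}) d} ↔ b ∣ y * d := fun y d => by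
    rw [Submodule.mem_colon_singleton, Submodule.mem_bot, Algebra.smul_def,
      Ideal.Quotient.algebraMap_eq, ← map_mul, Ideal.Quotient.eq_zero_iff_mem,
      Ideal.mem_span_singleton]
  have hPc : ∀ y, y ∈ P ↔ b ∣ y * c := fun y => by rw [hc', key]
  have hbP : b ∈ P := (hPc b).2 (dvd_mul_right b c)
  choose! x hx using fun y (hy : y ∈ P) => (hPc y).1 hy
  have hxK : ∀ y ∈ P, algebraMap A K c / algebraMap A K b * algebraMap A K y =
      algebraMap A K (x y) := fun y hy => by
    rw [div_mul_eq_mul_div, div_eq_iff hbK, ← map_mul, ← map_mul, mul_comm c, hx y hy, mul_comm]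
  by_cases hstab : ∀ y ∈ P, x y ∈ P
  · have hint : IsIntegral A (algebraMap A K c / algebraMap A K b) := by
      refine isIntegral_of_smul_mem_submodule (R := A) (A := K) (M := K) (N := Submodule.map (Algebra.linearMap A K) P) ?_ ?_ _ ?_
      · intro h0
        have : algebraMap A K b ∈ Submodule.map (Algebra.linearMap A K) P := ⟨b, hbP, rfl⟩
        rw [h0] at this
        exact hbK this
      · exact (isNoetherian_def.1 inferInstance P).map _
      · rintro _ ⟨y, hy, rfl⟩
        exact ⟨x y, hstab y hy, (hxK y hy).symm⟩
    obtain ⟨d, hd⟩ := IsIntegrallyClosed.isIntegral_iff.1 hint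
    rw [eq_div_iff hbK, ← map_mul] at hd
    have : (1 : A) ∈ P := (hPc 1).2 ⟨d, by rw [one_mul, ← hinj hd, mul_comm]⟩
    exact hPp.ne_top ((Ideal.eq_top_iff_one P).2 this)
  · push Not at hstab
    obtain ⟨t, ht, hu⟩ := hstab
    have hdvd : ∀ y ∈ P, t ∣ x t * y := fun y hy => by
      refine ⟨x y, hinj ?_⟩
      rw [map_mul, map_mul, ← hxK t ht, ← hxK y hy]
      ring
    have hP1 : P.height = 1 := by
      refine le_antisymm (height_le_one_of_dvd ht hu hdvd) (Order.one_le_iff_ne_zero.2 fun h0 => ?_)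
      rw [Ideal.height_eq_zero_iff_eq_bot] at h0
      rw [h0] at hbP
      exact hb0 hbP
    obtain ⟨a', s, hs, e⟩ := h P hPp hP1
    have hsK : algebraMap A K s ≠ 0 := by
      rw [Ne, map_eq_zero_iff _ hinj]
      rintro rfl
      exact hs P.zero_mem
    rw [div_eq_div_iff hbK hsK, ← map_mul, ← map_mul] at e
    refine hs (hle ((key s a).2 ⟨a', ?_⟩))
    rw [mul_comm, hinj e, mul_comm]

theorem exists_notMem_of_height_one {C : Type u} [CommRing C] [IsDomain C] [IsNoetherianRing C]
    [IsIntegrallyClosed C] (q : Ideal C) [q.IsPrime] (a b : C) (hb : b ≠ 0)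
    (h : ∀ P : Ideal C, P.IsPrime → P.height = 1 → P ≤ q → ∃ a' s, s ∉ P ∧ a * s = a' * b) :
    ∃ a' s, s ∉ q ∧ a * s = a' * b := by
  have hle : q.primeCompl ≤ nonZeroDivisors C := q.primeCompl_le_nonZeroDivisors
  suffices key : ∀ (S : Type u) [CommRing S] [IsDomain S] [Algebra C S]
      [IsLocalization.AtPrime S q], ∃ a' s, s ∉ q ∧ a * s = a' * b by
    have := IsLocalization.isDomain_localization hle
    exact key (Localization.AtPrime q)
  intro S _ _ _ _
  have := isIntegrallyClosed_of_isLocalization S q.primeCompl hle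
  have : IsNoetherianRing S := IsLocalization.isNoetherianRing q.primeCompl _ inferInstance
  let K := FractionRing S
  let f : C →+* K := (algebraMap (S) K).comp (algebraMap C _)
  have hf : Function.Injective f := (IsFractionRing.injective (S) K).comp
    (IsLocalization.injective (S) hle)
  have hfb : f b ≠ 0 := (map_ne_zero_iff _ hf).2 hb
  obtain ⟨c, hc⟩ := mem_range_of_height_one (A := S) (f a / f b) (by
    intro P hP hP1
    have h1 : (P.under C).height = 1 := by rw [IsLocalization.height_under q.primeCompl, hP1]
    have hPq : P.under C ≤ q := fun y hy => by
      by_contra hyq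
      exact hP.ne_top (Ideal.eq_top_of_isUnit_mem P hy
        (IsLocalization.map_units (S) (⟨y, hyq⟩ : q.primeCompl)))
    obtain ⟨a', s, hs, e⟩ := h _ inferInstance h1 hPq
    have hfs : f s ≠ 0 := (map_ne_zero_iff _ hf).2 fun h0 => hs (h0 ▸ Ideal.zero_mem _)
    refine ⟨algebraMap C _ a', algebraMap C _ s, fun h => hs h, ?_⟩
    change f a / f b = f a' / f s
    rw [div_eq_div_iff hfb hfs, ← map_mul, e, map_mul])
  obtain ⟨⟨a', s⟩, e⟩ := IsLocalization.surj q.primeCompl c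
  refine ⟨a', s, s.2, hf ?_⟩
  rw [eq_div_iff hfb] at hc
  have e' : algebraMap (S) K c * f s = f a' := by
    exact (map_mul (algebraMap S K) c (algebraMap C S s)).symm.trans (congrArg _ e)
  rw [map_mul, map_mul, ← e', ← hc]
  ring

end HeightOne

section Hartogs

variable {X : Scheme.{u}} [IsIntegral X] {C : Type u} [CommRing C] (j : Spec (.of C) ⟶ X)
  [IsOpenImmersion j]

omit [IsIntegral X] in
theorem exists_eq_of_specializes {x y : X} (hx : x ∈ j.opensRange) (h : y ⤳ x) :
    ∃ q : Spec (.of C), j q = y :=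
  h.mem_open j.opensRange.2 hx

omit [IsIntegral X] in
theorem specializes_chart_iff (P q : Spec (.of C)) : j P ⤳ j q ↔ P.asIdeal ≤ q.asIdeal := by
  rw [j.isOpenEmbedding.isInducing.specializes_iff]
  exact PrimeSpectrum.le_iff_specializes P q |>.symm

omit [IsIntegral X] in
theorem coheight_chart (P : Spec (.of C)) : Order.coheight (j P) = P.asIdeal.height := by
  rw [coheight_eq_of_isOpenImmersion j]
  exact (idealHeight_eq_coheight (.of C) P).symm

variable [IsDomain C] [IsNoetherianRing C] [IsIntegrallyClosed C]

theorem regularAt_of_coheight_one {x : X} (hx : x ∈ j.opensRange) {φ : X.functionField}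
    (h : ∀ y : X, Order.coheight y = 1 → y ⤳ x → RegularAt y φ) : RegularAt x φ := by
  obtain ⟨q, rfl⟩ := hx
  obtain ⟨a, b, hb, rfl⟩ := exists_toK_div j φ
  have hb' : toK j b ≠ 0 := toK_ne_zero j hb
  have hne : ∀ (P : Spec (.of C)) (s : C), s ∉ P.asIdeal → toK j s ≠ 0 := fun P s hs =>
    toK_ne_zero j fun h0 => hs (h0 ▸ P.asIdeal.zero_mem)
  have hq : q.asIdeal.IsPrime := q.isPrime
  obtain ⟨a', s, hs, e⟩ := exists_notMem_of_height_one q.asIdeal a b hb (by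
    intro P hP hP1 hle
    obtain ⟨a', s, hs, e⟩ := (regularAt_chart_iff j ⟨P, hP⟩ _).1
      (h (j ⟨P, hP⟩) ((coheight_chart j ⟨P, hP⟩).trans hP1)
        ((specializes_chart_iff j ⟨P, hP⟩ q).2 hle))
    rw [div_eq_div_iff hb' (hne _ s hs), ← map_mul, ← map_mul] at e
    exact ⟨a', s, hs, toK_injective j e⟩)
  refine (regularAt_chart_iff j q _).2 ⟨a', s, hs, ?_⟩
  rw [div_eq_div_iff hb' (hne _ s hs), ← map_mul, ← map_mul, e]

omit [IsNoetherianRing C] [IsIntegrallyClosed C] in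
theorem exists_toK_eq_of_regularAt {φ : X.functionField}
    (h : ∀ q, RegularAt (j q) φ) : ∃ a, toK j a = φ := by
  obtain ⟨a, b, hb, rfl⟩ := exists_toK_div j φ
  have hb' : toK j b ≠ 0 := toK_ne_zero j hb
  by_contra hne
  have hI : (Ideal.span {b}).colon (Ideal.span {a} : Set C) ≠ ⊤ := by
    intro h1
    have h2 := (Ideal.eq_top_iff_one _).1 h1
    rw [Submodule.mem_colon] at h2
    obtain ⟨c, hc⟩ := Ideal.mem_span_singleton.1 (h2 a (Ideal.mem_span_singleton_self a))
    refine hne ⟨c, ?_⟩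
    rw [eq_div_iff hb', ← map_mul]
    rw [one_smul] at hc
    rw [hc, mul_comm]
  obtain ⟨m, hm, hle⟩ := Ideal.exists_le_maximal _ hI
  obtain ⟨a', s, hs, e⟩ := (regularAt_chart_iff j ⟨m, hm.isPrime⟩ _).1 (h ⟨m, hm.isPrime⟩)
  have hs0 : toK j s ≠ 0 := toK_ne_zero j fun h0 => hs (h0 ▸ Ideal.zero_mem _)
  rw [div_eq_div_iff hb' hs0, ← map_mul, ← map_mul] at e
  refine hs (hle (Submodule.mem_colon.2 fun y hy => ?_))
  obtain ⟨c, rfl⟩ := Ideal.mem_span_singleton.1 hy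
  refine Ideal.mem_span_singleton.2 ⟨a' * c, ?_⟩
  have := toK_injective j e
  rw [smul_eq_mul]
  linear_combination c * this

theorem exists_toK_eq_of_coheight_one {φ : X.functionField}
    (h : ∀ y : X, Order.coheight y = 1 → y ∈ j.opensRange → RegularAt y φ) : ∃ a, toK j a = φ :=
  exists_toK_eq_of_regularAt j fun q => regularAt_of_coheight_one j ⟨q, rfl⟩ fun y hy hyq =>
    h y hy (exists_eq_of_specializes j ⟨q, rfl⟩ hyq)

omit [IsIntegral X] [IsNoetherianRing C] in
theorem isIntegrallyClosed_stalk (q : Spec (.of C)) :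
    IsIntegrallyClosed (X.presheaf.stalk (j q)) := by
  have hq : q.asIdeal.IsPrime := q.isPrime
  let _ : Algebra C ((Spec (.of C)).presheaf.stalk q) := StructureSheaf.stalkAlgebra C q
  have : IsLocalization.AtPrime ((Spec (.of C)).presheaf.stalk q) q.asIdeal :=
    StructureSheaf.IsLocalization.to_stalk C q
  have : IsIntegrallyClosed ((Spec (.of C)).presheaf.stalk q) :=
    isIntegrallyClosed_of_isLocalization _ q.asIdeal.primeCompl
      q.asIdeal.primeCompl_le_nonZeroDivisors
  exact IsIntegrallyClosed.of_equiv (asIso (j.stalkMap q)).commRingCatIsoToRingEquiv.symm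

omit [IsIntegrallyClosed C] in
/-- The primes of height one containing an element of a Noetherian domain. -/
theorem finite_height_one (a : C) (ha : a ≠ 0) :
    {P : Spec (.of C) | P.asIdeal.height = 1 ∧ a ∈ P.asIdeal}.Finite := by
  have hfin := (Ideal.span {a}).finite_minimalPrimes_of_isNoetherianRing C
  refine (hfin.preimage (f := fun P : Spec (.of C) => P.asIdeal)
    (fun P _ Q _ h => PrimeSpectrum.ext h)).subset fun P hP => ?_
  have hPp : P.asIdeal.IsPrime := P.isPrime
  refine ⟨⟨hPp, (Ideal.span_singleton_le_iff_mem _).2 hP.2⟩, fun Q hQ hle => ?_⟩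
  have hQp := hQ.1
  by_contra hne
  have hlt : Q < P.asIdeal := lt_of_le_not_ge hle hne
  have h1 := Ideal.height_add_one_le_of_lt_of_isPrime hlt
  rw [hP.1] at h1
  have h0 : Q.height = 0 := by
    by_contra h0
    have := Order.one_le_iff_ne_zero.2 h0
    have h2 : (2 : ℕ∞) ≤ 1 := le_trans (by
      calc (2 : ℕ∞) = 1 + 1 := by norm_num
        _ ≤ Q.height + 1 := by gcongr) h1
    exact absurd h2 (by decide)
  rw [Ideal.height_eq_zero_iff_eq_bot] at h0
  exact ha (by simpa [h0] using hQ.2 (Ideal.mem_span_singleton_self a))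

omit [IsIntegrallyClosed C] in
theorem finite_not_unitAt {φ : X.functionField} (hφ : φ ≠ 0) :
    {y : X | Order.coheight y = 1 ∧ y ∈ j.opensRange ∧ ¬ UnitAt y φ}.Finite := by
  obtain ⟨a, b, hb, rfl⟩ := exists_toK_div j φ
  have ha : a ≠ 0 := by
    rintro rfl
    exact hφ (by rw [map_zero, zero_div])
  refine (((finite_height_one a ha).union (finite_height_one b hb)).image j).subset ?_
  rintro _ ⟨hy, ⟨P, rfl⟩, hu⟩
  rw [coheight_chart] at hy
  refine ⟨P, ?_, rfl⟩
  by_contra hc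
  rw [Set.mem_union, not_or] at hc
  refine hu ?_
  rw [div_eq_mul_inv]
  exact ((unitAt_toK_iff j P a).2 fun h => hc.1 ⟨hy, h⟩).mul
    ((unitAt_toK_iff j P b).2 fun h => hc.2 ⟨hy, h⟩).inv

end Hartogs

section Orders

variable {X : Scheme.{u}} [IsIntegral X] [IsLocallyNoetherian X]

theorem ord_one (y : X) : Scheme.ord (1 : X.functionField) y = 0 := by
  have := Scheme.ord_mul (x := y) (one_ne_zero (α := X.functionField)) one_ne_zero
  rw [mul_one] at this
  omega

theorem ord_inv {φ : X.functionField} (hφ : φ ≠ 0) (y : X) :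
    Scheme.ord φ⁻¹ y = - Scheme.ord φ y := by
  have := Scheme.ord_mul (x := y) hφ (inv_ne_zero hφ)
  rw [mul_inv_cancel₀ hφ, ord_one] at this
  omega

theorem ord_pow {φ : X.functionField} (hφ : φ ≠ 0) (n : ℕ) (y : X) :
    Scheme.ord (φ ^ n) y = n * Scheme.ord φ y := by
  induction n with
  | zero => rw [pow_zero, ord_one]; simp
  | succ n ih =>
    rw [pow_succ, Scheme.ord_mul (pow_ne_zero n hφ) hφ, ih]
    push_cast
    ring

theorem ord_zpow {φ : X.functionField} (hφ : φ ≠ 0) (n : ℤ) (y : X) :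
    Scheme.ord (φ ^ n) y = n * Scheme.ord φ y := by
  obtain ⟨n, rfl | rfl⟩ := n.eq_nat_or_neg
  · rw [zpow_natCast, ord_pow hφ]
  · rw [zpow_neg, zpow_natCast, ord_inv (pow_ne_zero n hφ), ord_pow hφ]
    ring

theorem RegularAt.ord_nonneg {y : X} {φ : X.functionField} (h : RegularAt y φ) :
    0 ≤ Scheme.ord φ y := by
  by_cases hy : Order.coheight y = 1
  · by_cases hφ : φ = 0
    · simp [hφ]
    obtain ⟨a, rfl⟩ := h
    have : Ring.KrullDimLE 1 (X.presheaf.stalk y) := krullDimLE_of_coheight_le hy.le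
    rw [Scheme.le_ord_iff hy hφ]
    exact Ring.ordFrac_ge_one_of_ne_zero fun h0 => hφ (by rw [h0, map_zero])
  · simp [hy]

theorem UnitAt.ord_eq_zero {y : X} {φ : X.functionField} (h : UnitAt y φ) :
    Scheme.ord φ y = 0 := by
  have h1 := h.regularAt.ord_nonneg
  have h2 := h.inv.regularAt.ord_nonneg
  rw [ord_inv h.ne_zero] at h2
  omega

theorem isDiscreteValuationRing_stalk (hX : IsNormalScheme X) {y : X} (hy : Order.coheight y = 1) :
    IsDiscreteValuationRing (X.presheaf.stalk y) := by
  have := hX y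
  have h1 : Ring.KrullDimLE 1 (X.presheaf.stalk y) := krullDimLE_of_coheight_le hy.le
  have hd : ringKrullDim (X.presheaf.stalk y) = 1 := by
    rw [ringKrullDim_stalk_eq_coheight, hy]; rfl
  have hf : ¬ IsField (X.presheaf.stalk y) := fun h => by
    rw [ringKrullDim_eq_zero_of_isField h] at hd
    exact absurd hd (by decide)
  refine ((IsDiscreteValuationRing.TFAE _ hf).out 0 2).2 ?_
  have : Ring.DimensionLEOne (X.presheaf.stalk y) :=
    ⟨fun {_} h0 hP => ((Ring.krullDimLE_one_iff_of_isPrime_bot.1 h1 _ h0 hP))⟩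
  exact { }

theorem regularAt_iff_ord (hX : IsNormalScheme X) {y : X} (hy : Order.coheight y = 1)
    {φ : X.functionField} (hφ : φ ≠ 0) : RegularAt y φ ↔ 0 ≤ Scheme.ord φ y := by
  refine ⟨RegularAt.ord_nonneg, fun h => ?_⟩
  have := isDiscreteValuationRing_stalk hX hy
  have h1 : Ring.KrullDimLE 1 (X.presheaf.stalk y) := krullDimLE_of_coheight_le hy.le
  obtain h2 | h2 := ValuationRing.isInteger_or_isInteger (X.presheaf.stalk y) φ
  · exact h2
  · obtain ⟨a, ha⟩ := h2
    have h3 : RegularAt y φ⁻¹ := ⟨a, ha⟩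
    have h4 := h3.ord_nonneg
    rw [ord_inv hφ] at h4
    have h5 : Scheme.ord φ⁻¹ y = 0 := by rw [ord_inv hφ]; omega
    rw [Scheme.ord_eq_iff hy (inv_ne_zero hφ)] at h5
    have h6 : IsUnit a := by
      rw [Ring.isUnit_iff_ordFrac_one_of_isDiscreteValuationRing (K := X.functionField), ha]
      exact h5
    exact inv_inv φ ▸ (UnitAt.inv ⟨a, h6, ha⟩).regularAt

theorem unitAt_iff_ord (hX : IsNormalScheme X) {y : X} (hy : Order.coheight y = 1)
    {φ : X.functionField} (hφ : φ ≠ 0) : UnitAt y φ ↔ Scheme.ord φ y = 0 := by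
  refine ⟨UnitAt.ord_eq_zero, fun h => unitAt_iff.2 ⟨hφ, ?_, ?_⟩⟩
  · rw [regularAt_iff_ord hX hy hφ, h]
  · rw [regularAt_iff_ord hX hy (inv_ne_zero hφ), ord_inv hφ, h, neg_zero]

end Orders


section LocalEquations

variable {X : Scheme.{u}} [IsIntegral X] [IsLocallyNoetherian X]

theorem IsLocalEquation.mul {D D' D'' : X → ℚ} {x : X} {h h' : X.functionField}
    (H : IsLocalEquation D x h) (H' : IsLocalEquation D' x h') (e : ∀ y, D'' y = D y + D' y) :
    IsLocalEquation D'' x (h * h') := by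
  refine ⟨mul_ne_zero H.1 H'.1, fun y hy hyx => ?_⟩
  rw [Scheme.ord_mul H.1 H'.1, e, ← H.2 y hy hyx, ← H'.2 y hy hyx]
  push_cast
  rfl

theorem IsLocalEquation.pow {D D' : X → ℚ} {x : X} {h : X.functionField}
    (H : IsLocalEquation D x h) (n : ℕ) (e : ∀ y, D' y = n * D y) :
    IsLocalEquation D' x (h ^ n) := by
  refine ⟨pow_ne_zero _ H.1, fun y hy hyx => ?_⟩
  rw [ord_pow H.1, e, ← H.2 y hy hyx]
  push_cast
  rfl

/-- The function `h c` is a local equation of the divisor `N D` on the chart with index `c`. -/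
def IsEquation {ι : Type} {C : ι → Type u} [∀ c, CommRing (C c)]
    (ch : ∀ c, Spec (.of (C c)) ⟶ X) [∀ c, IsOpenImmersion (ch c)] (D : X → ℚ) (N : ℕ)
    (h : ι → X.functionField) : Prop :=
  ∀ c, ∀ x ∈ (ch c).opensRange, IsLocalEquation (fun y => N * D y) x (h c)

variable {ι : Type} {C : ι → Type u} [∀ c, CommRing (C c)]
    {ch : ∀ c, Spec (.of (C c)) ⟶ X} [∀ c, IsOpenImmersion (ch c)]

theorem IsEquation.add {D D' : QDivisor X} {N : ℕ} {h h' : ι → X.functionField}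
    (H : IsEquation ch D.1 N h) (H' : IsEquation ch D'.1 N h') :
    IsEquation ch (D + D').1 N (fun c => h c * h' c) := fun c x hx =>
  (H c x hx).mul (H' c x hx) fun y => mul_add (N : ℚ) (D.1 y) (D'.1 y)

theorem IsEquation.congr {D : X → ℚ} {N N' : ℕ} {h h' : ι → X.functionField}
    (H : IsEquation ch D N h) (e : N = N') (e' : ∀ c, h c = h' c) : IsEquation ch D N' h' := by
  subst e
  exact fun c x hx => e' c ▸ H c x hx

/-- Functions on charts that agree on the overlaps up to units define a `ℚ`-divisor. -/
theorem exists_isEquation [∀ c, IsDomain (C c)] [∀ c, IsNoetherianRing (C c)]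
    (hcov : ∀ x, ∃ c, x ∈ (ch c).opensRange) {N : ℕ} (hN : 0 < N) (h : ι → X.functionField)
    (h0 : ∀ c, h c ≠ 0)
    (hh : ∀ c c', ∀ x ∈ (ch c).opensRange, x ∈ (ch c').opensRange → UnitAt x (h c / h c')) :
    ∃ D : QDivisor X, IsEquation ch D.1 N h := by
  choose κ hκ using hcov
  let D : X → ℚ := fun y => (Scheme.ord (h (κ y)) y : ℚ) / N
  have hD : ∀ c, ∀ y ∈ (ch c).opensRange, (Scheme.ord (h c) y : ℚ) = N * D y := fun c y hy => by
    have h1 := (hh c (κ y) y hy (hκ y)).ord_eq_zero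
    rw [div_eq_mul_inv, Scheme.ord_mul (h0 c) (inv_ne_zero (h0 _)), ord_inv (h0 _)] at h1
    have h2 : Scheme.ord (h c) y = Scheme.ord (h (κ y)) y := by omega
    have hN' : (N : ℚ) ≠ 0 := by positivity
    simp only [D]
    rw [h2]
    field_simp
  have hsupp : ∀ y, D y ≠ 0 → Order.coheight y = 1 := fun y hy => by
    by_contra hc
    exact hy (by simp [D, hc])
  refine ⟨⟨⟨D, fun _ _ => trivial, fun x _ => ⟨(ch (κ x)).opensRange,
    (ch (κ x)).opensRange.2.mem_nhds (hκ x), ?_⟩⟩, hsupp⟩, fun c x hx => ⟨h0 c, fun y hy hyx => ?_⟩⟩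
  · refine (finite_not_unitAt (ch (κ x)) (h0 (κ x))).subset fun y hy => ?_
    refine ⟨hsupp y hy.2, hy.1, fun hu => hy.2 ?_⟩
    have h1 := hD (κ x) y hy.1
    rw [hu.ord_eq_zero] at h1
    simpa [hN.ne'] using h1.symm
  · exact hD c y (exists_eq_of_specializes (ch c) hx hyx)

theorem IsEquation.isEffective (hcov : ∀ x, ∃ c, x ∈ (ch c).opensRange) {D : QDivisor X} {N : ℕ}
    (hN : 0 < N) {h : ι → X.functionField} (H : IsEquation ch D.1 N h)
    (hreg : ∀ c, ∀ x ∈ (ch c).opensRange, RegularAt x (h c)) : IsEffective D := fun y => by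
  by_cases h0 : D.1 y = 0
  · rw [h0]
  · obtain ⟨c, hc⟩ := hcov y
    have h1 := (H c y hc).2 y (D.2 y h0) specializes_rfl
    have h2 := (hreg c y hc).ord_nonneg
    have h3 : (0 : ℚ) ≤ N * D.1 y := by
      have h4 : (Scheme.ord (h c) y : ℚ) = N * D.1 y := h1
      rw [← h4]
      exact_mod_cast h2
    exact nonneg_of_mul_nonneg_right h3 (by positivity)

theorem IsEquation.isQCartier (hcov : ∀ x, ∃ c, x ∈ (ch c).opensRange) {D : QDivisor X} {N : ℕ}
    (hN : 0 < N) {h : ι → X.functionField} (H : IsEquation ch D.1 N h) : IsQCartier D := fun x => by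
  obtain ⟨c, hc⟩ := hcov x
  exact ⟨N, hN, h c, H c x hc⟩

omit [IsLocallyNoetherian X] in
theorem isNormalScheme_of_charts [∀ c, IsDomain (C c)] [∀ c, IsIntegrallyClosed (C c)]
    (hcov : ∀ x, ∃ c, x ∈ (ch c).opensRange) : IsNormalScheme X := fun x => by
  obtain ⟨c, q, rfl⟩ := hcov x
  exact isIntegrallyClosed_stalk (ch c) q

theorem exists_ord_eq (hX : IsNormalScheme X) {y : X} (hy : Order.coheight y = 1) (n : ℤ) :
    ∃ φ : X.functionField, φ ≠ 0 ∧ Scheme.ord φ y = n := by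
  have := isDiscreteValuationRing_stalk hX hy
  have h1 : Ring.KrullDimLE 1 (X.presheaf.stalk y) := krullDimLE_of_coheight_le hy.le
  obtain ⟨ϖ, hϖ⟩ := IsDiscreteValuationRing.exists_irreducible (X.presheaf.stalk y)
  have h0 : algebraMap (X.presheaf.stalk y) X.functionField ϖ ≠ 0 :=
    (map_ne_zero_iff _ (IsFractionRing.injective _ _)).2 hϖ.ne_zero
  have h2 : Scheme.ord (algebraMap (X.presheaf.stalk y) X.functionField ϖ) y = 1 := by
    rw [Scheme.ord_eq_iff hy h0]
    exact Ring.ordFrac_irreducible hϖ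
  exact ⟨_, zpow_ne_zero n h0, by rw [ord_zpow h0, h2, mul_one]⟩

variable {R : Type u} [CommRing R]

theorem mem_sections_iff (hX : IsNormalScheme X) (f : X ⟶ Spec (.of R)) (D : X → ℤ)
    (s : FunctionField f) (hs : s ≠ 0) : s ∈ sections f D ↔
      ∀ y : X, Order.coheight y = 1 → 0 ≤ Scheme.ord (X := X) s y + D y := by
  constructor
  · intro h y hy
    obtain ⟨φ, h0, hφ⟩ := exists_ord_eq hX hy (D y)
    have h1 := (h y hy φ h0 hφ).ord_nonneg
    rw [← hφ]
    exact (Scheme.ord_mul (X := X) hs h0) ▸ h1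
  · intro h y hy φ h0 hφ
    refine (regularAt_iff_ord hX hy (mul_ne_zero hs h0)).2 ?_
    rw [Scheme.ord_mul (X := X) hs h0, hφ]
    exact h y hy

theorem IsEquation.mem_sections_iff [∀ c, IsDomain (C c)] [∀ c, IsNoetherianRing (C c)]
    [∀ c, IsIntegrallyClosed (C c)] (hcov : ∀ x, ∃ c, x ∈ (ch c).opensRange)
    (f : X ⟶ Spec (.of R)) {D : QDivisor X} {N : ℕ} (hN : 0 < N) {h : ι → X.functionField}
    (H : IsEquation ch D.1 N h) (m : ℕ) (s : X.functionField) :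
    s ∈ sections f (roundDown m D) ↔ ∀ c, s ^ N * h c ^ m ∈ (toK (ch c)).range := by
  have hX : IsNormalScheme X := isNormalScheme_of_charts hcov
  by_cases hs : s = 0
  · rw [hs]
    exact iff_of_true (Submodule.zero_mem _) fun c => by
      rw [zero_pow hN.ne', zero_mul]
      exact Subring.zero_mem _
  have h0 : ∀ c, h c ≠ 0 := fun c => (H c (genericPoint X)
    ⟨specBot (C c), chart_bot (ch c)⟩).1
  have hN' : (0 : ℚ) < N := by positivity
  have key : ∀ c, ∀ y ∈ (ch c).opensRange, Order.coheight y = 1 →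
      (0 ≤ Scheme.ord s y + roundDown m D y ↔ RegularAt y (s ^ N * h c ^ m)) := fun c y hy hy1 => by
    rw [regularAt_iff_ord hX hy1 (mul_ne_zero (pow_ne_zero _ hs) (pow_ne_zero _ (h0 c))),
      Scheme.ord_mul (pow_ne_zero _ hs) (pow_ne_zero _ (h0 c)), ord_pow hs, ord_pow (h0 c)]
    have h1 := (H c y hy).2 y hy1 specializes_rfl
    have e : ((N * Scheme.ord s y + m * Scheme.ord (h c) y : ℤ) : ℚ) =
        N * (Scheme.ord s y + m * D.1 y) := by
      push_cast
      rw [h1]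
      ring
    refine Iff.trans ?_ (Int.cast_nonneg_iff (R := ℚ))
    rw [e, mul_nonneg_iff_of_pos_left hN', roundDown,
      ← neg_le_iff_add_nonneg', Int.le_floor, Int.cast_neg, neg_le_iff_add_nonneg']
  refine (PlurigeneraJump.mem_sections_iff hX f _ s hs).trans ⟨fun hh c => ?_, fun hh y hy => ?_⟩
  · obtain ⟨a, ha⟩ := exists_toK_eq_of_coheight_one (ch c) (φ := s ^ N * h c ^ m)
      fun y hy hyc => (key c y hyc hy).1 (hh y hy)
    exact ⟨a, ha⟩
  · obtain ⟨c, hc⟩ := hcov y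
    refine (key c y hc hy).2 ?_
    obtain ⟨a, ha⟩ := hh c
    exact ha ▸ regularAt_toK (ch c) hc a

/-- Semiampleness of a divisor with given equations on charts. -/
theorem IsEquation.isSemiample [∀ c, IsDomain (C c)] [∀ c, IsNoetherianRing (C c)]
    [∀ c, IsIntegrallyClosed (C c)] (hcov : ∀ x, ∃ c, x ∈ (ch c).opensRange)
    (f : X ⟶ Spec (.of R)) {D : QDivisor X} {N : ℕ} (hN : 0 < N) {h : ι → X.functionField}
    (H : IsEquation ch D.1 N h) (𝒮 : Set X.functionField)
    (h𝒮 : ∀ s ∈ 𝒮, ∀ c, s * h c ∈ (toK (ch c)).range)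
    (hu : ∀ c, ∀ x ∈ (ch c).opensRange, ∃ s ∈ 𝒮, UnitAt x (s * h c)) : IsSemiample f D := by
  refine ⟨N, hN, fun x => ?_⟩
  obtain ⟨c, hc⟩ := hcov x
  obtain ⟨s, hs, hsu⟩ := hu c x hc
  refine ⟨h c, H c x hc, s, ?_, hsu⟩
  refine (H.mem_sections_iff hcov f hN N s).2 fun c => ?_
  rw [← mul_pow]
  exact Subring.pow_mem _ (h𝒮 s hs c) N

theorem IsEquation.isPullbackDivisor {Y : Scheme.{u}} [IsIntegral Y] [IsLocallyNoetherian Y]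
    {C' : ι → Type u} [∀ c, CommRing (C' c)] {ch' : ∀ c, Spec (.of (C' c)) ⟶ Y}
    [∀ c, IsOpenImmersion (ch' c)] (hcov : ∀ x, ∃ c, x ∈ (ch' c).opensRange) (ν : Y ⟶ X)
    (hν : ∀ c, ∀ y ∈ (ch' c).opensRange, ν y ∈ (ch c).opensRange) {D : QDivisor X} {N : ℕ}
    (hN : 0 < N) {h : ι → X.functionField} (H : IsEquation ch D.1 N h) {D' : QDivisor Y}
    {h' : ι → Y.functionField} (H' : IsEquation ch' D'.1 N h')
    (hh : ∀ c, IsPullbackFunction ν (h c) (h' c)) : IsPullbackDivisor ν D.1 D' := fun y hy => by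
  obtain ⟨c, hc⟩ := hcov y
  exact ⟨N, hN, h c, h' c, H c _ (hν c y hc), hh c, (H' c y hc).1,
    (H' c y hc).2 y hy specializes_rfl⟩

/-- Two local equations differ by a unit. -/
theorem unitAt_div_of_isLocalEquation {C : Type u} [CommRing C] (j : Spec (.of C) ⟶ X)
    [IsOpenImmersion j] [IsDomain C] [IsNoetherianRing C] [IsIntegrallyClosed C]
    (hX : IsNormalScheme X) {x : X} (hx : x ∈ j.opensRange) {D : X → ℚ} {h h' : X.functionField} (H : IsLocalEquation D x h)
    (H' : IsLocalEquation D x h') : UnitAt x (h / h') := by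
  have key : ∀ {h h' : X.functionField}, IsLocalEquation D x h → IsLocalEquation D x h' →
      RegularAt x (h / h') := fun {h h'} H H' => by
    refine regularAt_of_coheight_one j hx fun y hy hyx => ?_
    rw [regularAt_iff_ord hX hy (div_ne_zero H.1 H'.1), div_eq_mul_inv,
      Scheme.ord_mul H.1 (inv_ne_zero H'.1), ord_inv H'.1]
    have h1 : Scheme.ord h y = Scheme.ord h' y := by
      exact_mod_cast (H.2 _ hy hyx).trans (H'.2 _ hy hyx).symm
    omega
  exact unitAt_iff.2 ⟨div_ne_zero H.1 H'.1, key H H', by rw [inv_div]; exact key H' H⟩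

/-- A divisor with a global equation up to multiples is numerically trivial. -/
theorem isNumericallyTrivial_of_ord {k : Type u} [Field k] (g : X ⟶ AffineLine k)
    (L : QDivisor X) {N : ℕ} (hN : 0 < N) {h : X.functionField} (h0 : h ≠ 0)
    (H : ∀ y, Order.coheight y = 1 → N * L.1 y + Scheme.ord h y = 0) :
    IsNumericallyTrivial g L := by
  intro t Γ _ _ ν _ _
  have hz : ∀ y, L.1 y + (Scheme.ord h y : ℚ) / N = 0 := fun y => by
    by_cases hy : Order.coheight y = 1
    · have := H y hy
      have hN' : (N : ℚ) ≠ 0 := by positivity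
      field_simp
      linear_combination this
    · have : L.1 y = 0 := by
        by_contra hc
        exact hy (L.2 y hc)
      simp [this, hy]
  refine ⟨N, hN, h, h0, 0, fun y hy => ⟨1, one_pos, 1, 1, ⟨one_ne_zero, fun z _ _ => ?_⟩,
    ⟨1, map_one _, map_one _⟩, one_ne_zero, ?_⟩, ?_⟩
  · have := hz z
    simp [ord_one, this]
  · rw [ord_one]
    simp
  · exact finsum_eq_zero_of_forall_eq_zero fun y => rfl

end LocalEquations


open Polynomial

/-- Two subrings of a field `M` containing the ring `R`, with an element `a` that represents a
nonzero class in `M / (B₀ + B₁)` and satisfies an Artin-Schreier type equation modulo `B₀ + B₁`. -/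
structure AtiyahData (p : ℕ) (R M : Type u) [CommRing R] [Field M] [Algebra R M]
    (B : Fin 2 → Type u) [∀ i, CommRing (B i)] [∀ i, Algebra R (B i)] where
  /-- the embeddings -/
  θ : ∀ i, B i →ₐ[R] M
  inj : ∀ i, Function.Injective (θ i)
  injR : Function.Injective (algebraMap R M)
  /-- the parameter that scales the class of `a` -/
  τ : R
  /-- the linear coefficient -/
  lam : R
  /-- the representative -/
  a : M
  /-- the first factor of the representative -/
  α : B 0
  /-- the second factor of the representative -/
  β : B 1
  a_eq : a = θ 0 α * θ 1 β
  /-- the remainders of the Artin-Schreier equation -/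
  b : ∀ i, B i
  pow_eq : a ^ p = algebraMap R M lam * a + θ 0 (b 0) - θ 1 (b 1)
  inter : ∀ u v, θ 0 u = θ 1 v → ∃ r, θ 0 u = algebraMap R M r
  nonsplit : ∀ r u v, algebraMap R M r * a = θ 0 u + θ 1 v → r = 0

namespace AtiyahData

variable {p : ℕ} {R M : Type u} [CommRing R] [Field M] [Algebra R M]
    {B : Fin 2 → Type u} [∀ i, CommRing (B i)] [∀ i, Algebra R (B i)] (D : AtiyahData p R M B)

/-- The shift of the fiber coordinate. -/
def shift : Fin 2 → M := ![0, algebraMap R M D.τ * D.a]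

/-- The polynomial `h` in the coordinate of the `i`th chart. -/
def hFin (i : Fin 2) : (B i)[X] :=
  X ^ p - C (algebraMap R (B i) (D.lam * D.τ ^ (p - 1))) * X -
    C (algebraMap R (B i) (D.τ ^ p) * D.b i)

/-- The polynomial `h ζ ^ p` in the coordinate `ζ` at infinity of the `i`th chart. -/
def hInf (i : Fin 2) : (B i)[X] :=
  1 - C (algebraMap R (B i) (D.lam * D.τ ^ (p - 1))) * X ^ (p - 1) -
    C (algebraMap R (B i) (D.τ ^ p) * D.b i) * X ^ p

/-- `h` as a polynomial in `z` over the field `M`. -/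
def hM : M[X] := (D.hFin 0).map (D.θ 0 : B 0 →+* M)

theorem hFin_map (i : Fin 2) : (D.hFin i).map (D.θ i : B i →+* M) =
    X ^ p - C (algebraMap R M (D.lam * D.τ ^ (p - 1))) * X -
      C (algebraMap R M (D.τ ^ p) * D.θ i (D.b i)) := by
  simp only [hFin, Polynomial.map_sub, Polynomial.map_mul, Polynomial.map_pow, map_X, map_C,
    RingHom.coe_coe, map_mul, AlgHom.commutes]

variable [Fact p.Prime] [CharP M p]

theorem hFin_comp (i : Fin 2) :
    ((D.hFin i).map (D.θ i : B i →+* M)).comp (X - C (D.shift i)) = D.hM := by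
  have hp := (Fact.out : p.Prime)
  rw [hM, hFin_map, hFin_map]
  fin_cases i
  · simp [shift]
  · have h1 : (X - C (algebraMap R M D.τ * D.a)) ^ p =
        X ^ p - C (algebraMap R M (D.τ ^ p) * D.a ^ p) := by
      rw [sub_pow_char, ← C_pow, mul_pow, map_pow]
    have h2 : algebraMap R M (D.τ ^ p) = algebraMap R M (D.τ ^ (p - 1)) * algebraMap R M D.τ := by
      rw [← map_mul, ← pow_succ, Nat.sub_add_cancel hp.one_le]
    simp only [sub_comp, mul_comp, pow_comp, X_comp, C_comp, shift, Fin.mk_one, Fin.isValue,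
      Matrix.cons_val_one, Matrix.cons_val_fin_one]
    rw [h1, D.pow_eq]
    simp only [map_mul, map_add, map_sub, map_pow] at h2 ⊢
    have h3 := congrArg (C (R := M)) h2
    simp only [map_mul, map_pow] at h3
    linear_combination -(C D.a * C ((algebraMap R M) D.lam)) * h3

omit [CharP M p] in
theorem natDegree_hFin [∀ i, Nontrivial (B i)] (i : Fin 2) : (D.hFin i).Monic ∧
    (D.hFin i).natDegree = p := by
  have hp := (Fact.out : p.Prime)
  have hd : (C (algebraMap R (B i) (D.lam * D.τ ^ (p - 1))) * X +
    C (algebraMap R (B i) (D.τ ^ p) * D.b i)).degree < (p : WithBot ℕ) :=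
    lt_of_le_of_lt degree_linear_le (by exact_mod_cast hp.one_lt)
  have e : D.hFin i = X ^ p - (C (algebraMap R (B i) (D.lam * D.τ ^ (p - 1))) * X +
    C (algebraMap R (B i) (D.τ ^ p) * D.b i)) := by rw [hFin]; ring
  rw [e]
  exact ⟨monic_X_pow_sub hd, natDegree_eq_of_degree_eq_some
    ((degree_sub_eq_left_of_degree_lt (by rwa [degree_X_pow])).trans (degree_X_pow p))⟩

omit [Fact p.Prime] [CharP M p] in
theorem _root_.PlurigeneraJump.coeff_comp_X_sub_C (f : M[X]) (c : M) (d : ℕ)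
    (hd : f.natDegree = d + 1) :
    (f.comp (X - C c)).coeff d = f.coeff d - (d + 1) * f.coeff (d + 1) * c := by
  have h1 : f.comp (X - C c) = taylor (-c) f := by rw [taylor_apply, C_neg, sub_eq_add_neg]
  have h2 : (hasseDeriv d f).natDegree < 2 := by
    have := natDegree_hasseDeriv_le f d
    omega
  rw [h1, taylor_coeff, eval_eq_sum_range' h2, Finset.sum_range_succ, Finset.sum_range_one,
    hasseDeriv_coeff, hasseDeriv_coeff]
  simp [add_comm 1 d]
  ring

/-- A pair of polynomials over `B₀` and `B₁` that agree up to the shift of the coordinate is a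
polynomial in `h` over `R`. -/
theorem exists_comp_hM [IsDomain R] [∀ i, IsDomain (B i)] (hτ : D.τ ≠ 0) (n : ℕ) :
    ∀ (g₀ : (B 0)[X]) (g₁ : (B 1)[X]), g₀.natDegree ≤ n →
      g₀.map (D.θ 0 : B 0 →+* M) =
        (g₁.map (D.θ 1 : B 1 →+* M)).comp (X - C (D.shift 1)) →
      ∃ w : R[X], w.natDegree * p ≤ n ∧
        g₀.map (D.θ 0 : B 0 →+* M) = (w.map (algebraMap R M)).comp D.hM := by
  have hp := (Fact.out : p.Prime)
  have hpR : ((p : ℕ) : R) = 0 := D.injR (by rw [map_natCast, map_zero, CharP.cast_eq_zero])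
  induction n using Nat.strong_induction_on with
  | _ n ih =>
  intro g₀ g₁ hn e
  by_cases h0 : g₀ = 0
  · exact ⟨0, by simp, by simp [h0]⟩
  set d := g₀.natDegree with hd
  have hinj0 : Function.Injective (D.θ 0 : B 0 →+* M) := D.inj 0
  have hinj1 : Function.Injective (D.θ 1 : B 1 →+* M) := D.inj 1
  have hd1 : g₁.natDegree = d := by
    rw [hd, ← natDegree_map_eq_of_injective hinj0, e, natDegree_comp, natDegree_X_sub_C, mul_one,
      natDegree_map_eq_of_injective hinj1]
  have hlead : D.θ 0 (g₀.coeff d) = D.θ 1 (g₁.coeff d) := by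
    have h1 := congrArg leadingCoeff e
    rw [leadingCoeff_comp (by simp), (monic_X_sub_C _).leadingCoeff, one_pow, mul_one,
      leadingCoeff_map_of_injective hinj0, leadingCoeff_map_of_injective hinj1] at h1
    rw [leadingCoeff, leadingCoeff, hd1] at h1
    exact h1
  obtain ⟨r, hr⟩ := D.inter _ _ hlead
  have hr0 : r ≠ 0 := by
    rintro rfl
    rw [map_zero] at hr
    exact h0 (leadingCoeff_eq_zero.1 (hinj0 (by rw [map_zero]; exact hr)))
  have hr' : g₀.coeff d = algebraMap R (B 0) r := D.inj 0 (by rw [hr, AlgHom.commutes])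
  have hr1 : g₁.coeff d = algebraMap R (B 1) r :=
    D.inj 1 (by rw [← hlead, hr, AlgHom.commutes])
  have hpd : p ∣ d := by
    obtain hd0 | hd0 := Nat.eq_zero_or_pos d
    · rw [hd0]; exact dvd_zero p
    have hnext : algebraMap R M (d * r * D.τ) * D.a =
        D.θ 0 (-(g₀.coeff (d - 1))) + D.θ 1 (g₁.coeff (d - 1)) := by
      obtain ⟨d', hd'⟩ : ∃ d', d = d' + 1 := ⟨d - 1, by omega⟩
      have h1 := congrArg (fun f => coeff f d') e
      simp only [coeff_map, RingHom.coe_coe] at h1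
      rw [coeff_comp_X_sub_C _ _ d' (by rw [natDegree_map_eq_of_injective hinj1, hd1, hd']),
        coeff_map, coeff_map, ← hd', RingHom.coe_coe, ← hlead, hr] at h1
      simp only [shift, Matrix.cons_val_one, Matrix.cons_val_fin_one] at h1
      rw [hd', Nat.add_sub_cancel, map_neg, h1, ← hd']
      simp only [map_mul, map_natCast, hd']
      push_cast
      ring
    have h2 := D.nonsplit _ _ _ hnext
    have h3 : (d : R) = 0 := by
      simpa [hr0, hτ] using h2
    have h4 : ((d : ℕ) : M) = 0 := by
      rw [← map_natCast (algebraMap R M), h3, map_zero]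
    exact (CharP.cast_eq_zero_iff M p d).1 h4
  obtain ⟨c, hc⟩ := hpd
  have hmon := fun i => D.natDegree_hFin i
  set g₀' := g₀ - C (algebraMap R (B 0) r) * D.hFin 0 ^ c with hg₀'
  set g₁' := g₁ - C (algebraMap R (B 1) r) * D.hFin 1 ^ c with hg₁'
  have hcomp : g₀'.map (D.θ 0 : B 0 →+* M) =
      (g₁'.map (D.θ 1 : B 1 →+* M)).comp (X - C (D.shift 1)) := by
    have h1 := D.hFin_comp 1
    rw [hg₀', hg₁', Polynomial.map_sub, Polynomial.map_sub, sub_comp, ← e, Polynomial.map_mul,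
      Polynomial.map_mul, mul_comp, Polynomial.map_pow, Polynomial.map_pow, pow_comp, h1, map_C,
      map_C, C_comp]
    simp [hM]
  have hwr : g₀.map (D.θ 0 : B 0 →+* M) = g₀'.map (D.θ 0 : B 0 →+* M) +
      ((C r * X ^ c : R[X]).map (algebraMap R M)).comp D.hM := by
    rw [hg₀', Polynomial.map_sub, Polynomial.map_mul, Polynomial.map_mul, mul_comp]
    simp [hM]
  have hdlt : g₀' = 0 ∨ g₀'.natDegree < d := by
    by_cases h : g₀' = 0
    · exact Or.inl h
    right
    have hdeg : (C (algebraMap R (B 0) r) * D.hFin 0 ^ c).degree = g₀.degree := by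
      have hlc : algebraMap R (B 0) r ≠ 0 := by
        rw [← hr']
        exact leadingCoeff_ne_zero.2 h0
      rw [degree_mul, degree_C hlc, zero_add, degree_eq_natDegree ((hmon 0).1.pow c).ne_zero,
        (hmon 0).1.natDegree_pow, (hmon 0).2, degree_eq_natDegree h0, ← hd, hc, mul_comm]
    have hlt := degree_sub_lt_left hdeg.symm h0 (by
      rw [leadingCoeff_mul, ((hmon 0).1.pow c).leadingCoeff, mul_one, leadingCoeff_C]
      exact hr')
    exact (natDegree_lt_natDegree_iff h).2 hlt |>.trans_eq rfl
  obtain h | hlt := hdlt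
  · refine ⟨C r * X ^ c, ?_, ?_⟩
    · rw [natDegree_C_mul_X_pow _ _ hr0]
      rw [mul_comm, ← hc]; exact hn
    · rw [hwr, h]; simp
  · obtain ⟨w, hw, hw'⟩ := ih g₀'.natDegree (hlt.trans_le hn) g₀' g₁' le_rfl hcomp
    refine ⟨w + C r * X ^ c, ?_, ?_⟩
    · refine le_trans (Nat.mul_le_mul_right p (natDegree_add_le _ _)) ?_
      rw [natDegree_C_mul_X_pow _ _ hr0]
      rcases le_total w.natDegree c with h | h
      · rw [max_eq_right h, mul_comm, ← hc]; exact hn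
      · rw [max_eq_left h]; omega
    · rw [hwr, hw', Polynomial.map_add, add_comp]

omit [Fact p.Prime] [CharP M p] in
theorem exists_map_of_tau_eq_zero (hτ : D.τ = 0) (g₀ : (B 0)[X]) (g₁ : (B 1)[X])
    (e : g₀.map (D.θ 0 : B 0 →+* M) =
        (g₁.map (D.θ 1 : B 1 →+* M)).comp (X - C (D.shift 1))) :
    ∃ w : R[X], g₀.map (D.θ 0 : B 0 →+* M) = w.map (algebraMap R M) := by
  have hs : D.shift 1 = 0 := by simp [shift, hτ]
  rw [hs, C_0, sub_zero, comp_X] at e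
  have : g₀.map (D.θ 0 : B 0 →+* M) ∈ lifts (algebraMap R M) := by
    rw [lifts_iff_coeff_lifts]
    intro n
    obtain ⟨r, hr⟩ := D.inter (g₀.coeff n) (g₁.coeff n) (by
      simpa [coeff_map] using congrArg (fun f => coeff f n) e)
    exact ⟨r, by rw [coeff_map]; exact hr.symm⟩
  obtain ⟨w, hw⟩ := (mem_lifts _).1 this
  exact ⟨w, hw.symm⟩

end AtiyahData


/-- A scheme `X` over `Spec R` glued from four charts `Spec (B i)[z]` and `Spec (B i)[z⁻¹]`, where
the fiber coordinates of the two ruled pieces differ by `τ a`. -/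
structure Ruled {p : ℕ} {R M : Type u} [CommRing R] [Field M] [Algebra R M]
    {B : Fin 2 → Type u} [∀ i, CommRing (B i)] [∀ i, IsDomain (B i)]
    [∀ i, Algebra R (B i)] (D : AtiyahData p R M B)
    {X : Scheme.{u}} [IsIntegral X] (f : X ⟶ Spec (.of R)) where
  /-- the charts -/
  chart : ∀ c : Fin 2 × Bool, Spec (.of (B c.1)[X]) ⟶ X
  [isOpenImmersion : ∀ c, IsOpenImmersion (chart c)]
  covers : ∀ x, ∃ c, x ∈ (chart c).opensRange
  chart_comp : ∀ c, chart c ≫ f = specMap (algebraMap R (B c.1)[X])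
  /-- the inclusion of the ring of functions on the generic ruling -/
  Φ : M[X] →+* X.functionField
  inj : Function.Injective Φ
  toK_fin : ∀ i g, toK (chart (i, false)) g =
    Φ ((g.map (D.θ i : B i →+* M)).comp (Polynomial.X - C (D.shift i)))
  toK_inf_C : ∀ i b, toK (chart (i, true)) (C b) = Φ (C (D.θ i b))
  toK_inf_X : ∀ i, toK (chart (i, true)) Polynomial.X = (Φ (Polynomial.X - C (D.shift i)))⁻¹

attribute [instance] Ruled.isOpenImmersion

namespace Ruled

variable {p : ℕ} {R M : Type u} [CommRing R] [Field M] [Algebra R M]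
    {B : Fin 2 → Type u} [∀ i, CommRing (B i)] [∀ i, IsDomain (B i)]
    [∀ i, Algebra R (B i)] {D : AtiyahData p R M B}
    {X : Scheme.{u}} [IsIntegral X] {f : X ⟶ Spec (.of R)} (Q : Ruled D f)

theorem baseMap_eq (r : R) : baseMap f r = Q.Φ (C (algebraMap R M r)) := by
  rw [baseMap_eq_toK (Q.chart (0, false)) f (algebraMap R (B 0)[X]) (Q.chart_comp (0, false)),
    Q.toK_fin, Polynomial.algebraMap_apply]
  simp

/-- The fiber coordinate over the `i`th chart of the base. -/
def z (i : Fin 2) : X.functionField := Q.Φ (Polynomial.X - C (D.shift i))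

/-- Functions on the base. -/
def base (i : Fin 2) : B i →+* X.functionField := (Q.Φ.comp C).comp (D.θ i : B i →+* M)

theorem z_ne_zero (i : Fin 2) : Q.z i ≠ 0 :=
  (map_ne_zero_iff _ Q.inj).2 (X_sub_C_ne_zero _)

theorem toK_fin_eq (i : Fin 2) (g : (B i)[X]) :
    toK (Q.chart (i, false)) g = eval₂ (Q.base i) (Q.z i) g := by
  rw [Q.toK_fin, comp, eval₂_map, hom_eval₂]
  rfl

theorem toK_inf_eq (i : Fin 2) (g : (B i)[X]) :
    toK (Q.chart (i, true)) g = eval₂ (Q.base i) (Q.z i)⁻¹ g := by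
  have : toK (Q.chart (i, true)) = eval₂RingHom (Q.base i) (Q.z i)⁻¹ := by
    refine Polynomial.ringHom_ext (fun b => ?_) ?_
    · rw [Q.toK_inf_C]
      simp [base]
    · rw [Q.toK_inf_X]
      simp [z]
  rw [this]
  rfl

theorem toK_inf_mul_pow (i : Fin 2) (g : (B i)[X]) (N : ℕ) (hN : g.natDegree ≤ N) :
    toK (Q.chart (i, true)) g * Q.z i ^ N = toK (Q.chart (i, false)) (reflect N g) := by
  let _ : Invertible (Q.z i) := invertibleOfNonzero (Q.z_ne_zero i)
  have h := eval₂_reflect_mul_pow (Q.base i) (Q.z i) N (reflect N g) (by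
    refine (natDegree_reflect_le).trans ?_
    simp [hN])
  have h2 : reflect N (reflect N g) = g := by
    ext n
    simp
  rw [h2] at h
  rw [toK_inf_eq, toK_fin_eq, ← h, invOf_eq_inv]

theorem natDegree_le_of_mem_range (i : Fin 2) (g u : (B i)[X]) (n : ℕ)
    (h : toK (Q.chart (i, false)) g * ((Q.z i)⁻¹) ^ n = toK (Q.chart (i, true)) u) :
    g.natDegree ≤ n := by
  by_contra hc
  push Not at hc
  have hz := Q.z_ne_zero i
  obtain ⟨N, hN, hN'⟩ : ∃ N, u.natDegree ≤ N ∧ n ≤ N := ⟨max u.natDegree n, le_max_left _ _,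
    le_max_right _ _⟩
  have h1 := Q.toK_inf_mul_pow i u N hN
  have hX : toK (Q.chart (i, false)) Polynomial.X = Q.z i := by
    rw [toK_fin_eq, eval₂_X]
  have h2 : toK (Q.chart (i, false)) (g * Polynomial.X ^ (N - n)) =
      toK (Q.chart (i, false)) (reflect N u) := by
    rw [← h1, ← h, map_mul, map_pow, hX, mul_assoc]
    congr 1
    rw [inv_pow, ← Nat.sub_add_cancel hN', pow_add, Nat.add_sub_cancel]
    field_simp
  have h3 := toK_injective _ h2
  have h4 : (g * Polynomial.X ^ (N - n)).natDegree ≤ N := by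
    rw [h3]
    refine natDegree_reflect_le.trans ?_
    simp [hN]
  have hg : g ≠ 0 := by
    rintro rfl
    simp at hc
  have : Nontrivial (B i) := by
    by_contra hn
    rw [not_nontrivial_iff_subsingleton] at hn
    exact hg (Subsingleton.elim _ _)
  rw [natDegree_mul_X_pow _ hg] at h4
  omega

/-- The rational function `h`. -/
def h : X.functionField := Q.Φ D.hM

/-- The local coordinate at infinity, or `1` on charts that do not meet infinity. -/
def zeta (c : Fin 2 × Bool) : X.functionField := if c.2 then (Q.z c.1)⁻¹ else 1

variable [Fact p.Prime] [CharP M p]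

theorem toK_hFin (i : Fin 2) : toK (Q.chart (i, false)) (D.hFin i) = Q.h := by
  rw [Q.toK_fin, D.hFin_comp]
  rfl

theorem toK_hInf (i : Fin 2) : toK (Q.chart (i, true)) (D.hInf i) = Q.h * ((Q.z i)⁻¹) ^ p := by
  have hp := (Fact.out : p.Prime)
  have hz := Q.z_ne_zero i
  have e : Q.z i ^ p = Q.z i ^ (p - 1) * Q.z i := by rw [← pow_succ, Nat.sub_add_cancel hp.one_le]
  rw [← Q.toK_hFin i, toK_inf_eq, toK_fin_eq]
  simp only [AtiyahData.hInf, AtiyahData.hFin, eval₂_sub, eval₂_mul, eval₂_pow, eval₂_X, eval₂_C,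
    eval₂_one]
  rw [inv_pow, inv_pow, e]
  field_simp

omit [Fact p.Prime] [CharP M p] in
theorem zeta_ne_zero (c : Fin 2 × Bool) : Q.zeta c ≠ 0 := by
  unfold zeta
  split_ifs
  · exact inv_ne_zero (Q.z_ne_zero _)
  · exact one_ne_zero

omit [Fact p.Prime] [CharP M p] in
theorem regularAt_base (c : Fin 2 × Bool) {x : X} (hx : x ∈ (Q.chart c).opensRange) (b : B c.1) :
    RegularAt x (Q.base c.1 b) := by
  have h := regularAt_toK (Q.chart c) hx (C b)
  obtain ⟨i, _ | _⟩ := c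
  · rwa [toK_fin_eq, eval₂_C] at h
  · rwa [toK_inf_eq, eval₂_C] at h

omit [Fact p.Prime] [CharP M p] in
/-- The difference of the fiber coordinates is regular on overlaps. -/
theorem regularAt_z_sub (c c' : Fin 2 × Bool) {x : X} (hx : x ∈ (Q.chart c).opensRange)
    (hx' : x ∈ (Q.chart c').opensRange) : RegularAt x (Q.z c.1 - Q.z c'.1) := by
  by_cases hc : c.1 = c'.1
  · rw [hc, sub_self]
    exact RegularAt.zero x
  have key : ∀ d d' : Fin 2 × Bool, x ∈ (Q.chart d).opensRange → x ∈ (Q.chart d').opensRange →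
      d.1 = 0 → d'.1 = 1 → RegularAt x (Q.z d.1 - Q.z d'.1) := by
    rintro ⟨_, e⟩ ⟨_, e'⟩ hd hd' rfl rfl
    have h1 := (regularAt_baseMap f x D.τ).mul
      ((Q.regularAt_base _ hd D.α).mul (Q.regularAt_base _ hd' D.β))
    rw [Q.baseMap_eq] at h1
    have h2 : Q.z 0 - Q.z 1 = Q.Φ (C (algebraMap R M D.τ)) * (Q.base 0 D.α * Q.base 1 D.β) := by
      simp only [z, base, ← map_sub, RingHom.comp_apply, ← map_mul]
      congr 1
      simp [AtiyahData.shift, D.a_eq]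
    exact h2 ▸ h1
  rcases (by omega : c.1 = 0 ∨ c.1 = 1) with h | h
  · exact key c c' hx hx' h (by omega)
  · have := (key c' c hx' hx (by omega) h).neg
    rwa [neg_sub] at this

omit [Fact p.Prime] [CharP M p] in
theorem unitAt_zeta_div (c c' : Fin 2 × Bool) (x : X) (hx : x ∈ (Q.chart c).opensRange)
    (hx' : x ∈ (Q.chart c').opensRange) : UnitAt x (Q.zeta c / Q.zeta c') := by
  have key : ∀ c c' : Fin 2 × Bool, x ∈ (Q.chart c).opensRange → x ∈ (Q.chart c').opensRange →
      RegularAt x (Q.zeta c / Q.zeta c') := by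
    intro c c' hx hx'
    have hs := Q.regularAt_z_sub c c' hx hx'
    have hz := Q.z_ne_zero
    obtain ⟨i, e⟩ := c
    obtain ⟨i', e'⟩ := c'
    have hinf : ∀ j, x ∈ (Q.chart (j, true)).opensRange → RegularAt x (Q.z j)⁻¹ := fun j hj => by
      have := regularAt_toK (Q.chart (j, true)) hj Polynomial.X
      rwa [toK_inf_eq, eval₂_X] at this
    have hfin : ∀ j, x ∈ (Q.chart (j, false)).opensRange → RegularAt x (Q.z j) := fun j hj => by
      have := regularAt_toK (Q.chart (j, false)) hj Polynomial.X
      rwa [toK_fin_eq, eval₂_X] at this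
    cases e <;> cases e' <;> simp only [zeta, if_true, div_one, Bool.false_eq_true, if_false]
    · exact RegularAt.one x
    · rw [one_div, inv_inv]
      have := (hfin i hx).sub hs
      rwa [sub_sub_cancel] at this
    · exact hinf i hx
    · have h1 := (RegularAt.one x).sub (hs.mul (hinf i hx))
      have e1 : (Q.z i)⁻¹ / (Q.z i')⁻¹ = 1 - (Q.z i - Q.z i') * (Q.z i)⁻¹ := by
        have := hz i
        have := hz i'
        field_simp
        ring
      exact e1 ▸ h1
  refine unitAt_iff.2 ⟨div_ne_zero (Q.zeta_ne_zero c) (Q.zeta_ne_zero c'), key c c' hx hx', ?_⟩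
  rw [inv_div]
  exact key c' c hx' hx

/-- The polynomial `h (h - 1)`. -/
def _root_.PlurigeneraJump.AtiyahData.eqDelta (D : AtiyahData p R M B) (c : Fin 2 × Bool) :
    (B c.1)[X] :=
  if c.2 then (D.hInf c.1 * (D.hInf c.1 - Polynomial.X ^ p)) ^ 4 * Polynomial.X ^ (4 * p) else
    (D.hFin c.1 * (D.hFin c.1 - 1)) ^ 4

/-- The equation of `p C`, with `C` the curve at infinity. -/
def _root_.PlurigeneraJump.AtiyahData.eqTheta (_D : AtiyahData p R M B) (c : Fin 2 × Bool) :
    (B c.1)[X] :=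
  if c.2 then Polynomial.X ^ p else 1

omit [Fact p.Prime] [CharP M p] in
theorem toK_eqTheta (c : Fin 2 × Bool) :
    toK (Q.chart c) (D.eqTheta c) = Q.zeta c ^ p := by
  obtain ⟨i, _ | _⟩ := c <;> simp [AtiyahData.eqTheta, zeta, toK_inf_X, z]

theorem toK_eqDelta (c : Fin 2 × Bool) :
    toK (Q.chart c) (D.eqDelta c) = (Q.h * (Q.h - 1)) ^ 4 * Q.zeta c ^ (12 * p) := by
  obtain ⟨i, _ | _⟩ := c
  · simp only [AtiyahData.eqDelta, zeta, Bool.false_eq_true, if_false, one_pow, mul_one, map_pow,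
      map_mul, map_sub, map_one]
    rw [toK_hFin]
  · have hX : toK (Q.chart (i, true)) Polynomial.X = (Q.z i)⁻¹ := by rw [Q.toK_inf_X]; rfl
    simp only [AtiyahData.eqDelta, zeta, if_true, map_pow, map_mul, map_sub]
    rw [toK_hInf, hX]
    ring

end Ruled


section Kodaira

variable {X : Scheme.{u}} [IsIntegral X] [IsLocallyNoetherian X]

theorem mem_range_of_pow_mem (hX : IsNormalScheme X) {C : Type u} [CommRing C] [IsDomain C]
    [IsNoetherianRing C] [IsIntegrallyClosed C] (j : Spec (.of C) ⟶ X) [IsOpenImmersion j]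
    {φ : X.functionField} {n : ℕ} (hn : 0 < n) (h : φ ^ n ∈ (toK j).range) :
    φ ∈ (toK j).range := by
  by_cases h0 : φ = 0
  · rw [h0]
    exact Subring.zero_mem _
  obtain ⟨a, ha⟩ := exists_toK_eq_of_coheight_one j (φ := φ) fun y hy hyj => by
    obtain ⟨b, hb⟩ := h
    have h1 := (regularAt_toK j hyj b).ord_nonneg
    rw [hb, ord_pow h0] at h1
    rw [regularAt_iff_ord hX hy h0]
    exact nonneg_of_mul_nonneg_right h1 (by exact_mod_cast hn)
  exact ⟨a, ha⟩

variable {R : Type u} [CommRing R]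

theorem hasKodairaDim_one [IsDomain R] (f : X ⟶ Spec (.of R)) (L : QDivisor X) (H : FunctionField f)
    (hH : Function.Injective (aeval H : R[X] →ₐ[R] FunctionField f))
    (hup : ∀ m, ∀ s ∈ sections f (roundDown m L), ∀ t ∈ sections f (roundDown m L), t ≠ 0 →
      ∃ w w' : R[X], w' ≠ 0 ∧ s / t = aeval H w / aeval H w')
    {m₀ : ℕ} (hm₀ : 0 < m₀) {s t : FunctionField f} (hs : s ∈ sections f (roundDown m₀ L))
    (ht : t ∈ sections f (roundDown m₀ L)) (ht0 : t ≠ 0) (htr : Transcendental R (s / t)) :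
    HasKodairaDim f L 1 := by
  let F := FractionRing R[X]
  let ψ : F →ₐ[R] FunctionField f := IsFractionRing.liftAlgHom (g := (aeval H : R[X] →ₐ[R] _)) hH
  have hψ : ∀ w : R[X], ψ (algebraMap R[X] F w) = aeval H w := fun w =>
    IsFractionRing.lift_algebraMap hH w
  have hψi : Function.Injective ψ := ψ.toRingHom.injective
  have hF : Algebra.trdeg R F = 1 := by
    have h1 := IsTranscendenceBasis.polynomial (ι := PUnit.{u + 1}) (R := R)
    have : Algebra.IsAlgebraic R[X] F := IsLocalization.isAlgebraic F (nonZeroDivisors R[X])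
    have h2 := IsTranscendenceBasis.algebraMap_comp (A := F) h1
    rw [← h2.cardinalMk_eq_trdeg]
    simp
  have key : ∀ m, Algebra.trdeg R (Algebra.adjoin R (sectionRatios f m L)) ≤ 1 := fun m => by
    have hle : Algebra.adjoin R (sectionRatios f m L) ≤ ψ.range := by
      refine Algebra.adjoin_le ?_
      rintro _ ⟨s, hs, t, ht, ht0, rfl⟩
      obtain ⟨w, w', -, e⟩ := hup m s hs t ht ht0
      rw [e]
      exact ⟨algebraMap _ F w / algebraMap _ F w', by
        change ψ _ = _
        rw [map_div₀, hψ, hψ]⟩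
    let e := AlgEquiv.ofInjective ψ hψi
    rw [← hF]
    exact trdeg_le_of_injective
      ((e.symm : ψ.range →ₐ[R] F).comp (Subalgebra.inclusion hle))
      (e.symm.injective.comp (Subalgebra.inclusion_injective hle))
  refine ⟨⟨m₀, hm₀, fun h => ht0 ?_, ?_⟩, ?_⟩
  · rw [h] at ht
    exact ht
  · refine le_antisymm ?_ (by simpa using key m₀)
    have hmem : s / t ∈ Algebra.adjoin R (sectionRatios f m₀ L) :=
      Algebra.subset_adjoin ⟨s, hs, t, ht, ht0, rfl⟩
    have : Algebra.Transcendental R (Algebra.adjoin R (sectionRatios f m₀ L)) :=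
      ⟨⟨⟨s / t, hmem⟩, fun hal => htr (by
        have := hal.algHom (Algebra.adjoin R (sectionRatios f m₀ L)).val
        exact this)⟩⟩
    have h2 := trdeg_pos R (Algebra.adjoin R (sectionRatios f m₀ L))
    simpa using Cardinal.one_le_iff_pos.2 h2
  · rintro _ ⟨m, -, -, rfl⟩
    simpa using key m

end Kodaira

namespace Ruled

variable {p : ℕ} {R M : Type u} [CommRing R] [Field M] [Algebra R M]
    {B : Fin 2 → Type u} [∀ i, CommRing (B i)] [∀ i, IsDomain (B i)]
    [∀ i, Algebra R (B i)] {E : AtiyahData p R M B}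
    {X : Scheme.{u}} [IsIntegral X] {f : X ⟶ Spec (.of R)} (Q : Ruled E f)
    [IsLocallyNoetherian X] [∀ i, IsNoetherianRing (B i)] [∀ i, IsIntegrallyClosed (B i)]
    [Fact p.Prime] [CharP M p]

include Q in
omit [∀ i, IsNoetherianRing (B i)] [Fact p.Prime] [CharP M p] [IsLocallyNoetherian X] in
theorem isNormalScheme : IsNormalScheme X := isNormalScheme_of_charts Q.covers

omit [IsLocallyNoetherian X] [∀ i, IsNoetherianRing (B i)] [∀ i, IsIntegrallyClosed (B i)] in
theorem h_mul_ne_zero : Q.h * (Q.h - 1) ≠ 0 := by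
  have hp := (Fact.out : p.Prime)
  rw [← Q.toK_hFin 0, ← map_one (toK (Q.chart (0, false))), ← map_sub, ← map_mul]
  refine toK_ne_zero _ (mul_ne_zero (E.natDegree_hFin 0).1.ne_zero fun h0 => ?_)
  have h1 := congrArg natDegree (sub_eq_zero.1 h0)
  rw [(E.natDegree_hFin 0).2, natDegree_one] at h1
  exact hp.ne_zero h1

omit [∀ i, IsIntegrallyClosed (B i)] in
/-- The divisors `K`, `Δ` and `Θ`. -/
theorem exists_divisors : ∃ K Δ Θ : QDivisor X,
    IsEquation Q.chart K.1 (6 * p) (fun c => (Q.zeta c ^ (12 * p))⁻¹) ∧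
    IsEquation Q.chart Δ.1 (6 * p) (fun c => toK (Q.chart c) (E.eqDelta c)) ∧
    IsEquation Q.chart Θ.1 (6 * p) (fun c => toK (Q.chart c) (E.eqTheta c)) := by
  have hp : 0 < 6 * p := by have := (Fact.out : p.Prime).pos; omega
  have hz := Q.zeta_ne_zero
  have hG := Q.h_mul_ne_zero
  obtain ⟨K, hK⟩ := exists_isEquation Q.covers hp (fun c => (Q.zeta c ^ (12 * p))⁻¹)
    (fun c => inv_ne_zero (pow_ne_zero _ (hz c))) fun c c' x hx hx' => by
      have := ((Q.unitAt_zeta_div c c' x hx hx').pow (12 * p)).inv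
      rw [div_pow, inv_div] at this
      rwa [inv_div_inv]
  obtain ⟨Δ, hΔ⟩ := exists_isEquation Q.covers hp (fun c => toK (Q.chart c) (E.eqDelta c))
    (fun c => by
      rw [toK_eqDelta]
      exact mul_ne_zero (pow_ne_zero _ hG) (pow_ne_zero _ (hz c))) fun c c' x hx hx' => by
      have := ((Q.unitAt_zeta_div c c' x hx hx').pow (12 * p))
      rw [toK_eqDelta, toK_eqDelta, mul_div_mul_left _ _ (pow_ne_zero _ hG), ← div_pow]
      exact this
  obtain ⟨Θ, hΘ⟩ := exists_isEquation Q.covers hp (fun c => toK (Q.chart c) (E.eqTheta c))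
    (fun c => by
      rw [toK_eqTheta]
      exact pow_ne_zero _ (hz c)) fun c c' x hx hx' => by
      rw [toK_eqTheta, toK_eqTheta, ← div_pow]
      exact (Q.unitAt_zeta_div c c' x hx hx').pow p
  exact ⟨K, Δ, Θ, hK, hΔ, hΘ⟩

variable {K Δ Θ : QDivisor X}
    (hK : IsEquation Q.chart K.1 (6 * p) (fun c => (Q.zeta c ^ (12 * p))⁻¹))
    (hΔ : IsEquation Q.chart Δ.1 (6 * p) (fun c => toK (Q.chart c) (E.eqDelta c)))
    (hΘ : IsEquation Q.chart Θ.1 (6 * p) (fun c => toK (Q.chart c) (E.eqTheta c)))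

include hK hΔ in
omit [∀ i, IsNoetherianRing (B i)] [∀ i, IsIntegrallyClosed (B i)] in
theorem isEquation_add : IsEquation Q.chart (K + Δ).1 (6 * p)
    (fun _ => (Q.h * (Q.h - 1)) ^ 4) :=
  (hK.add hΔ).congr rfl fun c => by
    have := Q.zeta_ne_zero c
    rw [toK_eqDelta]
    field_simp

include hK hΔ hΘ in
omit [∀ i, IsNoetherianRing (B i)] [∀ i, IsIntegrallyClosed (B i)] in
theorem isEquation_add_add : IsEquation Q.chart (K + Δ + Θ).1 (6 * p)
    (fun c => (Q.h * (Q.h - 1)) ^ 4 * Q.zeta c ^ p) :=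
  ((Q.isEquation_add hK hΔ).add hΘ).congr rfl fun c => by rw [toK_eqTheta]

include hK hΔ in
theorem isSemiample_add : IsSemiample f (K + Δ) := by
  have hp : 0 < 6 * p := by have := (Fact.out : p.Prime).pos; omega
  have h0 : (Q.h * (Q.h - 1)) ^ 4 ≠ 0 := pow_ne_zero _ Q.h_mul_ne_zero
  refine (Q.isEquation_add hK hΔ).isSemiample Q.covers f hp {((Q.h * (Q.h - 1)) ^ 4)⁻¹} ?_ ?_
  · rintro _ rfl c
    rw [inv_mul_cancel₀ h0]
    exact Subring.one_mem _
  · intro c x hx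
    refine ⟨_, rfl, ?_⟩
    rw [inv_mul_cancel₀ h0]
    exact UnitAt.one x

include hK hΔ in
omit [∀ i, IsNoetherianRing (B i)] [∀ i, IsIntegrallyClosed (B i)] in
theorem isNumericallyTrivial_add {k : Type u} [Field k] (g : X ⟶ AffineLine k) :
    IsNumericallyTrivial g (K + Δ) := by
  have hp : 0 < 6 * p := by have := (Fact.out : p.Prime).pos; omega
  have h0 : (Q.h * (Q.h - 1)) ^ 4 ≠ 0 := pow_ne_zero _ Q.h_mul_ne_zero
  refine isNumericallyTrivial_of_ord g (K + Δ) hp (inv_ne_zero h0) fun y hy => ?_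
  obtain ⟨c, hc⟩ := Q.covers y
  have h1 : (Scheme.ord ((Q.h * (Q.h - 1)) ^ 4) y : ℚ) = (6 * p : ℕ) * (K + Δ).1 y :=
    (Q.isEquation_add hK hΔ c y hc).2 y hy specializes_rfl
  rw [ord_inv h0, ← h1]
  simp

omit [∀ i, IsNoetherianRing (B i)] [∀ i, IsIntegrallyClosed (B i)] [IsLocallyNoetherian X] in
theorem h_mul_zeta_pow_mem (c : Fin 2 × Bool) : ∃ g : (B c.1)[X], toK (Q.chart c) g =
    Q.h * Q.zeta c ^ p := by
  obtain ⟨i, _ | _⟩ := c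
  · exact ⟨E.hFin i, by simp [zeta, toK_hFin]⟩
  · exact ⟨E.hInf i, by simp [zeta, toK_hInf]⟩

include hK hΔ hΘ in
theorem isSemiample_add_add : IsSemiample f (K + Δ + Θ) := by
  have hp1 := (Fact.out : p.Prime)
  have hp : 0 < 6 * p := by have := hp1.pos; omega
  have h0 : (Q.h * (Q.h - 1)) ^ 4 ≠ 0 := pow_ne_zero _ Q.h_mul_ne_zero
  refine (Q.isEquation_add_add hK hΔ hΘ).isSemiample Q.covers f hp
    {((Q.h * (Q.h - 1)) ^ 4)⁻¹, ((Q.h * (Q.h - 1)) ^ 4)⁻¹ * Q.h} ?_ ?_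
  · rintro _ (rfl | rfl) c
    · rw [inv_mul_cancel_left₀ h0, ← toK_eqTheta]
      exact ⟨_, rfl⟩
    · rw [mul_mul_mul_comm, inv_mul_cancel₀ h0, one_mul]
      obtain ⟨g, hg⟩ := Q.h_mul_zeta_pow_mem c
      exact ⟨g, hg⟩
  · rintro ⟨i, _ | _⟩ _ ⟨q, rfl⟩
    · refine ⟨_, Or.inl rfl, ?_⟩
      rw [inv_mul_cancel_left₀ h0]
      simpa [zeta] using UnitAt.one _
    · by_cases hq : (Polynomial.X : (B i)[X]) ∈ q.asIdeal
      · refine ⟨_, Or.inr rfl, ?_⟩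
        rw [mul_mul_mul_comm, inv_mul_cancel₀ h0, one_mul]
        have e : Q.h * Q.zeta (i, true) ^ p = toK (Q.chart (i, true)) (E.hInf i) := by
          rw [toK_hInf]
          simp [zeta]
        rw [e]
        refine (unitAt_toK_iff (Q.chart (i, true)) q _).2 fun hm => ?_
        have hpr : q.asIdeal.IsPrime := q.isPrime
        have h1 : (1 : (B i)[X]) = E.hInf i +
            (C (algebraMap R (B i) (E.lam * E.τ ^ (p - 1))) * Polynomial.X ^ (p - 1) +
              C (algebraMap R (B i) (E.τ ^ p) * E.b i) * Polynomial.X ^ p) := by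
          rw [AtiyahData.hInf]
          ring
        refine hpr.ne_top ((Ideal.eq_top_iff_one _).2 ?_)
        rw [h1]
        exact q.asIdeal.add_mem hm (q.asIdeal.add_mem
          (q.asIdeal.mul_mem_left _ (q.asIdeal.pow_mem_of_mem hq _ (by have := hp1.two_le; omega)))
          (q.asIdeal.mul_mem_left _ (q.asIdeal.pow_mem_of_mem hq _ hp1.pos)))
      · refine ⟨_, Or.inl rfl, ?_⟩
        rw [inv_mul_cancel_left₀ h0]
        have h1 := ((unitAt_toK_iff (Q.chart (i, true)) q _).2 hq).pow p
        rw [toK_inf_X] at h1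
        simpa [zeta, z] using h1

open Classical in
/-- The rational function on the base of the canonical fibration. -/
def fib : X.functionField := if E.τ = 0 then Q.Φ Polynomial.X else Q.h

omit [IsLocallyNoetherian X] [∀ i, IsNoetherianRing (B i)] [∀ i, IsIntegrallyClosed (B i)]
  [Fact p.Prime] [CharP M p] in
theorem aeval_Φ (P : M[X]) (w : R[X]) : (aeval (R := R) (A := FunctionField f) (Q.Φ P) w) =
    Q.Φ ((w.map (algebraMap R M)).comp P) := by
  have e : algebraMap R (FunctionField f) = (Q.Φ.comp C).comp (algebraMap R M) :=
    RingHom.ext fun r => Q.baseMap_eq r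
  have h1 : eval₂ ((Q.Φ.comp C).comp (algebraMap R M)) (Q.Φ P) w =
      Q.Φ ((w.map (algebraMap R M)).comp P) := by
    rw [comp, eval₂_map, hom_eval₂, RingHom.comp_assoc]
  exact (congrArg (fun r => eval₂ r (show FunctionField f from Q.Φ P) w) e).trans h1

omit [IsLocallyNoetherian X] [∀ i, IsNoetherianRing (B i)] [∀ i, IsIntegrallyClosed (B i)]
  [Fact p.Prime] [CharP M p] in
theorem aeval_Φ_injective {P : M[X]} (hP : P.natDegree ≠ 0) :
    Function.Injective (aeval (R := R) (A := FunctionField f) (Q.Φ P)) := by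
  rw [injective_iff_map_eq_zero]
  intro w hw
  rw [aeval_Φ] at hw
  have h1 := (map_eq_zero_iff _ Q.inj).1 hw
  rw [comp_eq_zero_iff] at h1
  obtain h1 | ⟨-, h1⟩ := h1
  · exact (Polynomial.map_injective _ E.injR) (by rw [h1, Polynomial.map_zero])
  · exact absurd (by rw [h1, natDegree_C]) hP

omit [IsLocallyNoetherian X] [∀ i, IsNoetherianRing (B i)] [∀ i, IsIntegrallyClosed (B i)]
  [CharP M p] in
theorem natDegree_hM : (E.hM).natDegree = p := by
  have h1 : Function.Injective (E.θ 0 : B 0 →+* M) := E.inj 0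
  rw [AtiyahData.hM, natDegree_map_eq_of_injective h1, (E.natDegree_hFin 0).2]

include hK hΔ hΘ in
/-- Sections of multiples of `K + Δ + Θ` are polynomials up to a fixed denominator. -/
theorem exists_polynomials {m a n D e : ℕ} (hD : 6 * p * a = 4 * m + D)
    (he : 6 * p * n = p * m + 2 * p * D + e) {s : X.functionField}
    (hs : s ∈ sections f (roundDown m (K + Δ + Θ))) (i : Fin 2) :
    ∃ g : (B i)[X], g.natDegree ≤ n ∧
      s * (Q.h * (Q.h - 1)) ^ a = Q.Φ ((g.map (E.θ i : B i →+* M)).comp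
        (Polynomial.X - C (E.shift i))) := by
  have hp : 0 < 6 * p := by have := (Fact.out : p.Prime).pos; omega
  have hmem := ((Q.isEquation_add_add hK hΔ hΘ).mem_sections_iff Q.covers f hp m s).1 hs
  have hz := Q.z_ne_zero i
  have h1 := Q.toK_hFin i
  have h2 := Q.toK_hInf i
  have h3 : toK (Q.chart (i, true)) Polynomial.X = (Q.z i)⁻¹ := Q.toK_inf_X i
  obtain ⟨g, hg⟩ := mem_range_of_pow_mem Q.isNormalScheme (Q.chart (i, false)) hp
      (φ := s * (Q.h * (Q.h - 1)) ^ a) (by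
    obtain ⟨u, hu⟩ := hmem (i, false)
    refine ⟨u * (E.hFin i * (E.hFin i - 1)) ^ D, ?_⟩
    rw [map_mul, hu, map_pow, map_mul, map_sub, h1, map_one]
    simp only [zeta, Bool.false_eq_true, if_false, one_pow, mul_one]
    generalize Q.h * (Q.h - 1) = G
    rw [mul_pow, ← pow_mul, ← pow_mul, mul_comm a, hD, pow_add, mul_assoc])
  obtain ⟨u', hu'⟩ := mem_range_of_pow_mem Q.isNormalScheme (Q.chart (i, true)) hp
      (φ := s * (Q.h * (Q.h - 1)) ^ a * ((Q.z i)⁻¹) ^ n) (by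
    obtain ⟨u, hu⟩ := hmem (i, true)
    refine ⟨u * (E.hInf i * (E.hInf i - Polynomial.X ^ p)) ^ D * Polynomial.X ^ e, ?_⟩
    rw [map_mul, map_mul, hu, map_pow, map_mul, map_sub, h2, map_pow, map_pow, h3]
    simp only [zeta, if_true]
    generalize (Q.z i)⁻¹ = ζ
    have h4 : Q.h * ζ ^ p * (Q.h * ζ ^ p - ζ ^ p) = Q.h * (Q.h - 1) * ζ ^ (2 * p) := by ring
    rw [h4]
    generalize Q.h * (Q.h - 1) = G
    simp only [mul_pow, ← pow_mul, mul_comm a, mul_comm n, hD, he, pow_add]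
    ring)
  refine ⟨g, ?_, ?_⟩
  · exact Q.natDegree_le_of_mem_range i g u' n (by rw [hg, hu'])
  · rw [← hg, Q.toK_fin]

variable [IsDomain R]

include hK hΔ hΘ in
theorem exists_aeval_fib {m a n D e : ℕ} (hD : 6 * p * a = 4 * m + D)
    (he : 6 * p * n = p * m + 2 * p * D + e) {s : X.functionField}
    (hs : s ∈ sections f (roundDown m (K + Δ + Θ))) :
    ∃ w : R[X], (E.τ ≠ 0 → w.natDegree * p ≤ n) ∧
      s * (Q.h * (Q.h - 1)) ^ a = aeval (R := R) (A := FunctionField f) Q.fib w := by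
  obtain ⟨g₀, h0, e0⟩ := Q.exists_polynomials hK hΔ hΘ hD he hs 0
  obtain ⟨g₁, h1, e1⟩ := Q.exists_polynomials hK hΔ hΘ hD he hs 1
  have hs0 : E.shift 0 = 0 := rfl
  rw [hs0, C_0, sub_zero, comp_X] at e0
  have e2 := Q.inj (e0.symm.trans e1)
  by_cases hτ : E.τ = 0
  · obtain ⟨w, hw⟩ := E.exists_map_of_tau_eq_zero hτ g₀ g₁ e2
    refine ⟨w, fun h => absurd hτ h, ?_⟩
    have h2 := Q.aeval_Φ Polynomial.X w
    rw [comp_X, ← hw, ← e0] at h2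
    rw [fib, if_pos hτ]
    exact h2.symm
  · obtain ⟨w, hw, hw'⟩ := E.exists_comp_hM hτ n g₀ g₁ h0 e2
    refine ⟨w, fun _ => hw, ?_⟩
    have h2 := Q.aeval_Φ E.hM w
    rw [← hw', ← e0] at h2
    rw [fib, if_neg hτ]
    exact h2.symm

omit [IsLocallyNoetherian X] [∀ i, IsNoetherianRing (B i)] [∀ i, IsIntegrallyClosed (B i)]
  [CharP M p] [IsDomain R] in
theorem aeval_fib_injective :
    Function.Injective (aeval (R := R) (A := FunctionField f) Q.fib) := by
  unfold fib
  split_ifs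
  · exact Q.aeval_Φ_injective (by simp)
  · exact Q.aeval_Φ_injective (by rw [natDegree_hM]; exact (Fact.out : p.Prime).ne_zero)

include hK hΔ hΘ in
theorem hasKodairaDim_one : HasKodairaDim f (K + Δ + Θ) 1 := by
  have hp1 := (Fact.out : p.Prime)
  have hp : 0 < 6 * p := by have := hp1.pos; omega
  have hG := Q.h_mul_ne_zero
  have h0 : (Q.h * (Q.h - 1)) ^ 4 ≠ 0 := pow_ne_zero _ hG
  have hL := Q.isEquation_add_add hK hΔ hΘ
  refine PlurigeneraJump.hasKodairaDim_one f (K + Δ + Θ) Q.fib Q.aeval_fib_injective ?_ hp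
    (s := show X.functionField from ((Q.h * (Q.h - 1)) ^ 4)⁻¹ * Q.h)
    (t := show X.functionField from ((Q.h * (Q.h - 1)) ^ 4)⁻¹) ?_ ?_ ?_ ?_
  · intro m s hs t ht ht0
    have hD : 6 * p * m = 4 * m + (6 * p - 4) * m := by
      rw [← add_mul]
      congr 1
      have := hp1.two_le
      omega
    have he : 6 * p * (2 * p * m) = p * m + 2 * p * ((6 * p - 4) * m) + 7 * p * m := by
      obtain ⟨r, hr⟩ : ∃ r, 6 * p = r + 4 := ⟨6 * p - 4, by have := hp1.two_le; omega⟩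
      rw [hr, Nat.add_sub_cancel]
      ring
    obtain ⟨w, -, hw⟩ := Q.exists_aeval_fib hK hΔ hΘ hD he hs
    obtain ⟨w', -, hw'⟩ := Q.exists_aeval_fib hK hΔ hΘ hD he ht
    refine ⟨w, w', ?_, ?_⟩
    · rintro rfl
      rw [map_zero] at hw'
      exact mul_ne_zero (M₀ := X.functionField) ht0 (pow_ne_zero m hG) hw'
    · rw [← hw, ← hw']
      exact (mul_div_mul_right (G₀ := X.functionField) s t (pow_ne_zero m hG)).symm
  · refine (hL.mem_sections_iff Q.covers f hp _ _).2 fun c => ?_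
    rw [← mul_pow, mul_mul_mul_comm, inv_mul_cancel₀ h0, one_mul]
    obtain ⟨g, hg⟩ := Q.h_mul_zeta_pow_mem c
    exact Subring.pow_mem (toK (Q.chart c)).range (RingHom.mem_range.2 ⟨g, hg⟩) _
  · refine (hL.mem_sections_iff Q.covers f hp _ _).2 fun c => ?_
    rw [← mul_pow, inv_mul_cancel_left₀ h0, ← toK_eqTheta]
    exact Subring.pow_mem (toK (Q.chart c)).range (RingHom.mem_range.2 ⟨_, rfl⟩) _
  · exact inv_ne_zero h0
  · have e : (((Q.h * (Q.h - 1)) ^ 4)⁻¹ * Q.h) / ((Q.h * (Q.h - 1)) ^ 4)⁻¹ = Q.h :=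
      mul_div_cancel_left₀ _ (inv_ne_zero h0)
    have h1 : Transcendental R (A := FunctionField f) Q.h :=
      transcendental_iff_injective.2
        (Q.aeval_Φ_injective (by rw [natDegree_hM]; exact hp1.ne_zero))
    exact (congrArg (Transcendental R (A := FunctionField f)) e).mpr h1

end Ruled

namespace Ruled

variable {p : ℕ} {k M : Type u} [Field k] [Field M] [Algebra k M]
    {B : Fin 2 → Type u} [∀ i, CommRing (B i)] [∀ i, IsDomain (B i)]
    [∀ i, Algebra k (B i)] {E : AtiyahData p k M B}
    {X : Scheme.{u}} [IsIntegral X] {f : X ⟶ Spec (.of k)} (Q : Ruled E f)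
    [IsLocallyNoetherian X] [∀ i, IsNoetherianRing (B i)] [∀ i, IsIntegrallyClosed (B i)]
    [Fact p.Prime] [CharP M p] {K Δ Θ : QDivisor X}
    (hK : IsEquation Q.chart K.1 (6 * p) (fun c => (Q.zeta c ^ (12 * p))⁻¹))
    (hΔ : IsEquation Q.chart Δ.1 (6 * p) (fun c => toK (Q.chart c) (E.eqDelta c)))
    (hΘ : IsEquation Q.chart Θ.1 (6 * p) (fun c => toK (Q.chart c) (E.eqTheta c)))

include hK hΔ hΘ in
theorem h0_le (hτ : E.τ ≠ 0) (m : ℕ) :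
    h0 f m (K + Δ + Θ) ≤ (((m / 6 + 1) / 2 + 3 : ℕ) : Cardinal) := by
  have hp1 := (Fact.out : p.Prime)
  have hp2 := hp1.two_le
  have hG := Q.h_mul_ne_zero
  set a := 2 * m / (3 * p) + 1 with ha
  have ha1 : 2 * m ≤ 3 * p * a := by
    rw [ha, mul_add, mul_one]
    exact (Nat.lt_mul_div_succ (2 * m) (by omega : 0 < 3 * p)).le
  have ha2 : 3 * p * a ≤ 2 * m + 3 * p := by
    rw [ha, mul_add, mul_one]
    exact Nat.add_le_add_right (Nat.mul_div_le _ _) _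
  obtain ⟨D, hD⟩ : ∃ D, 6 * p * a = 4 * m + D := Nat.exists_eq_add_of_le (by linarith)
  have hD2 : D ≤ 6 * p := by linarith
  set n := m / 6 + 2 * p + 1 with hn
  have hn1 : m + 2 * D ≤ 6 * n := by omega
  obtain ⟨e, he⟩ : ∃ e, 6 * p * n = p * m + 2 * p * D + e := Nat.exists_eq_add_of_le (by
    calc p * m + 2 * p * D = p * (m + 2 * D) := by ring
      _ ≤ p * (6 * n) := Nat.mul_le_mul_left p hn1
      _ = 6 * p * n := by ring)
  set N := (m / 6 + 1) / 2 + 3 with hN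
  have hnN : ∀ d, d * p ≤ n → d < N := fun d hd => by
    by_contra hc
    push Not at hc
    obtain ⟨r, hr⟩ : ∃ r, d = r + 2 := ⟨d - 2, by omega⟩
    have h1 : r * 2 ≤ r * p := Nat.mul_le_mul_left r hp2
    have h2 : d * p = r * p + 2 * p := by rw [hr]; ring
    omega
  let c : X.functionField := ((Q.h * (Q.h - 1)) ^ a)⁻¹
  let ψ : k[X] →ₗ[k] FunctionField f := LinearMap.mulLeft k (show FunctionField f from c) ∘ₗ
      (aeval (R := k) (A := FunctionField f) Q.fib).toLinearMap
  have hle : sections f (roundDown m (K + Δ + Θ)) ≤ (degreeLT k N).map ψ := fun s hs => by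
    obtain ⟨w, hw, hw'⟩ := Q.exists_aeval_fib hK hΔ hΘ hD he hs
    refine ⟨w, mem_degreeLT.2 ?_, ?_⟩
    · by_cases h0 : w = 0
      · rw [h0, degree_zero]
        exact WithBot.bot_lt_coe _
      · rw [degree_eq_natDegree h0]
        exact_mod_cast hnN _ (hw hτ)
    · refine (congrArg (c * ·) hw'.symm).trans ?_
      change ((Q.h * (Q.h - 1)) ^ a)⁻¹ * ((show X.functionField from s) * _) = _
      rw [mul_comm (show X.functionField from s)]
      exact inv_mul_cancel_left₀ (pow_ne_zero a hG) _
  calc Module.rank k (sections f (roundDown m (K + Δ + Θ)))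
      ≤ Module.rank k ((degreeLT k N).map ψ) := Submodule.rank_mono hle
    _ ≤ Module.rank k (degreeLT k N) := rank_map_le _ _
    _ = Module.rank k (Fin N → k) := (degreeLTEquiv k N).rank_eq
    _ = N := by rw [rank_fun', Fintype.card_fin]

include hK hΔ hΘ in
theorem le_h0 (hτ : E.τ = 0) (m : ℕ) (hm : 8 ≤ m) :
    (((m - 8) / 6 + 1 : ℕ) : Cardinal) ≤ h0 f m (K + Δ + Θ) := by
  have hp1 := (Fact.out : p.Prime)
  have hp : 0 < 6 * p := by have := hp1.pos; omega
  set N := (m - 8) / 6 + 1 with hN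
  set b := 2 * m / 3 with hb
  set z : X.functionField := Q.Φ Polynomial.X with hz
  have hfib : Q.fib = z := by rw [fib, if_pos hτ]
  have hs : ∀ i, E.shift i = 0 := fun i => by fin_cases i <;> simp [AtiyahData.shift, hτ]
  have hzi : ∀ i, Q.z i = z := fun i => by rw [Ruled.z, hs, C_0, sub_zero]
  have hz0 : z ≠ 0 := hzi 0 ▸ Q.z_ne_zero 0
  have hz1 : z - 1 ≠ 0 := by
    rw [hz, ← map_one Q.Φ, ← map_sub]
    exact (map_ne_zero_iff _ Q.inj).2 (by simpa using X_sub_C_ne_zero (1 : M))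
  have hh : Q.h = z ^ p := by
    rw [h, hz, ← map_pow, AtiyahData.hM, AtiyahData.hFin_map]
    simp [hτ, hp1.ne_zero, Nat.sub_ne_zero_of_lt hp1.one_lt]
  have : CharP X.functionField p := charP_of_injective_ringHom (f := Q.Φ.comp C)
    (Q.inj.comp C_injective) p
  have hG : Q.h * (Q.h - 1) = (z * (z - 1)) ^ p := by
    rw [hh, mul_pow, sub_pow_char, one_pow]
  have hzz : z * (z - 1) ≠ 0 := mul_ne_zero hz0 hz1
  classical
  let c : X.functionField := ((z * (z - 1)) ^ b)⁻¹
  let ψ : k[X] →ₗ[k] FunctionField f := LinearMap.mulLeft k (show FunctionField f from c) ∘ₗ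
      (aeval (R := k) (A := FunctionField f) Q.fib).toLinearMap
  have hψ : Function.Injective ψ := fun w w' hw => by
    refine Q.aeval_fib_injective ?_
    exact mul_left_cancel₀ (M₀ := X.functionField) (inv_ne_zero (pow_ne_zero b hzz)) hw
  have hle : (degreeLT k N).map ψ ≤ sections f (roundDown m (K + Δ + Θ)) := by
    rw [degreeLT_eq_span_X_pow, Submodule.map_span, Submodule.span_le]
    rintro _ ⟨_, hw, rfl⟩
    obtain ⟨r, hr, rfl⟩ := Finset.mem_image.1 (Finset.mem_coe.1 hw)
    rw [Finset.mem_range] at hr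
    have e1 : ψ (Polynomial.X ^ r) = (show X.functionField from ((z * (z - 1)) ^ b)⁻¹ * z ^ r) := by
      change ((z * (z - 1)) ^ b)⁻¹ * _ = _
      congr 1
      exact (aeval_X_pow (R := k) (A := FunctionField f) _).trans (by rw [hfib]; rfl)
    rw [e1]
    refine ((Q.isEquation_add_add hK hΔ hΘ).mem_sections_iff Q.covers f hp m _).2 fun c => ?_
    obtain ⟨D, hD⟩ : ∃ D, 4 * m = 6 * b + D := Nat.exists_eq_add_of_le (by omega)
    have e2 : ((z * (z - 1)) ^ b)⁻¹ ^ (6 * p) * (((z * (z - 1)) ^ p) ^ 4) ^ m =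
        (z * (z - 1)) ^ (p * D) := by
      rw [inv_pow, inv_mul_eq_iff_eq_mul₀ (pow_ne_zero _ (pow_ne_zero _ hzz)), ← pow_mul, ← pow_mul,
        ← pow_mul, ← pow_add]
      congr 1
      rw [hD]
      ring
    rw [mul_pow _ (z ^ r), mul_pow _ (Q.zeta c ^ p), hG, mul_mul_mul_comm, e2]
    have hzr : ∀ i, toK (Q.chart (i, false)) Polynomial.X = z := fun i => by
      rw [toK_fin_eq, eval₂_X, hzi]
    have hzi' : ∀ i, toK (Q.chart (i, true)) Polynomial.X = z⁻¹ := fun i => by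
      rw [toK_inf_eq, eval₂_X, hzi]
    obtain ⟨i, _ | _⟩ := c
    · refine ⟨(Polynomial.X * (Polynomial.X - 1)) ^ (p * D) * (Polynomial.X ^ r) ^ (6 * p), ?_⟩
      simp only [map_mul, map_pow, map_sub, map_one, hzr, zeta, Bool.false_eq_true, if_false,
        one_pow, mul_one]
    · obtain ⟨e, he⟩ : ∃ e, p * m = 2 * (p * D) + r * (6 * p) + e := Nat.exists_eq_add_of_le (by
        calc 2 * (p * D) + r * (6 * p) = p * (2 * D + 6 * r) := by ring
          _ ≤ p * m := Nat.mul_le_mul_left p (by omega))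
      refine ⟨(1 - Polynomial.X) ^ (p * D) * Polynomial.X ^ e, ?_⟩
      simp only [map_mul, map_pow, map_sub, map_one, hzi', zeta, if_true, hzi, ← pow_mul]
      rw [he, pow_add, pow_add, pow_mul _ 2]
      have e3 : z * (z - 1) * z⁻¹ ^ 2 = 1 - z⁻¹ := by field_simp
      have e4 : z ^ (r * (6 * p)) * z⁻¹ ^ (r * (6 * p)) = 1 := by
        rw [← mul_pow, mul_inv_cancel₀ hz0, one_pow]
      rw [← e3, mul_pow _ (z⁻¹ ^ 2)]
      linear_combination (-(z * (z - 1)) ^ (p * D) * (z⁻¹ ^ 2) ^ (p * D) * z⁻¹ ^ e) * e4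
  calc ((N : ℕ) : Cardinal) = Module.rank k (Fin N → k) := by rw [rank_fun', Fintype.card_fin]
    _ = Module.rank k (degreeLT k N) := (degreeLTEquiv k N).symm.rank_eq
    _ = Module.rank k ((degreeLT k N).map ψ) :=
      (Submodule.equivMapOfInjective ψ hψ _).rank_eq
    _ ≤ _ := Submodule.rank_mono hle

end Ruled


section ChartRing

variable {k : Type u} [Field k] (W : WeierstrassCurve k)

/-- The presentation of a chart ring. -/
def chartMap (i : Fin 2) : MvPolynomial (Fin 2) k →ₐ[k] chartRing W i := (chartEval W i).rangeRestrict

theorem chartMap_surjective (i : Fin 2) :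
    Function.Surjective (chartMap W i) := AlgHom.rangeRestrict_surjective _

theorem ker_chartMap (i : Fin 2) :
    RingHom.ker (chartMap W i) = Ideal.span {chartEqn W i} := by
  rw [← ker_chartEval]
  exact AlgHom.ker_rangeRestrict _

instance (i : Fin 2) : IsNoetherianRing (chartRing W i) :=
  isNoetherianRing_of_surjective _ _ (chartMap W i).toRingHom
    (chartMap_surjective W i)

instance (i : Fin 2) [IsAlgClosed k] [W.IsElliptic] : IsIntegrallyClosed (chartRing W i) :=
  isIntegrallyClosed_of_nonsingular (chartMap_surjective W i)
    (ker_chartMap W i) (nonsingular_chartEqn W i)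

/-- The coordinates as elements of the chart rings. -/
def coord (i l : Fin 2) : chartRing W i := ⟨coordFun W i l, coordFun_mem W i l⟩

theorem adjoin_coord (i : Fin 2) : Algebra.adjoin k (Set.range (coord W i)) = ⊤ := by
  have h : chartRing W i = Algebra.adjoin k (Set.range (coordFun W i)) :=
    (Algebra.adjoin_range_eq_range_aeval k (coordFun W i)).symm
  apply Subalgebra.map_injective (f := (chartRing W i).val) Subtype.val_injective
  rw [AlgHom.map_adjoin, ← Set.range_comp, Algebra.map_top, Subalgebra.range_val]
  exact h.symm

theorem algebraMap_coe (i : Fin 2) (c : k) :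
    ((algebraMap k (chartRing W i) c : chartRing W i) : CurveField W) = algebraMap k _ c := rfl

theorem smooth_chartRing [IsAlgClosed k] [W.IsElliptic] (i : Fin 2) :
    SmoothOfRelativeDimension 1
      (specMap (algebraMap k (chartRing W i))) := by
  rw [HasRingHomProperty.Spec_iff (P := @SmoothOfRelativeDimension 1)]
  refine RingHom.locally_of_exists (S := chartRing W i) ?_ _ (fun l : Fin 2 => (chartMap W i)
    (MvPolynomial.pderiv l (chartEqn W i))) ?_ (fun l => Localization.Away
      ((chartMap W i) (MvPolynomial.pderiv l (chartEqn W i)))) ?_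
  · exact RingHom.isStandardSmoothOfRelativeDimension_respectsIso
  · exact span_pderiv_eq_top (chartMap_surjective W i)
      (ker_chartMap W i) (nonsingular_chartEqn W i)
  intro l
  · have h := isStandardSmooth_away_pderiv (chartMap_surjective W i)
      (ker_chartMap W i) l (Localization.Away
      ((chartMap W i) (MvPolynomial.pderiv l (chartEqn W i))))
    rw [← RingHom.isStandardSmoothOfRelativeDimension_algebraMap] at h
    exact h

end ChartRing

/-- Smoothness may be checked on open charts. -/
theorem smoothOfRelativeDimension_of_charts {X Y : Scheme.{u}} (f : X ⟶ Y) (n : ℕ) {I : Type}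
    {U : I → Scheme.{u}} (j : ∀ c, U c ⟶ X) [∀ c, IsOpenImmersion (j c)]
    (hj : ∀ x, ∃ c, x ∈ (j c).opensRange) (h : ∀ c, SmoothOfRelativeDimension n (j c ≫ f)) :
    SmoothOfRelativeDimension n f := by
  refine ⟨fun x => ?_⟩
  obtain ⟨c, q, rfl⟩ := hj x
  obtain ⟨U, hU, V, hV, hx, e, h1⟩ := (h c).exists_isStandardSmoothOfRelativeDimension q
  refine ⟨U, hU, j c ''ᵁ V, hV.image_of_isOpenImmersion (j c), ⟨q, hx, rfl⟩, ?_, ?_⟩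
  · rintro _ ⟨y, hy, rfl⟩
    exact e hy
  · have h2 : f.appLE U (j c ''ᵁ V) (by rintro _ ⟨y, hy, rfl⟩; exact e hy) ≫
        ((j c).appIso V).hom = (j c ≫ f).appLE U V e := by
      rw [Scheme.Hom.appIso_hom', Scheme.Hom.appLE_comp_appLE]
    rw [← h2] at h1
    have h3 : f.appLE U (j c ''ᵁ V) (by rintro _ ⟨y, hy, rfl⟩; exact e hy) =
        (j c ≫ f).appLE U V e ≫ ((j c).appIso V).inv := by
      rw [← h2, Category.assoc, Iso.hom_inv_id, Category.comp_id]
    rw [h3, CommRingCat.hom_comp]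
    rw [h2] at h1
    exact (RingHom.isStandardSmoothOfRelativeDimension_respectsIso (n := n)).1 _
      ((j c).appIso V).symm.commRingCatIsoToRingEquiv h1

attribute [local instance] MvPolynomial.gradedAlgebra in
theorem isProper_toSpec (R : Type u) [CommRing R] (n : ℕ) :
    IsProper (ProjSpace.toSpec R n) := by
  have hb : Function.Bijective (algebraMap R (MvPolynomial.homogeneousSubmodule (Fin (n + 1)) R 0)) := by
    refine ⟨fun a b h => ?_, fun a => ?_⟩
    · have := congrArg Subtype.val h
      exact MvPolynomial.C_injective _ _ this
    · obtain ⟨q, hq⟩ := a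
      have h0 := hq
      rw [MvPolynomial.homogeneousSubmodule_zero, Submodule.mem_one] at h0
      obtain ⟨r, hr⟩ := h0
      exact ⟨r, Subtype.ext hr⟩
  have : IsIso (CommRingCat.ofHom
      (algebraMap R (MvPolynomial.homogeneousSubmodule (Fin (n + 1)) R 0))) := by
    rw [ConcreteCategory.isIso_iff_bijective]
    exact hb
  have : Algebra.FiniteType (MvPolynomial.homogeneousSubmodule (Fin (n + 1)) R 0)
      (MvPolynomial (Fin (n + 1)) R) := by
    have h : ((algebraMap (MvPolynomial.homogeneousSubmodule (Fin (n + 1)) R 0)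
        (MvPolynomial (Fin (n + 1)) R)).comp
        (algebraMap R (MvPolynomial.homogeneousSubmodule (Fin (n + 1)) R 0))).FiniteType :=
      (RingHom.finiteType_algebraMap (A := R)).2 inferInstance
    exact RingHom.finiteType_algebraMap.1 h.of_comp_finiteType
  exact inferInstanceAs (IsProper (Proj.toSpecZero _ ≫ Spec.map _))


section Curve

variable {k : Type u} [Field k] (W : WeierstrassCurve k)

/-- The inclusions of the chart rings in the function field. -/
abbrev chartIncl (i : Fin 2) : chartRing W i →+* CurveField W := (chartRing W i).subtype

theorem weierstrass_equation_homogeneous :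
    1 + algebraMap k _ W.a₁ * (xFun W / yFun W) + algebraMap k _ W.a₃ * (1 / yFun W) =
      (xFun W / yFun W) * (xFun W ^ 2 / yFun W) + algebraMap k _ W.a₂ * (xFun W / yFun W) ^ 2 +
      algebraMap k _ W.a₄ * (xFun W / yFun W) * (1 / yFun W) +
      algebraMap k _ W.a₆ * (1 / yFun W) ^ 2 := by
  have h := weierstrass_equation W
  have hx := xFun_ne_zero W
  have hy := yFun_ne_zero W
  field_simp
  linear_combination h

attribute [local instance] MvPolynomial.gradedAlgebra in
theorem exists_curve : ∃ (E : Scheme.{u}) (e : E ⟶ Spec (.of k))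
    (A : Atlas E (CurveField W) (fun i => chartRing W i) (chartIncl W)),
    E.IsSeparated ∧ IsProper e ∧
      ∀ i, A.chart i ≫ e = specMap (algebraMap k (chartRing W i)) := by
  have hx := xFun_ne_zero W
  have hy := yFun_ne_zero W
  let s : Fin 4 → CurveField W := ![1, xFun W, xFun W ^ 2, yFun W]
  let l : Fin 2 → Fin 4 := ![0, 2]
  let γ : ∀ i : Fin 2, Fin 4 → chartRing W i :=
    Fin.cons ![1, coord W 0 0, coord W 0 0 ^ 2, coord W 0 1]
      (Fin.cons ![coord W 1 0 ^ 2, coord W 1 0, 1, coord W 1 1] finZeroElim)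
  have hgen : ∀ i, Algebra.adjoin k (Set.range (γ i)) = ⊤ := by
    intro i
    rw [← top_le_iff, ← adjoin_coord W i]
    refine Algebra.adjoin_mono ?_
    rintro _ ⟨j, rfl⟩
    fin_cases i <;> fin_cases j
    · exact ⟨1, rfl⟩
    · exact ⟨3, rfl⟩
    · exact ⟨1, rfl⟩
    · exact ⟨3, rfl⟩
  have hcov : ∀ j (O : Subring (CurveField W)) (_ : ∀ r, algebraMap k _ r ∈ O)
      (hO : ∀ i, s i / s j ∈ O) (F : Type u) [Field F] (v : O →+* F),
      ∃ c, v ⟨s (l c) / s j, hO _⟩ ≠ 0 := by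
    intro j O hR hO F _ v
    by_contra! hc
    have h0 := hc 0
    have h2 := hc 1
    fin_cases j
    · refine one_ne_zero (α := F) (Eq.trans ?_ h0)
      rw [← map_one v]; congr 1; ext; simp [s, l]
    · refine one_ne_zero (α := F) (Eq.trans (b := v ⟨_, hO (l 0)⟩ * v ⟨_, hO (l 1)⟩) ?_ 
        (by rw [h0, zero_mul]))
      rw [← map_mul, ← map_one v]; congr 1; ext
      simp [s, l]
      field_simp
    · refine one_ne_zero (α := F) (Eq.trans ?_ h2)
      rw [← map_one v]; congr 1; ext; simp [s, l, hx]
    · have h1 : v ⟨_, hO 1⟩ = 0 := by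
        have : v ⟨_, hO 1⟩ ^ 2 = v ⟨_, hO (l 0)⟩ * v ⟨_, hO (l 1)⟩ := by
          rw [← map_mul, ← map_pow]; congr 1; ext
          simp [s, l]; field_simp
        rw [h0, zero_mul] at this
        exact pow_eq_zero_iff two_ne_zero |>.1 this
      have : (1 : O) + ⟨_, hR W.a₁⟩ * ⟨_, hO 1⟩ + ⟨_, hR W.a₃⟩ * ⟨_, hO (l 0)⟩ =
        ⟨_, hO 1⟩ * ⟨_, hO (l 1)⟩ + ⟨_, hR W.a₂⟩ * ⟨_, hO 1⟩ ^ 2 +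
          ⟨_, hR W.a₄⟩ * ⟨_, hO 1⟩ * ⟨_, hO (l 0)⟩ + ⟨_, hR W.a₆⟩ * ⟨_, hO (l 0)⟩ ^ 2 :=
        Subtype.ext (weierstrass_equation_homogeneous W)
      have h3 := congrArg v this
      simp only [map_add, map_mul, map_pow, map_one] at h3
      rw [h1] at h3
      erw [h0, h2] at h3
      simp at h3
  obtain ⟨E, ι, A, hι, hA⟩ := exists_atlas_projective (R := k) (n := 3) (s := s)
    (by intro i; fin_cases i <;> simp [s, hx, hy]) (fun i => chartRing W i) (chartIncl W)
    (fun _ => Subtype.val_injective) (fun _ _ => rfl) l γ (fun i j => by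
      fin_cases i <;> fin_cases j <;>
        simp [γ, s, l, coord, coordFun, rFun, vFun] <;> field_simp) hgen hcov
  have := isProper_toSpec k 3
  have hs : (ProjSpace k 3).IsSeparated :=
    inferInstanceAs (Scheme.IsSeparated (Proj _))
  refine ⟨E, ι ≫ ProjSpace.toSpec k 3, A, ?_, inferInstance, hA⟩
  have : terminal.from E = ι ≫ terminal.from _ := Subsingleton.elim _ _
  exact ⟨this ▸ inferInstance⟩

variable {W}

theorem isSmoothProperModel [IsAlgClosed k] [W.IsElliptic] {E : Scheme.{u}} {e : E ⟶ Spec (.of k)}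
    (A : Atlas E (CurveField W) (fun i => chartRing W i) (chartIncl W)) (hp : IsProper e)
    (hA : ∀ i, A.chart i ≫ e = specMap (algebraMap k (chartRing W i))) :
    IsSmoothProperModel W e := by
  refine ⟨A.isIntegral (fun _ => Subtype.val_injective), hp,
    smoothOfRelativeDimension_of_charts e 1 A.chart A.covers fun c => ?_, ?_⟩
  · rw [hA]; exact smooth_chartRing W c
  let f : W.toAffine.CoordinateRing →ₐ[k] CurveField W := IsScalarTower.toAlgHom k _ _
  have hf : f.range = chartRing W 0 := by
    apply le_antisymm
    · rintro _ ⟨a, rfl⟩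
      exact algebraMap_coordinateRing_mem W a
    · rintro _ ⟨q, rfl⟩
      have : chartEval W 0 q = f (MvPolynomial.aeval 
        ![algebraMap (Polynomial k) _ X,
          WeierstrassCurve.Affine.CoordinateRing.mk _ X] q) := by
        rw [← AlgHom.comp_apply]
        congr 1
        ext i
        fin_cases i <;> simp [chartEval, coordFun] <;> rfl
      exact ⟨_, this.symm⟩
  let g : W.toAffine.CoordinateRing ≃ₐ[k] chartRing W 0 :=
    (AlgEquiv.ofInjective f (IsFractionRing.injective _ _)).trans (Subalgebra.equivOfEq _ _ hf)
  have : IsIso (CommRingCat.ofHom (g : W.toAffine.CoordinateRing →ₐ[k] chartRing W 0).toRingHom) := by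
    rw [ConcreteCategory.isIso_iff_bijective]
    exact g.bijective
  refine ⟨inv (Spec.map (CommRingCat.ofHom (g : W.toAffine.CoordinateRing →ₐ[k] chartRing W 0).toRingHom)) ≫ A.chart 0, inferInstance, ?_⟩
  rw [Category.assoc, hA, IsIso.inv_comp_eq, ← Spec.map_comp, ← CommRingCat.ofHom_comp]
  exact congrArg (fun f => specMap f) (RingHom.ext fun r => (g.commutes r).symm)

end Curve


section Extension

variable {k : Type u} [Field k] {W : WeierstrassCurve k} {E : Scheme.{u}} [IsIntegral E]
  (H : Atlas E (CurveField W) (fun i => chartRing W i) (chartIncl W))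
  (ρ : CurveField W →+* E.functionField) (hρ : ∀ i a, ρ (chartIncl W i a) = toK (H.chart i) a)

include hρ in
theorem regularAt_atiyahFun (x : E) (h₀ : x ∈ (H.chart 0).opensRange)
    (h₁ : x ∈ (H.chart 1).opensRange) : RegularAt x (ρ (atiyahFun W)) := by
  have : atiyahFun W = chartIncl W 0 (coord W 0 1) * chartIncl W 1 (coord W 1 0) := by
    rw [atiyahFun, div_eq_mul_inv]; rfl
  rw [this, map_mul, hρ, hρ]
  exact (regularAt_toK _ h₀ _).mul (regularAt_toK _ h₁ _)

/-- The extension of the structure sheaf with the class of `y / x`. -/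
def atiyahExtension : SelfExtension E where
  ι := Fin 2
  U i := (H.chart i).opensRange
  nonempty i := ⟨H.chart i (specBot _), _, rfl⟩
  cover := H.covers
  a i j := ![ρ (atiyahFun W), 0] i - ![ρ (atiyahFun W), 0] j
  regular i j x hi hj := by
    fin_cases i <;> fin_cases j
    · simpa using RegularAt.zero x
    · simpa using regularAt_atiyahFun H ρ hρ x hi hj
    · simpa using (regularAt_atiyahFun H ρ hρ x hj hi).neg
    · simpa using RegularAt.zero x
  cocycle i j l := by ring

theorem not_isSplit_atiyahExtension [IsAlgClosed k] [W.IsElliptic] : ¬ (atiyahExtension H ρ hρ).IsSplit := by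
  rintro ⟨b, hb, h⟩
  have hb' (i : Fin 2) : ∃ c, toK (H.chart i) c = b (show Fin 2 from i) :=
    exists_toK_eq_of_regularAt (H.chart i) fun q => hb i _ ⟨q, rfl⟩
  obtain ⟨u, hu⟩ := hb' 0
  obtain ⟨v, hv⟩ := hb' 1
  have h1 : ρ (atiyahFun W) = b (0 : Fin 2) - b (1 : Fin 2) := by
    rw [← h (0 : Fin 2) (1 : Fin 2)]
    exact (sub_zero _).symm
  rw [← hu, ← hv, ← hρ, ← hρ, ← map_sub] at h1
  refine atiyahFun_ne W u.2 (-v).2 ((ρ.injective h1).trans ?_)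
  rw [sub_eq_add_neg]
  rfl

end Extension

section Family

/-- The polynomial ring over `B` as an algebra over the polynomial ring in the same variable over
a base ring. -/
def FamilyRing (B : Type u) [CommRing B] : Type u := B[X]

variable (B : Type u) [CommRing B]

instance : CommRing (FamilyRing B) := inferInstanceAs (CommRing B[X])
instance [IsDomain B] : IsDomain (FamilyRing B) := inferInstanceAs (IsDomain B[X])
instance [IsNoetherianRing B] : IsNoetherianRing (FamilyRing B) :=
  inferInstanceAs (IsNoetherianRing B[X])
instance [IsDomain B] [IsIntegrallyClosed B] : IsIntegrallyClosed (FamilyRing B) :=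
  inferInstanceAs (IsIntegrallyClosed B[X])

instance {R : Type u} [CommRing R] [Algebra R B] : Algebra R[X] (FamilyRing B) :=
  (mapRingHom (algebraMap R B)).toAlgebra

theorem FamilyRing.algebraMap_eq {R : Type u} [CommRing R] [Algebra R B] (r : R[X]) :
    algebraMap R[X] (FamilyRing B) r = (r.map (algebraMap R B) : B[X]) := rfl

/-- The field of rational functions over `M`. -/
def FamilyField (M : Type u) [Field M] : Type u := FractionRing M[X]

variable (M : Type u) [Field M]

instance : Field (FamilyField M) := inferInstanceAs (Field (FractionRing M[X]))
instance : Algebra (FamilyRing M) (FamilyField M) :=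
  inferInstanceAs (Algebra M[X] (FractionRing M[X]))
instance : IsFractionRing (FamilyRing M) (FamilyField M) :=
  inferInstanceAs (IsFractionRing M[X] (FractionRing M[X]))
instance {R : Type u} [CommRing R] [Algebra R M] : Algebra R[X] (FamilyField M) :=
  ((algebraMap (FamilyRing M) (FamilyField M)).comp
    (algebraMap R[X] (FamilyRing M))).toAlgebra
instance {R : Type u} [CommRing R] [Algebra R M] :
    IsScalarTower R[X] (FamilyRing M) (FamilyField M) := IsScalarTower.of_algebraMap_eq fun _ => rfl
instance (p : ℕ) [CharP M p] : CharP (FamilyField M) p :=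
  have : CharP (FamilyRing M) p := inferInstanceAs (CharP M[X] p)
  charP_of_injective_algebraMap (IsFractionRing.injective (FamilyRing M) (FamilyField M)) p

variable {B M}

/-- The extension of an algebra homomorphism to families. -/
def FamilyRing.map {R : Type u} [CommRing R] {A : Type u} [CommRing A] [Algebra R A] [Algebra R B]
    (θ : B →ₐ[R] A) : FamilyRing B →ₐ[R[X]] FamilyRing A where
  __ := mapRingHom (θ : B →+* A)
  commutes' r := by
    refine (Polynomial.map_map _ _ _).trans ?_
    rw [θ.comp_algebraMap]
    rfl

/-- Constants and the parameter generate a family. -/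
def FamilyRing.C : B →+* FamilyRing B := Polynomial.C

namespace AtiyahData

variable {p : ℕ} {k M : Type u} [Field k] [Field M] [Algebra k M]
    {B : Fin 2 → Type u} [∀ i, CommRing (B i)] [∀ i, Algebra k (B i)] (D : AtiyahData p k M B)

/-- The family over the affine line in which the class of the extension is scaled by the
parameter. -/
def family : AtiyahData p k[X] (FamilyField M) (fun i => FamilyRing (B i)) where
  θ i := (IsScalarTower.toAlgHom k[X] (FamilyRing M) (FamilyField M)).comp
    (FamilyRing.map (D.θ i))
  inj i := (IsFractionRing.injective (FamilyRing M) (FamilyField M)).comp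
    (Polynomial.map_injective (D.θ i : B i →+* M) (D.inj i))
  injR := (IsFractionRing.injective (FamilyRing M) (FamilyField M)).comp
    (Polynomial.map_injective _ D.injR)
  τ := X
  lam := C D.lam
  a := algebraMap (FamilyRing M) (FamilyField M) (FamilyRing.C D.a)
  α := FamilyRing.C D.α
  β := FamilyRing.C D.β
  a_eq := by
    have h : FamilyRing.C D.a = FamilyRing.map (D.θ 0) (FamilyRing.C D.α) *
        FamilyRing.map (D.θ 1) (FamilyRing.C D.β) := by
      rw [D.a_eq, map_mul]
      exact congrArg₂ (fun a b : M[X] => a * b) (Polynomial.map_C _).symm (Polynomial.map_C _).symm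
    rw [h, map_mul]
    rfl
  b i := FamilyRing.C (D.b i)
  pow_eq := by
    have h : FamilyRing.C D.a ^ p = algebraMap k[X] (FamilyRing M) (C D.lam) * FamilyRing.C D.a +
        FamilyRing.map (D.θ 0) (FamilyRing.C (D.b 0)) -
        FamilyRing.map (D.θ 1) (FamilyRing.C (D.b 1)) := by
      have h1 := congrArg (FamilyRing.C (B := M)) D.pow_eq
      rw [map_pow, map_sub, map_add, map_mul] at h1
      refine h1.trans ?_
      refine congrArg₂ (fun a b : M[X] => a - b) (congrArg₂ (fun a b : M[X] => a + b)
        (congrArg (fun a : M[X] => a * C D.a) ?_) ?_) ?_ <;> exact (Polynomial.map_C _).symm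
    rw [← map_pow, h, map_sub, map_add, map_mul]
    rfl
  inter u v h := by
    have h1 : (Polynomial.map (D.θ 0 : B 0 →+* M) u : M[X]) =
        Polynomial.map (D.θ 1 : B 1 →+* M) v :=
      IsFractionRing.injective (FamilyRing M) (FamilyField M) h
    have h2 (n : ℕ) : ∃ r, D.θ 0 (Polynomial.coeff u n) = algebraMap k M r :=
      D.inter _ (Polynomial.coeff v n)
        ((coeff_map (D.θ 0 : B 0 →+* M) n).symm.trans ((congrArg (fun f => Polynomial.coeff f n) h1).trans
          (coeff_map (D.θ 1 : B 1 →+* M) n)))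
    have h3 : (Polynomial.map (D.θ 0 : B 0 →+* M) u : M[X]) ∈ lifts (algebraMap k M) := by
      rw [lifts_iff_coeff_lifts]
      intro n
      obtain ⟨r, hr⟩ := h2 n
      exact ⟨r, hr.symm.trans (coeff_map (D.θ 0 : B 0 →+* M) n).symm⟩
    obtain ⟨r, hr⟩ := (mem_lifts _).1 h3
    exact ⟨r, congrArg (algebraMap (FamilyRing M) (FamilyField M)) hr.symm⟩
  nonsplit r u v h := by
    have h0 : algebraMap (FamilyRing M) (FamilyField M) (Polynomial.map (algebraMap k M) r * C D.a) =
        algebraMap (FamilyRing M) (FamilyField M)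
          (FamilyRing.map (D.θ 0) u + FamilyRing.map (D.θ 1) v) := by
      rw [map_add]
      refine Eq.trans ?_ h
      exact map_mul (algebraMap (FamilyRing M) (FamilyField M)) _ _
    have h1 : (Polynomial.map (algebraMap k M) r * C D.a : M[X]) =
        Polynomial.map (D.θ 0 : B 0 →+* M) u + Polynomial.map (D.θ 1 : B 1 →+* M) v :=
      IsFractionRing.injective (FamilyRing M) (FamilyField M) h0
    ext n
    rw [coeff_zero]
    refine D.nonsplit _ (Polynomial.coeff u n) (Polynomial.coeff v n) ?_
    have h2 := congrArg (fun f => Polynomial.coeff f n) h1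
    refine Eq.trans ?_ (h2.trans ((coeff_add _ _ n).trans (congrArg₂ (fun a b : M => a + b)
      (coeff_map (D.θ 0 : B 0 →+* M) n) (coeff_map (D.θ 1 : B 1 →+* M) n))))
    simp

end AtiyahData

end Family

section Atlas

namespace AtiyahData

variable {p : ℕ} {R M : Type u} [CommRing R] [Field M] [Algebra R M]
    {B : Fin 2 → Type u} [∀ i, CommRing (B i)] [∀ i, Algebra R (B i)] (D : AtiyahData p R M B)

/-- The fiber coordinates of the charts as rational functions. -/
def fracCoord (c : Fin 2 × Bool) : FractionRing M[X] :=
  if c.2 then (algebraMap M[X] _ (X - C (D.shift c.1)))⁻¹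
  else algebraMap M[X] _ (X - C (D.shift c.1))

/-- The embeddings of the coordinate rings of the charts into the field of rational functions. -/
def toFrac (c : Fin 2 × Bool) : (B c.1)[X] →+* FractionRing M[X] :=
  eval₂RingHom ((algebraMap M (FractionRing M[X])).comp (D.θ c.1 : B c.1 →+* M)) (D.fracCoord c)

omit [Algebra R M] in
theorem _root_.PlurigeneraJump.transcendental_X_sub_C (s : M) :
    Transcendental M (X - C s : M[X]) := by
  intro h
  have h1 := h.add (isAlgebraic_algebraMap (A := M[X]) s)
  rw [algebraMap_eq, sub_add_cancel] at h1
  exact transcendental_X M h1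

theorem toFrac_injective (c : Fin 2 × Bool) : Function.Injective (D.toFrac c) := by
  have h0 : Transcendental M (algebraMap M[X] (FractionRing M[X]) (X - C (D.shift c.1))) := by
    rw [transcendental_algebraMap_iff (IsFractionRing.injective _ _)]
    exact transcendental_X_sub_C _
  have h1 : Transcendental M (D.fracCoord c) := by
    rw [fracCoord]
    split_ifs
    · exact fun h => h0 (IsAlgebraic.inv_iff.1 h)
    · exact h0
  have h2 : ⇑(D.toFrac c) = ⇑(aeval (R := M) (D.fracCoord c)) ∘
      Polynomial.map (D.θ c.1 : B c.1 →+* M) := by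
    ext g
    exact (eval₂_map _ _ _).symm
  rw [h2]
  exact (transcendental_iff_injective.1 h1).comp (Polynomial.map_injective _ (D.inj c.1))

/-- A scheme with four charts is ruled if the charts are compatible with the embeddings of their
coordinate rings in the field of rational functions. -/
def ruledOfCharts [∀ i, IsDomain (B i)] {X : Scheme.{u}} [IsIntegral X] {f : X ⟶ Spec (.of R)}
    (chart : ∀ c : Fin 2 × Bool, Spec (.of (B c.1)[X]) ⟶ X) (ho : ∀ c, IsOpenImmersion (chart c))
    (hc : ∀ x, ∃ c, x ∈ (chart c).opensRange)
    (h : ∀ c, chart c ≫ f = specMap (algebraMap R (B c.1)[X]))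
    (ρ : FractionRing M[X] →+* X.functionField)
    (hρ : ∀ c a, ρ (D.toFrac c a) = toK (chart c) a) : Ruled D f where
  chart := chart
  isOpenImmersion := ho
  covers := hc
  chart_comp := h
  Φ := ρ.comp (algebraMap M[X] _)
  inj := ρ.injective.comp (IsFractionRing.injective _ _)
  toK_fin i g := by
    rw [← hρ]
    change _ = ρ _
    congr 1
    rw [comp, eval₂_map, hom_eval₂]
    rfl
  toK_inf_C i b := by
    rw [← hρ, toFrac, coe_eval₂RingHom, eval₂_C]
    rfl
  toK_inf_X i := by
    rw [← hρ, toFrac, coe_eval₂RingHom, eval₂_X, fracCoord, if_pos rfl, map_inv₀]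
    rfl

end AtiyahData

end Atlas


section Covering

variable {𝕂 : Type u} [Field 𝕂]

/-- The rational functions that define the projective embedding of the family. -/
def familySections (x y z T : 𝕂) : Fin 8 → 𝕂 :=
  ![1, x, x ^ 2, y, z, z * x, z * y, x ^ 2 * (z - T * (y / x))]

/-- The denominators of the four charts of the family. -/
def familyDenominator (c : Fin 2 × Bool) : Fin 8 := if c.2 then ![4, 7] c.1 else ![0, 2] c.1

theorem familySections_cover {x y z T a₁ a₂ a₃ a₄ a₆ : 𝕂} (hx : x ≠ 0) (hy : y ≠ 0) (hz : z ≠ 0)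
    (hz' : z - T * (y / x) ≠ 0)
    (hW : y ^ 2 + a₁ * x * y + a₃ * y = x ^ 3 + a₂ * x ^ 2 + a₄ * x + a₆)
    (j : Fin 8) (O : Subring 𝕂) (hT : T ∈ O) (h₁ : a₁ ∈ O) (h₂ : a₂ ∈ O) (h₃ : a₃ ∈ O)
    (h₄ : a₄ ∈ O) (h₆ : a₆ ∈ O)
    (hO : ∀ i, familySections x y z T i / familySections x y z T j ∈ O) {F : Type u} [Field F]
    (v : O →+* F) : ∃ c, v ⟨_, hO (familyDenominator c)⟩ ≠ 0 := by
  by_contra! hc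
  have e0 : v ⟨_, hO 0⟩ = 0 := hc (0, false)
  have e2 : v ⟨_, hO 2⟩ = 0 := hc (1, false)
  have e4 : v ⟨_, hO 4⟩ = 0 := hc (0, true)
  have e7 : v ⟨_, hO 7⟩ = 0 := hc (1, true)
  have key {u w : O} (hu : v u = 0) (h : (u : 𝕂) = w) : v w = 0 := by
    rw [← hu]; congr 1; exact Subtype.ext h.symm
  have zero_of_sq {u : O} (hu : v (u ^ 2) = 0) : v u = 0 := by
    rw [map_pow] at hu; exact pow_eq_zero_iff two_ne_zero |>.1 hu
  have one {u : O} (hu : v u = 0) (h : (u : 𝕂) = 1) : False :=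
    one_ne_zero (α := F) ((map_one v).symm.trans (key hu h))
  have mul {u w : O} (hu : v u = 0) : v (u * w) = 0 := by rw [map_mul, hu, zero_mul]
  fin_cases j
  · exact one e0 (by simp [familySections])
  · refine one (mul (w := ⟨_, hO 2⟩) e0) ?_
    simp [familySections]
    field_simp
  · exact one e2 (by simp [familySections, hx])
  · have e1 : v ⟨_, hO 1⟩ = 0 := by
      refine zero_of_sq (key (mul (w := ⟨_, hO 2⟩) e0) ?_)
      simp [familySections]
      field_simp
    refine one (u := ⟨_, hO 1⟩ * ⟨_, hO 2⟩ + ⟨_, h₂⟩ * ⟨_, hO 1⟩ ^ 2 +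
      ⟨_, h₄⟩ * ⟨_, hO 1⟩ * ⟨_, hO 0⟩ + ⟨_, h₆⟩ * ⟨_, hO 0⟩ ^ 2 -
      (⟨_, h₁⟩ * ⟨_, hO 1⟩ + ⟨_, h₃⟩ * ⟨_, hO 0⟩)) ?_ ?_
    · simp only [map_add, map_sub, map_mul, map_pow, e0, e1, e2]
      ring
    · simp [familySections]
      field_simp
      linear_combination -hW
  · exact one e4 (by simp [familySections, hz])
  · have e1 : v ⟨_, hO 1⟩ = 0 := by
      refine zero_of_sq (key (mul (w := ⟨_, hO 2⟩) e0) ?_)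
      simp [familySections]
      field_simp
    have e3 : v ⟨_, hO 3⟩ = 0 := by
      refine key (mul (w := ⟨_, hO 6⟩) e1) ?_
      simp [familySections]
      field_simp
    refine one (u := ⟨_, hO 7⟩ * ⟨_, hO 4⟩ + ⟨_, hT⟩ * ⟨_, hO 3⟩) ?_ ?_
    · simp only [map_add, map_mul, e7, e3]
      ring
    · simp [familySections]
      field_simp
      ring
  · have e1 : v ⟨_, hO 1⟩ = 0 := by
      refine zero_of_sq (key (mul (w := ⟨_, hO 2⟩) e0) ?_)
      simp [familySections]
      field_simp
    have e5 : v ⟨_, hO 5⟩ = 0 := by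
      refine zero_of_sq (key (u := ⟨_, hO 7⟩ * ⟨_, hO 4⟩ + ⟨_, hT⟩ * ⟨_, hO 1⟩) ?_ ?_)
      · simp only [map_add, map_mul, e7, e1, zero_mul, mul_zero, add_zero]
      · simp [familySections]
        field_simp
        ring
    refine one (u := ⟨_, hO 5⟩ * ⟨_, hO 7⟩ + ⟨_, hT⟩ * ⟨_, hO 2⟩ + ⟨_, h₂⟩ * ⟨_, hO 5⟩ ^ 2 +
      ⟨_, h₄⟩ * ⟨_, hO 5⟩ * ⟨_, hO 4⟩ + ⟨_, h₆⟩ * ⟨_, hO 4⟩ ^ 2 -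
      (⟨_, h₁⟩ * ⟨_, hO 5⟩ + ⟨_, h₃⟩ * ⟨_, hO 4⟩)) ?_ ?_
    · simp only [map_add, map_sub, map_mul, map_pow, e2, e4, e5, e7]
      ring
    · simp [familySections]
      field_simp
      linear_combination -z * hW
  · exact one e7 (by simp [familySections, hx, hz'])

end Covering

section Surface

variable {k : Type u} [Field k] (p : ℕ) (W : WeierstrassCurve k)

/-- The Artin-Schreier type data of a Weierstrass curve. -/
def atiyahData (t : k) : AtiyahData p k (CurveField W) (fun i => chartRing W i) :=
  have h := exists_atiyahFun_pow W p
  { θ i := (chartRing W i).val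
    inj _ := Subtype.val_injective
    injR := (algebraMap k (CurveField W)).injective
    τ := t
    lam := h.choose
    a := atiyahFun W
    α := coord W 0 1
    β := coord W 1 0
    a_eq := div_eq_mul_inv _ _
    b := Fin.cons ⟨_, h.choose_spec.choose_spec.choose_spec.1⟩
      (Fin.cons ⟨_, h.choose_spec.choose_spec.choose_spec.2.1⟩ finZeroElim)
    pow_eq := h.choose_spec.choose_spec.choose_spec.2.2
    inter u v h := by
      obtain ⟨c, hc⟩ := chartRing_zero_inf_one W u.2 (by
        have e : (u : CurveField W) = v := h
        rw [e]; exact v.2)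
      exact ⟨c, hc⟩
    nonsplit r u v h := by
      by_contra hr
      have hr' : algebraMap k (CurveField W) r ≠ 0 := by simpa using hr
      refine atiyahFun_ne W (r⁻¹ • u).2 (r⁻¹ • v).2 ?_
      have : atiyahFun W = algebraMap k (CurveField W) r⁻¹ * (u + v : CurveField W) := by
        rw [map_inv₀, eq_inv_mul_iff_mul_eq₀ hr']
        exact h
      rw [this, mul_add, ← Algebra.smul_def, ← Algebra.smul_def]
      rfl }

/-- The data of the family that degenerates the Atiyah bundle. -/
abbrev familyData : AtiyahData p k[X] (FamilyField (CurveField W))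
    (fun i => FamilyRing (chartRing W i)) := (atiyahData p W 1).family

/-- The inclusion of the function field of the curve in the function field of the family. -/
def curveIncl : CurveField W →+* FractionRing (FamilyField (CurveField W))[X] :=
  (algebraMap (FamilyField (CurveField W)) _).comp
    ((algebraMap (FamilyRing (CurveField W)) (FamilyField (CurveField W))).comp FamilyRing.C)

/-- The parameter as a rational function on the family. -/
def paramFun : FractionRing (FamilyField (CurveField W))[X] := algebraMap k[X] _ X

/-- The fiber coordinate as a rational function on the family. -/
def fiberFun : FractionRing (FamilyField (CurveField W))[X] :=
  algebraMap (FamilyField (CurveField W))[X] _ X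

/-- The constant functions on the charts of the family that come from the curve. -/
def chartConst (c : Fin 2 × Bool) : chartRing W c.1 →+* (FamilyRing (chartRing W c.1))[X] :=
  C.comp FamilyRing.C

theorem toFrac_chartConst (c : Fin 2 × Bool) (u : chartRing W c.1) :
    (familyData p W).toFrac c (chartConst W c u) = curveIncl W u := by
  rw [AtiyahData.toFrac, coe_eval₂RingHom]
  refine (eval₂_C _ _).trans ?_
  refine congrArg (algebraMap (FamilyField (CurveField W)) _) (congrArg
    (algebraMap (FamilyRing (CurveField W)) (FamilyField (CurveField W))) ?_)
  exact Polynomial.map_C _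

theorem toFrac_algebraMap (c : Fin 2 × Bool) (r : k[X]) :
    (familyData p W).toFrac c (algebraMap k[X] (FamilyRing (chartRing W c.1))[X] r) =
      algebraMap k[X] (FractionRing (FamilyField (CurveField W))[X]) r := by
  rw [AtiyahData.toFrac, coe_eval₂RingHom, Polynomial.algebraMap_apply]
  refine (eval₂_C _ _).trans ?_
  refine congrArg (algebraMap (FamilyField (CurveField W))
    (FractionRing (FamilyField (CurveField W))[X])) ?_
  exact AlgHom.commutes ((familyData p W).θ c.1) r

theorem fracCoord_zero : (familyData p W).fracCoord (0, false) = fiberFun W ∧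
    (familyData p W).fracCoord (0, true) = (fiberFun W)⁻¹ := by
  simp [AtiyahData.fracCoord, AtiyahData.shift, fiberFun]

theorem fracCoord_one : (familyData p W).fracCoord (1, false) = fiberFun W - paramFun W *
      (curveIncl W (yFun W) / curveIncl W (xFun W)) ∧
    (familyData p W).fracCoord (1, true) = (fiberFun W - paramFun W *
      (curveIncl W (yFun W) / curveIncl W (xFun W)))⁻¹ := by
  have h : algebraMap (FamilyField (CurveField W))[X] (FractionRing (FamilyField (CurveField W))[X])
      (X - C ((familyData p W).shift 1)) = fiberFun W - paramFun W *
      (curveIncl W (yFun W) / curveIncl W (xFun W)) := by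
    rw [map_sub, ← map_div₀]
    refine congrArg (fun a => fiberFun W - a) ?_
    rw [AtiyahData.shift, Matrix.cons_val_one, Matrix.cons_val_fin_one, C_mul, map_mul]
    rfl
  exact ⟨by rw [← h]; rfl, by rw [← h]; rfl⟩

theorem adjoin_chart (c : Fin 2 × Bool)
    (V : Subalgebra k[X] (FamilyRing (chartRing W c.1))[X])
    (hX : X ∈ V) (h : ∀ l, chartConst W c (coord W c.1 l) ∈ V) : V = ⊤ := by
  have h1 (u : chartRing W c.1) : chartConst W c u ∈ V := by
    have : u ∈ Algebra.adjoin k (Set.range (coord W c.1)) := by rw [adjoin_coord]; trivial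
    induction this using Algebra.adjoin_induction with
    | mem u hu => obtain ⟨l, rfl⟩ := hu; exact h l
    | algebraMap r =>
      have : chartConst W c (algebraMap k _ r) = algebraMap k[X] _ (C r) := by
        rw [Polynomial.algebraMap_apply]
        exact congrArg C (Polynomial.map_C _).symm
      rw [this]
      exact V.algebraMap_mem _
    | add u w _ _ hu hw => rw [map_add]; exact add_mem hu hw
    | mul u w _ _ hu hw => rw [map_mul]; exact mul_mem hu hw
  have h2 (b : FamilyRing (chartRing W c.1)) : C b ∈ V := by
    induction b using Polynomial.induction_on' with
    | add u w hu hw => exact (C.map_add u w : C (R := FamilyRing (chartRing W c.1)) (u + w) = _) ▸ add_mem hu hw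
    | monomial n a =>
      have : (C (R := FamilyRing (chartRing W c.1)) (monomial n a)) =
          chartConst W c a * algebraMap k[X] _ X ^ n := by
        rw [Polynomial.algebraMap_apply, chartConst, RingHom.comp_apply, ← C_pow, ← C_mul,
          ← C_mul_X_pow_eq_monomial]
        refine congrArg C ?_
        rw [FamilyRing.algebraMap_eq, map_X]
        rfl
      rw [this]
      exact mul_mem (h1 a) (pow_mem (V.algebraMap_mem _) n)
  rw [← top_le_iff]
  rintro g -
  induction g using Polynomial.induction_on' with
  | add u w hu hw => exact add_mem hu hw
  | monomial n a =>
    rw [← C_mul_X_pow_eq_monomial]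
    exact mul_mem (h2 a) (pow_mem hX n)

/-- The projective coordinates in the charts of the family. -/
def familyCoord : ∀ c : Fin 2 × Bool, Fin 8 → (FamilyRing (chartRing W c.1))[X]
  | (0, false) =>
    let x := chartConst W (0, false) (coord W 0 0)
    let y := chartConst W (0, false) (coord W 0 1)
    let T := algebraMap k[X] _ X
    ![1, x, x ^ 2, y, X, X * x, X * y, x ^ 2 * X - T * x * y]
  | (1, false) =>
    let r := chartConst W (1, false) (coord W 1 0)
    let v := chartConst W (1, false) (coord W 1 1)
    let T := algebraMap k[X] _ X
    let a (u : k) := chartConst W (1, false) (algebraMap k _ u)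
    ![r ^ 2, r, 1, v, r ^ 2 * X + T * r * v, r * X + T * v,
      v * X + T * (1 + a W.a₂ * r + a W.a₄ * r ^ 2 + a W.a₆ * r ^ 3 - a W.a₁ * v - a W.a₃ * r * v),
      X]
  | (0, true) =>
    let x := chartConst W (0, true) (coord W 0 0)
    let y := chartConst W (0, true) (coord W 0 1)
    let T := algebraMap k[X] _ X
    ![X, x * X, x ^ 2 * X, y * X, 1, x, y, x ^ 2 - T * x * y * X]
  | (1, true) =>
    let r := chartConst W (1, true) (coord W 1 0)
    let v := chartConst W (1, true) (coord W 1 1)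
    let T := algebraMap k[X] _ X
    let a (u : k) := chartConst W (1, true) (algebraMap k _ u)
    ![r ^ 2 * X, r * X, X, v * X, r ^ 2 + T * r * v * X, r + T * v * X,
      v + T * (1 + a W.a₂ * r + a W.a₄ * r ^ 2 + a W.a₆ * r ^ 3 - a W.a₁ * v - a W.a₃ * r * v) * X,
      1]

theorem adjoin_familyCoord (c : Fin 2 × Bool) :
    Algebra.adjoin k[X] (Set.range (familyCoord W c)) = ⊤ := by
  set V := Algebra.adjoin k[X] (Set.range (familyCoord W c)) with hV
  have h (j) : familyCoord W c j ∈ V := Algebra.subset_adjoin ⟨j, rfl⟩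
  have hT (r) : algebraMap k[X] _ r ∈ V := V.algebraMap_mem r
  obtain ⟨i, e⟩ := c
  fin_cases i <;> cases e
  · refine adjoin_chart W _ V (h 4) fun l => ?_
    fin_cases l
    exacts [h 1, h 3]
  · refine adjoin_chart W _ V (h 0) fun l => ?_
    fin_cases l
    exacts [h 5, h 6]
  · refine adjoin_chart W _ V (h 7) fun l => ?_
    fin_cases l
    exacts [h 1, h 3]
  · have ha (u : k) : chartConst W (1, true) (algebraMap k _ u) ∈ V := by
      have : chartConst W (1, true) (algebraMap k _ u) = algebraMap k[X] _ (C u) := by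
        rw [Polynomial.algebraMap_apply]
        exact congrArg C (Polynomial.map_C _).symm
      rw [this]
      exact hT _
    have hr : chartConst W (1, true) (coord W 1 0) ∈ V := by
      have : chartConst W (1, true) (coord W 1 0) = familyCoord W (1, true) 5 -
          algebraMap k[X] _ X * familyCoord W (1, true) 3 := by
        simp [familyCoord]
        ring
      rw [this]
      exact sub_mem (h 5) (mul_mem (hT _) (h 3))
    have hv : chartConst W (1, true) (coord W 1 1) ∈ V := by
      have : chartConst W (1, true) (coord W 1 1) = familyCoord W (1, true) 6 -
          algebraMap k[X] _ X * (familyCoord W (1, true) 2 +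
            chartConst W (1, true) (algebraMap k _ W.a₂) * familyCoord W (1, true) 1 +
            chartConst W (1, true) (algebraMap k _ W.a₄) * familyCoord W (1, true) 0 +
            chartConst W (1, true) (algebraMap k _ W.a₆) * chartConst W (1, true) (coord W 1 0) *
              familyCoord W (1, true) 0 -
            chartConst W (1, true) (algebraMap k _ W.a₁) * familyCoord W (1, true) 3 -
            chartConst W (1, true) (algebraMap k _ W.a₃) * chartConst W (1, true) (coord W 1 0) *
              familyCoord W (1, true) 3) := by
        simp [familyCoord]
        ring
      rw [this]
      exact sub_mem (h 6) (mul_mem (hT _) (sub_mem (sub_mem (add_mem (add_mem (add_mem (h 2)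
        (mul_mem (ha _) (h 1))) (mul_mem (ha _) (h 0))) (mul_mem (mul_mem (ha _) hr) (h 0)))
        (mul_mem (ha _) (h 3))) (mul_mem (mul_mem (ha _) hr) (h 3))))
    refine adjoin_chart W _ V (h 2) fun l => ?_
    fin_cases l
    exacts [hr, hv]

theorem curveIncl_algebraMap (r : k) :
    curveIncl W (algebraMap k _ r) = algebraMap k[X] (FractionRing (FamilyField (CurveField W))[X]) (C r) := by
  rw [← toFrac_algebraMap 1 W (0, false), Polynomial.algebraMap_apply]
  have := toFrac_chartConst 1 W (0, false) (algebraMap k _ r)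
  rw [algebraMap_coe] at this
  rw [← this]
  congr 1
  exact congrArg C (Polynomial.map_C _).symm

theorem weierstrass_equation_curveIncl :
    curveIncl W (yFun W) ^ 2 + curveIncl W (algebraMap k _ W.a₁) * curveIncl W (xFun W) *
      curveIncl W (yFun W) + curveIncl W (algebraMap k _ W.a₃) * curveIncl W (yFun W) =
    curveIncl W (xFun W) ^ 3 + curveIncl W (algebraMap k _ W.a₂) * curveIncl W (xFun W) ^ 2 +
      curveIncl W (algebraMap k _ W.a₄) * curveIncl W (xFun W) +
      curveIncl W (algebraMap k _ W.a₆) := by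
  have := congrArg (curveIncl W) (weierstrass_equation W)
  simpa only [map_add, map_mul, map_pow] using this

set_option maxHeartbeats 1000000 in
theorem toFrac_familyCoord (c : Fin 2 × Bool) (j : Fin 8) :
    (familyData p W).toFrac c (familyCoord W c j) =
      familySections (curveIncl W (xFun W)) (curveIncl W (yFun W)) (fiberFun W) (paramFun W) j /
      familySections (curveIncl W (xFun W)) (curveIncl W (yFun W)) (fiberFun W) (paramFun W)
        (familyDenominator c) := by
  have hx : curveIncl W (xFun W) ≠ 0 := (_root_.map_ne_zero _).2 (xFun_ne_zero W)
  have hy : curveIncl W (yFun W) ≠ 0 := (_root_.map_ne_zero _).2 (yFun_ne_zero W)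
  have hX (c) : (familyData p W).toFrac c X = (familyData p W).fracCoord c := by
    rw [AtiyahData.toFrac, coe_eval₂RingHom, eval₂_X]
  have hX0 (c) : (familyData p W).fracCoord c ≠ 0 := by
    rw [← hX]
    exact (map_ne_zero_iff _ ((familyData p W).toFrac_injective c)).2 X_ne_zero
  have hz := hX0 (0, false)
  have hz1 := hX0 (1, false)
  rw [(fracCoord_zero p W).1] at hz
  rw [(fracCoord_one p W).1] at hz1
  have hT (c) := toFrac_algebraMap p W c X
  have hW := weierstrass_equation_curveIncl W
  change ∀ c, _ = paramFun W at hT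
  obtain ⟨i, e⟩ := c
  have hr : curveIncl W (rFun W) = (curveIncl W (xFun W))⁻¹ := map_inv₀ _ _
  have hv : curveIncl W (vFun W) = curveIncl W (yFun W) / curveIncl W (xFun W) ^ 2 := by
    rw [vFun, map_div₀, map_pow]
  have hc0 (e l) : (familyData p W).toFrac (0, e) (chartConst W (0, e) (coord W 0 l)) =
    curveIncl W (coordFun W 0 l) := toFrac_chartConst p W (0, e) _
  have hc1 (e l) : (familyData p W).toFrac (1, e) (chartConst W (1, e) (coord W 1 l)) =
    curveIncl W (coordFun W 1 l) := toFrac_chartConst p W (1, e) _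
  have hca (e u) : (familyData p W).toFrac (1, e) (chartConst W (1, e) (algebraMap k _ u)) =
    curveIncl W (algebraMap k _ u) := toFrac_chartConst p W (1, e) _
  have c00 : coordFun W 0 0 = xFun W := rfl
  have c01 : coordFun W 0 1 = yFun W := rfl
  have c10 : coordFun W 1 0 = rFun W := rfl
  have c11 : coordFun W 1 1 = vFun W := rfl
  have f0 := (fracCoord_zero p W).1
  have f0' := (fracCoord_zero p W).2
  have f1 := (fracCoord_one p W).1
  have f1' := (fracCoord_one p W).2
  generalize hxe : curveIncl W (xFun W) = x at *
  generalize hye : curveIncl W (yFun W) = y at *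
  generalize fiberFun W = z at *
  generalize paramFun W = T at *
  have hz1' : x * z - T * y ≠ 0 := by
    intro h
    apply hz1
    field_simp
    linear_combination h
  have hz2 : z * x - T * y ≠ 0 := by rwa [mul_comm z]
  have hz3 : z * x - y * T ≠ 0 := by rwa [mul_comm y]
  have hz4 : x * z - y * T ≠ 0 := by rwa [mul_comm y]
  fin_cases i <;> cases e <;> fin_cases j <;>
    simp only [familyCoord, familySections, familyDenominator, Fin.zero_eta, Fin.mk_one, Fin.isValue,
      Matrix.cons_val, if_true, Bool.false_eq_true, if_false, map_one, map_add, map_sub, map_mul,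
      map_pow, hc0, hc1, hca, hT, hX, c00, c01, c10, c11, hxe, hye, hr, hv, f0, f0', f1, f1', Fin.reduceFinMk] <;>
    (try field_simp) <;> first | done | ring1 | linear_combination (-T) * hW

attribute [local instance] MvPolynomial.gradedAlgebra in
theorem exists_family : ∃ (S : Scheme.{u}) (g : S ⟶ AffineLine k)
    (A : Atlas S (FractionRing (FamilyField (CurveField W))[X])
      (fun c : Fin 2 × Bool => (FamilyRing (chartRing W c.1))[X]) (familyData p W).toFrac),
    S.IsSeparated ∧ IsProjective g ∧ ∀ c, A.chart c ≫ g =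
      specMap (algebraMap k[X] (FamilyRing (chartRing W c.1))[X]) := by
  have hx : curveIncl W (xFun W) ≠ 0 := (_root_.map_ne_zero _).2 (xFun_ne_zero W)
  have hy : curveIncl W (yFun W) ≠ 0 := (_root_.map_ne_zero _).2 (yFun_ne_zero W)
  have hX0 (c) : (familyData p W).fracCoord c ≠ 0 := by
    have hX : (familyData p W).toFrac c X = (familyData p W).fracCoord c := by
      rw [AtiyahData.toFrac, coe_eval₂RingHom, eval₂_X]
    rw [← hX]
    exact (map_ne_zero_iff _ ((familyData p W).toFrac_injective c)).2 X_ne_zero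
  have hz := hX0 (0, false)
  have hz1 := hX0 (1, false)
  rw [(fracCoord_zero p W).1] at hz
  rw [(fracCoord_one p W).1] at hz1
  obtain ⟨S, ι, A, hι, hA⟩ := exists_atlas_projective (R := k[X]) (n := 7)
    (s := familySections (curveIncl W (xFun W)) (curveIncl W (yFun W)) (fiberFun W) (paramFun W))
    (by
      intro i
      fin_cases i <;> simp [familySections, hx, hy, hz]
      exact hz1)
    (fun c : Fin 2 × Bool => (FamilyRing (chartRing W c.1))[X]) (familyData p W).toFrac
    (familyData p W).toFrac_injective (toFrac_algebraMap p W) familyDenominator (familyCoord W)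
    (toFrac_familyCoord p W) (adjoin_familyCoord W)
    (fun j O hR hO F _ v => by
      have hR' (a : k) : curveIncl W (algebraMap k _ a) ∈ O := by
        rw [curveIncl_algebraMap]; exact hR _
      exact familySections_cover hx hy hz hz1 (weierstrass_equation_curveIncl W) j O (hR X) (hR' _)
        (hR' _) (hR' _) (hR' _) (hR' _) hO v)
  have hs : (ProjSpace k[X] 7).IsSeparated :=
    inferInstanceAs (Scheme.IsSeparated (Proj _))
  refine ⟨S, ι ≫ ProjSpace.toSpec k[X] 7, A, ?_, ⟨7, ι, hι, rfl⟩, hA⟩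
  have : terminal.from S = ι ≫ terminal.from _ := Subsingleton.elim _ _
  exact ⟨this ▸ inferInstance⟩

end Surface


section Squares

theorem isPullback_specMap_mapRingHom {R S : Type u} [CommRing R] [CommRing S] (φ : R →+* S) :
    IsPullback (specMap (mapRingHom φ)) (specMap C)
      (specMap C) (specMap φ) := by
  let _ : Algebra R S := φ.toAlgebra
  let _ : Algebra R[X] S[X] := Polynomial.algebra R S
  have h : Algebra.IsPushout R R[X] S S[X] := inferInstance
  refine (isPullback_SpecMap_of_isPushout _ _ _ _ ?_).flip
  exact (CommRingCat.isPushout_iff_isPushout.2 h).flip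

variable {k B : Type u} [Field k] [CommRing B] [Algebra k B]

/-- The restriction of a family to a fiber. -/
def FamilyRing.eval (t : k) : FamilyRing B →+* B := evalRingHom (algebraMap k B t)

theorem FamilyRing.eval_C (t : k) (b : B) : FamilyRing.eval t (FamilyRing.C b) = b :=
  Polynomial.eval_C

theorem FamilyRing.eval_algebraMap (t : k) (r : k[X]) :
    FamilyRing.eval (B := B) t (algebraMap k[X] _ r) = algebraMap k B (r.eval t) := by
  rw [FamilyRing.algebraMap_eq]
  exact (Polynomial.eval_map_algebraMap r _).trans (Polynomial.aeval_algebraMap_apply_eq_algebraMap_eval t r)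

theorem isPullback_family (t : k) :
    IsPullback (specMap (mapRingHom (FamilyRing.eval (B := B) t)))
      (specMap (algebraMap k B[X]))
      (specMap (algebraMap k[X] (FamilyRing B)[X]))
      (AffineLine.point t) := by
  have h1 := isPullback_specMap_mapRingHom (FamilyRing.eval (B := B) t)
  have h2 : IsPullback (specMap (FamilyRing.C : B →+* FamilyRing B))
      (specMap (algebraMap k[X] (FamilyRing B)))
      (specMap (algebraMap k B)) (specMap C) :=
    (isPullback_specMap_mapRingHom (algebraMap k B)).flip
  have h3 : IsPullback (specMap (FamilyRing.eval (B := B) t))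
      (specMap (algebraMap k B))
      (specMap (algebraMap k[X] (FamilyRing B))) (AffineLine.point t) := by
    refine IsPullback.of_right (h₁₂ := specMap (FamilyRing.C : B →+* FamilyRing B))
      (h₂₂ := specMap (C : k →+* k[X]))
      (v₁₃ := specMap (algebraMap k B)) ?_ ?_ h2
    · have e1 : specMap (FamilyRing.eval (B := B) t) ≫
          specMap (FamilyRing.C : B →+* FamilyRing B) = 𝟙 _ := by
        rw [← Spec.map_comp, ← Spec.map_id, ← CommRingCat.ofHom_comp, ← CommRingCat.ofHom_id]
        exact congrArg (fun f => specMap f)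
          (RingHom.ext fun b => FamilyRing.eval_C t b)
      have e2 : AffineLine.point t ≫ specMap (C : k →+* k[X]) = 𝟙 _ := by
        rw [AffineLine.point, ← Spec.map_comp, ← Spec.map_id, ← CommRingCat.ofHom_comp,
          ← CommRingCat.ofHom_id]
        exact congrArg (fun f => specMap f)
          (RingHom.ext fun b => Polynomial.eval_C)
      rw [e1, e2]
      exact IsPullback.of_horiz_isIso ⟨by simp⟩
    · rw [AffineLine.point, ← Spec.map_comp, ← Spec.map_comp, ← CommRingCat.ofHom_comp,
        ← CommRingCat.ofHom_comp]
      exact congrArg (fun f => specMap f)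
          (RingHom.ext fun r => FamilyRing.eval_algebraMap t r)
  have h4 := h1.paste_vert h3
  rw [← Spec.map_comp, ← Spec.map_comp, ← CommRingCat.ofHom_comp, ← CommRingCat.ofHom_comp] at h4
  exact h4

/-- A family of smooth affine curves, times the affine line. -/
theorem smooth_family (h : SmoothOfRelativeDimension 1
    (specMap (algebraMap k B))) :
    SmoothOfRelativeDimension 2
      (specMap (algebraMap k[X] (FamilyRing B)[X])) := by
  have h1 : SmoothOfRelativeDimension 1
      (specMap (algebraMap k[X] (FamilyRing B))) :=
    (smoothOfRelativeDimension_isStableUnderBaseChange 1).of_isPullback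
      (isPullback_specMap_mapRingHom (algebraMap k B)).flip h
  have h2 : SmoothOfRelativeDimension 1
      (specMap (C : FamilyRing B →+* (FamilyRing B)[X])) := by
    rw [HasRingHomProperty.Spec_iff (P := @SmoothOfRelativeDimension 1)]
    have := isStandardSmooth_polynomial (FamilyRing B)
    rw [← RingHom.isStandardSmoothOfRelativeDimension_algebraMap] at this
    exact RingHom.locally_of RingHom.isStandardSmoothOfRelativeDimension_respectsIso _ this
  have h3 := smoothOfRelativeDimension_comp 1 1
    (specMap (C : FamilyRing B →+* (FamilyRing B)[X]))
    (specMap (algebraMap k[X] (FamilyRing B)))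
  rw [← Spec.map_comp, ← CommRingCat.ofHom_comp] at h3
  exact h3

end Squares

/-- The open cover given by affine charts. -/
def chartCover {X : Scheme.{u}} {I : Type} (A : I → Type u)
    [∀ c, CommRing (A c)] (j : ∀ c, Spec (.of (A c)) ⟶ X)
    [∀ c, IsOpenImmersion (j c)] (hj : ∀ x, ∃ c, x ∈ (j c).opensRange) : X.OpenCover :=
  Scheme.Cover.mkOfCovers I (fun c => Spec (.of (A c))) j
    (fun x => let ⟨c, q, h⟩ := hj x; ⟨c, q, h⟩) (fun _ => inferInstance)

theorem isLocallyNoetherian_of_charts {X : Scheme.{u}} {I : Type} (A : I → Type u)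
    [∀ c, CommRing (A c)] [∀ c, IsNoetherianRing (A c)] (j : ∀ c, Spec (.of (A c)) ⟶ X)
    [∀ c, IsOpenImmersion (j c)] (hj : ∀ x, ∃ c, x ∈ (j c).opensRange) : IsLocallyNoetherian X := by
  rw [isLocallyNoetherian_iff_openCover (chartCover A j hj)]
  have h (c : I) : IsLocallyNoetherian (Spec (.of (A c))) := inferInstance
  exact h

/-- A scheme is integral if it is covered by integral affine charts whose generic points lie in
all charts. -/
theorem isIntegral_of_charts {X : Scheme.{u}} {I : Type} (A : I → Type u)
    [∀ c, CommRing (A c)] [∀ c, IsDomain (A c)] (j : ∀ c, Spec (.of (A c)) ⟶ X)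
    [∀ c, IsOpenImmersion (j c)] (hj : ∀ x, ∃ c, x ∈ (j c).opensRange) (c₀ : I)
    (h : ∀ c, j c₀ (specBot _) ∈ (j c).opensRange) : IsIntegral X := by
  have h1 : IsReduced X := by
    have h (i : I) : IsReduced (Spec (.of (A i))) := inferInstance
    have : ∀ i, IsReduced ((chartCover A j hj).X i) := h
    exact IsReduced.of_openCover X (chartCover A j hj)
  have key (c) : j c₀ (specBot _) = j c (specBot _) := by
    obtain ⟨q, hq⟩ := h c
    have h2 : j c (specBot _) ⤳ j c₀ (specBot _) := by
      rw [← hq]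
      exact (specializes_chart_iff (j c) _ _).2 bot_le
    obtain ⟨P, hP⟩ := exists_eq_of_specializes (j c₀) ⟨_, rfl⟩ h2
    have h3 : P.asIdeal ≤ (specBot (A c₀)).asIdeal := by
      rw [← specializes_chart_iff (j c₀)]
      rw [hP]; exact h2
    have h4 : P = specBot _ := PrimeSpectrum.ext (le_bot_iff.1 h3)
    rw [← hP, h4]
  have h2 : IrreducibleSpace X := by
    rw [irreducibleSpace_def]
    have : closure {j c₀ (specBot _)} = Set.univ := by
      refine Set.eq_univ_of_forall fun x => ?_
      obtain ⟨c, q, rfl⟩ := hj x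
      rw [key c, ← specializes_iff_mem_closure]
      exact (specializes_chart_iff (j c) _ _).2 bot_le
    rw [Set.top_eq_univ, ← this]
    exact isIrreducible_singleton.closure
  exact isIntegral_of_irreducibleSpace_of_isReduced X


section Fibers

variable {p : ℕ} {k M : Type u} [Field k] [Field M] [Algebra k M]
    {B : Fin 2 → Type u} [∀ i, CommRing (B i)] [∀ i, Algebra k (B i)]
    (D : AtiyahData p k M B)

/-- The data with another value of the parameter. -/
def AtiyahData.withParam (t : k) : AtiyahData p k M B := { D with τ := t }

/-- The restriction of functions on the charts of a family to a fiber. -/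
def restrict (B : Fin 2 → Type u) [∀ i, CommRing (B i)] [∀ i, Algebra k (B i)] (t : k)
    (c : Fin 2 × Bool) : (FamilyRing (B c.1))[X] →+* (B c.1)[X] :=
  mapRingHom (FamilyRing.eval t)

theorem restrict_C_C (t : k) (c : Fin 2 × Bool) (u : B c.1) :
    restrict B t c (C (FamilyRing.C u)) = C u := by
  rw [restrict, coe_mapRingHom, map_C, FamilyRing.eval_C]

theorem restrict_X (t : k) (c : Fin 2 × Bool) : restrict B t c X = X := by
  rw [restrict, coe_mapRingHom, map_X]

theorem restrict_algebraMap (t : k) (c : Fin 2 × Bool) (r : k[X]) :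
    restrict B t c (algebraMap k[X] _ r) = C (algebraMap k (B c.1) (r.eval t)) := by
  rw [Polynomial.algebraMap_apply, restrict, coe_mapRingHom, map_C, FamilyRing.eval_algebraMap]

variable {S : Scheme.{u}} (g : S ⟶ AffineLine k)

section Charts

variable (chart : ∀ c : Fin 2 × Bool, Spec (.of (FamilyRing (B c.1))[X]) ⟶ S)
  (hch : ∀ c, chart c ≫ g = specMap (algebraMap k[X] (FamilyRing (B c.1))[X]))
  (t : k)

/-- The restriction of a chart to a fiber. -/
def fiberChart (c : Fin 2 × Bool) : Spec (.of (B c.1)[X]) ⟶ fiber g t :=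
  pullback.lift (specMap (restrict B t c) ≫ chart c)
    (specMap (algebraMap k (B c.1)[X]))
    (by rw [Category.assoc, hch]; exact (isPullback_family (B := B c.1) t).w)

theorem fiberChart_ι (c : Fin 2 × Bool) : fiberChart g chart hch t c ≫ fiberι g t =
    specMap (restrict B t c) ≫ chart c := pullback.lift_fst _ _ _

theorem fiberChart_toSpec (c : Fin 2 × Bool) : fiberChart g chart hch t c ≫ fiberToSpec g t =
    specMap (algebraMap k (B c.1)[X]) := pullback.lift_snd _ _ _

theorem isPullback_fiberChart (c : Fin 2 × Bool) :
    IsPullback (specMap (restrict B t c)) (fiberChart g chart hch t c)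
      (chart c) (fiberι g t) := by
  refine IsPullback.of_bot (v₂₁ := fiberToSpec g t) (v₂₂ := g) (h₃₁ := AffineLine.point t) ?_
    (fiberChart_ι g chart hch t c).symm (IsPullback.of_hasPullback _ _)
  rw [fiberChart_toSpec, hch]
  exact isPullback_family (B := B c.1) t

instance isOpenImmersion_fiberChart [∀ c, IsOpenImmersion (chart c)] (c : Fin 2 × Bool) :
    IsOpenImmersion (fiberChart g chart hch t c) :=
  MorphismProperty.of_isPullback (P := @IsOpenImmersion)
    (isPullback_fiberChart g chart hch t c) inferInstance

theorem mem_range_fiberChart_iff [∀ c, IsOpenImmersion (chart c)] (c : Fin 2 × Bool)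
    (x : fiber g t) : x ∈ (fiberChart g chart hch t c).opensRange ↔
      fiberι g t x ∈ (chart c).opensRange := by
  have h := (isPullback_fiberChart g chart hch t c).flip
  have e : fiberChart g chart hch t c = h.isoPullback.hom ≫ pullback.fst _ _ :=
    h.isoPullback_hom_fst.symm
  have h2 : Set.range (fiberChart g chart hch t c) =
      fiberι g t ⁻¹' Set.range (chart c) := by
    rw [← Scheme.Pullback.range_fst, e]
    ext y
    constructor
    · rintro ⟨q, rfl⟩
      exact ⟨h.isoPullback.hom q, rfl⟩
    · rintro ⟨q, rfl⟩
      refine ⟨h.isoPullback.inv q, ?_⟩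
      rw [← Scheme.Hom.comp_apply, Iso.inv_hom_id_assoc]
  exact Set.ext_iff.1 h2 x

theorem fiberChart_covers [∀ c, IsOpenImmersion (chart c)]
    (hc : ∀ x, ∃ c, x ∈ (chart c).opensRange) (x : fiber g t) :
    ∃ c, x ∈ (fiberChart g chart hch t c).opensRange :=
  (hc (fiberι g t x)).imp fun _ h => (mem_range_fiberChart_iff g chart hch t _ x).2 h

end Charts

variable {D} {g}
variable [∀ i, IsDomain (B i)] [IsIntegral S] (Q : Ruled D.family g) (t : k)
  (hB : ∀ φ : M, ∃ a b : B 0, D.θ 0 b ≠ 0 ∧ φ = D.θ 0 a / D.θ 0 b)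

/-- The charts of a fiber. -/
abbrev Ruled.fiberChart (c : Fin 2 × Bool) : Spec (.of (B c.1)[X]) ⟶ fiber g t :=
  PlurigeneraJump.fiberChart g Q.chart Q.chart_comp t c

theorem Ruled.base_C_mul {u : B 1} {a b : B 0} (h : D.θ 1 u = D.θ 0 a / D.θ 0 b)
    (hb : D.θ 0 b ≠ 0) : Q.base 1 (FamilyRing.C u) * Q.base 0 (FamilyRing.C b) =
      Q.base 0 (FamilyRing.C a) := by
  rw [eq_div_iff hb] at h
  have h1 : FamilyRing.map (D.θ 1) (FamilyRing.C u) * FamilyRing.map (D.θ 0) (FamilyRing.C b) =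
      FamilyRing.map (D.θ 0) (FamilyRing.C a) := by
    have e (i : Fin 2) (v : B i) : FamilyRing.map (D.θ i) (FamilyRing.C v) =
        FamilyRing.C (D.θ i v) := Polynomial.map_C _
    rw [e, e, e, ← map_mul, h]
  have h2 := congrArg (fun v => Q.Φ (C (algebraMap (FamilyRing M) (FamilyField M) v))) h1
  simp only [map_mul] at h2
  exact h2

theorem Ruled.z_one_eq : Q.z 1 = Q.z 0 - baseMap g X *
    (Q.base 0 (FamilyRing.C D.α) * Q.base 1 (FamilyRing.C D.β)) := by
  rw [Q.baseMap_eq]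
  simp only [Ruled.z, Ruled.base, ← map_sub, RingHom.comp_apply, ← map_mul]
  congr 1
  have h : D.family.a = D.family.θ 0 (FamilyRing.C D.α) * D.family.θ 1 (FamilyRing.C D.β) :=
    D.family.a_eq
  simp only [AtiyahData.shift, Matrix.cons_val_zero, Matrix.cons_val_one, Matrix.cons_val_fin_one,
    h, map_zero, sub_zero]
  rfl

include hB in
theorem Ruled.exists_z_one_mul : ∃ (d : (FamilyRing (B 0))[X]) (b : B 0), b ≠ 0 ∧
    Q.z 1 * toK (Q.chart (0, false)) (C (FamilyRing.C b)) = toK (Q.chart (0, false)) d ∧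
    ∃ e : B 0, restrict B t (0, false) d = C b * X - C e ∧
      (C (D.θ 0 e) : M[X]) = C (D.θ 0 b) * C ((D.withParam t).shift 1) := by
  obtain ⟨a, b, hb, h⟩ := hB (D.θ 1 D.β)
  have h1 := Q.base_C_mul h hb
  refine ⟨C (FamilyRing.C b) * X - algebraMap k[X] _ X * C (FamilyRing.C (D.α * a)), b,
    fun h0 => hb (by rw [h0, map_zero]), ?_, algebraMap k _ t * (D.α * a), ?_, ?_⟩
  · rw [map_sub, map_mul, map_mul, ← baseMap_eq_toK (Q.chart (0, false)) g
      (algebraMap k[X] _) (Q.chart_comp (0, false)), Q.z_one_eq]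
    simp only [Q.toK_fin_eq, eval₂_C, eval₂_X, map_mul, eval₂_mul]
    rw [← h1]
    ring
  · rw [map_sub, map_mul, map_mul, restrict_algebraMap, restrict_C_C, restrict_C_C, restrict_X,
      eval_X, ← C_mul]
  · rw [← C_mul]
    congr 1
    simp only [AtiyahData.shift, AtiyahData.withParam, Matrix.cons_val_one, Matrix.cons_val_fin_one,
      D.a_eq, map_mul, AlgHom.commutes]
    rw [eq_div_iff hb] at h
    rw [← h]
    ring

theorem Ruled.isUnit_of_restrict_ne_zero {a : (FamilyRing (B 0))[X]}
    (ha : restrict B t (0, false) a ≠ 0) :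
    UnitAt (fiberι g t (Q.fiberChart t (0, false) (specBot _))) (toK (Q.chart (0, false)) a) := by
  have h := congrArg (fun f => f (specBot _)) (congrArg (fun f : _ ⟶ S => (f : _ → S))
    (fiberChart_ι g Q.chart Q.chart_comp t (0, false)))
  change fiberι g t (Q.fiberChart t (0, false) (specBot _)) = Q.chart (0, false) _ at h
  rw [h, unitAt_toK_iff]
  exact ha

theorem Ruled.regularAt_fiber (a : (FamilyRing (B 0))[X]) :
    RegularAt (fiberι g t (Q.fiberChart t (0, false) (specBot _))) (toK (Q.chart (0, false)) a) :=
  regularAt_toK _ ((mem_range_fiberChart_iff g Q.chart Q.chart_comp t _ _).1 ⟨_, rfl⟩) _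

include hB in
theorem Ruled.regularAt_fiber_base (i : Fin 2) (b : FamilyRing (B i)) :
    RegularAt (fiberι g t (Q.fiberChart t (0, false) (specBot _))) (Q.base i b) := by
  set P := fiberι g t (Q.fiberChart t (0, false) (specBot _))
  have h0 (b : FamilyRing (B 0)) : RegularAt P (Q.base 0 b) := by
    have := Q.regularAt_fiber t (C b)
    rwa [Q.toK_fin_eq, eval₂_C] at this
  fin_cases i
  · exact h0 b
  have h1 (u : B 1) : RegularAt P (Q.base 1 (FamilyRing.C u)) := by
    obtain ⟨a, b, hb, h⟩ := hB (D.θ 1 u)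
    have hu : UnitAt P (toK (Q.chart (0, false)) (C (FamilyRing.C b))) := by
      refine Q.isUnit_of_restrict_ne_zero t ?_
      rw [restrict_C_C]
      intro h0
      exact hb (by rw [C_eq_zero.1 h0, map_zero])
    rw [Q.toK_fin_eq, eval₂_C] at hu
    rw [eq_div_of_mul_eq hu.ne_zero (Q.base_C_mul h hb), div_eq_mul_inv]
    exact (h0 _).mul hu.inv.regularAt
  refine Polynomial.induction_on' (motive := fun b => RegularAt P (Q.base 1 b)) b
    (fun u v hu hv => ?_) (fun n a => ?_)
  · exact (map_add (Q.base 1) u v) ▸ hu.add hv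
  · have e : (monomial n a : (B 1)[X]) = (show (B 1)[X] from FamilyRing.C a) *
        (show (B 1)[X] from algebraMap k[X] (FamilyRing (B 1)) X) ^ n := by
      rw [← C_mul_X_pow_eq_monomial, FamilyRing.algebraMap_eq, map_X]
      rfl
    have e1 : Q.base 1 (algebraMap k[X] (FamilyRing (B 1)) X) = baseMap g X := by
      rw [Q.baseMap_eq]
      exact congrArg (fun a => Q.Φ (C a)) (AlgHom.commutes (D.family.θ 1) X)
    have e2 : Q.base 1 (monomial n a : (B 1)[X]) =
        Q.base 1 (FamilyRing.C a) * (baseMap g X) ^ n := by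
      rw [← e1, ← map_pow, ← map_mul]
      exact congrArg (Q.base 1) e
    exact e2 ▸ (h1 a).mul ((regularAt_baseMap g P X).pow n)

include hB in
theorem Ruled.unitAt_fiber_z (i : Fin 2) :
    UnitAt (fiberι g t (Q.fiberChart t (0, false) (specBot _))) (Q.z i) := by
  fin_cases i
  · have := Q.isUnit_of_restrict_ne_zero t (a := X) (by rw [restrict_X]; exact X_ne_zero)
    rwa [Q.toK_fin_eq, eval₂_X] at this
  · obtain ⟨d, b, hb, h, e, hd, -⟩ := Q.exists_z_one_mul t hB
    have hu := Q.isUnit_of_restrict_ne_zero t (a := C (FamilyRing.C b)) (by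
      rw [restrict_C_C]; exact C_ne_zero.2 hb)
    have hv := Q.isUnit_of_restrict_ne_zero t (a := d) (by
      intro h0
      rw [hd] at h0
      have := congrArg (fun f => coeff f 1) h0
      simp [coeff_C] at this
      exact hb this)
    have := eq_div_of_mul_eq hu.ne_zero h
    change UnitAt _ (Q.z 1)
    rw [this, div_eq_mul_inv]
    exact hv.mul hu.inv

include hB in
theorem Ruled.mem_range_of_fiber [S.IsSeparated] (c : Fin 2 × Bool) :
    fiberι g t (Q.fiberChart t (0, false) (specBot _)) ∈ (Q.chart c).opensRange := by
  refine mem_range_of_regularAt _ _ fun a => ?_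
  have key (w : S.functionField) (hw : RegularAt
      (fiberι g t (Q.fiberChart t (0, false) (specBot _))) w) : RegularAt
      (fiberι g t (Q.fiberChart t (0, false) (specBot _))) (eval₂ (Q.base c.1) w a) := by
    induction a using Polynomial.induction_on' with
    | add u v hu hv => rw [eval₂_add]; exact hu.add hv
    | monomial n a =>
      rw [eval₂_monomial]
      exact (Q.regularAt_fiber_base t hB _ a).mul (hw.pow n)
  obtain ⟨i, e⟩ := c
  cases e
  · rw [Q.toK_fin_eq]
    exact key _ (Q.unitAt_fiber_z t hB i).regularAt
  · rw [Q.toK_inf_eq]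
    exact key _ (Q.unitAt_fiber_z t hB i).inv.regularAt

include Q hB in
theorem Ruled.isIntegral_fiber [S.IsSeparated] : IsIntegral (fiber g t) := by
  refine isIntegral_of_charts (fun c : Fin 2 × Bool => (B c.1)[X]) (Q.fiberChart t)
    (fiberChart_covers g Q.chart Q.chart_comp t Q.covers) (0, false) fun c => ?_
  exact (mem_range_fiberChart_iff g Q.chart Q.chart_comp t _ _).2 (Q.mem_range_of_fiber t hB c)

section FiberRuled

variable [IsIntegral (fiber g t)]

theorem Ruled.isPullbackFunction_fiber (c : Fin 2 × Bool) (a : (FamilyRing (B c.1))[X]) :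
    IsPullbackFunction (fiberι g t) (toK (Q.chart c) a)
      (toK (Q.fiberChart t c) (restrict B t c a)) :=
  isPullbackFunction_toK (Q.chart c) (Q.fiberChart t c) (fiberι g t) (restrict B t c)
    (fiberChart_ι g Q.chart Q.chart_comp t c) a

theorem Ruled.toK_fiber_mul {c c' c'' : Fin 2 × Bool} {a : (FamilyRing (B c.1))[X]}
    {a' : (FamilyRing (B c'.1))[X]} {a'' : (FamilyRing (B c''.1))[X]}
    (h : toK (Q.chart c) a * toK (Q.chart c') a' = toK (Q.chart c'') a'') :
    toK (Q.fiberChart t c) (restrict B t c a) * toK (Q.fiberChart t c') (restrict B t c' a') =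
      toK (Q.fiberChart t c'') (restrict B t c'' a'') := by
  have h1 := (Q.isPullbackFunction_fiber t c a).mul (Q.isPullbackFunction_fiber t c' a')
  rw [h] at h1
  exact h1.unique (Q.isPullbackFunction_fiber t c'' a'')

end FiberRuled

end Fibers


theorem exists_div_polynomial {A M : Type u} [CommRing A] [IsDomain A] [Field M] {θ : A →+* M}
    (hθ : Function.Injective θ) (hA : ∀ φ : M, ∃ a b : A, θ b ≠ 0 ∧ φ = θ a / θ b)
    {F : Type u} [Field F] [Algebra M[X] F] [IsFractionRing M[X] F] (Ψ : F) :
    ∃ a b : A[X], algebraMap M[X] F (b.map θ) ≠ 0 ∧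
      Ψ = algebraMap M[X] F (a.map θ) / algebraMap M[X] F (b.map θ) := by
  let _ : Algebra A M := θ.toAlgebra
  have : FaithfulSMul A M := (faithfulSMul_iff_algebraMap_injective _ _).2 hθ
  have : IsFractionRing A M := IsFractionRing.of_field _ _ fun φ =>
    let ⟨a, b, _, h⟩ := hA φ
    ⟨a, b, h⟩
  have key (f : M[X]) : ∃ (a : A[X]) (b : A), b ≠ 0 ∧ a.map θ = C (θ b) * f := by
    obtain ⟨b, hb0, hb⟩ := IsLocalization.integerNormalization_spec (nonZeroDivisors A) f
    refine ⟨_, b, nonZeroDivisors.ne_zero hb0, hb.trans ?_⟩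
    rw [← Polynomial.smul_eq_C_mul, Algebra.smul_def, Algebra.smul_def, Polynomial.algebraMap_apply,
      Polynomial.algebraMap_apply]
    rfl
  obtain ⟨f, g, hg, rfl⟩ := IsFractionRing.div_surjective (A := M[X]) Ψ
  obtain ⟨a, b, hb, h⟩ := key f
  obtain ⟨a', b', hb', h'⟩ := key g
  have hg0 : algebraMap M[X] F g ≠ 0 := IsFractionRing.to_map_ne_zero_of_mem_nonZeroDivisors hg
  have hC (c : A) (hc : c ≠ 0) : algebraMap M[X] F (C (θ c)) ≠ 0 := by
    rw [map_ne_zero_iff _ (IsFractionRing.injective M[X] F), C_ne_zero, map_ne_zero_iff _ hθ]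
    exact hc
  refine ⟨a * C b', a' * C b, ?_, ?_⟩
  · rw [Polynomial.map_mul, h', map_C, map_mul, map_mul]
    exact mul_ne_zero (mul_ne_zero (hC _ hb') hg0) (hC _ hb)
  · have h1 := hC _ hb
    have h2 := hC _ hb'
    rw [Polynomial.map_mul, Polynomial.map_mul, h, h', map_C, map_C]
    simp only [map_mul]
    field_simp

namespace AtiyahData

variable {p : ℕ} {R M : Type u} [CommRing R] [Field M] [Algebra R M]
    {B : Fin 2 → Type u} [∀ i, CommRing (B i)] [∀ i, Algebra R (B i)] (D : AtiyahData p R M B)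

theorem toFrac_zero (g : (B 0)[X]) : D.toFrac (0, false) g =
    algebraMap M[X] _ (g.map (D.θ 0 : B 0 →+* M)) := by
  have : D.toFrac (0, false) = (algebraMap M[X] _).comp (mapRingHom (D.θ 0 : B 0 →+* M)) := by
    refine Polynomial.ringHom_ext (fun b => ?_) ?_
    · rw [toFrac, coe_eval₂RingHom, eval₂_C, RingHom.comp_apply, RingHom.comp_apply,
        coe_mapRingHom, map_C]
      rfl
    · rw [toFrac, coe_eval₂RingHom, eval₂_X, RingHom.comp_apply, coe_mapRingHom, map_X]
      simp [fracCoord, shift]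
  rw [this]
  rfl

theorem exists_div_toFrac [∀ i, IsDomain (B i)]
    (hB : ∀ φ : M, ∃ a b : B 0, D.θ 0 b ≠ 0 ∧ φ = D.θ 0 a / D.θ 0 b) (Ψ : FractionRing M[X]) :
    ∃ a b, D.toFrac (0, false) b ≠ 0 ∧ Ψ = D.toFrac (0, false) a / D.toFrac (0, false) b := by
  obtain ⟨a, b, hb, h⟩ := exists_div_polynomial (θ := (D.θ 0 : B 0 →+* M)) (D.inj 0) hB Ψ
  exact ⟨a, b, by rwa [toFrac_zero], by rw [toFrac_zero, toFrac_zero]; exact h⟩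

end AtiyahData

section Fibers

variable {p : ℕ} {k M : Type u} [Field k] [Field M] [Algebra k M]
    {B : Fin 2 → Type u} [∀ i, CommRing (B i)] [∀ i, Algebra k (B i)]
    {D : AtiyahData p k M B}

theorem AtiyahData.exists_div_family [∀ i, IsDomain (B i)]
    (hB : ∀ φ : M, ∃ a b : B 0, D.θ 0 b ≠ 0 ∧ φ = D.θ 0 a / D.θ 0 b) (φ : FamilyField M) :
    ∃ a b : FamilyRing (B 0), D.family.θ 0 b ≠ 0 ∧ φ = D.family.θ 0 a / D.family.θ 0 b := by
  have : IsFractionRing M[X] (FractionRing M[X]) := inferInstance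
  obtain ⟨a, b, hb, h⟩ := exists_div_polynomial (θ := (D.θ 0 : B 0 →+* M)) (D.inj 0) hB
    (F := FractionRing M[X]) φ
  exact ⟨a, b, hb, h⟩

variable [∀ i, IsDomain (B i)] {S : Scheme.{u}} {g : S ⟶ AffineLine k}
  [IsIntegral S] (Q : Ruled D.family g) (t : k) [IsIntegral (fiber g t)]
  (hB : ∀ φ : M, ∃ a b : B 0, D.θ 0 b ≠ 0 ∧ φ = D.θ 0 a / D.θ 0 b)

include hB in
theorem Ruled.exists_fieldHom_fiber : ∃ ρ : FractionRing M[X] →+* (fiber g t).functionField,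
    ∀ c a, ρ ((D.withParam t).toFrac c a) = toK (Q.fiberChart t c) a := by
  obtain ⟨ρ, hρ⟩ := exists_ringHom_comp_eq ((D.withParam t).toFrac_injective (0, false))
    ((D.withParam t).exists_div_toFrac hB) (toK_injective (Q.fiberChart t (0, false)))
  refine ⟨ρ, ?_⟩
  have h0 (a) : ρ ((D.withParam t).toFrac (0, false) a) = toK (Q.fiberChart t (0, false)) a :=
    congrArg (fun f => f a) hρ
  have hCC (c : Fin 2 × Bool) (u : B c.1) : (D.withParam t).toFrac c (C u) =
      algebraMap M[X] _ (C (D.θ c.1 u)) := by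
    rw [AtiyahData.toFrac, coe_eval₂RingHom, eval₂_C]; rfl
  have hX (c : Fin 2 × Bool) : (D.withParam t).toFrac c X = (D.withParam t).fracCoord c := by
    rw [AtiyahData.toFrac, coe_eval₂RingHom, eval₂_X]
  have hchC (c : Fin 2 × Bool) (u : FamilyRing (B c.1)) :
      toK (Q.chart c) (C u) = Q.base c.1 u := by
    obtain ⟨i, e⟩ := c
    cases e
    · rw [Q.toK_fin_eq, eval₂_C]
    · rw [Q.toK_inf_eq, eval₂_C]
  have hne (b : B 0) (hb : b ≠ 0) : toK (Q.fiberChart t (0, false)) (C b) ≠ 0 :=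
    toK_ne_zero _ (C_ne_zero.2 hb)
  have hC (c : Fin 2 × Bool) (u : B c.1) : ρ ((D.withParam t).toFrac c (C u)) =
      toK (Q.fiberChart t c) (C u) := by
    obtain ⟨i, e⟩ := c
    fin_cases i
    · have h1 := Q.toK_fiber_mul t (c := (0, e)) (c' := (0, false)) (c'' := (0, false))
        (a := C (FamilyRing.C u)) (a' := 1) (a'' := C (FamilyRing.C u)) (by
          rw [map_one, mul_one, hchC, hchC])
      rw [map_one, map_one, mul_one, restrict_C_C, restrict_C_C] at h1
      refine Eq.trans ?_ h1.symm
      rw [← h0, hCC]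
      exact congrArg ρ (hCC (0, false) u).symm
    · obtain ⟨a, b, hb, h⟩ := hB (D.θ 1 u)
      have hb0 : b ≠ 0 := fun h0 => hb (by rw [h0, map_zero])
      have h1 := Q.toK_fiber_mul t (c := (1, e)) (c' := (0, false)) (c'' := (0, false))
        (a := C (FamilyRing.C u)) (a' := C (FamilyRing.C b)) (a'' := C (FamilyRing.C a)) (by
          rw [hchC, hchC, hchC]
          exact Q.base_C_mul h hb)
      rw [restrict_C_C, restrict_C_C, restrict_C_C] at h1
      refine mul_right_cancel₀ (hne b hb0) (Eq.trans ?_ h1.symm)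
      rw [← h0, ← h0, ← map_mul, hCC, hCC]
      refine congrArg ρ (Eq.trans ?_ (hCC (0, false) a).symm)
      rw [← map_mul, ← C_mul]
      refine congrArg (fun m => algebraMap M[X] _ (C m)) ?_
      change D.θ 1 u * D.θ 0 b = D.θ 0 a
      rw [h, div_mul_cancel₀ _ hb]
  have hfin (i : Fin 2) : ρ ((D.withParam t).toFrac (i, false) X) =
      toK (Q.fiberChart t (i, false)) X := by
    fin_cases i
    · exact h0 X
    · obtain ⟨d, b, hb, h, e, hd, he⟩ := Q.exists_z_one_mul t hB
      have h1 := Q.toK_fiber_mul t (c := (1, false)) (c' := (0, false)) (c'' := (0, false))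
        (a := X) (a' := C (FamilyRing.C b)) (a'' := d) (by
          rw [Q.toK_fin_eq, eval₂_X]
          exact h)
      rw [restrict_X, restrict_C_C, hd] at h1
      refine mul_right_cancel₀ (hne b hb) (Eq.trans ?_ h1.symm)
      rw [← h0, ← h0, ← map_mul, hX, hCC, (D.withParam t).toFrac_zero]
      refine congrArg ρ ?_
      simp only [AtiyahData.fracCoord, Bool.false_eq_true, if_false]
      rw [← map_mul]
      congr 1
      rw [Polynomial.map_sub, Polynomial.map_mul, map_C, map_X, map_C]
      change _ = C (D.θ 0 b) * X - C (D.θ 0 e)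
      rw [he]
      change (X - C ((D.withParam t).shift 1)) * C (D.θ 0 b) = _
      ring
  have hinf (i : Fin 2) : ρ ((D.withParam t).toFrac (i, true) X) =
      toK (Q.fiberChart t (i, true)) X := by
    have h1 := Q.toK_fiber_mul t (c := (i, true)) (c' := (i, false)) (c'' := (0, false))
        (a := X) (a' := X) (a'' := 1) (by
          rw [Q.toK_fin_eq, eval₂_X, Q.toK_inf_eq, eval₂_X, map_one,
            inv_mul_cancel₀ (Q.z_ne_zero i)])
    rw [map_one, map_one, restrict_X, restrict_X, ← hfin] at h1
    rw [eq_inv_of_mul_eq_one_left h1, ← map_inv₀, hX, hX]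
    simp [AtiyahData.fracCoord]
  intro c
  have : ρ.comp ((D.withParam t).toFrac c) = toK (Q.fiberChart t c) := by
    refine Polynomial.ringHom_ext (hC c) ?_
    obtain ⟨i, e⟩ := c
    cases e
    · exact hfin i
    · exact hinf i
  exact fun a => congrArg (fun f => f a) this

include hB in
theorem Ruled.exists_ruled_fiber : ∃ Qt : Ruled (D.withParam t) (fiberToSpec g t),
    Qt.chart = Q.fiberChart t := by
  obtain ⟨ρ, hρ⟩ := Q.exists_fieldHom_fiber t hB
  exact ⟨(D.withParam t).ruledOfCharts (Q.fiberChart t) inferInstance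
    (fiberChart_covers g Q.chart Q.chart_comp t Q.covers)
    (fiberChart_toSpec g Q.chart Q.chart_comp t) ρ hρ, rfl⟩

end Fibers


section LinearAlgebra

variable {K V : Type*} [Field K] [AddCommGroup V] [Module K V] {n : ℕ}

theorem ιMulti_sum_smul (v : Fin n → V) (M : Matrix (Fin n) (Fin n) K) :
    exteriorPower.ιMulti K n (fun i => ∑ j, M i j • v j) = M.det • exteriorPower.ιMulti K n v := by
  have h := (exteriorPower.ιMulti K n (M := V)).toMultilinearMap.map_sum (fun i j => M i j • v j)
  refine h.trans ?_
  simp only [MultilinearMap.map_smul_univ, AlternatingMap.coe_multilinearMap]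
  rw [← Matrix.det_transpose, Matrix.det_apply, Finset.sum_smul]
  have hz : ∀ r ∈ (Finset.univ : Finset (Fin n → Fin n)), r ∉ Finset.univ.image
      (fun σ : Equiv.Perm (Fin n) => (σ : Fin n → Fin n)) →
      (∏ i, M i (r i)) • exteriorPower.ιMulti K n (fun i => v (r i)) = 0 := by
    intro r _ hr
    have hi : ¬ Function.Injective r := fun hi => hr (Finset.mem_image.2
      ⟨Equiv.ofBijective r (Finite.injective_iff_bijective.1 hi), Finset.mem_univ _, rfl⟩)
    rw [Function.Injective] at hi
    push Not at hi
    obtain ⟨i, j, hij, hne⟩ := hi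
    rw [AlternatingMap.map_eq_zero_of_eq _ _ (by rw [hij]) hne, smul_zero]
  rw [← Finset.sum_subset (Finset.subset_univ _) hz, Finset.sum_image
    (fun σ _ τ _ h => Equiv.coe_fn_injective h)]
  refine Finset.sum_congr rfl fun σ _ => ?_
  have := (exteriorPower.ιMulti K n (M := V)).map_perm v σ
  change (∏ i, M i (σ i)) • exteriorPower.ιMulti K n (v ∘ σ) = _
  rw [this, smul_comm, smul_assoc]
  rfl

theorem ιMulti_ne_zero (v : Fin n → V) (h : ⊤ ≤ Submodule.span K (Set.range v))
    (hn : Module.finrank K V = n) : exteriorPower.ιMulti K n v ≠ 0 := by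
  let e := basisOfTopLeSpanOfCardEqFinrank v h (by rw [Fintype.card_fin, hn])
  intro h0
  have h1 := congrArg (exteriorPower.alternatingMapLinearEquiv e.det) h0
  rw [exteriorPower.alternatingMapLinearEquiv_apply_ιMulti, map_zero] at h1
  have h2 : (e : Fin n → V) = v := coe_basisOfTopLeSpanOfCardEqFinrank _ _ _
  rw [← h2, e.det_self] at h1
  exact one_ne_zero h1

end LinearAlgebra

theorem finrank_kaehlerDifferential_of_isFractionRing {k S K : Type*} [CommRing k] [CommRing S]
    [IsDomain S] [Field K] [Algebra k S] [Algebra S K] [Algebra k K] [IsScalarTower k S K]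
    [IsFractionRing S K] (n : ℕ) [h : Algebra.IsStandardSmoothOfRelativeDimension n k S] :
    Module.finrank K Ω[K⁄k] = n := by
  have i6 : Algebra.FormallyEtale S K := Algebra.FormallyEtale.of_isLocalization (nonZeroDivisors S)
  have i7 : Module.Free S Ω[S⁄k] :=
    have := h.isStandardSmooth
    inferInstance
  have hr : Module.rank S Ω[S⁄k] = n :=
    Algebra.IsStandardSmoothOfRelativeDimension.rank_kaehlerDifferential n
  rw [← (KaehlerDifferential.tensorKaehlerEquivOfFormallyEtale k S K).finrank_eq,
    Module.finrank_baseChange, Module.finrank, hr, Cardinal.toNat_natCast]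

/-- The rank of the module of differentials of the function field of a smooth scheme. -/
theorem finrank_kaehlerDifferential {k : Type u} [Field k] {X : Scheme.{u}} [IsIntegral X]
    (f : X ⟶ Spec (.of k)) (n : ℕ) [h : SmoothOfRelativeDimension n f] :
    Module.finrank (FunctionField f) Ω[FunctionField f⁄k] = n := by
  obtain ⟨U, hU, V, hV, hx, e, h1⟩ := h.exists_isStandardSmoothOfRelativeDimension (genericPoint X)
  have hUtop : U = ⊤ := by
    refine top_le_iff.1 fun y _ => ?_
    have : y = f (genericPoint X) := Subsingleton.elim _ _
    exact this ▸ e hx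
  subst hUtop
  have : Nonempty V := ⟨⟨_, hx⟩⟩
  have hα : RingHom.IsStandardSmoothOfRelativeDimension 0 (Scheme.ΓSpecIso (.of k)).inv.hom :=
    RingHom.IsStandardSmoothOfRelativeDimension.equiv
      (Scheme.ΓSpecIso (.of k)).symm.commRingCatIsoToRingEquiv
  have h2 := h1.comp hα
  have h3 := functionField_isFractionRing_of_isAffineOpen X V hV
  let γ : Γ(X, V) →+* FunctionField f := (X.presheaf.germ V (genericPoint X) hx).hom
  have h5 (r : k) : algebraMap k (FunctionField f) r =
      γ (((f.appLE ⊤ V e).hom.comp (Scheme.ΓSpecIso (.of k)).inv.hom) r) := by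
    change baseMap f r = X.presheaf.germ V (genericPoint X) hx _
    rw [baseMap, Scheme.Hom.appLE]
    simp only [CommRingCat.hom_comp, RingHom.comp_apply]
    exact (X.presheaf.germ_res_apply' _ _ _ _).symm
  exact @finrank_kaehlerDifferential_of_isFractionRing k Γ(X, V) (FunctionField f) _ _ _ _
    ((f.appLE ⊤ V e).hom.comp (Scheme.ΓSpecIso (.of k)).inv.hom).toAlgebra γ.toAlgebra _
    (@IsScalarTower.of_algebraMap_eq _ _ _ _ _ _ (_) (_) _ h5) h3 n h2

section LocalCoordinates

variable {k : Type u} [Field k] {X : Scheme.{u}} [IsIntegral X] (f : X ⟶ Spec (.of k)) {n : ℕ}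

local notation "KX" => FunctionField f

local notation "Reg" => RegularAt (X := X)

local notation "IsU" => UnitAt (X := X)

local notation "𝖣" => KaehlerDifferential.D k KX

/-- The functions `a` are local coordinates at `y`. -/
def IsLocalCoordinates (a : Fin n → KX) (y : X) : Prop :=
  (∀ i, Reg y (a i)) ∧ wedge f n a ≠ 0 ∧
    (∀ b : Fin n → KX, (∀ i, Reg y (b i)) →
      ∃ r : KX, Reg y r ∧ wedge f n b = r • wedge f n a)

/-- The functions at `y` whose differentials are combinations of the `d aⱼ` with regular
coefficients. -/
def differentialSubalgebra (a : Fin n → KX) (y : X) :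
    Subalgebra k KX where
  carrier := {b | Reg y b ∧ ∃ r : Fin n → KX,
    (∀ j, Reg y (r j)) ∧
      𝖣 b =
        ∑ j, r j • 𝖣 (a j)}
  mul_mem' := by
    rintro b b' ⟨hb, r, hr, h⟩ ⟨hb', r', hr', h'⟩
    refine ⟨hb.mul hb', fun j => b * r' j + b' * r j,
      fun j => (hb.mul (hr' j)).add (hb'.mul (hr j)), ?_⟩
    rw [Derivation.leibniz, h, h', Finset.smul_sum, Finset.smul_sum, ← Finset.sum_add_distrib]
    simp only [add_smul, mul_smul]
  add_mem' := by
    rintro b b' ⟨hb, r, hr, h⟩ ⟨hb', r', hr', h'⟩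
    refine ⟨hb.add hb', fun j => r j + r' j, fun j => (hr j).add (hr' j), ?_⟩
    rw [map_add, h, h', ← Finset.sum_add_distrib]
    simp only [add_smul]
  algebraMap_mem' r := ⟨regularAt_baseMap f y r, 0, fun _ => RegularAt.zero y, by simp⟩

variable {f}

theorem differentialSubalgebra_div {a : Fin n → KX} {y : X} {u v : KX}
    (hu : u ∈ differentialSubalgebra f a y) (hv : v ∈ differentialSubalgebra f a y)
    (h : IsU y v) : u / v ∈ differentialSubalgebra f a y := by
  have hv0 : v ≠ 0 := h.ne_zero
  suffices hi : v⁻¹ ∈ differentialSubalgebra f a y by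
    rw [div_eq_mul_inv]; exact mul_mem hu hi
  obtain ⟨-, r, hr, h'⟩ := hv
  have hi : Reg y v⁻¹ := h.inv.regularAt
  refine ⟨hi, fun j => -(v⁻¹ * v⁻¹) * r j, fun j => ?_, ?_⟩
  · exact ((hi.mul hi).neg).mul (hr j)
  · rw [Derivation.leibniz_inv, h', Finset.smul_sum]
    simp only [smul_smul, pow_two]

theorem isLocalCoordinates_of_generate {a : Fin n → KX} {y : X}
    (hn : Module.finrank KX Ω[KX⁄k] = n)
    (ha : ∀ i, Reg y (a i))
    (h : ∀ b, Reg y b → b ∈ differentialSubalgebra f a y) :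
    IsLocalCoordinates f a y := by
  have hgen (b : Fin n → KX) (hb : ∀ i, Reg y (b i)) :
      ∃ r : KX, Reg y r ∧ wedge f n b = r • wedge f n a := by
    choose r hr h' using fun i => (h (b i) (hb i)).2
    choose s hs using hr
    let M : Matrix (Fin n) (Fin n) (X.presheaf.stalk y) := Matrix.of s
    refine ⟨(Matrix.of r).det, ⟨M.det, ?_⟩, ?_⟩
    · refine (RingHom.map_det _ _).trans ?_
      congr 1
      ext i j
      exact hs i j
    · rw [wedge, wedge, ← ιMulti_sum_smul]
      congr 1
      funext i
      exact h' i
  refine ⟨ha, ιMulti_ne_zero _ ?_ hn, hgen⟩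
  rw [← KaehlerDifferential.span_range_derivation, Submodule.span_le]
  have key (b : KX) (hb : Reg y b) :
      𝖣 b ∈ Submodule.span KX
        (Set.range fun i => 𝖣 (a i)) := by
    obtain ⟨-, r, -, h'⟩ := h b hb
    rw [h']
    exact Submodule.sum_mem _ fun j _ => Submodule.smul_mem _ _ (Submodule.subset_span ⟨j, rfl⟩)
  rintro _ ⟨φ, rfl⟩
  obtain ⟨c, d, hd, hφ⟩ := IsFractionRing.div_surjective (A := X.presheaf.stalk y)
    (show X.functionField from φ)
  let c' : KX := algebraMap (X.presheaf.stalk y) X.functionField c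
  let d' : KX := algebraMap (X.presheaf.stalk y) X.functionField d
  have hφ' : φ = c' / d' := hφ.symm
  rw [hφ', SetLike.mem_coe, div_eq_mul_inv, Derivation.leibniz, Derivation.leibniz_inv]
  exact add_mem (Submodule.smul_mem _ _ (Submodule.smul_mem _ _ (key d' ⟨d, rfl⟩)))
    (Submodule.smul_mem _ _ (key c' ⟨c, rfl⟩))

end LocalCoordinates


section InvariantForm

variable {k : Type u} [Field k] (W : WeierstrassCurve k)

/-- The partial derivatives of the equation of a chart. -/
def chartPartial (i l : Fin 2) : chartRing W i := chartMap W i (MvPolynomial.pderiv l (chartEqn W i))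

/-- The quotients of the differentials of the coordinates by the invariant differential. -/
def chartSlope (i : Fin 2) : Fin 2 → chartRing W i :=
  if i = 0 then ![chartPartial W i 1, -chartPartial W i 0]
  else ![-chartPartial W i 1, chartPartial W i 0]

theorem chartPartial_zero_zero : (chartPartial W 0 0 : CurveField W) =
    algebraMap k _ W.a₁ * yFun W - (3 * xFun W ^ 2 + 2 * algebraMap k _ W.a₂ * xFun W +
      algebraMap k _ W.a₄) := by
  change chartEval W 0 _ = _
  simp [chartEqn, chartEval, MvPolynomial.pderiv_X, coordFun]
  ring

theorem chartPartial_zero_one : (chartPartial W 0 1 : CurveField W) =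
    2 * yFun W + algebraMap k _ W.a₁ * xFun W + algebraMap k _ W.a₃ := by
  change chartEval W 0 _ = _
  simp [chartEqn, chartEval, MvPolynomial.pderiv_X, coordFun]

theorem chartPartial_one_zero : (chartPartial W 1 0 : CurveField W) =
    algebraMap k _ W.a₁ * vFun W + 2 * algebraMap k _ W.a₃ * rFun W * vFun W -
      (1 + 2 * algebraMap k _ W.a₂ * rFun W + 3 * algebraMap k _ W.a₄ * rFun W ^ 2 +
        4 * algebraMap k _ W.a₆ * rFun W ^ 3) := by
  change chartEval W 1 _ = _
  simp [chartEqn, chartEval, MvPolynomial.pderiv_X, coordFun]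
  ring

theorem chartPartial_one_one : (chartPartial W 1 1 : CurveField W) =
    2 * vFun W + algebraMap k _ W.a₁ * rFun W + algebraMap k _ W.a₃ * rFun W ^ 2 := by
  change chartEval W 1 _ = _
  simp [chartEqn, chartEval, MvPolynomial.pderiv_X, coordFun]

theorem span_chartPartial [IsAlgClosed k] [W.IsElliptic] (i : Fin 2) :
    ∃ u v, u * chartPartial W i 0 + v * chartPartial W i 1 = 1 := by
  have h := span_pderiv_eq_top (chartMap_surjective W i) (ker_chartMap W i) (nonsingular_chartEqn W i)
  have h1 : Set.range (fun l => chartMap W i (MvPolynomial.pderiv l (chartEqn W i))) =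
      {chartPartial W i 0, chartPartial W i 1} := by
    ext a
    simp [chartPartial, Fin.exists_fin_two, eq_comm]
  rw [h1, Ideal.eq_top_iff_one, Ideal.mem_span_pair] at h
  exact h

theorem span_chartSlope [IsAlgClosed k] [W.IsElliptic] (i : Fin 2) :
    ∃ u v, u * chartSlope W i 0 + v * chartSlope W i 1 = 1 := by
  obtain ⟨u, v, h⟩ := span_chartPartial W i
  by_cases hi : i = 0
  · refine ⟨v, -u, ?_⟩
    simp only [chartSlope, if_pos hi, Matrix.cons_val_zero, Matrix.cons_val_one]
    linear_combination h
  · refine ⟨-v, u, ?_⟩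
    simp only [chartSlope, if_neg hi, Matrix.cons_val_zero, Matrix.cons_val_one]
    linear_combination h

variable {W} {K V : Type*} [Field K] [Algebra k K] [AddCommGroup V] [Module K V] [Module k V]

theorem derivation_aeval {σ : Type*} [Fintype σ] (D : Derivation k K V) (x : σ → K)
    (F : MvPolynomial σ k) : D (MvPolynomial.aeval x F) =
      ∑ l, MvPolynomial.aeval x (MvPolynomial.pderiv l F) • D (x l) := by
  classical
  induction F using MvPolynomial.induction_on with
  | C a => simp
  | add f g hf hg => simp only [map_add, hf, hg, add_smul, Finset.sum_add_distrib]
  | mul_X f i hf =>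
    simp only [map_mul, Derivation.leibniz, hf, MvPolynomial.aeval_X, map_add, smul_eq_mul,
      add_smul, Finset.sum_add_distrib, mul_smul, Finset.smul_sum, MvPolynomial.pderiv_X]
    congr 1
    rw [Finset.sum_eq_single i]
    · simp
    · intro j _ hj
      simp [hj.symm]
    · simp

/-- The invariant differential of an elliptic curve. -/
theorem exists_invariantForm [IsAlgClosed k] [W.IsElliptic] (ψ : CurveField W →ₐ[k] K)
    (D : Derivation k K V) :
    ∃ ω : V, ∀ i l, D (ψ (coordFun W i l)) = ψ (chartSlope W i l) • ω := by
  have hx := xFun_ne_zero W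
  obtain ⟨u, v, huv⟩ := span_chartPartial W 0
  have huv' : ψ u * ψ (chartPartial W 0 0) + ψ v * ψ (chartPartial W 0 1) = 1 := by
    rw [← map_mul, ← map_mul, ← map_add, ← map_one ψ]
    congr 1
    exact congrArg Subtype.val huv
  have hF : ψ (chartPartial W 0 0) • D (ψ (xFun W)) +
      ψ (chartPartial W 0 1) • D (ψ (yFun W)) = 0 := by
    have e (F : MvPolynomial (Fin 2) k) : MvPolynomial.aeval (ψ ∘ coordFun W 0) F =
        ψ (chartEval W 0 F) := (MvPolynomial.comp_aeval_apply _ ψ F).symm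
    have h := derivation_aeval D (ψ ∘ coordFun W 0) (chartEqn W 0)
    rw [e, chartEval_chartEqn, map_zero, map_zero, Fin.sum_univ_two, e, e] at h
    exact h.symm
  let ω : V := ψ v • D (ψ (xFun W)) - ψ u • D (ψ (yFun W))
  have h0 : D (ψ (xFun W)) = ψ (chartPartial W 0 1) • ω := by
    have : ψ (chartPartial W 0 1) • ω =
        (ψ u * ψ (chartPartial W 0 0) + ψ v * ψ (chartPartial W 0 1)) • D (ψ (xFun W)) -
        ψ u • (ψ (chartPartial W 0 0) • D (ψ (xFun W)) +
          ψ (chartPartial W 0 1) • D (ψ (yFun W))) := by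
      simp only [ω]
      module
    rw [this, huv', hF, smul_zero, sub_zero, one_smul]
  have h1 : D (ψ (yFun W)) = -ψ (chartPartial W 0 0) • ω := by
    have : -ψ (chartPartial W 0 0) • ω =
        (ψ u * ψ (chartPartial W 0 0) + ψ v * ψ (chartPartial W 0 1)) • D (ψ (yFun W)) -
        ψ v • (ψ (chartPartial W 0 0) • D (ψ (xFun W)) +
          ψ (chartPartial W 0 1) • D (ψ (yFun W))) := by
      simp only [ω]
      module
    rw [this, huv', hF, smul_zero, sub_zero, one_smul]
  have h2 : D (ψ (rFun W)) = -ψ (rFun W ^ 2 * chartPartial W 0 1) • ω := by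
    rw [rFun, map_inv₀, Derivation.leibniz_inv, h0, smul_smul, map_mul, map_pow, map_inv₀, neg_mul]
  have h3 : vFun W = yFun W * rFun W ^ 2 := by rw [vFun, rFun, inv_pow, div_eq_mul_inv]
  refine ⟨ω, fun i l => ?_⟩
  fin_cases i <;> fin_cases l
  · exact h0
  · refine h1.trans ?_
    simp [chartSlope]
  · refine h2.trans ?_
    simp only [chartSlope, Fin.mk_one, one_ne_zero, if_false, Fin.zero_eta, Matrix.cons_val_zero,
      NegMemClass.coe_neg, chartPartial_zero_one, chartPartial_one_one, map_neg]
    congr 3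
    rw [vFun, rFun]
    field_simp
  · change D (ψ (vFun W)) = ψ (chartPartial W 1 0) • ω
    rw [h3, map_mul, map_pow, Derivation.leibniz, h1, Derivation.leibniz_pow, h2]
    have : ψ (chartPartial W 1 0) = -(ψ (yFun W) * (2 * ψ (rFun W) *
        ψ (rFun W ^ 2 * chartPartial W 0 1))) - ψ (rFun W) ^ 2 * ψ (chartPartial W 0 0) := by
      simp only [← map_mul, ← map_pow, ← map_neg, ← map_sub, ← map_ofNat ψ 2]
      congr 1
      rw [chartPartial_zero_one, chartPartial_one_zero, chartPartial_zero_zero, vFun, rFun]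
      have hW := weierstrass_equation W
      field_simp
      linear_combination (4 : CurveField W) * hW
    rw [this]
    simp only [← Nat.cast_smul_eq_nsmul K]
    push_cast
    simp only [pow_one]
    module

/-- The quotient of the differential of a function by the invariant differential. -/
def chartDeriv (W : WeierstrassCurve k) (i : Fin 2) (F : MvPolynomial (Fin 2) k) : chartRing W i :=
  ∑ l, chartMap W i (MvPolynomial.pderiv l F) * chartSlope W i l

theorem derivation_chartMap (ψ : CurveField W →ₐ[k] K) (D : Derivation k K V) {ω : V}
    (h : ∀ i l, D (ψ (coordFun W i l)) = ψ (chartSlope W i l) • ω) (i : Fin 2)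
    (F : MvPolynomial (Fin 2) k) : D (ψ (chartMap W i F)) = ψ (chartDeriv W i F) • ω := by
  have e (F : MvPolynomial (Fin 2) k) : MvPolynomial.aeval (ψ ∘ coordFun W i) F =
      ψ (chartMap W i F) := (MvPolynomial.comp_aeval_apply _ ψ F).symm
  rw [← e, derivation_aeval, chartDeriv]
  simp only [Function.comp_apply, h, e, AddSubmonoidClass.coe_finsetSum, Subalgebra.coe_mul,
    map_sum, map_mul, Finset.sum_smul, mul_smul]

theorem derivation_chartRing (ψ : CurveField W →ₐ[k] K) (D : Derivation k K V) {ω : V}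
    (h : ∀ i l, D (ψ (coordFun W i l)) = ψ (chartSlope W i l) • ω) (i : Fin 2)
    (b : chartRing W i) : ∃ b' : chartRing W i, D (ψ b) = ψ b' • ω := by
  obtain ⟨F, rfl⟩ := chartMap_surjective W i b
  exact ⟨_, derivation_chartMap ψ D h i F⟩

theorem derivation_curveField (ψ : CurveField W →ₐ[k] K) (D : Derivation k K V) {ω : V}
    (h : ∀ i l, D (ψ (coordFun W i l)) = ψ (chartSlope W i l) • ω) (b : CurveField W) :
    ∃ b' : CurveField W, D (ψ b) = ψ b' • ω := by
  obtain ⟨u, v, hv, rfl⟩ := exists_div_chartRing W 0 b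
  obtain ⟨u', hu'⟩ := derivation_chartRing ψ D h 0 u
  obtain ⟨v', hv'⟩ := derivation_chartRing ψ D h 0 v
  refine ⟨(v : CurveField W)⁻¹ * u' - u * ((v : CurveField W)⁻¹ ^ 2 * v'), ?_⟩
  rw [div_eq_mul_inv, map_mul, Derivation.leibniz, map_inv₀, Derivation.leibniz_inv, hu', hv']
  simp only [map_sub, map_mul, map_pow, map_inv₀]
  module

end InvariantForm


section FormOfSpan

variable {K V : Type*} [Field K] [AddCommGroup V] [Module K V] {n : ℕ}

/-- The second factor of an exterior product matters only modulo the other factors. -/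
theorem ιMulti_vecCons_vecCons_eq (ω b b' : V) (T : Fin n → V) (c : K)
    (h : b - c • b' ∈ Submodule.span K (insert ω (Set.range T))) :
    exteriorPower.ιMulti K (n + 2) (Matrix.vecCons ω (Matrix.vecCons b T)) =
      c • exteriorPower.ιMulti K (n + 2) (Matrix.vecCons ω (Matrix.vecCons b' T)) := by
  let ℓ : V →ₗ[K] ⋀[K]^(n + 2) V :=
    { toFun b := ((exteriorPower.ιMulti K (n + 2) (M := V)).curryLeft ω).curryLeft b T
      map_add' := fun _ _ => by rw [map_add]; rfl
      map_smul' := fun _ _ => by rw [map_smul]; rfl }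
  have hle : Submodule.span K (insert ω (Set.range T)) ≤ LinearMap.ker ℓ := by
    rw [Submodule.span_le]
    rintro b (rfl | ⟨j, rfl⟩)
    · exact AlternatingMap.map_eq_zero_of_eq (exteriorPower.ιMulti K (n + 2))
        (Matrix.vecCons b (Matrix.vecCons b T)) (i := 0) (j := 1) rfl (by simp)
    · exact AlternatingMap.map_eq_zero_of_eq (exteriorPower.ιMulti K (n + 2))
        (Matrix.vecCons ω (Matrix.vecCons (T j) T)) (i := 1) (j := j.succ.succ) rfl
        (by rw [← Fin.succ_zero_eq_one]; exact fun e => Fin.succ_ne_zero j (Fin.succ_injective _ e).symm)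
  have h1 := hle h
  rw [LinearMap.mem_ker, map_sub, map_smul, sub_eq_zero] at h1
  exact h1

theorem ιMulti_vecCons_smul (ω : V) (v : Fin n → V) (c : K) :
    exteriorPower.ιMulti K (n + 1) (Matrix.vecCons (c • ω) v) =
      c • exteriorPower.ιMulti K (n + 1) (Matrix.vecCons ω v) :=
  AlternatingMap.map_vecCons_smul _ _ _ _

end FormOfSpan

theorem UnitAt.of_mul {X : Scheme.{u}} [IsIntegral X] {x : X} {φ ψ : X.functionField}
    (hφ : RegularAt x φ) (hψ : RegularAt x ψ) (h : UnitAt x (φ * ψ)) : UnitAt x ψ := by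
  have h0 := h.ne_zero
  refine unitAt_iff.2 ⟨right_ne_zero_of_mul h0, hψ, ?_⟩
  have e : ψ⁻¹ = φ * (φ * ψ)⁻¹ := by
    have := left_ne_zero_of_mul h0
    have := right_ne_zero_of_mul h0
    field_simp
  rw [e]
  exact hφ.mul h.inv.regularAt

theorem UnitAt.neg {X : Scheme.{u}} [IsIntegral X] {x : X} {φ : X.functionField}
    (h : UnitAt x φ) : UnitAt x (-φ) := by
  obtain ⟨a, ha, rfl⟩ := h
  exact ⟨-a, ha.neg, map_neg _ _⟩

/-- The function field of a scheme over `k` with charts like those of a ruled variety over the curve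
with Weierstrass equation `W`: the functions on the charts are generated by functions on the curve,
a fiber coordinate or its inverse, and parameters `T`. -/
structure RuledCoordinates {k : Type u} [Field k] (W : WeierstrassCurve k) {X : Scheme.{u}}
    [IsIntegral X] (f : X ⟶ Spec (.of k)) (m : ℕ) {A : Fin 2 × Bool → Type u}
    [∀ c, CommRing (A c)] [∀ c, IsDomain (A c)] (chart : ∀ c, Spec (.of (A c)) ⟶ X)
    [∀ c, IsOpenImmersion (chart c)] where
  /-- functions on the curve -/
  ψ : CurveField W →ₐ[k] FunctionField f
  /-- the fiber coordinates -/
  z : Fin 2 → FunctionField f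
  z_ne_zero : ∀ i, z i ≠ 0
  /-- the parameters -/
  T : Fin m → FunctionField f
  base_mem : ∀ c, ∀ u ∈ chartRing W c.1, ∃ a, toK (chart c) a = ψ u
  coord_mem : ∀ c, ∃ a, toK (chart c) a = if c.2 then (z c.1)⁻¹ else z c.1
  T_mem : ∀ c j, ∃ a, toK (chart c) a = T j
  generates : ∀ c a, (show FunctionField f from toK (chart c) a) ∈
    Algebra.adjoin k (ψ '' chartRing W c.1 ∪
      insert (if c.2 then (z c.1)⁻¹ else z c.1) (Set.range T))
  transition : ∃ s ∈ Algebra.adjoin k (Set.range T), ∃ u, z 0 - z 1 = s * ψ u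

namespace RuledCoordinates

variable {k : Type u} [Field k] {W : WeierstrassCurve k} {X : Scheme.{u}}
    [IsIntegral X] {f : X ⟶ Spec (.of k)} {m : ℕ} {A : Fin 2 × Bool → Type u}
    [∀ c, CommRing (A c)] [∀ c, IsDomain (A c)] {chart : ∀ c, Spec (.of (A c)) ⟶ X}
    [∀ c, IsOpenImmersion (chart c)] (G : RuledCoordinates W f m chart)

local notation "KX" => FunctionField f

local notation "Reg" => RegularAt (X := X)

local notation "IsU" => UnitAt (X := X)

local notation "𝖣" => KaehlerDifferential.D k KX

/-- The inverse of the fiber coordinate, or `1`. -/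
def zeta (c : Fin 2 × Bool) : KX := if c.2 then (G.z c.1)⁻¹ else 1

/-- The coordinate along the fibers of the ruling. -/
def fiberCoord (c : Fin 2 × Bool) : KX := if c.2 then (G.z c.1)⁻¹ else G.z c.1

/-- The form `ω ∧ d z ∧ d T`. -/
def form (ω : Ω[KX⁄k]) : ⋀[KX]^(m + 2) Ω[KX⁄k] :=
  exteriorPower.ιMulti _ (m + 2) (Matrix.vecCons ω (Matrix.vecCons (𝖣 (G.z 0))
    (fun j => 𝖣 (G.T j))))

theorem wedge_vecCons (a b : KX) (T : Fin m → KX) :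
    wedge f (m + 2) (Matrix.vecCons a (Matrix.vecCons b T)) =
      exteriorPower.ιMulti _ (m + 2) (Matrix.vecCons (𝖣 a) (Matrix.vecCons (𝖣 b)
        (fun j => 𝖣 (T j)))) := by
  rw [wedge]
  congr 1
  funext i
  refine Fin.cases rfl (fun i => Fin.cases rfl (fun _ => rfl) i) i

theorem zeta_ne_zero (c : Fin 2 × Bool) : G.zeta c ≠ 0 := by
  unfold zeta
  split_ifs
  · exact inv_ne_zero (G.z_ne_zero _)
  · exact one_ne_zero

/-- The form `ω` is the pullback of the invariant differential of the curve. -/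
def IsInvariant (ω : Ω[KX⁄k]) : Prop :=
  ∀ i l, 𝖣 (G.ψ (coordFun W i l)) = G.ψ (chartSlope W i l) • ω

variable {ω : Ω[FunctionField f⁄k]} (hω : G.IsInvariant ω)

include hω in
theorem D_z (i : Fin 2) : 𝖣 (G.z i) - 𝖣 (G.z 0) ∈
    Submodule.span KX (insert ω (Set.range fun j => 𝖣 (G.T j))) := by
  set P := Submodule.span KX (insert ω (Set.range fun j => 𝖣 (G.T j)))
  by_cases hi : i = 0
  · rw [hi, sub_self]
    exact zero_mem _
  obtain rfl : i = 1 := by omega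
  obtain ⟨s, hs, u, h⟩ := G.transition
  have hz : G.z 1 = G.z 0 - s * G.ψ u := by rw [← h]; ring
  obtain ⟨u', hu'⟩ := derivation_curveField G.ψ 𝖣 hω u
  have hs' : 𝖣 s ∈ P := by
    clear h hz hu'
    induction hs using Algebra.adjoin_induction with
    | mem x hx =>
      obtain ⟨j, rfl⟩ := hx
      exact Submodule.subset_span (Or.inr ⟨j, rfl⟩)
    | algebraMap r => rw [Derivation.map_algebraMap]; exact zero_mem _
    | add x y _ _ hx hy => rw [map_add]; exact add_mem hx hy
    | mul x y _ _ hx hy =>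
      rw [Derivation.leibniz]
      exact add_mem (Submodule.smul_mem _ _ hy) (Submodule.smul_mem _ _ hx)
  rw [hz, map_sub, sub_sub_cancel_left, Derivation.leibniz, hu']
  refine neg_mem (add_mem (Submodule.smul_mem _ _ (Submodule.smul_mem _ _
    (Submodule.subset_span (Or.inl rfl)))) (Submodule.smul_mem _ _ hs'))

include hω in
theorem wedge_eq_smul_form {a b : KX} {c d : KX} {i : Fin 2}
    (ha : 𝖣 a = c • ω) (hb : 𝖣 b - d • 𝖣 (G.z i) ∈
      Submodule.span KX (insert ω (Set.range fun j => 𝖣 (G.T j)))) :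
    wedge f (m + 2) (Matrix.vecCons a (Matrix.vecCons b G.T)) = (c * d) • G.form ω := by
  rw [wedge_vecCons, ha, ιMulti_vecCons_smul, ιMulti_vecCons_vecCons_eq ω _ (𝖣 (G.z 0)) _ d,
    smul_smul]
  · rfl
  · have := add_mem hb (Submodule.smul_mem _ d (G.D_z hω i))
    rwa [smul_sub, sub_add_sub_cancel] at this

theorem D_fiberCoord (c : Fin 2 × Bool) : 𝖣 (G.fiberCoord c) =
    ((if c.2 then -1 else 1) * G.zeta c ^ 2) • 𝖣 (G.z c.1) := by
  unfold fiberCoord zeta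
  split_ifs
  · rw [Derivation.leibniz_inv, neg_one_mul]
  · simp

/-- The coordinates near a point of the chart `c` at which the coordinate `l` is a local coordinate
of the curve. -/
def coords (c : Fin 2 × Bool) (l : Fin 2) : Fin (m + 2) → KX :=
  Matrix.vecCons (G.ψ (coordFun W c.1 l)) (Matrix.vecCons (G.fiberCoord c) G.T)

include hω in
theorem wedge_coords (c : Fin 2 × Bool) (l : Fin 2) : wedge f (m + 2) (G.coords c l) =
    (G.ψ (chartSlope W c.1 l) * ((if c.2 then -1 else 1) * G.zeta c ^ 2)) • G.form ω := by
  refine G.wedge_eq_smul_form hω (i := c.1) (hω _ _) ?_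
  rw [D_fiberCoord, sub_self]
  exact zero_mem _

theorem regularAt_base {c : Fin 2 × Bool} {y : X} (hy : y ∈ (chart c).opensRange)
    {u : CurveField W} (hu : u ∈ chartRing W c.1) : Reg y (G.ψ u) := by
  obtain ⟨a, ha⟩ := G.base_mem c u hu
  exact ha ▸ regularAt_toK (chart c) hy a

theorem regularAt_fiberCoord {c : Fin 2 × Bool} {y : X} (hy : y ∈ (chart c).opensRange) :
    Reg y (G.fiberCoord c) := by
  obtain ⟨a, ha⟩ := G.coord_mem c
  have := regularAt_toK (chart c) hy a
  rw [ha] at this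
  exact this

theorem exists_unitAt_slope [IsAlgClosed k] [W.IsElliptic] {c : Fin 2 × Bool} {y : X}
    (hy : y ∈ (chart c).opensRange) : ∃ l, IsU y (G.ψ (chartSlope W c.1 l)) := by
  obtain ⟨u, v, h⟩ := span_chartSlope W c.1
  have hr (b : chartRing W c.1) := G.regularAt_base hy b.2
  have h1 : IsU y (G.ψ u * G.ψ (chartSlope W c.1 0) +
      G.ψ v * G.ψ (chartSlope W c.1 1)) := by
    have e : G.ψ u * G.ψ (chartSlope W c.1 0) + G.ψ v * G.ψ (chartSlope W c.1 1) = 1 := by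
      rw [← map_mul, ← map_mul, ← map_add, ← map_one G.ψ]
      exact congrArg G.ψ (congrArg Subtype.val h)
    rw [e]
    exact UnitAt.one y
  rcases RegularAt.unitAt_or ((hr u).mul (hr _)) ((hr v).mul (hr _)) h1 with h | h
  exacts [⟨0, UnitAt.of_mul (hr u) (hr _) h⟩, ⟨1, UnitAt.of_mul (hr v) (hr _) h⟩]

include hω in
theorem isLocalCoordinates_coords (hn : Module.finrank KX Ω[KX⁄k] = m + 2)
    {c : Fin 2 × Bool} {y : X} (hy : y ∈ (chart c).opensRange) {l : Fin 2}
    (hl : IsU y (G.ψ (chartSlope W c.1 l))) :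
    IsLocalCoordinates f (G.coords c l) y := by
  have hT (j) : Reg y (G.T j) := by
    obtain ⟨a, ha⟩ := G.T_mem c j
    exact ha ▸ regularAt_toK (chart c) hy a
  have hreg (i) : Reg y (G.coords c l i) := by
    refine Fin.cases (G.regularAt_base hy (coordFun_mem W c.1 l)) (fun i => Fin.cases
      (G.regularAt_fiberCoord hy) hT i) i
  have hmem {b r : KX} (i) (hb : Reg y b) (hr : Reg y r)
      (h : 𝖣 b = r • 𝖣 (G.coords c l i)) : b ∈ differentialSubalgebra f (G.coords c l) y := by
    refine ⟨hb, Pi.single i r, fun j => ?_, ?_⟩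
    · by_cases hj : j = i
      · subst hj; rwa [Pi.single_eq_same]
      · rw [Pi.single_eq_of_ne hj]; exact RegularAt.zero y
    · rw [h, Finset.sum_eq_single i]
      · rw [Pi.single_eq_same]
      · intro j _ hj
        rw [Pi.single_eq_of_ne hj, zero_smul]
      · simp
  have hgen : Algebra.adjoin k (G.ψ '' chartRing W c.1 ∪
      insert (if c.2 then (G.z c.1)⁻¹ else G.z c.1) (Set.range G.T)) ≤
        differentialSubalgebra f (G.coords c l) y := by
    refine Algebra.adjoin_le ?_
    rintro _ (⟨u, hu, rfl⟩ | rfl | ⟨j, rfl⟩)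
    · obtain ⟨u', hu'⟩ := derivation_chartRing G.ψ 𝖣 hω c.1 ⟨u, hu⟩
      refine hmem (r := G.ψ u' * (G.ψ (chartSlope W c.1 l))⁻¹) 0 (G.regularAt_base hy hu)
        ((G.regularAt_base hy u'.2).mul hl.inv.regularAt) ?_
      change 𝖣 (G.ψ u) = _ • 𝖣 (G.ψ (coordFun W c.1 l))
      rw [hu', hω c.1 l, smul_smul]
      congr 1
      have : G.ψ (chartSlope W c.1 l) ≠ 0 := hl.ne_zero
      exact (inv_mul_cancel_right₀ this _).symm
    · exact hmem 1 (G.regularAt_fiberCoord hy) (RegularAt.one y)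
        (one_smul KX (𝖣 (G.fiberCoord c))).symm
    · exact hmem j.succ.succ (hT j) (RegularAt.one y)
        (one_smul KX (𝖣 (G.T j))).symm
  refine isLocalCoordinates_of_generate hn hreg fun b hb => ?_
  obtain ⟨q, rfl⟩ := hy
  obtain ⟨u, v, hv, h⟩ := (regularAt_chart_iff (chart c) q b).1 hb
  have := differentialSubalgebra_div (hgen (G.generates c u)) (hgen (G.generates c v))
    ((unitAt_toK_iff (chart c) q v).2 hv)
  exact h ▸ this

include hω in
theorem exists_form_eq_wedge [IsAlgClosed k] [W.IsElliptic]
    (hn : Module.finrank KX Ω[KX⁄k] = m + 2) {c : Fin 2 × Bool} {y : X}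
    (hy : y ∈ (chart c).opensRange) : ∃ (a : Fin (m + 2) → KX) (κ : KX), IsLocalCoordinates f a y ∧
      G.form ω = κ • wedge f (m + 2) a ∧ IsU y (κ * G.zeta c ^ 2) := by
  obtain ⟨l, hl⟩ := G.exists_unitAt_slope hy
  have hs : G.ψ (chartSlope W c.1 l) ≠ 0 := hl.ne_zero
  have hz := G.zeta_ne_zero c
  have h1 : (if c.2 then -1 else 1 : KX) ≠ 0 := by split_ifs <;> simp
  refine ⟨G.coords c l, (G.ψ (chartSlope W c.1 l) * ((if c.2 then -1 else 1) * G.zeta c ^ 2))⁻¹,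
    G.isLocalCoordinates_coords hω hn hy hl, ?_, ?_⟩
  · rw [G.wedge_coords hω, smul_smul, inv_mul_cancel₀, one_smul]
    exact mul_ne_zero hs (mul_ne_zero h1 (pow_ne_zero 2 hz))
  · have e : (G.ψ (chartSlope W c.1 l) * ((if c.2 then -1 else 1) * G.zeta c ^ 2))⁻¹ *
        G.zeta c ^ 2 = (G.ψ (chartSlope W c.1 l))⁻¹ * (if c.2 then -1 else 1) := by
      split_ifs <;> field_simp
    refine cast (congrArg (IsU y) e.symm) (UnitAt.mul hl.inv ?_)
    split_ifs
    · exact (UnitAt.one y).neg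
    · exact UnitAt.one y

include hω in
/-- The form `ω ∧ d z ∧ d T` has poles of order two along the curve at infinity. -/
theorem isDivisorOfForm [IsAlgClosed k] [W.IsElliptic] [IsLocallyNoetherian X]
    (hn : Module.finrank KX Ω[KX⁄k] = m + 2)
    (hcov : ∀ x, ∃ c, x ∈ (chart c).opensRange) {K : QDivisor X} {N : ℕ} (hN : 0 < N)
    (hK : IsEquation chart K.1 N (fun c => (G.zeta c ^ (2 * N))⁻¹)) {φ : KX}
    {x : Fin (m + 2) → KX} (hφ : G.form ω = φ • wedge f (m + 2) x) :
    IsDivisorOfForm f (m + 2) φ x K := by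
  refine ⟨?_, fun y hy => ?_⟩
  · obtain ⟨c, hc⟩ := hcov (genericPoint X)
    obtain ⟨a, κ, ha, h, hu⟩ := G.exists_form_eq_wedge hω hn hc
    rw [← hφ, h]
    exact smul_ne_zero (left_ne_zero_of_mul hu.ne_zero) ha.2.1
  · obtain ⟨c, hc⟩ := hcov y
    obtain ⟨a, κ, ha, h, hu⟩ := G.exists_form_eq_wedge hω hn hc
    have hκ : κ ≠ 0 := left_ne_zero_of_mul hu.ne_zero
    have hz := G.zeta_ne_zero c
    refine ⟨Scheme.ord (X := X) κ y, ⟨a, ha.1, ha.2.1, ha.2.2, κ, hκ, hφ ▸ h, rfl⟩, ?_⟩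
    have h1 := (hK c y hc).2 y hy specializes_rfl
    have h2 := hu.ord_eq_zero
    have h3 : Scheme.ord (X := X) (κ * G.zeta c ^ 2) y = Scheme.ord (X := X) κ y +
        (2 : ℕ) * Scheme.ord (X := X) (G.zeta c) y := by
      refine (Scheme.ord_mul hκ (pow_ne_zero 2 hz)).trans ?_
      congr 1
      exact ord_pow hz 2 y
    have h4 : Scheme.ord (X := X) (G.zeta c ^ (2 * N))⁻¹ y =
        -((2 * N : ℕ) * Scheme.ord (X := X) (G.zeta c) y) := by
      refine (ord_inv (pow_ne_zero _ hz) y).trans ?_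
      congr 1
      exact ord_pow hz _ y
    have h5 : (Scheme.ord (X := X) (G.zeta c ^ (2 * N))⁻¹ y : ℚ) = N * K.1 y := h1
    rw [h4] at h5
    rw [h3] at h2
    have h6 : (Scheme.ord (X := X) κ y : ℚ) + 2 * Scheme.ord (X := X) (G.zeta c) y = 0 := by
      exact_mod_cast h2
    have hN' : (N : ℚ) ≠ 0 := by positivity
    have h7 : (N : ℚ) * K.1 y = N * Scheme.ord (X := X) κ y := by
      rw [← h5]
      push_cast
      linear_combination (-(N : ℚ)) * h6
    exact mul_left_cancel₀ hN' h7

end RuledCoordinates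

open exteriorPower (ιMulti)
open KaehlerDifferential (D map_D)

section ExteriorSquare

variable {K V : Type*} [Field K] [AddCommGroup V] [Module K V]

/-- The exterior product of two vectors, as a bilinear map. -/
def wedgeTwo : V →ₗ[K] V →ₗ[K] ⋀[K]^2 V :=
  LinearMap.mk₂ K (fun x y => ιMulti K 2 ![x, y])
    (fun x x' y => by
      have := (ιMulti K 2 (M := V)).map_vecCons_add ![y] x x'
      exact this)
    (fun c x y => AlternatingMap.map_vecCons_smul _ _ _ _)
    (fun x y y' => by
      have := congrArg (fun F => F ![]) (((ιMulti K 2 (M := V)).curryLeft x).curryLeft.map_add y y')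
      exact this)
    (fun c x y => by
      have := congrArg (fun F => F ![]) (((ιMulti K 2 (M := V)).curryLeft x).curryLeft.map_smul c y)
      exact this)

theorem wedgeTwo_apply (x y : V) : wedgeTwo x y = ιMulti K 2 ![x, y] := rfl

theorem wedgeTwo_self (x : V) : wedgeTwo (K := K) x x = 0 :=
  AlternatingMap.map_eq_zero_of_eq (ιMulti K 2) ![x, x] (i := 0) (j := 1) rfl
    (by simp)

end ExteriorSquare

theorem wedge_two {k : Type u} [CommRing k] {X : Scheme.{u}} [IsIntegral X] (f : X ⟶ Spec (.of k))
    (a b : FunctionField f) : wedge f 2 ![a, b] =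
      wedgeTwo (D k (FunctionField f) a)
        (D k (FunctionField f) b) := by
  rw [wedge, wedgeTwo_apply]
  congr 1
  funext i
  fin_cases i <;> rfl

section MapForms

variable {k K K' : Type*} [CommRing k] [Field K] [Field K'] [Algebra k K] [Algebra k K']

/-- Equations between forms are preserved by field extensions. -/
theorem smul_ιMulti_map (σ : K →ₐ[k] K') {n : ℕ} {φ κ : K} {x y : Fin n → K}
    (h : φ • ιMulti K n (fun i => D k K (x i)) =
      κ • ιMulti K n (fun i => D k K (y i))) :
    σ φ • ιMulti K' n (fun i => D k K' (σ (x i))) =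
      σ κ • ιMulti K' n (fun i => D k K' (σ (y i))) := by
  let _ : Algebra K K' := σ.toRingHom.toAlgebra
  have : IsScalarTower k K K' := IsScalarTower.of_algebraMap_eq fun r => (σ.commutes r).symm
  have hF [DecidableEq (Fin n)] (v : Fin n → Ω[K⁄k]) (i : Fin n) (c) :
      (fun j => KaehlerDifferential.map k k K K' (Function.update v i c j)) =
    Function.update (fun j => KaehlerDifferential.map k k K K' (v j)) i
      (KaehlerDifferential.map k k K K' c) := by
    funext j
    by_cases hj : j = i
    · subst hj; simp
    · simp [hj]
  let F : Ω[K⁄k] [⋀^Fin n]→ₗ[K] ⋀[K']^n Ω[K'⁄k] :=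
    { toFun v := ιMulti K' n (fun i => KaehlerDifferential.map k k K K' (v i))
      map_update_add' v i a b := by
        rw [hF, hF, hF, map_add, AlternatingMap.map_update_add]
      map_update_smul' v i a b := by
        rw [hF, hF, map_smul, algebra_compatible_smul K' a, AlternatingMap.map_update_smul,
          ← algebra_compatible_smul K' a]
      map_eq_zero_of_eq' v i j hij hne :=
        AlternatingMap.map_eq_zero_of_eq (ιMulti K' n) _ (by rw [hij]) hne }
  have h1 := congrArg (exteriorPower.alternatingMapLinearEquiv F) h
  rw [map_smul, map_smul, exteriorPower.alternatingMapLinearEquiv_apply_ιMulti,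
    exteriorPower.alternatingMapLinearEquiv_apply_ιMulti] at h1
  have e (x : Fin n → K) : F (fun i => D k K (x i)) =
      ιMulti K' n (fun i => D k K' (σ (x i))) := by
    change ιMulti K' n
      (fun i => KaehlerDifferential.map k k K K' (D k K (x i))) = _
    simp only [map_D]
    rfl
  rw [e, e] at h1
  exact h1

end MapForms

theorem IsPullbackFunction.unitAt_of_unitAt {X Y : Scheme.{u}} [IsIntegral X] [IsIntegral Y]
    {ν : Y ⟶ X} {φ : X.functionField} {ψ : Y.functionField} (h : IsPullbackFunction ν φ ψ) {y : Y}
    (hφ : RegularAt (ν y) φ) (hψ : UnitAt y ψ) : UnitAt (ν y) φ := by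
  obtain ⟨a, ha, rfl⟩ := h
  obtain ⟨b, hb⟩ := hφ
  obtain ⟨d, hd, e⟩ := hψ
  have hs := genericPoint_specializes y
  have hab : X.presheaf.stalkSpecializes (hs.map ν.continuous) b = a := by
    apply IsFractionRing.injective (X.presheaf.stalk (ν (genericPoint Y))) X.functionField
    rw [ha, ← hb]
    simp only [RingHom.algebraMap_toAlgebra]
    rw [← CommRingCat.comp_apply, TopCat.Presheaf.stalkSpecializes_comp]
  have h1 : ν.stalkMap y b = d := by
    apply IsFractionRing.injective (Y.presheaf.stalk y) Y.functionField
    rw [e, ← hab]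
    exact (ConcreteCategory.congr_hom (ν.stalkSpecializes_stalkMap _ _ hs) b).symm
  refine ⟨b, ?_, hb⟩
  rw [← h1] at hd
  exact (isUnit_map_iff (ν.stalkMap y).hom b).1 hd

section Birational

variable {X Y : Scheme.{u}} [IsIntegral X] [IsIntegral Y] {b : Y ⟶ X}

theorem isPullbackFunction_baseMap {R : Type u} [CommRing R] (f : X ⟶ Spec (.of R)) (b : Y ⟶ X)
    (r : R) : IsPullbackFunction b (baseMap f r) (baseMap (b ≫ f) r) := by
  have : Nonempty (⊤ : X.Opens) := ⟨⟨genericPoint X, trivial⟩⟩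
  refine ⟨X.presheaf.germ ⊤ _ trivial (f.appTop ((Scheme.ΓSpecIso (.of R)).inv r)),
    Scheme.algebraMap_germ_eq_germToFunctionField X (U := ⊤) trivial _, ?_⟩
  erw [Scheme.Hom.germ_stalkMap_apply]
  simp only [baseMap, Scheme.Hom.comp_appTop, CommRingCat.hom_comp, RingHom.comp_apply]
  rfl

theorem IsBirationalMorphism.exists_fieldHom (hb : IsBirationalMorphism b) {k : Type u} [Field k]
    (f : X ⟶ Spec (.of k)) : ∃ σ : FunctionField f →ₐ[k] FunctionField (b ≫ f),
      (∀ φ, IsPullbackFunction b φ (σ φ)) ∧ Function.Surjective σ := by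
  have hα : Function.Bijective (algebraMap (X.presheaf.stalk (b (genericPoint Y))) X.functionField) :=
    ⟨IsFractionRing.injective _ _, fun φ => by
      have h : RegularAt (b (genericPoint Y)) φ := hb.1 ▸ regularAt_genericPoint φ
      exact h⟩
  let e := RingEquiv.ofBijective _ hα
  let σ : X.functionField →+* Y.functionField :=
    (b.stalkMap (genericPoint Y)).hom.comp (e.symm : X.functionField →+* _)
  have hσ (φ) : IsPullbackFunction b φ (σ φ) := ⟨e.symm φ, e.apply_symm_apply φ, rfl⟩
  exact ⟨{ σ with commutes' := fun r => (hσ _).unique (isPullbackFunction_baseMap f b r) }, hσ,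
    hb.2.2.comp e.symm.surjective⟩

/-- An exceptional divisor does not map to the generic point. -/
theorem IsBirationalMorphism.coheight_ne_zero (hb : IsBirationalMorphism b)
    [IsLocallyNoetherian Y] (hY : IsNormalScheme Y) {e : Y} (he : Order.coheight e = 1)
    {k : Type u} [Field k] (f : X ⟶ Spec (.of k)) : b e ≠ genericPoint X := by
  intro h
  obtain ⟨φ, hφ, ho⟩ := exists_ord_eq hY he (-1)
  obtain ⟨σ, hσ, hs⟩ := hb.exists_fieldHom f
  obtain ⟨ψ, hψ⟩ := hs φ
  have h1 : RegularAt e φ := by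
    have := (hσ ψ).regularAt (y := e) (by rw [h]; exact regularAt_genericPoint _)
    rw [hψ] at this
    exact this
  have := h1.ord_nonneg
  omega

end Birational

section Discrepancy

variable {k : Type u} [Field k] {Y : Scheme.{u}} [IsIntegral Y] [IsLocallyNoetherian Y]

theorem exists_eq_uniformizer_pow (hY : IsNormalScheme Y) {e : Y} (he : Order.coheight e = 1)
    {π ξ : Y.functionField} (hπ : Scheme.ord π e = 1) (hπ0 : π ≠ 0) (hξ : ξ ≠ 0)
    (hr : RegularAt e ξ) (hu : ¬ UnitAt e ξ) :
    ∃ (l : ℕ) (u : Y.functionField), UnitAt e u ∧ ξ = π ^ (l + 1) * u ∧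
      Scheme.ord ξ e = l + 1 := by
  have h0 := hr.ord_nonneg
  rw [unitAt_iff_ord hY he hξ] at hu
  obtain ⟨l, hl⟩ := Int.eq_ofNat_of_zero_le (show 0 ≤ Scheme.ord ξ e - 1 by omega)
  have hp : π ^ (l + 1) ≠ 0 := pow_ne_zero _ hπ0
  refine ⟨l, ξ / π ^ (l + 1), ?_, by field_simp, by omega⟩
  rw [unitAt_iff_ord hY he (div_ne_zero hξ hp), div_eq_mul_inv,
    Scheme.ord_mul hξ (inv_ne_zero hp), ord_inv hp, ord_pow hπ0, hπ]
  push_cast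
  omega

omit [IsLocallyNoetherian Y] in
/-- The order of the form `d ξ ∧ d η` along a divisor on which `ξ` and `η` vanish. -/
theorem exists_wedge_eq {F : Y ⟶ Spec (.of k)} {e : Y} {a : Fin 2 → FunctionField F}
    (ha : ∀ b : Fin 2 → FunctionField F, (∀ i, RegularAt (X := Y) e (b i)) →
      ∃ r : FunctionField F, RegularAt (X := Y) e r ∧ wedge F 2 b = r • wedge F 2 a)
    {π u w : FunctionField F} (hπ : RegularAt (X := Y) e π) (hu : RegularAt (X := Y) e u)
    (hw : RegularAt (X := Y) e w) (l m : ℕ) :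
    ∃ r : FunctionField F, RegularAt (X := Y) e r ∧
      wedge F 2 ![π ^ (l + 1) * u, π ^ (m + 1) * w] = (π ^ (l + m + 1) * r) • wedge F 2 a := by
  have h2 {c d : FunctionField F} (hc : RegularAt (X := Y) e c) (hd : RegularAt (X := Y) e d) :
      ∃ r : FunctionField F, RegularAt (X := Y) e r ∧
        wedgeTwo (D k (FunctionField F) c)
          (D k (FunctionField F) d) = r • wedge F 2 a := by
    obtain ⟨r, hr, h⟩ := ha ![c, d] (fun i => by fin_cases i <;> assumption)
    exact ⟨r, hr, wedge_two F c d ▸ h⟩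
  obtain ⟨r₁, h₁, e₁⟩ := h2 hπ hw
  obtain ⟨r₂, h₂, e₂⟩ := h2 hu hπ
  obtain ⟨r₃, h₃, e₃⟩ := h2 hu hw
  have hnat (n : ℕ) : RegularAt (X := Y) e (n : Y.functionField) := ⟨n, map_natCast _ _⟩
  refine ⟨((l + 1 : ℕ) : FunctionField F) * u * r₁ + ((m + 1 : ℕ) : FunctionField F) * w * r₂ +
    π * r₃, ((((hnat (l + 1)).mul hu).mul h₁).add (((hnat (m + 1)).mul hw).mul h₂)).add
      (hπ.mul h₃), ?_⟩
  have hD (n : ℕ) (c : FunctionField F) : D k (FunctionField F) (π ^ (n + 1) * c) =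
      π ^ n • ((((n + 1 : ℕ) : FunctionField F) * c) • D k (FunctionField F) π +
        π • D k (FunctionField F) c) := by
    rw [Derivation.leibniz, Derivation.leibniz_pow, ← Nat.cast_smul_eq_nsmul (FunctionField F),
      Nat.add_sub_cancel]
    module
  rw [wedge_two, hD, hD]
  simp only [map_add, map_smul, LinearMap.add_apply, LinearMap.smul_apply, smul_add, wedgeTwo_self,
    e₁, e₂, e₃]
  module

/-- The discrepancy of an exceptional divisor over a point at which the boundary is a multiple
less than one of a smooth curve. -/
theorem discrepancy_pos {X : Scheme.{u}} [IsIntegral X] [IsLocallyNoetherian X]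
    {f : X ⟶ Spec (.of k)} {C : Type u} [CommRing C] (j : Spec (.of C) ⟶ X)
    [IsOpenImmersion j] [IsDomain C] [IsNoetherianRing C] [IsIntegrallyClosed C]
    (hX : IsNormalScheme X) {b : Y ⟶ X} (hY : IsNormalScheme Y) (hb : IsBirationalMorphism b)
    {e : Y} (he : Order.coheight e = 1) (hx : b e ∈ j.opensRange)
    {φ κ : FunctionField f} {x : Fin 2 → FunctionField f} {ξ η g : FunctionField f}
    (hκ : φ • wedge f 2 x = κ • wedge f 2 ![ξ, η]) (hξ : RegularAt (X := X) (b e) ξ)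
    (hξ' : ¬ UnitAt (X := X) (b e) ξ)
    (hη : RegularAt (X := X) (b e) η)
    (hη' : ¬ UnitAt (X := X) (b e) η)
    {D : X → ℚ} {N r : ℕ} (hr : r < N) (H : IsLocalEquation (fun y => N * D y) (b e) g)
    (hg : UnitAt (X := X) (b e) (g / (κ ^ N * η ^ r)))
    {φ' : FunctionField (b ≫ f)} {x' : Fin 2 → FunctionField (b ≫ f)}
    (hφ' : IsPullbackFunction b φ φ') (hx' : ∀ i, IsPullbackFunction b (x i) (x' i))
    {v : ℤ} {q : ℚ} (hv : HasFormOrder (b ≫ f) 2 φ' x' e v) (hq : IsPullbackCoeff b D e q) :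
    0 < (v : ℚ) - q := by
  obtain ⟨σ, hσ, -⟩ := hb.exists_fieldHom f
  obtain ⟨a, ha, ha0, hgen, c, hc, hform, rfl⟩ := hv
  have hform' : c • wedge (b ≫ f) 2 a = σ κ • wedge (b ≫ f) 2 ![σ ξ, σ η] := by
    rw [← hform]
    have h1 := smul_ιMulti_map σ hκ
    have e1 : φ' = σ φ := hφ'.unique (hσ φ)
    have e2 : x' = fun i => σ (x i) := funext fun i => (hx' i).unique (hσ (x i))
    have e3 : (![σ ξ, σ η] : Fin 2 → FunctionField (b ≫ f)) = fun i => σ (![ξ, η] i) := by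
      funext i
      fin_cases i <;> rfl
    rw [e1, e2, e3]
    exact h1
  have hne : σ κ • wedge (b ≫ f) 2 ![σ ξ, σ η] ≠ 0 := hform' ▸ smul_ne_zero hc ha0
  have hκ0 : σ κ ≠ 0 := fun h => hne (by rw [h, zero_smul])
  have hξ0 : σ ξ ≠ 0 := fun h => hne (by rw [h, wedge_two]; simp)
  have hη0 : σ η ≠ 0 := fun h => hne (by rw [h, wedge_two]; simp)
  obtain ⟨π, hπ0, hπ⟩ : ∃ π : FunctionField (b ≫ f), π ≠ 0 ∧ Scheme.ord (X := Y) π e = 1 :=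
    exists_ord_eq hY he 1
  have hπr : RegularAt (X := Y) e π := (regularAt_iff_ord hY he hπ0).2 (hπ ▸ zero_le_one)
  obtain ⟨l, u, hu, eξ, oξ⟩ := exists_eq_uniformizer_pow hY he hπ hπ0 hξ0 ((hσ ξ).regularAt hξ)
    (fun h => hξ' ((hσ ξ).unitAt_of_unitAt hξ h))
  obtain ⟨m, w, hw, eη, oη⟩ := exists_eq_uniformizer_pow hY he hπ hπ0 hη0 ((hσ η).regularAt hη)
    (fun h => hη' ((hσ η).unitAt_of_unitAt hη h))
  obtain ⟨s, hs, es⟩ := exists_wedge_eq hgen hπr hu.regularAt hw.regularAt l m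
  have ec : c = σ κ * (π ^ (l + m + 1) * s) := by
    have h1 : c • wedge (b ≫ f) 2 a = (σ κ * (π ^ (l + m + 1) * s)) • wedge (b ≫ f) 2 a := by
      rw [hform', mul_smul, ← es]
      congr 2
      rw [eξ, eη]
      rfl
    exact smul_left_injective _ ha0 h1
  have hs0 : s ≠ 0 := by
    rintro rfl
    exact hc (by rw [ec, mul_zero, mul_zero])
  have ov : Scheme.ord (X := Y) c e =
      Scheme.ord (X := Y) (σ κ) e + (l + m + 1 + Scheme.ord (X := Y) s e) := by
    rw [ec]
    refine (Scheme.ord_mul hκ0 (mul_ne_zero (pow_ne_zero _ hπ0) hs0)).trans ?_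
    congr 1
    refine (Scheme.ord_mul (pow_ne_zero _ hπ0) hs0).trans ?_
    congr 1
    refine (ord_pow hπ0 _ e).trans ?_
    rw [hπ]
    push_cast
    ring
  have os := hs.ord_nonneg
  obtain ⟨N', hN', φ₀, ψ₀, H₀, hp, hψ₀, oψ⟩ := hq
  have hg0 : g ≠ 0 := H.1
  have hσg : σ g ≠ 0 := (map_ne_zero σ).2 hg0
  have h1 : UnitAt (X := X) (b e) ((show FunctionField f from φ₀) ^ N / g ^ N') :=
    unitAt_div_of_isLocalEquation j hX hx (D := fun y => N * (N' * D y))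
      (H₀.pow N fun _ => rfl) (H.pow N' fun y => by ring)
  have h2 := ((hσ _).unitAt h1).ord_eq_zero
  have hψ : σ (show FunctionField f from φ₀) = ψ₀ := (hσ _).unique hp
  have h3 : (N : ℤ) * Scheme.ord ψ₀ e = N' * Scheme.ord (X := Y) (σ g) e := by
    have e1 : σ ((show FunctionField f from φ₀) ^ N / g ^ N') =
        (show FunctionField (b ≫ f) from ψ₀) ^ N * ((σ g) ^ N')⁻¹ := by
      rw [map_div₀, map_pow, map_pow, hψ, div_eq_mul_inv]
    rw [e1] at h2
    have h4 := Scheme.ord_mul (x := e) (pow_ne_zero N hψ₀) (inv_ne_zero (pow_ne_zero N' hσg))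
    have h5 := h4.symm.trans h2
    have h6 := ord_inv (X := Y) (pow_ne_zero N' hσg) e
    have h7 := ord_pow (X := Y) hσg N' e
    have h8 := ord_pow hψ₀ N e
    have h9 : Scheme.ord (ψ₀ ^ N) e + -(N' * Scheme.ord (X := Y) (σ g) e) = 0 :=
      (congrArg (Scheme.ord (ψ₀ ^ N) e + ·) (h6.trans (congrArg Neg.neg h7))).symm.trans h5
    rw [h8] at h9
    omega
  have h4 : Scheme.ord (X := Y) (σ g) e = N * Scheme.ord (X := Y) (σ κ) e + r * (m + 1) := by
    have h5 := ((hσ _).unitAt hg).ord_eq_zero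
    have hκη : (σ κ ^ N * σ η ^ r) ≠ 0 := mul_ne_zero (pow_ne_zero _ hκ0) (pow_ne_zero _ hη0)
    have e1 : σ (g / (κ ^ N * η ^ r)) = σ g * (σ κ ^ N * σ η ^ r)⁻¹ := by
      rw [map_div₀, map_mul, map_pow, map_pow, div_eq_mul_inv]
    rw [e1] at h5
    have h6 := (Scheme.ord_mul (x := e) hσg (inv_ne_zero hκη)).symm.trans h5
    have h7 := ord_inv (X := Y) hκη e
    have h8 : Scheme.ord (X := Y) (σ κ ^ N * σ η ^ r) e = N * Scheme.ord (X := Y) (σ κ) e +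
        r * (m + 1) := by
      refine (Scheme.ord_mul (pow_ne_zero _ hκ0) (pow_ne_zero _ hη0)).trans ?_
      refine (congrArg₂ (· + ·) (ord_pow (X := Y) hκ0 N e) (ord_pow (X := Y) hη0 r e)).trans ?_
      rw [oη]
    have h9 : Scheme.ord (X := Y) (σ g) e + -(N * Scheme.ord (X := Y) (σ κ) e + r * (m + 1)) = 0 :=
      (congrArg (Scheme.ord (X := Y) (σ g) e + ·) (h7.trans (congrArg Neg.neg h8))).symm.trans h6
    omega
  rw [h4] at h3
  have hN : (0 : ℚ) < N := by exact_mod_cast (Nat.zero_le r).trans_lt hr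
  have hN'' : (0 : ℚ) < N' := by exact_mod_cast hN'
  have h5 : (N : ℚ) * (N' * q) = N' * (N * Scheme.ord (X := Y) (σ κ) e + r * (m + 1)) := by
    rw [← oψ]
    exact_mod_cast h3
  have h6 : (N : ℚ) * q = N * Scheme.ord (X := Y) (σ κ) e + r * (m + 1) := by
    refine mul_left_cancel₀ hN''.ne' ?_
    linear_combination h5
  have h7 : (r : ℚ) + 1 ≤ N := by exact_mod_cast hr
  have h8 : (0 : ℚ) ≤ Scheme.ord (X := Y) s e := by exact_mod_cast os
  have h9 : (0 : ℚ) < N * ((Scheme.ord (X := Y) c e : ℚ) - q) := by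
    rw [ov, mul_sub, h6]
    push_cast
    have hl : (0 : ℚ) ≤ l := Nat.cast_nonneg l
    have hm : (0 : ℚ) ≤ m := Nat.cast_nonneg m
    nlinarith [mul_nonneg hN.le hl, mul_nonneg hN.le h8, mul_nonneg (sub_nonneg.2 h7) hm]
  exact pos_of_mul_pos_right h9 hN.le

end Discrepancy


open scoped IntermediateField

section PthPowers

variable {k L : Type u} [Field k] [IsAlgClosed k] [Field L] [Algebra k L] (p : ℕ) [Fact p.Prime]
  [CharP k p]

/-- The field of `p`th powers. -/
def pthPowers (k L : Type u) [Field k] [IsAlgClosed k] [Field L] [Algebra k L] (p : ℕ)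
    [Fact p.Prime] [CharP k p] : IntermediateField k L :=
  have : CharP L p := charP_of_injective_algebraMap (algebraMap k L).injective p
  { (frobenius L p).fieldRange with
    algebraMap_mem' := fun r => by
      obtain ⟨s, hs⟩ := IsAlgClosed.exists_pow_nat_eq r (Fact.out : p.Prime).pos
      exact ⟨algebraMap k L s, by rw [← hs, map_pow]; rfl⟩ }

theorem mem_pthPowers {a : L} : a ∈ pthPowers k L p ↔ ∃ b, b ^ p = a := Iff.rfl

instance (F : IntermediateField k L) (E : IntermediateField F L) : IsScalarTower k E L :=
  IsScalarTower.of_algebraMap_eq fun _ => rfl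

theorem eq_top_of_subsingleton_kaehlerDifferential [Algebra.EssFiniteType k L]
    (E : IntermediateField (pthPowers k L p) L) (h : Subsingleton Ω[L⁄E]) : E = ⊤ := by
  have : CharP L p := charP_of_injective_algebraMap (algebraMap k L).injective p
  have : CharP E p := (RingHom.charP_iff (algebraMap E L) (algebraMap E L).injective p).2 this
  have : ExpChar E p := ExpChar.prime Fact.out
  have h1 : Algebra.EssFiniteType E L := Algebra.EssFiniteType.of_comp k E L
  have h2 : Algebra.FormallyUnramified E L := ⟨h⟩
  have h3 : Algebra.IsSeparable E L := Algebra.FormallyUnramified.isSeparable E L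
  have h4 : IsPurelyInseparable E L := (isPurelyInseparable_iff_pow_mem E p).2 fun x => by
    refine ⟨1, ⟨⟨x ^ p, E.algebraMap_mem ⟨x ^ p, x, rfl⟩⟩, ?_⟩⟩
    rw [pow_one]
    rfl
  refine IntermediateField.ext fun x => ⟨fun _ => trivial, fun _ => ?_⟩
  obtain ⟨y, rfl⟩ := IsPurelyInseparable.surjective_algebraMap_of_isSeparable E L x
  exact y.2

theorem adjoin_pthPowers_eq_top {x b : L} (hx : (pthPowers k L p)⟮x⟯ = ⊤)
    (hb : b ∉ pthPowers k L p) : (pthPowers k L p)⟮b⟯ = ⊤ := by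
  have hp := (Fact.out : p.Prime)
  have : CharP L p := charP_of_injective_algebraMap (algebraMap k L).injective p
  set F := pthPowers k L p
  have hroot (y : L) : aeval y (X ^ p - C (⟨y ^ p, y, rfl⟩ : F)) = 0 := by
    rw [map_sub, map_pow, aeval_X, aeval_C]
    exact sub_self _
  have hmon (c : F) : (X ^ p - C c : F[X]).Monic := monic_X_pow_sub_C c hp.ne_zero
  have hint (y : L) : IsIntegral F y := ⟨_, hmon _, hroot y⟩
  have hfin : FiniteDimensional F F⟮x⟯ := IntermediateField.adjoin.finiteDimensional (hint x)
  have h1 : Module.finrank F F⟮x⟯ ≤ p := by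
    rw [IntermediateField.adjoin.finrank (hint x)]
    refine (natDegree_le_of_dvd (minpoly.dvd F x (hroot x)) (hmon _).ne_zero).trans ?_
    rw [natDegree_X_pow_sub_C]
  have h2 : Module.finrank F F⟮b⟯ = p := by
    rw [IntermediateField.adjoin.finrank (hint b), ← minpoly.eq_of_irreducible_of_monic
      (X_pow_sub_C_irreducible_of_prime hp fun c hc => hb ?_) (hroot b) (hmon _),
      natDegree_X_pow_sub_C]
    have h3 : (c : L) ^ p = b ^ p := congrArg Subtype.val hc
    rw [← frobenius_inj L p h3]
    exact c.2
  have hle : F⟮b⟯ ≤ F⟮x⟯ := hx ▸ le_top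
  rw [IntermediateField.eq_of_le_of_finrank_le hle (h1.trans h2.ge), hx]

theorem derivation_eq_zero_of_adjoin_eq_top {K V : Type*} [Field K] [Algebra k K] [AddCommGroup V]
    [Module K V] [Module k V] (ψ : L →ₐ[k] K) (D : Derivation k K V) {b : L}
    (hb : (pthPowers k L p)⟮b⟯ = ⊤) (h : D (ψ b) = 0) (u : L) : D (ψ u) = 0 := by
  have : CharP K p := charP_of_injective_algebraMap (algebraMap k K).injective p
  have hu : u ∈ (pthPowers k L p)⟮b⟯ := hb ▸ trivial
  induction hu using IntermediateField.adjoin_induction with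
  | mem x hx => rw [Set.mem_singleton_iff.1 hx, h]
  | algebraMap x =>
    obtain ⟨y, hy⟩ := x.2
    have e : algebraMap (pthPowers k L p) L x = y ^ p := hy.symm
    rw [e, map_pow, Derivation.leibniz_pow, ← Nat.cast_smul_eq_nsmul K, CharP.cast_eq_zero, zero_smul]
  | add x y _ _ hx hy => rw [map_add, map_add, hx, hy, add_zero]
  | inv x _ hx => rw [map_inv₀, Derivation.leibniz_inv, hx, smul_zero]
  | mul x y _ _ hx hy => rw [map_mul, Derivation.leibniz, hx, hy, smul_zero, smul_zero, add_zero]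

end PthPowers

section Curve

variable {k : Type u} [Field k] [IsAlgClosed k] (p : ℕ) [Fact p.Prime] [CharP k p]
  (W : WeierstrassCurve k)

instance (i : Fin 2) : IsFractionRing (chartRing W i) (CurveField W) := by
  have : FaithfulSMul (chartRing W i) (CurveField W) :=
    (faithfulSMul_iff_algebraMap_injective _ _).2 Subtype.val_injective
  exact IsFractionRing.of_field _ _ fun φ =>
    let ⟨a, b, _, h⟩ := exists_div_chartRing W i φ
    ⟨a, b, h⟩

instance : Algebra.EssFiniteType k (CurveField W) := by
  have h1 : Algebra.FiniteType k (chartRing W 0) :=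
    Algebra.FiniteType.of_surjective (chartMap W 0) (chartMap_surjective W 0)
  have h2 : Algebra.EssFiniteType (chartRing W 0) (CurveField W) :=
    Algebra.EssFiniteType.of_isLocalization _ (nonZeroDivisors (chartRing W 0))
  exact Algebra.EssFiniteType.comp k (chartRing W 0) (CurveField W)

variable [W.IsElliptic]

theorem exists_adjoin_eq_top : ∃ x : CurveField W, (pthPowers k (CurveField W) p)⟮x⟯ = ⊤ := by
  obtain ⟨l, hl⟩ : ∃ l, (chartSlope W 0 l : CurveField W) ≠ 0 := by
    by_contra! h
    obtain ⟨u, v, huv⟩ := span_chartSlope W 0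
    have h1 := congrArg Subtype.val huv
    simp [h] at h1
  refine ⟨coordFun W 0 l, eq_top_of_subsingleton_kaehlerDifferential p _ ?_⟩
  set E := (pthPowers k (CurveField W) p)⟮coordFun W 0 l⟯
  let D : Derivation k (CurveField W) Ω[CurveField W⁄E] :=
    (KaehlerDifferential.D E (CurveField W)).restrictScalars k
  obtain ⟨ω, hω⟩ := exists_invariantForm (AlgHom.id k (CurveField W)) D
  have h1 : D (coordFun W 0 l) = 0 := (KaehlerDifferential.D E (CurveField W)).map_algebraMap
    ⟨_, IntermediateField.mem_adjoin_simple_self _ _⟩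
  have h2 : ω = 0 := by
    have := hω 0 l
    rw [AlgHom.id_apply, h1, AlgHom.id_apply] at this
    exact (smul_eq_zero.1 this.symm).resolve_left hl
  refine subsingleton_of_forall_eq 0 fun a => ?_
  have ha : a ∈ Submodule.span (CurveField W) (Set.range (KaehlerDifferential.D E (CurveField W))) :=
    KaehlerDifferential.span_range_derivation E (CurveField W) ▸ trivial
  have hle : Submodule.span (CurveField W) (Set.range (KaehlerDifferential.D E (CurveField W))) ≤ ⊥ := by
    rw [Submodule.span_le]
    rintro _ ⟨u, rfl⟩
    obtain ⟨u', hu'⟩ := derivation_curveField (AlgHom.id k (CurveField W)) D hω u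
    rw [h2, smul_zero] at hu'
    exact hu'
  exact hle ha

omit [CharP k p] in
theorem mem_chartRing_of_pow {i : Fin 2} {c : CurveField W} (h : c ^ p ∈ chartRing W i) :
    c ∈ chartRing W i := by
  have hi : IsIntegral (chartRing W i) c := by
    refine IsIntegral.of_pow (Fact.out : p.Prime).pos ?_
    exact isIntegral_algebraMap (A := CurveField W) (x := (⟨_, h⟩ : chartRing W i))
  obtain ⟨b, hb⟩ := IsIntegrallyClosed.isIntegral_iff.1 hi
  exact hb ▸ b.2

/-- If the Hasse invariant vanishes, the Artin-Schreier type equation has a remainder with nonzero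
constant derivative. -/
theorem exists_derivation_remainder {b₀ : chartRing W 0} {b₁ : chartRing W 1}
    (h : atiyahFun W ^ p = b₀ - b₁) {K V : Type*} [Field K] [Algebra k K] [AddCommGroup V]
    [Module K V] [Module k V] (ψ : CurveField W →ₐ[k] K) (D : Derivation k K V) {ω : V}
    (hω : ∀ i l, D (ψ (coordFun W i l)) = ψ (chartSlope W i l) • ω) (hω0 : ω ≠ 0) :
    ∃ κ : k, κ ≠ 0 ∧ D (ψ b₀) = algebraMap k K κ • ω ∧ D (ψ b₁) = algebraMap k K κ • ω := by
  have : CharP K p := charP_of_injective_algebraMap (algebraMap k K).injective p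
  obtain ⟨s₀, h₀⟩ := derivation_chartRing ψ D hω 0 b₀
  obtain ⟨s₁, h₁⟩ := derivation_chartRing ψ D hω 1 b₁
  have h01 : D (ψ b₀) = D (ψ b₁) := by
    rw [← sub_eq_zero, ← map_sub, ← map_sub, ← h, map_pow, Derivation.leibniz_pow,
      ← Nat.cast_smul_eq_nsmul K, CharP.cast_eq_zero, zero_smul]
  have hs : (s₀ : CurveField W) = s₁ := by
    rw [h₀, h₁] at h01
    exact ψ.injective (smul_left_injective K hω0 h01)
  obtain ⟨κ, hκ⟩ := chartRing_zero_inf_one W s₀.2 (hs ▸ s₁.2)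
  have e₀ : D (ψ b₀) = algebraMap k K κ • ω := by rw [h₀, hκ, AlgHom.commutes]
  refine ⟨κ, ?_, e₀, h01 ▸ e₀⟩
  rintro rfl
  rw [map_zero, zero_smul] at e₀
  by_cases hb : (b₀ : CurveField W) ∈ pthPowers k (CurveField W) p
  · obtain ⟨c, hc⟩ := (mem_pthPowers p).1 hb
    have : CharP (CurveField W) p :=
      charP_of_injective_algebraMap (algebraMap k (CurveField W)).injective p
    have h2 : atiyahFun W - c ∈ chartRing W 1 := by
      refine mem_chartRing_of_pow p W ?_
      rw [sub_pow_char, hc, h, sub_sub_cancel_left]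
      exact neg_mem b₁.2
    exact atiyahFun_ne W (mem_chartRing_of_pow p W (hc ▸ b₀.2)) h2 (add_sub_cancel _ _).symm
  · obtain ⟨x, hx⟩ := exists_adjoin_eq_top p W
    have h2 := derivation_eq_zero_of_adjoin_eq_top p ψ D (adjoin_pthPowers_eq_top p hx hb) e₀
    refine hω0 ?_
    obtain ⟨u, v, huv⟩ := span_chartSlope W 0
    have h3 (l) : ψ (chartSlope W 0 l) • ω = 0 := by rw [← hω, h2]
    have h4 : (ψ u * ψ (chartSlope W 0 0) + ψ v * ψ (chartSlope W 0 1)) • ω = 0 := by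
      rw [add_smul, mul_smul, mul_smul, h3, h3, smul_zero, smul_zero, add_zero]
    rwa [← map_mul, ← map_mul, ← map_add, show (u * chartSlope W 0 0 + v * chartSlope W 0 1 :
      CurveField W) = 1 from congrArg Subtype.val huv, map_one, one_smul] at h4

end Curve


section ClosedPoints

variable {k : Type u} [Field k] [IsAlgClosed k] (W : WeierstrassCurve k)

omit [IsAlgClosed k] in
theorem ringKrullDim_chartRing_polynomial_le [W.IsElliptic] (i : Fin 2) :
    ringKrullDim (chartRing W i)[X] ≤ 2 := by
  have hF : chartEqn W i ∈ nonZeroDivisors (MvPolynomial (Fin 2) k) := by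
    refine mem_nonZeroDivisors_of_ne_zero fun h => ?_
    refine nonsingular_chartEqn W i 0 ?_ ?_ ?_ <;> rw [h] <;> simp
  have h1 := ringKrullDim_quotient_succ_le_of_nonZeroDivisor hF
  rw [MvPolynomial.ringKrullDim_of_isNoetherianRing, ringKrullDim_eq_zero_of_field] at h1
  have h2 : ringKrullDim (chartRing W i) ≤
      ringKrullDim (MvPolynomial (Fin 2) k ⧸ Ideal.span {chartEqn W i}) :=
    ringKrullDim_le_of_surjective (Ideal.Quotient.lift _ (chartMap W i : _ →+* chartRing W i) fun a ha => by
      rw [← ker_chartMap] at ha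
      exact ha) (Ideal.Quotient.lift_surjective_of_surjective _ _ (chartMap_surjective W i))
  rw [Polynomial.ringKrullDim_of_isNoetherianRing]
  refine (add_le_add_left h2 1).trans (h1.trans ?_)
  simp

instance (i : Fin 2) : Algebra.FiniteType k (chartRing W i)[X] :=
  Algebra.FiniteType.trans
    (Algebra.FiniteType.of_surjective (chartMap W i) (chartMap_surjective W i)) inferInstance

theorem exists_value_of_height {A : Type u} [CommRing A] [IsNoetherianRing A] [Algebra k A]
    [Algebra.FiniteType k A] (hd : ringKrullDim A ≤ 2) (q : Ideal A) [q.IsPrime]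
    (h₀ : q.height ≠ 0) (h₁ : q.height ≠ 1) : ∃ χ : A →ₐ[k] k, ∀ a, χ a = 0 ↔ a ∈ q := by
  have hq : (2 : ℕ∞) ≤ q.height := by
    have h2 : 1 ≤ q.height := Order.one_le_iff_ne_zero.2 h₀
    have h3 := lt_of_le_of_ne h2 h₁.symm
    exact Order.add_one_le_of_lt h3
  have hle := Ideal.height_le_ringKrullDim_of_ne_top (I := q) (Ideal.IsPrime.ne_top ‹_›)
  have hq' : (2 : WithBot ℕ∞) ≤ q.height := WithBot.coe_le_coe.2 hq
  have hdim : ringKrullDim A = 2 := le_antisymm hd (hq'.trans hle)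
  have : FiniteRingKrullDim A :=
    finiteRingKrullDim_iff_ne_bot_and_top.2 ⟨by rw [hdim]; exact (by decide), by
      rw [hdim]; exact WithBot.coe_injective.ne (ENat.natCast_ne_top 2)⟩
  have hmax : q.IsMaximal := Ideal.isMaximal_of_height_eq_ringKrullDim
    (le_antisymm hle (hdim ▸ hq'))
  let _ : Field (A ⧸ q) := Ideal.Quotient.field q
  have h3 : Algebra.FiniteType k (A ⧸ q) :=
    Algebra.FiniteType.of_surjective (Ideal.Quotient.mkₐ k q) (Ideal.Quotient.mkₐ_surjective k q)
  have h4 : Module.Finite k (A ⧸ q) := finite_of_finite_type_of_isJacobsonRing k _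
  have h5 : Function.Bijective (algebraMap k (A ⧸ q)) :=
    IsAlgClosed.algebraMap_bijective_of_isIntegral
  let e := AlgEquiv.ofBijective (Algebra.ofId k (A ⧸ q)) h5
  refine ⟨(e.symm : _ →ₐ[k] k).comp (Ideal.Quotient.mkₐ k q), fun a => ?_⟩
  change e.symm (Ideal.Quotient.mk q a) = 0 ↔ _
  rw [EmbeddingLike.map_eq_zero_iff, Ideal.Quotient.eq_zero_iff_mem]

end ClosedPoints

section Units

variable {X : Scheme.{u}} [IsIntegral X] {x : X}

theorem UnitAt.add_of_not {φ ψ : X.functionField} (h : UnitAt x φ) (hψ : RegularAt x ψ)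
    (hψ' : ¬ UnitAt x ψ) : UnitAt x (φ + ψ) := by
  have h1 : UnitAt x ((φ + ψ) + -ψ) := by rwa [add_neg_cancel_right]
  refine (RegularAt.unitAt_or (h.regularAt.add hψ) hψ.neg h1).resolve_right fun h2 => hψ' ?_
  rw [← neg_neg ψ]
  exact h2.neg

theorem unitAt_baseMap {k : Type u} [Field k] (f : X ⟶ Spec (.of k)) {c : k} (hc : c ≠ 0) :
    UnitAt x (baseMap f c) :=
  unitAt_iff.2 ⟨(map_ne_zero (baseMap f)).2 hc, regularAt_baseMap f x c, by
    rw [← map_inv₀]; exact regularAt_baseMap f x _⟩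

theorem not_unitAt_of_pow {φ : X.functionField} {n : ℕ} (h : ¬ UnitAt x (φ ^ n)) : ¬ UnitAt x φ :=
  fun h' => h (h'.pow n)

/-- Functions have values in `k` at the closed points of a chart. -/
theorem exists_not_unitAt_sub {k : Type u} [Field k] (f : X ⟶ Spec (.of k)) {C : Type u}
    [CommRing C] [IsDomain C] [Algebra k C] (j : Spec (.of C) ⟶ X) [IsOpenImmersion j]
    (hj : j ≫ f = specMap (algebraMap k C)) {q : Spec (.of C)} {χ : C →ₐ[k] k}
    (hχ : ∀ a, χ a = 0 ↔ a ∈ q.asIdeal) {φ : X.functionField} (h : RegularAt (j q) φ) :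
    ∃ c : k, ¬ UnitAt (j q) (φ - baseMap f c) := by
  obtain ⟨a, b, hb, rfl⟩ := (regularAt_chart_iff j q φ).1 h
  have hb' := (unitAt_toK_iff j q b).2 hb
  have hχb : χ b ≠ 0 := fun h => hb ((hχ b).1 h)
  refine ⟨χ a / χ b, fun hu => ?_⟩
  have h1 := hu.mul hb'
  have e : (toK j a / toK j b - baseMap f (χ a / χ b)) * toK j b =
      toK j (a - algebraMap k C (χ a / χ b) * b) := by
    have := hb'.ne_zero
    rw [baseMap_eq_toK j f _ hj, map_sub, map_mul]
    field_simp
  rw [e, unitAt_toK_iff] at h1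
  refine h1 ((hχ _).1 ?_)
  rw [map_sub, map_mul, AlgHom.commutes, Algebra.algebraMap_self, RingHom.id_apply]
  field_simp
  ring

end Units


section Coordinates

variable {p : ℕ} {k : Type u} [Field k] {W : WeierstrassCurve k}
  {D : AtiyahData p k (CurveField W) (fun i => chartRing W i)}
  {X : Scheme.{u}} [IsIntegral X] {f : X ⟶ Spec (.of k)}

/-- The coordinates on a ruled surface over a Weierstrass curve. -/
def Ruled.coordinates (Q : Ruled D f) (hθ : ∀ i, D.θ i = (chartRing W i).val) :
    RuledCoordinates W f 0 Q.chart where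
  ψ := { Q.Φ.comp C with commutes' := fun r => (Q.baseMap_eq r).symm }
  z := fun i => Q.z i
  z_ne_zero := Q.z_ne_zero
  T := Fin.elim0
  base_mem := by
    rintro ⟨i, _ | _⟩ u hu
    · refine ⟨C ⟨u, hu⟩, ?_⟩
      rw [Q.toK_fin_eq, eval₂_C]
      change Q.Φ (C (D.θ i _)) = Q.Φ (C u)
      rw [hθ]
      rfl
    · refine ⟨C ⟨u, hu⟩, ?_⟩
      rw [Q.toK_inf_C, hθ]
      rfl
  coord_mem := by
    rintro ⟨i, _ | _⟩
    · exact ⟨Polynomial.X, by rw [Q.toK_fin_eq, eval₂_X]; rfl⟩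
    · exact ⟨Polynomial.X, by rw [Q.toK_inf_eq, eval₂_X]; rfl⟩
  T_mem := fun _ j => j.elim0
  generates := by
    intro c a
    set V : Subalgebra k (FunctionField f) := Algebra.adjoin k _ with hV
    have hC (u : chartRing W c.1) : (show FunctionField f from toK (Q.chart c) (C u)) ∈ V := by
      refine Algebra.subset_adjoin (Or.inl ⟨u, u.2, ?_⟩)
      obtain ⟨i, _ | _⟩ := c
      · have e : toK (Q.chart (i, false)) (C u) = Q.Φ (C (D.θ i u)) := by
          rw [Q.toK_fin_eq, eval₂_C]
          rfl
        refine Eq.trans ?_ e.symm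
        rw [hθ]
        rfl
      · refine Eq.trans ?_ (Q.toK_inf_C i u).symm
        rw [hθ]
        rfl
    have hX : (show FunctionField f from toK (Q.chart c) Polynomial.X) ∈ V := by
      refine Algebra.subset_adjoin (Or.inr (Or.inl ?_))
      obtain ⟨i, _ | _⟩ := c
      · exact (by rw [Q.toK_fin_eq, eval₂_X] : toK (Q.chart (i, false)) Polynomial.X = Q.z i)
      · exact (by rw [Q.toK_inf_eq, eval₂_X] : toK (Q.chart (i, true)) Polynomial.X = (Q.z i)⁻¹)
    induction a using Polynomial.induction_on' with
    | add a b ha hb =>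
      have := add_mem ha hb
      rw [map_add]
      exact this
    | monomial n u =>
      have := mul_mem (hC u) (pow_mem hX n)
      rw [← C_mul_X_pow_eq_monomial, map_mul, map_pow]
      exact this
  transition := ⟨1, one_mem _, algebraMap k _ D.τ * D.a, by
    refine Eq.trans ?_ (one_mul _).symm
    change Q.Φ _ - Q.Φ _ = Q.Φ (C _)
    rw [← map_sub]
    congr 1
    simp [AtiyahData.shift]⟩

theorem wedge_swap (a b : FunctionField f) : wedge f 2 ![b, a] = -wedge f 2 ![a, b] := by
  rw [wedge_two, wedge_two, eq_neg_iff_add_eq_zero]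
  have := wedgeTwo_self (K := FunctionField f) (KaehlerDifferential.D k (FunctionField f) a +
    KaehlerDifferential.D k (FunctionField f) b)
  rw [map_add, map_add, LinearMap.add_apply, LinearMap.add_apply, wedgeTwo_self, wedgeTwo_self, zero_add,
    add_zero] at this
  exact this

namespace Ruled

variable (Q : Ruled D f) (hθ : ∀ i, D.θ i = (chartRing W i).val)

local notation "KX" => FunctionField f

local notation "Reg" => RegularAt (X := X)

local notation "IsU" => UnitAt (X := X)

local notation "𝖣" => KaehlerDifferential.D k KX

theorem wedge_two_eq {ω : Ω[KX⁄k]} (hω : (Q.coordinates hθ).IsInvariant ω) {i : Fin 2}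
    {a b c d e : KX} (ha : 𝖣 a = c • ω)
    (hb : 𝖣 b = d • 𝖣 ((Q.coordinates hθ).z i) + e • ω) :
    wedge f 2 ![a, b] = (c * d) • (Q.coordinates hθ).form ω := by
  rw [← (Q.coordinates hθ).wedge_eq_smul_form hω ha (b := b) (d := d) (i := i)]
  · congr 3
  · rw [hb, add_sub_cancel_left]
    exact Submodule.smul_mem _ _ (Submodule.subset_span (Or.inl rfl))

variable [Fact p.Prime] [CharP k p]

theorem h_eq (i : Fin 2) : (show KX from Q.h) = (Q.coordinates hθ).z i ^ p -
    algebraMap k _ (D.lam * D.τ ^ (p - 1)) * (Q.coordinates hθ).z i -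
      algebraMap k _ (D.τ ^ p) * (Q.coordinates hθ).ψ (D.b i) := by
  have : CharP (CurveField W) p :=
    charP_of_injective_algebraMap (algebraMap k (CurveField W)).injective p
  have h1 := Q.toK_hFin i
  rw [Q.toK_fin_eq] at h1
  have hb (r : k) : Q.base i (algebraMap k _ r) = baseMap f r := by
    rw [Q.baseMap_eq]
    change Q.Φ (C (D.θ i (algebraMap k _ r))) = _
    rw [AlgHom.commutes]
  have hψ (u : chartRing W i) : Q.base i u = (Q.coordinates hθ).ψ u := by
    change Q.Φ (C (D.θ i u)) = Q.Φ (C (u : CurveField W))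
    rw [hθ]
    rfl
  have h2 : Q.h = Q.z i ^ p - baseMap f (D.lam * D.τ ^ (p - 1)) * Q.z i -
      baseMap f (D.τ ^ p) * Q.base i (D.b i) := by
    rw [← h1, AtiyahData.hFin, eval₂_sub, eval₂_sub, eval₂_mul, eval₂_pow, eval₂_X, eval₂_C,
      eval₂_C, map_mul (Q.base i), hb, hb]
  rw [hψ] at h2
  exact h2

theorem D_h (i : Fin 2) : 𝖣 (show KX from Q.h) =
    (-algebraMap k KX (D.lam * D.τ ^ (p - 1))) • 𝖣 ((Q.coordinates hθ).z i) +
      (-algebraMap k KX (D.τ ^ p)) • 𝖣 ((Q.coordinates hθ).ψ (D.b i)) := by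
  have : CharP KX p :=
    charP_of_injective_algebraMap (algebraMap k KX).injective p
  rw [Q.h_eq hθ i, map_sub, map_sub, Derivation.leibniz_pow, Derivation.leibniz, Derivation.leibniz,
    Derivation.map_algebraMap, Derivation.map_algebraMap,
    ← Nat.cast_smul_eq_nsmul KX, CharP.cast_eq_zero]
  module

theorem D_sub_algebraMap (a : KX) (c : k) :
    𝖣 (a - algebraMap k KX c) = 𝖣 a := by
  rw [map_sub, Derivation.map_algebraMap, sub_zero]

end Ruled

end Coordinates


section Terminal

variable {p : ℕ} {k : Type u} [Field k] [IsAlgClosed k] {W : WeierstrassCurve k} [W.IsElliptic]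
  {D : AtiyahData p k (CurveField W) (fun i => chartRing W i)}
  {X : Scheme.{u}} [IsIntegral X] {f : X ⟶ Spec (.of k)}
  (Q : Ruled D f) (hθ : ∀ i, D.θ i = (chartRing W i).val)

local notation "KX" => FunctionField f

local notation "Reg" => RegularAt (X := X)

local notation "IsU" => UnitAt (X := X)

local notation "𝖣" => KaehlerDifferential.D k KX

/-- Local coordinates at `x` whose second member is an equation of the support of the boundary with
equation `g`. -/
def IsAdapted (F : ⋀[KX]^2 Ω[KX⁄k]) (g : KX) (N : ℕ) (x : X) :
    Prop :=
  ∃ (ξ η κ : KX) (r : ℕ), F = κ • wedge f 2 ![ξ, η] ∧ Reg x ξ ∧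
    ¬ IsU x ξ ∧ Reg x η ∧ ¬ IsU x η ∧ r < N ∧
      IsU x (g / (κ ^ N * η ^ r))

omit [IsAlgClosed k] in
theorem isAdapted_of_eq {F : ⋀[KX]^2 Ω[KX⁄k]} {g : KX} {N : ℕ}
    {x : X} {ξ η s : KX} {r : ℕ} (hs : s ≠ 0) (h : wedge f 2 ![ξ, η] = s • F)
    (hξ : Reg x ξ) (hξ' : ¬ IsU x ξ) (hη : Reg x η)
    (hη' : ¬ IsU x η) (hr : r < N) (hη0 : η ≠ 0) {u : KX}
    (hu : IsU x u) (hg : g * s ^ N = u * η ^ r) : IsAdapted F g N x := by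
  refine ⟨ξ, η, s⁻¹, r, ?_, hξ, hξ', hη, hη', hr, ?_⟩
  · rw [h, smul_smul, inv_mul_cancel₀ hs, one_smul]
  · have e : g / (s⁻¹ ^ N * η ^ r) = u := by
      rw [inv_pow]
      field_simp
      exact hg.trans (mul_comm _ _)
    exact e ▸ hu

variable [Fact p.Prime] [CharP k p]

/-- The equation of the boundary of `K + Δ + Θ`. -/
def Ruled.boundaryEqn (c : Fin 2 × Bool) : KX :=
  ((show KX from Q.h) * ((show KX from Q.h) - 1)) ^ 4 *
    (Q.coordinates hθ).zeta c ^ p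

set_option maxHeartbeats 800000 in
theorem Ruled.isAdapted_of_unitAt {ω : Ω[KX⁄k]}
    (hω : (Q.coordinates hθ).IsInvariant ω) (hω0 : ω ≠ 0)
    (hr : D.lam = 0 → D.a = atiyahFun W)
    {c : Fin 2 × Bool} {x : X} (hx : x ∈ (Q.chart c).opensRange)
    (hval : ∀ φ : KX, Reg x φ →
      ∃ c : k, ¬ IsU x (φ - algebraMap k KX c))
    (hz : IsU x ((Q.coordinates hθ).zeta c)) :
    IsAdapted ((Q.coordinates hθ).form ω) (Q.boundaryEqn hθ c) (6 * p) x := by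
  have hp := (Fact.out : p.Prime)
  set G := Q.coordinates hθ
  set h : KX := Q.h with hh
  set z : KX := G.z c.1 with hzdef
  have hK : CharP KX p :=
    charP_of_injective_algebraMap (algebraMap k KX).injective p
  have hL : CharP (CurveField W) p :=
    charP_of_injective_algebraMap (algebraMap k (CurveField W)).injective p
  have halg (c : k) : Reg x (algebraMap k KX c) :=
    regularAt_baseMap f x c
  have halg' {c : k} (hc : c ≠ 0) : IsU x (algebraMap k KX c) :=
    unitAt_baseMap f hc
  have hzr : Reg x z := by
    have h1 := G.regularAt_fiberCoord hx
    obtain ⟨i, _ | _⟩ := c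
    · exact h1
    · have h2 := hz.inv.regularAt
      have e : (G.zeta (i, true))⁻¹ = z := inv_inv _
      exact e ▸ h2
  have hb : Reg x (G.ψ (D.b c.1)) := G.regularAt_base hx (D.b c.1).2
  have h_eq : h = z ^ p - algebraMap k KX (D.lam * D.τ ^ (p - 1)) * z -
      algebraMap k KX (D.τ ^ p) * G.ψ (D.b c.1) := Q.h_eq hθ c.1
  have hhr : Reg x h := by
    rw [h_eq]
    exact ((hzr.pow p).sub ((halg _).mul hzr)).sub ((halg _).mul hb)
  have hn (φ : KX) (hφ : ¬ IsU x φ) (c : k) (hc : c ≠ 0)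
      (hφr : Reg x φ) : IsU x (algebraMap k KX c + φ) :=
    (halg' hc).add_of_not hφr hφ
  obtain ⟨l, hl⟩ := G.exists_unitAt_slope hx
  have hl0 : G.ψ (chartSlope W c.1 l) ≠ 0 := hl.ne_zero
  have hcr : Reg x (G.ψ (coordFun W c.1 l)) :=
    G.regularAt_base hx (coordFun_mem W c.1 l)
  obtain ⟨α, hα⟩ := hval _ hcr
  obtain ⟨z₀, hz₀⟩ := hval _ hzr
  set ξ := G.ψ (coordFun W c.1 l) - algebraMap k KX α with hξdef
  have hξr : Reg x ξ := hcr.sub (halg α)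
  have hDξ : 𝖣 ξ = G.ψ (chartSlope W c.1 l) • ω := by
    rw [hξdef, Ruled.D_sub_algebraMap, hω c.1 l]
  have hDz (c₀ : k) : 𝖣 (z - algebraMap k KX c₀) = (1 : KX) • 𝖣 z +
      (0 : KX) • ω := by
    rw [Ruled.D_sub_algebraMap, one_smul, zero_smul, add_zero]
  have w₁ (c₀ : k) : wedge f 2 ![ξ, z - algebraMap k KX c₀] =
      G.ψ (chartSlope W c.1 l) • G.form ω := by
    rw [Q.wedge_two_eq hθ hω hDξ (hDz c₀), mul_one]
  have hz0 (c₀ : k) : z - algebraMap k KX c₀ ≠ 0 := fun h0 => by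
    have h1 : Q.Φ (Polynomial.X - C (D.shift c.1) - C (algebraMap k _ c₀)) = 0 := by
      rw [map_sub, ← Q.baseMap_eq]
      exact h0
    rw [map_eq_zero_iff _ Q.inj, sub_sub, ← C_add] at h1
    exact X_sub_C_ne_zero _ h1
  have hg (u : KX) : Q.boundaryEqn hθ c * u = (h * (h - (1 : KX))) ^ 4 * G.zeta c ^ p * u := rfl
  by_cases hunit : IsU x h ∧ IsU x (h - (1 : KX))
  · refine isAdapted_of_eq (r := 0)
      (u := (h * (h - 1)) ^ 4 * G.zeta c ^ p * G.ψ (chartSlope W c.1 l) ^ (6 * p)) hl0 (w₁ z₀) hξr hα (hzr.sub (halg z₀)) hz₀ (by have := hp.pos; omega)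
      (hz0 z₀) ?_ ((hg _).trans ?_)
    · exact (((hunit.1.mul hunit.2).pow 4).mul (hz.pow p)).mul (hl.pow _)
    · rw [pow_zero, mul_one]
  obtain ⟨c₀, c₁, hc₀, hnon, hunit', hprod⟩ : ∃ c₀ c₁ : k, c₀ ^ p = c₀ ∧
      ¬ IsU x (h - algebraMap k KX c₀) ∧ IsU x (h - algebraMap k KX c₁) ∧
      h * (h - 1) = (h - algebraMap k KX c₀) * (h - algebraMap k KX c₁) := by
    by_cases h0 : IsU x h
    · have h1 : ¬ IsU x (h - (1 : KX)) := fun h1 => hunit ⟨h0, h1⟩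
      exact ⟨1, 0, one_pow p, by rwa [map_one], by rwa [map_zero, sub_zero], by
        rw [map_one, map_zero]; ring⟩
    · refine ⟨0, 1, zero_pow hp.ne_zero, by rwa [map_zero, sub_zero], ?_, by
        rw [map_one, map_zero]; ring⟩
      have h1 := hn h h0 (-1) (neg_ne_zero.2 one_ne_zero) hhr
      rwa [map_neg, neg_add_eq_sub] at h1
  set η := h - algebraMap k KX c₀ with hηdef
  have hηr : Reg x η := hhr.sub (halg c₀)
  have hη0 : η ≠ 0 := fun h0 => by
    have h1 := Q.h_mul_ne_zero
    refine h1 ?_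
    refine Eq.trans hprod ?_
    rw [h0, zero_mul]
    rfl
  have hgη (u : KX) : Q.boundaryEqn hθ c * u =
      ((h - algebraMap k KX c₁) ^ 4 * G.zeta c ^ p * u) * η ^ 4 := by
    rw [hg, hprod]
    ring
  have hun {u : KX} (hu : IsU x u) :
      IsU x ((h - algebraMap k KX c₁) ^ 4 * G.zeta c ^ p * u ^ (6 * p)) :=
    ((hunit'.pow 4).mul (hz.pow p)).mul (hu.pow _)
  have h46 : 4 < 6 * p := by have := hp.two_le; omega
  have hDη : 𝖣 η = (-algebraMap k KX (D.lam * D.τ ^ (p - 1))) • 𝖣 z +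
      (-algebraMap k KX (D.τ ^ p)) • 𝖣 (G.ψ (D.b c.1)) := by
    rw [hηdef, Ruled.D_sub_algebraMap]
    exact Q.D_h hθ c.1
  by_cases hτ : D.τ = 0
  · have h1 : h = z ^ p := by
      rw [h_eq, hτ, zero_pow hp.ne_zero, zero_pow (by have := hp.two_le; omega), mul_zero, map_zero]
      ring
    have h2 : η = (z - algebraMap k KX c₀) ^ p := by
      rw [hηdef, h1, sub_pow_char, ← map_pow, hc₀]
    have h3 : ¬ IsU x (z - algebraMap k KX c₀) := by
      refine not_unitAt_of_pow (n := p) ?_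
      exact h2 ▸ hnon
    refine isAdapted_of_eq (r := 4 * p) hl0 (w₁ c₀) hξr hα (hzr.sub (halg c₀)) h3
      (by have := hp.pos; omega) (hz0 c₀) (hun hl) ?_
    rw [hgη, h2, ← pow_mul, mul_comm p 4]
    rfl
  by_cases hlam : D.lam = 0
  · have h1 : atiyahFun W ^ p = (D.b 0 : CurveField W) - D.b 1 := by
      have h2 := D.pow_eq
      rw [hr hlam, hlam, map_zero, zero_mul, zero_add, hθ, hθ] at h2
      exact h2
    obtain ⟨κ, hκ, e₀, e₁⟩ := exists_derivation_remainder p W h1 G.ψ 𝖣 hω hω0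
    have e : 𝖣 (G.ψ (D.b c.1)) = algebraMap k KX κ • ω := by
      rcases (by omega : c.1 = 0 ∨ c.1 = 1) with h | h <;> rw [h] <;> assumption
    have hDη' : 𝖣 η = algebraMap k KX (-(D.τ ^ p * κ)) • ω := by
      rw [hDη, hlam, zero_mul, map_zero, neg_zero, zero_smul, zero_add, e, smul_smul, map_neg,
        map_mul, neg_mul]
    have hc : D.τ ^ p * κ ≠ 0 := mul_ne_zero (pow_ne_zero _ hτ) hκ
    have w₂ : wedge f 2 ![z - algebraMap k KX z₀, η] =
        algebraMap k KX (D.τ ^ p * κ) • G.form ω := by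
      rw [wedge_swap, Q.wedge_two_eq hθ hω hDη' (hDz z₀), mul_one, map_neg]
      exact (congrArg Neg.neg (neg_smul (algebraMap k KX (D.τ ^ p * κ))
        (G.form ω))).trans (neg_neg _)
    exact isAdapted_of_eq (r := 4) ((_root_.map_ne_zero _).2 hc) w₂ (hzr.sub (halg z₀)) hz₀ hηr hnon h46
      hη0 (hun (halg' hc)) (hgη _)
  · obtain ⟨b', hb'⟩ := derivation_chartRing G.ψ 𝖣 hω c.1 (D.b c.1)
    have hDη' : 𝖣 η = (-algebraMap k KX (D.lam * D.τ ^ (p - 1))) • 𝖣 z +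
        (-algebraMap k KX (D.τ ^ p) * G.ψ b') • ω := by
      rw [hDη, hb', smul_smul]
    have hc : D.lam * D.τ ^ (p - 1) ≠ 0 := mul_ne_zero hlam (pow_ne_zero _ hτ)
    have w₂ := Q.wedge_two_eq hθ hω hDξ hDη'
    have hs := hl.mul (halg' hc).neg
    exact isAdapted_of_eq (r := 4) (s := G.ψ (chartSlope W c.1 l) *
      -algebraMap k KX (D.lam * D.τ ^ (p - 1))) hs.ne_zero w₂ hξr hα hηr hnon h46
      hη0 (hun hs) (hgη _)

theorem Ruled.isAdapted_of_not_unitAt {ω : Ω[KX⁄k]}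
    (hω : (Q.coordinates hθ).IsInvariant ω)
    {c : Fin 2 × Bool} {x : X} (hx : x ∈ (Q.chart c).opensRange)
    (hval : ∀ φ : KX, Reg x φ →
      ∃ c : k, ¬ IsU x (φ - algebraMap k KX c))
    (hz : ¬ IsU x ((Q.coordinates hθ).zeta c)) :
    IsAdapted ((Q.coordinates hθ).form ω) (Q.boundaryEqn hθ c) (6 * p) x := by
  have hp := (Fact.out : p.Prime)
  have hL : CharP (CurveField W) p :=
    charP_of_injective_algebraMap (algebraMap k (CurveField W)).injective p
  obtain ⟨i, _ | _⟩ := c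
  · exact absurd (UnitAt.one x) hz
  set G := Q.coordinates hθ
  set h : KX := Q.h with hh
  set ζ : KX := G.zeta (i, true) with hζ
  have hX : toK (Q.chart (i, true)) Polynomial.X = ζ := by
    rw [Q.toK_inf_eq, eval₂_X]
    rfl
  have hu₀ : IsU x (h * ζ ^ p) ∧
      IsU x ((h - (1 : KX)) * ζ ^ p) := by
    obtain ⟨q, rfl⟩ := hx
    have hXq : (Polynomial.X : (chartRing W i)[X]) ∈ q.asIdeal := by
      by_contra h1
      exact hz (hX ▸ (unitAt_toK_iff (Q.chart (i, true)) q _).2 h1)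
    have h1 : D.hInf i ∉ q.asIdeal := fun h1 => by
      refine q.isPrime.ne_top ((Ideal.eq_top_iff_one _).2 ?_)
      have h2 := add_mem (add_mem h1 (q.asIdeal.mul_mem_left
        (C (algebraMap k (chartRing W i) (D.lam * D.τ ^ (p - 1))))
        (Ideal.pow_mem_of_mem _ hXq (p - 1) (by have := hp.two_le; omega))))
        (q.asIdeal.mul_mem_left (C (algebraMap k (chartRing W i) (D.τ ^ p) * D.b i))
          (Ideal.pow_mem_of_mem _ hXq p hp.pos))
      rwa [AtiyahData.hInf, sub_add_eq_add_sub, sub_add_cancel, sub_add_cancel] at h2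
    have h2 : D.hInf i - Polynomial.X ^ p ∉ q.asIdeal := fun h2 => h1 (by
      have := add_mem h2 (Ideal.pow_mem_of_mem _ hXq p hp.pos)
      rwa [sub_add_cancel] at this)
    have h3 := (unitAt_toK_iff (Q.chart (i, true)) q _).2 h1
    have h4 := (unitAt_toK_iff (Q.chart (i, true)) q _).2 h2
    have e : toK (Q.chart (i, true)) (D.hInf i) = h * ζ ^ p := Q.toK_hInf i
    refine ⟨e ▸ h3, ?_⟩
    have e' : toK (Q.chart (i, true)) (D.hInf i - Polynomial.X ^ p) =
        (h - (1 : KX)) * ζ ^ p := by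
      refine (map_sub (toK (Q.chart (i, true))) _ _).trans ?_
      rw [map_pow, e, hX]
      exact (sub_one_mul h (ζ ^ p)).symm
    exact e' ▸ h4
  obtain ⟨l, hl⟩ := G.exists_unitAt_slope hx
  have hl0 : G.ψ (chartSlope W i l) ≠ 0 := hl.ne_zero
  have hcr : Reg x (G.ψ (coordFun W i l)) :=
    G.regularAt_base hx (coordFun_mem W i l)
  obtain ⟨α, hα⟩ := hval _ hcr
  have hζ0 : ζ ≠ 0 := G.zeta_ne_zero _
  have hDξ : 𝖣 (G.ψ (coordFun W i l) - algebraMap k KX α) =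
      G.ψ (chartSlope W i l) • ω := by
    rw [Ruled.D_sub_algebraMap, hω i l]
  have hDζ : 𝖣 ζ = (-1 * ζ ^ 2) • 𝖣 (G.z i) + (0 : KX) • ω := by
    rw [zero_smul, add_zero]
    exact G.D_fiberCoord (i, true)
  refine isAdapted_of_eq (r := 5 * p) (s := G.ψ (chartSlope W i l) * (-1 * ζ ^ 2))
    (mul_ne_zero hl0 (mul_ne_zero (neg_ne_zero.2 one_ne_zero) (pow_ne_zero 2 hζ0)))
    (Q.wedge_two_eq hθ hω hDξ hDζ) (hcr.sub (regularAt_baseMap f x α)) hα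
    (G.regularAt_fiberCoord hx) hz (by have := hp.pos; omega) hζ0
    (((hu₀.1.pow 4).mul (hu₀.2.pow 4)).mul (hl.neg.pow (6 * p))) ?_
  generalize G.ψ (chartSlope W i l) = s
  have e (h ζ s : KX) : (h * (h - 1)) ^ 4 * ζ ^ p * (s * (-1 * ζ ^ 2)) ^ (6 * p) =
      (h * ζ ^ p) ^ 4 * ((h - 1) * ζ ^ p) ^ 4 * (-s) ^ (6 * p) * ζ ^ (5 * p) := by
    rw [show s * (-1 * ζ ^ 2) = -s * ζ ^ 2 by ring]
    generalize -s = s'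
    ring
  exact e h ζ s

include hθ in
theorem Ruled.isTerminalPair [IsLocallyNoetherian X]
    (hn : Module.finrank KX Ω[KX⁄k] = 2)
    (hr : D.a = atiyahFun W) {K Δ Θ : QDivisor X}
    (hK : IsEquation Q.chart K.1 (6 * p) (fun c => (Q.zeta c ^ (12 * p))⁻¹))
    (hΔ : IsEquation Q.chart Δ.1 (6 * p) (fun c => toK (Q.chart c) (D.eqDelta c)))
    (hΘ : IsEquation Q.chart Θ.1 (6 * p) (fun c => toK (Q.chart c) (D.eqTheta c))) :
    IsTerminalPair f 2 (Δ + Θ) ∧ IsCanonicalDivisor f 2 K := by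
  have hp := (Fact.out : p.Prime)
  have hL : CharP (CurveField W) p :=
    charP_of_injective_algebraMap (algebraMap k (CurveField W)).injective p
  have hN : 0 < 6 * p := by have := hp.pos; omega
  set G := Q.coordinates hθ
  obtain ⟨ω, hω⟩ := exists_invariantForm G.ψ 𝖣
  have hω' : G.IsInvariant ω := hω
  obtain ⟨c₀, hc₀⟩ := Q.covers (genericPoint X)
  obtain ⟨x, φ, hx, hφ, hu⟩ := G.exists_form_eq_wedge hω' hn hc₀
  have hform0 : G.form ω ≠ 0 := by
    rw [hφ]
    exact smul_ne_zero (left_ne_zero_of_mul hu.ne_zero) hx.2.1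
  have hω0 : ω ≠ 0 := by
    rintro rfl
    refine hform0 ?_
    have := ιMulti_vecCons_smul (0 : Ω[KX⁄k]) (Matrix.vecCons (𝖣 (G.z 0))
      (fun j => 𝖣 (G.T j))) (0 : KX)
    rw [smul_zero, zero_smul] at this
    exact this
  have hdiv : IsDivisorOfForm f 2 φ x K := G.isDivisorOfForm hω' hn Q.covers hN
    (hK.congr rfl fun c => by rw [← mul_assoc]; rfl) hφ
  have hE : IsEquation Q.chart (K + (Δ + Θ)).1 (6 * p) (fun c => Q.boundaryEqn hθ c) := by
    refine (hK.add (hΔ.add hΘ)).congr rfl fun c => ?_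
    rw [Q.toK_eqDelta, Q.toK_eqTheta]
    have h0 := Q.zeta_ne_zero c
    have : (Q.zeta c ^ (12 * p))⁻¹ * ((Q.h * (Q.h - 1)) ^ 4 * Q.zeta c ^ (12 * p) * Q.zeta c ^ p) =
        (Q.h * (Q.h - 1)) ^ 4 * Q.zeta c ^ p := by
      field_simp
    exact this
  refine ⟨⟨Q.isNormalScheme, φ, x, K, hdiv, hE.isQCartier Q.covers hN, ?_⟩, φ, x, hdiv⟩
  intro Y _ _ b _ hY hb φ' x' hφ' hx' e he hbe v q hv hq
  obtain ⟨c, hc⟩ := Q.covers (b e)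
  have hval : ∀ φ : KX, Reg (b e) φ →
      ∃ c : k, ¬ IsU (b e) (φ - algebraMap k KX c) := by
    obtain ⟨s, hs⟩ := hc
    have := s.isPrime
    have h0 : s.asIdeal.height ≠ 0 := fun h0 => by
      rw [Ideal.height_eq_zero_iff, IsDomain.minimalPrimes_eq_singleton_bot] at h0
      have h1 : s = specBot _ := PrimeSpectrum.ext h0
      exact hb.coheight_ne_zero hY he f (by rw [← hs, h1, chart_bot])
    have h1 : s.asIdeal.height ≠ 1 := fun h1 => hbe (by rw [← hs, coheight_chart, h1])
    obtain ⟨χ, hχ⟩ := exists_value_of_height (k := k) (ringKrullDim_chartRing_polynomial_le W c.1)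
      s.asIdeal h0 h1
    rw [← hs]
    intro ψ hψ
    exact exists_not_unitAt_sub f (Q.chart c) (Q.chart_comp c) hχ hψ
  obtain ⟨ξ, η, κ, r, hF, hξ, hξ', hη, hη', hrN, hg⟩ :
      IsAdapted (G.form ω) (Q.boundaryEqn hθ c) (6 * p) (b e) := by
    by_cases hz : IsU (b e) (G.zeta c)
    · exact Q.isAdapted_of_unitAt hθ hω' hω0 (fun _ => hr) hc hval hz
    · exact Q.isAdapted_of_not_unitAt hθ hω' hc hval hz
  exact discrepancy_pos (Q.chart c) Q.isNormalScheme hY hb he hc (hφ.symm.trans hF) hξ hξ' hη hη'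
    hrN (hE c (b e) hc) hg hφ' hx' hv hq

end Terminal


section Threefold

variable {p : ℕ} {k : Type u} [Field k] {W : WeierstrassCurve k}
  {D : AtiyahData p k (CurveField W) (fun i => chartRing W i)}
  {S : Scheme.{u}} [IsIntegral S] {g : S ⟶ AffineLine k} (Q : Ruled D.family g)
  (hθ : ∀ i, D.θ i = (chartRing W i).val)

theorem Ruled.toK_C {p : ℕ} {R M : Type u} [CommRing R] [Field M] [Algebra R M]
    {B : Fin 2 → Type u} [∀ i, CommRing (B i)] [∀ i, IsDomain (B i)]
    [∀ i, Algebra R (B i)] {D : AtiyahData p R M B}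
    {X : Scheme.{u}} [IsIntegral X] {f : X ⟶ Spec (.of R)} (Q : Ruled D f) (c : Fin 2 × Bool)
    (b : B c.1) : toK (Q.chart c) (C b) = Q.Φ (C (D.θ c.1 b)) := by
  obtain ⟨i, _ | _⟩ := c
  · rw [Q.toK_fin_eq, eval₂_C]
    rfl
  · exact Q.toK_inf_C i b

theorem Ruled.toK_X {p : ℕ} {R M : Type u} [CommRing R] [Field M] [Algebra R M]
    {B : Fin 2 → Type u} [∀ i, CommRing (B i)] [∀ i, IsDomain (B i)]
    [∀ i, Algebra R (B i)] {D : AtiyahData p R M B}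
    {X : Scheme.{u}} [IsIntegral X] {f : X ⟶ Spec (.of R)} (Q : Ruled D f) (c : Fin 2 × Bool) :
    toK (Q.chart c) Polynomial.X = if c.2 then (Q.z c.1)⁻¹ else Q.z c.1 := by
  obtain ⟨i, _ | _⟩ := c
  · rw [Q.toK_fin_eq, eval₂_X]
    rfl
  · rw [Q.toK_inf_eq, eval₂_X]
    rfl

theorem Ruled.baseMap_comp_toSpec (r : k) :
    baseMap (g ≫ AffineLine.toSpec k) r = Q.Φ (C (algebraMap k[X] _ (C r))) := by
  rw [← Q.baseMap_eq, baseMap_eq_toK (Q.chart (0, false)) g _ (Q.chart_comp (0, false)),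
    baseMap_eq_toK (Q.chart (0, false)) (g ≫ AffineLine.toSpec k) ((algebraMap k[X] _).comp C)]
  · rfl
  · rw [← Category.assoc, Q.chart_comp, AffineLine.toSpec, ← Spec.map_comp, ← CommRingCat.ofHom_comp]

include hθ in
theorem Ruled.toK_C_C (c : Fin 2 × Bool) (u : chartRing W c.1) :
    toK (Q.chart c) (C (FamilyRing.C u)) = Q.Φ (C (algebraMap (FamilyRing (CurveField W)) _
      (FamilyRing.C (u : CurveField W)))) := by
  rw [Q.toK_C]
  refine congrArg (fun a => Q.Φ (C (algebraMap (FamilyRing (CurveField W))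
    (FamilyField (CurveField W)) a))) ?_
  refine (Polynomial.map_C _).trans ?_
  rw [hθ]
  rfl

/-- The coordinates on a family of ruled surfaces over a Weierstrass curve. -/
def Ruled.familyCoordinates : RuledCoordinates W (g ≫ AffineLine.toSpec k) 1 Q.chart where
  ψ := { (Q.Φ.comp C).comp ((algebraMap (FamilyRing (CurveField W)) (FamilyField (CurveField W))).comp
          FamilyRing.C) with
          commutes' := fun r => by
            refine Eq.trans ?_ (Q.baseMap_comp_toSpec r).symm
            refine congrArg (fun a => Q.Φ (C (algebraMap (FamilyRing (CurveField W))
              (FamilyField (CurveField W)) a))) ?_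
            exact (Polynomial.map_C _).symm }
  z := fun i => Q.z i
  z_ne_zero := Q.z_ne_zero
  T := fun _ => Q.Φ (C (algebraMap k[X] _ Polynomial.X))
  base_mem := fun c u hu => ⟨C (FamilyRing.C ⟨u, hu⟩), Q.toK_C_C hθ c ⟨u, hu⟩⟩
  coord_mem := fun c => ⟨Polynomial.X, Q.toK_X c⟩
  T_mem := fun c _ => ⟨C (algebraMap k[X] _ Polynomial.X), by
    rw [Q.toK_C, AlgHom.commutes]⟩
  generates := by
    intro c a
    set V : Subalgebra k (FunctionField (g ≫ AffineLine.toSpec k)) := Algebra.adjoin k _ with hV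
    have hC (u : chartRing W c.1) : (show FunctionField (g ≫ AffineLine.toSpec k) from
        toK (Q.chart c) (C (FamilyRing.C u))) ∈ V :=
      Algebra.subset_adjoin (Or.inl ⟨u, u.2, (Q.toK_C_C hθ c u).symm⟩)
    have hX : (show FunctionField (g ≫ AffineLine.toSpec k) from
        toK (Q.chart c) Polynomial.X) ∈ V :=
      Algebra.subset_adjoin (Or.inr (Or.inl (Q.toK_X c)))
    have hT : (show FunctionField (g ≫ AffineLine.toSpec k) from
        toK (Q.chart c) (C (algebraMap k[X] _ Polynomial.X))) ∈ V :=
      Algebra.subset_adjoin (Or.inr (Or.inr ⟨0, by rw [Q.toK_C, AlgHom.commutes]⟩))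
    have hCC (b : FamilyRing (chartRing W c.1)) : (show FunctionField (g ≫ AffineLine.toSpec k) from
        toK (Q.chart c) (C b)) ∈ V := by
      have h1 (b : (chartRing W c.1)[X]) : (show FunctionField (g ≫ AffineLine.toSpec k) from
          toK (Q.chart c) (C (show FamilyRing (chartRing W c.1) from b))) ∈ V := by
        induction b using Polynomial.induction_on' with
        | add a b ha hb =>
          refine cast (congrArg (· ∈ V) ?_) (add_mem ha hb)
          exact (((toK (Q.chart c)).comp C).map_add
            (show FamilyRing (chartRing W c.1) from a) b).symm
        | monomial n u =>
          refine cast (congrArg (· ∈ V) ?_) (mul_mem (hC u) (pow_mem hT n))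
          have e : (show FamilyRing (chartRing W c.1) from monomial n u) =
              FamilyRing.C u * (algebraMap k[X] _ Polynomial.X) ^ n := by
            refine (C_mul_X_pow_eq_monomial (R := chartRing W c.1)).symm.trans ?_
            rw [FamilyRing.algebraMap_eq, map_X]
            rfl
          rw [e]
          exact ((((toK (Q.chart c)).comp C).map_mul _ _).trans
            (congrArg (_ * ·) (((toK (Q.chart c)).comp C).map_pow _ n))).symm
      exact h1 b
    induction a using Polynomial.induction_on' with
    | add a b ha hb =>
      have := add_mem ha hb
      rw [map_add]
      exact this
    | monomial n u =>
      have := mul_mem (hCC u) (pow_mem hX n)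
      rw [← C_mul_X_pow_eq_monomial, map_mul, map_pow]
      exact this
  transition := ⟨Q.Φ (C (algebraMap k[X] _ Polynomial.X)), Algebra.subset_adjoin ⟨0, rfl⟩, D.a, by
    change Q.Φ _ - Q.Φ _ = Q.Φ (C _) * Q.Φ (C (D.family.a))
    rw [← map_sub, ← map_mul, ← C_mul]
    congr 1
    simp [AtiyahData.shift]
    exact Or.inl rfl⟩

include hθ in
theorem Ruled.isCanonicalDivisor_family [IsAlgClosed k] [W.IsElliptic] [IsLocallyNoetherian S]
    (hn : Module.finrank (FunctionField (g ≫ AffineLine.toSpec k))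
      Ω[FunctionField (g ≫ AffineLine.toSpec k)⁄k] = 3) {K : QDivisor S} {N : ℕ} (hN : 0 < N)
    (hK : IsEquation Q.chart K.1 N (fun c => (Q.zeta c ^ (2 * N))⁻¹)) :
    IsCanonicalDivisor (g ≫ AffineLine.toSpec k) 3 K := by
  set G := Q.familyCoordinates hθ
  obtain ⟨ω, hω⟩ := exists_invariantForm G.ψ (KaehlerDifferential.D k _)
  have hω' : G.IsInvariant ω := hω
  obtain ⟨c₀, hc₀⟩ := Q.covers (genericPoint S)
  obtain ⟨x, φ, -, hφ, -⟩ := G.exists_form_eq_wedge hω' hn hc₀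
  exact ⟨φ, x, G.isDivisorOfForm hω' hn Q.covers hN hK hφ⟩

end Threefold

section Smooth

variable {k : Type u} [Field k]

theorem smooth_affineLine : SmoothOfRelativeDimension 1 (AffineLine.toSpec k) := by
  rw [AffineLine.toSpec, HasRingHomProperty.Spec_iff (P := @SmoothOfRelativeDimension 1)]
  have := isStandardSmooth_polynomial k
  rw [← RingHom.isStandardSmoothOfRelativeDimension_algebraMap] at this
  exact RingHom.locally_of RingHom.isStandardSmoothOfRelativeDimension_respectsIso _ this

theorem smooth_fiber {S : Scheme.{u}} (g : S ⟶ AffineLine k) (h : SmoothOfRelativeDimension 2 g)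
    (t : k) : SmoothOfRelativeDimension 2 (fiberToSpec g t) :=
  (smoothOfRelativeDimension_isStableUnderBaseChange 2).of_isPullback
    (IsPullback.of_hasPullback g (AffineLine.point t)) h

theorem smooth_comp_affineLine {S : Scheme.{u}} (g : S ⟶ AffineLine k)
    (h : SmoothOfRelativeDimension 2 g) :
    SmoothOfRelativeDimension 3 (g ≫ AffineLine.toSpec k) := by
  have := smooth_affineLine (k := k)
  exact smoothOfRelativeDimension_comp 2 1 g (AffineLine.toSpec k)

end Smooth


section Line

open HomogeneousLocalization

attribute [local instance] MvPolynomial.gradedAlgebra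

local notation "𝒮" => MvPolynomial.homogeneousSubmodule

instance (R : Type u) [CommRing R] (n : ℕ) : (ProjSpace R n).IsSeparated :=
  inferInstanceAs (Scheme.IsSeparated (Proj _))

variable (k : Type u) [Field k]

/-- The ring of functions on the affine part of the projective line where `X i` does not vanish. -/
abbrev LineRing (i : Fin 2) : Type u := Away
  (𝒮 (Fin 2) k) (MvPolynomial.X i)

/-- The polynomials in the inhomogeneous coordinate. -/
def lineHom (i : Fin 2) : k[X] →+* LineRing k i :=
  eval₂RingHom ((fromZeroRingHom _ (Submonoid.powers (MvPolynomial.X i))).comp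
      (algebraMap k (𝒮 (Fin 2) k 0)))
    (Away.mk (𝒮 (Fin 2) k)
      (MvPolynomial.isHomogeneous_X k i) 1 (MvPolynomial.X (1 - i))
      (MvPolynomial.isHomogeneous_X k (1 - i)))

variable {k} in
theorem evalAway_lineHom {K : Type u} [Field K] [Algebra k K] (s : Fin 2 → K) (i : Fin 2)
    (hs : MvPolynomial.aeval (R := k) s (MvPolynomial.X i) ≠ 0) (f : k[X]) :
    evalAway s _ hs (lineHom k i f) = aeval (s (1 - i) / s i) f := by
  have h : (evalAway s _ hs).comp (lineHom k i) = (aeval (R := k) (s (1 - i) / s i)).toRingHom := by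
    refine Polynomial.ringHom_ext (fun r => ?_) ?_
    · rw [RingHom.comp_apply, lineHom, coe_eval₂RingHom, eval₂_C]
      refine (evalAway_fromZero (n := 1) s hs (X_mem_deg_one k i) r).trans ?_
      exact (aeval_C (s (1 - i) / s i) r).symm
    · rw [RingHom.comp_apply, lineHom, coe_eval₂RingHom, eval₂_X]
      refine (evalAway_mk (n := 1) s hs (X_mem_deg_one k i) 1 _ _).trans ?_
      simp
  exact congrArg (fun f' => f' f) h

theorem lineHom_bijective (i : Fin 2) : Function.Bijective (lineHom k i) := by
  constructor
  · let s : Fin 2 → FractionRing k[X] := fun j => if j = i then 1 else algebraMap k[X] _ X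
    have hs : MvPolynomial.aeval (R := k) s (MvPolynomial.X i) ≠ 0 := by simp [s]
    have h1 : s (1 - i) / s i = algebraMap k[X] _ X := by
      have : 1 - i ≠ i := by omega
      simp [s, this]
    refine Function.Injective.of_comp (f := evalAway s _ hs) fun f f' h => ?_
    simp only [Function.comp_apply, evalAway_lineHom, h1, aeval_algebraMap_apply, aeval_X_left_apply] at h
    exact IsFractionRing.injective k[X] (FractionRing k[X]) h
  · intro a
    let M := MvPolynomial (Fin 2) k
    let s : Fin 2 → FractionRing M := fun j => algebraMap M _ (MvPolynomial.X j)
    have hX (j : Fin 2) : s j ≠ 0 := (map_ne_zero_iff _ (IsFractionRing.injective M _)).2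
      (MvPolynomial.X_ne_zero j)
    have haev (b : M) : MvPolynomial.aeval s b = algebraMap M (FractionRing M) b := by
      have : MvPolynomial.aeval s = IsScalarTower.toAlgHom k M (FractionRing M) := by
        ext j
        rw [MvPolynomial.aeval_X]
        rfl
      rw [this]
      rfl
    have hs : MvPolynomial.aeval (R := k) s (MvPolynomial.X i) ≠ 0 := by
      rw [MvPolynomial.aeval_X]
      exact hX i
    have hinj : Function.Injective (evalAway s _ hs) := by
      rw [injective_iff_map_eq_zero]
      intro b hb
      obtain ⟨m, b, hb', rfl⟩ :=
        Away.mk_surjective _ (X_mem_deg_one k i) b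
      rw [evalAway_mk, div_eq_zero_iff, haev] at hb
      rcases hb with hb | hb
      · rw [map_eq_zero_iff _ (IsFractionRing.injective M _)] at hb
        subst hb
        apply val_injective
        rw [Away.val_mk, val_zero,
          Localization.mk_zero]
      · exact absurd hb (pow_ne_zero _ hs)
    obtain ⟨m, b, hb, rfl⟩ :=
      Away.mk_surjective _ (X_mem_deg_one k i) a
    refine ⟨MvPolynomial.aeval (fun j => if j = i then 1 else X) b, hinj ?_⟩
    have hb' : b.IsHomogeneous m := by simpa using hb
    rw [evalAway_lineHom, evalAway_mk, MvPolynomial.aeval_X, aeval_div_pow s _ hb']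
    have : (aeval (R := k) (s (1 - i) / s i)).comp
        (MvPolynomial.aeval fun j => if j = i then (1 : k[X]) else X) =
        MvPolynomial.aeval (fun j => s j / s i) := by
      ext j
      rcases eq_or_ne j i with rfl | h
      · simp [hX]
      · obtain rfl : j = 1 - i := by omega
        simp [h]
    exact congrArg (fun f => f b) this

/-- The ring of functions on an affine part of the projective line is a polynomial ring. -/
def lineEquiv (i : Fin 2) : k[X] ≃+* LineRing k i :=
  RingEquiv.ofBijective _ (lineHom_bijective k i)

instance (i : Fin 2) : IsIso (CommRingCat.ofHom (lineEquiv k i).symm.toRingHom) := by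
  rw [ConcreteCategory.isIso_iff_bijective]
  exact (lineEquiv k i).symm.bijective

/-- The affine charts of the projective line. -/
def lineChart (i : Fin 2) : Spec (.of k[X]) ⟶ ProjSpace k 1 :=
  Spec.map (CommRingCat.ofHom (lineEquiv k i).symm.toRingHom) ≫ coordι k 1 i

instance (i : Fin 2) : IsOpenImmersion (lineChart k i) := by
  unfold lineChart
  infer_instance

theorem opensRange_lineChart (i : Fin 2) : (lineChart k i).opensRange =
    Proj.basicOpen (𝒮 (Fin 2) k) (MvPolynomial.X i) := by
  refine Eq.trans ?_ (opensRange_coordι k 1 i)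
  exact Scheme.Hom.opensRange_comp_of_isIso _ _

theorem lineChart_covers (x : ProjSpace k 1) : ∃ i, x ∈ (lineChart k i).opensRange := by
  have h : x ∈ (⨆ i, Proj.basicOpen (𝒮 (Fin 2) k)
      (MvPolynomial.X i) : (ProjSpace k 1).Opens) := by
    have h := iSup_basicOpen_X_eq_top k 1
    exact h ▸ (trivial : x ∈ (⊤ : (ProjSpace k 1).Opens))
  obtain ⟨i, hi⟩ := TopologicalSpace.Opens.mem_iSup.1 h
  exact ⟨i, by rw [opensRange_lineChart]; exact hi⟩

theorem lineChart_toSpec (i : Fin 2) : lineChart k i ≫ ProjSpace.toSpec k 1 =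
    specMap C := by
  rw [lineChart, Category.assoc, coordι_toSpec, ← Spec.map_comp, ← CommRingCat.ofHom_comp]
  refine congrArg (fun f => specMap f) (RingHom.ext fun r => ?_)
  refine (lineEquiv k i).symm_apply_eq.2 ?_
  exact (eval₂_C _ _).symm

variable {k} in
theorem lineChart_eq {K : Type u} [Field K] (φ : k →+* K) {w : K} (hw : w ≠ 0) :
    specMap (eval₂RingHom φ w) ≫ lineChart k 0 =
      specMap (eval₂RingHom φ w⁻¹) ≫ lineChart k 1 := by
  let _ := φ.toAlgebra
  let s : Fin 2 → K := ![1, w]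
  have hs (i : Fin 2) : s i ≠ 0 := by fin_cases i <;> simp [s, hw]
  have h (i : Fin 2) (v : K) (hv : s (1 - i) / s i = v) :
      specMap (eval₂RingHom φ v) ≫ lineChart k i =
      specMap (evalAway s _ (aeval_X_ne_zero k s hs i)) ≫ coordι k 1 i := by
    rw [lineChart, ← Category.assoc, ← Spec.map_comp, ← CommRingCat.ofHom_comp]
    congr 2
    refine congrArg CommRingCat.ofHom (RingHom.ext fun a => ?_)
    obtain ⟨f, rfl⟩ := (lineEquiv k i).surjective a
    refine Eq.trans ?_ (evalAway_lineHom s i (aeval_X_ne_zero k s hs i) f).symm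
    rw [RingHom.comp_apply, hv]
    exact congrArg (eval₂ φ v) ((lineEquiv k i).symm_apply_apply f)
  rw [h 0 w (by simp [s]), h 1 w⁻¹ (by simp [s])]
  exact evalAway_coordι_eq (n := 1) s hs 0 1

theorem germ_eq_chartGerm {X : Scheme.{u}} {A : Type u} [CommRing A] (j : Spec (.of A) ⟶ X)
    [IsOpenImmersion j] {U : X.Opens} (hU : ⊤ ≤ j ⁻¹ᵁ U) {s : Γ(X, U)} {a : A}
    (h : j.appLE U ⊤ hU s = (Scheme.ΓSpecIso (.of A)).inv a) (x : X) (hx : x ∈ j.opensRange)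
    (hx' : x ∈ U) : X.presheaf.germ U x hx' s = chartGerm j x hx a := by
  have hle : j.opensRange ≤ U := by
    rintro _ ⟨q, rfl⟩
    exact hU (trivial : q ∈ ⊤)
  have h1 : X.presheaf.map (homOfLE hle).op s = chartSec j a := by
    apply appLE_opensRange_injective j
    rw [appLE_chartSec, ← h, ← CommRingCat.comp_apply, Scheme.Hom.map_appLE]
  rw [chartGerm, RingHom.comp_apply, ← h1]
  exact (TopCat.Presheaf.germ_res_apply _ _ _ _ _).symm

theorem awayToSection_awayι_appLE {σ A : Type*} [CommRing A] [SetLike σ A] [AddSubgroupClass σ A]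
    (H : ℕ → σ) [GradedRing H] {f : A} {m : ℕ} (f_deg : f ∈ H m) (hm : 0 < m)
    (hU : ⊤ ≤ Proj.awayι H f f_deg hm ⁻¹ᵁ Proj.basicOpen H f) :
    Proj.awayToSection H f ≫ (Proj.awayι H f f_deg hm).appLE (Proj.basicOpen H f) ⊤ hU =
      (Scheme.ΓSpecIso _).inv := by
  set e := Proj.basicOpenIsoSpec H f f_deg hm
  have h1 : Proj.awayToSection H f ≫ (Proj.basicOpen H f).topIso.inv =
      (Scheme.ΓSpecIso _).inv ≫ e.hom.appTop :=
    (Iso.eq_inv_comp _).2 (Proj.basicOpenToSpec_app_top H f).symm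
  have h2 : (e.inv ≫ (Proj.basicOpen H f).ι).appLE (Proj.basicOpen H f) ⊤ hU =
      (Proj.basicOpen H f).topIso.inv ≫ e.inv.appTop := by
    rw [Scheme.Hom.appTop, Scheme.Hom.app_eq_appLE]
    refine Eq.trans (Scheme.Hom.appLE_comp_appLE e.inv (Proj.basicOpen H f).ι _ ⊤ ⊤
      (Proj.basicOpen H f).ι_preimage_self.ge le_top).symm ?_
    rw [Scheme.Opens.ι_appLE]
    rfl
  have h3 : e.hom.appTop ≫ e.inv.appTop = 𝟙 _ := by
    rw [← Scheme.Hom.comp_appTop, e.inv_hom_id, Scheme.Hom.id_appTop]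
  refine (congrArg (Proj.awayToSection H f ≫ ·) h2).trans ?_
  refine (Category.assoc _ _ _).symm.trans ?_
  rw [h1]
  refine (Category.assoc _ _ _).trans ?_
  exact (congrArg ((Scheme.ΓSpecIso _).inv ≫ ·) h3).trans (Category.comp_id _)

theorem P1Coord_appLE (hU : ⊤ ≤ lineChart k 0 ⁻¹ᵁ P1Chart k) :
    (lineChart k 0).appLE (P1Chart k) ⊤ hU (P1Coord k) = (Scheme.ΓSpecIso (.of k[X])).inv X := by
  have hU' : ⊤ ≤ coordι k 1 0 ⁻¹ᵁ P1Chart k := fun x _ => by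
    have : coordι k 1 0 x ∈ (coordι k 1 0).opensRange := ⟨x, rfl⟩
    rw [opensRange_coordι] at this
    exact this
  have h1 : (lineChart k 0).appLE (P1Chart k) ⊤ hU = (coordι k 1 0).appLE (P1Chart k) ⊤ hU' ≫
      (Spec.map (CommRingCat.ofHom (lineEquiv k 0).symm.toRingHom)).appTop := by
    rw [Scheme.Hom.appTop, Scheme.Hom.app_eq_appLE]
    exact (Scheme.Hom.appLE_comp_appLE _ (coordι k 1 0) _ ⊤ ⊤ hU' le_top).symm
  have h2 := ConcreteCategory.congr_hom (awayToSection_awayι_appLE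
    (𝒮 (Fin 2) k) (X_mem_deg_one k 0) one_pos hU')
    (lineEquiv k 0 X)
  have h3 : lineEquiv k 0 X = Away.mk
      (𝒮 (Fin 2) k) (MvPolynomial.isHomogeneous_X k 0) 1
      (MvPolynomial.X 1) (MvPolynomial.isHomogeneous_X k 1) := eval₂_X _ _
  have h4 := ConcreteCategory.congr_hom (Scheme.ΓSpecIso_inv_naturality
    (CommRingCat.ofHom (lineEquiv k 0).symm.toRingHom)) (lineEquiv k 0 X)
  rw [h1, P1Coord, ← h3]
  refine (congrArg (Spec.map (CommRingCat.ofHom (lineEquiv k 0).symm.toRingHom)).appTop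
    h2).trans (h4.symm.trans ?_)
  exact congrArg (Scheme.ΓSpecIso (.of k[X])).inv ((lineEquiv k 0).symm_apply_apply X)

variable {k}

theorem isPullbackOfCoord {P : Scheme.{u}} [IsIntegral P] {V : P.Opens} {A : Type u} [CommRing A]
    [IsDomain A] (j : Spec (.of A) ⟶ V.toScheme) [IsOpenImmersion j] (q : V.toScheme ⟶ ProjSpace k 1)
    (α : k[X] →+* A) (h : j ≫ q = specMap α ≫ lineChart k 0) :
    IsPullbackOfCoord q (toK (j ≫ V.ι) (α X)) := by
  have hg : (j ≫ V.ι) (specBot A) = genericPoint P := chart_bot _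
  have hV : genericPoint P ∈ V := by
    rw [← hg, Scheme.Hom.comp_apply]
    exact (j (specBot A)).2
  have hj : (⟨genericPoint P, hV⟩ : V.toScheme) = j (specBot A) := Subtype.ext (hg.symm.trans
    (Scheme.Hom.comp_apply j V.ι (specBot A)))
  have hy : (⟨genericPoint P, hV⟩ : V.toScheme) ∈ j.opensRange := ⟨_, hj.symm⟩
  have hx : q ⟨genericPoint P, hV⟩ ∈ (lineChart k 0).opensRange := by
    rw [hj, ← Scheme.Hom.comp_apply, h, Scheme.Hom.comp_apply]
    exact ⟨_, rfl⟩
  have hq : q ⟨genericPoint P, hV⟩ ∈ P1Chart k := by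
    rw [opensRange_lineChart] at hx
    exact hx
  have hU : ⊤ ≤ lineChart k 0 ⁻¹ᵁ P1Chart k := fun x _ => by
    have : lineChart k 0 x ∈ (lineChart k 0).opensRange := ⟨x, rfl⟩
    rw [opensRange_lineChart] at this
    exact this
  refine ⟨hV, hq, ?_⟩
  have e : (ProjSpace k 1).presheaf.germ (P1Chart k) (q ⟨genericPoint P, hV⟩) hq (P1Coord k) =
      chartGerm (lineChart k 0) _ hx X :=
    germ_eq_chartGerm (lineChart k 0) hU (P1Coord_appLE k hU) _ hx hq
  rw [e, stalkMap_chartGerm (lineChart k 0) j q α h _ hy hx]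
  have hy' : genericPoint P ∈ (j ≫ V.ι).opensRange := ⟨_, hg⟩
  have e2 : toK (j ≫ V.ι) (α X) = chartGerm (j ≫ V.ι) (genericPoint P) hy' (α X) := by
    rw [← toK_eq (j ≫ V.ι) _ hy']
    simp only [RingHom.algebraMap_toAlgebra]
    rw [TopCat.Presheaf.stalkSpecializes_refl]
    rfl
  have e3 := stalkMap_chartGerm (j ≫ V.ι) j V.ι (RingHom.id A)
    (by rw [CommRingCat.ofHom_id, Spec.map_id, Category.id_comp]) ⟨genericPoint P, hV⟩ hy hy' (α X)
  rw [← Scheme.Opens.stalkIso_inv] at e3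
  rw [e2]
  have e4 := congrArg (V.stalkIso ⟨genericPoint P, hV⟩).hom.hom e3
  refine Eq.trans ?_ e4
  exact (ConcreteCategory.congr_hom (V.stalkIso ⟨genericPoint P, hV⟩).inv_hom_id _).symm

end Line

section Product

variable {k : Type u} [Field k]

/-- Multiplication of the coordinate by a constant. -/
def scaleHom (κ : k) : k[X] →+* k[X] := eval₂RingHom C (C κ * X)

theorem scaleHom_comp {κ κ' : k} (h : κ * κ' = 1) :
    (scaleHom κ).comp (scaleHom κ') = RingHom.id _ := by
  refine Polynomial.ringHom_ext (fun a => ?_) ?_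
  · simp [scaleHom]
  · simp [scaleHom, ← mul_assoc, ← C_mul, mul_comm κ', h]

theorem isIso_scaleHom {κ : k} (h : κ ≠ 0) : IsIso (CommRingCat.ofHom (scaleHom κ)) := by
  refine ⟨CommRingCat.ofHom (scaleHom κ⁻¹), ?_, ?_⟩ <;>
    rw [← CommRingCat.ofHom_comp, scaleHom_comp] <;> first | rfl | simp [h]

/-- The charts of the projective line with the coordinate multiplied by a constant. -/
def scaledChart (κ : k) (s : Bool) : Spec (.of k[X]) ⟶ ProjSpace k 1 :=
  specMap (scaleHom (if s then κ⁻¹ else κ)) ≫ lineChart k (if s then 1 else 0)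

theorem isIso_scaledChart {κ : k} (h : κ ≠ 0) (s : Bool) :
    IsIso (specMap (scaleHom (if s then κ⁻¹ else κ))) := by
  have : (if s then κ⁻¹ else κ) ≠ 0 := by split_ifs <;> simp [h]
  have := isIso_scaleHom this
  infer_instance

theorem isOpenImmersion_scaledChart {κ : k} (h : κ ≠ 0) (s : Bool) :
    IsOpenImmersion (scaledChart κ s) := by
  have := isIso_scaledChart h s
  unfold scaledChart
  infer_instance

theorem scaledChart_toSpec (κ : k) (s : Bool) : scaledChart κ s ≫ ProjSpace.toSpec k 1 =
    specMap C := by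
  rw [scaledChart, Category.assoc, lineChart_toSpec, ← Spec.map_comp, ← CommRingCat.ofHom_comp]
  exact congrArg (fun f => specMap f) (RingHom.ext fun r => eval₂_C _ _)

theorem scaledChart_covers {κ : k} (h : κ ≠ 0) (x : ProjSpace k 1) :
    ∃ s, x ∈ Set.range (scaledChart κ s) := by
  have key (s : Bool) (hx : x ∈ (lineChart k (if s then 1 else 0)).opensRange) :
      x ∈ Set.range (scaledChart κ s) := by
    obtain ⟨y, rfl⟩ := hx
    have := isIso_scaledChart h s
    obtain ⟨y, rfl⟩ := (specMap (scaleHom (if s then κ⁻¹ else κ))).surjective y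
    exact ⟨y, Scheme.Hom.comp_apply _ _ _⟩
  obtain ⟨i, hi⟩ := lineChart_covers k x
  rcases (by omega : i = 0 ∨ i = 1) with rfl | rfl
  · exact ⟨false, key false hi⟩
  · exact ⟨true, key true hi⟩

theorem isIntegral_of_surjective {X Z : Scheme.{u}} [IsIntegral X] (f : X ⟶ Z) {I : Type}
    (C : I → Type u) [∀ c, CommRing (C c)] [∀ c, IsDomain (C c)]
    (j : ∀ c, Spec (.of (C c)) ⟶ Z) [∀ c, IsOpenImmersion (j c)]
    (hj : ∀ x, ∃ c, x ∈ (j c).opensRange) (hf : Function.Surjective f) : IsIntegral Z := by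
  have h1 : IsReduced Z := by
    have h (i : I) : IsReduced (Spec (.of (C i))) := inferInstance
    have : ∀ i, IsReduced ((chartCover C j hj).X i) := h
    exact IsReduced.of_openCover Z (chartCover C j hj)
  have h2 : IrreducibleSpace Z := by
    rw [irreducibleSpace_def]
    have := (irreducibleSpace_def X).1 inferInstance
    have := this.image f f.continuous.continuousOn
    rwa [Set.top_eq_univ, Set.image_univ, hf.range_eq] at this
  exact isIntegral_of_irreducibleSpace_of_isReduced Z

variable {I : Type} {B : I → Type u} [∀ i, CommRing (B i)] [∀ i, IsDomain (B i)]
  [∀ i, Algebra k (B i)] {U Q : Scheme.{u}} [IsIntegral Q] [Q.IsSeparated] (e : U ⟶ Spec (.of k))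
  (u : ∀ i, Spec (.of (B i)) ⟶ U) [∀ i, IsOpenImmersion (u i)]
  (hu : ∀ x, ∃ i, x ∈ (u i).opensRange)
  (hue : ∀ i, u i ≫ e = specMap (algebraMap k (B i)))
  (v : ∀ c : I × Bool, Spec (.of (B c.1)[X]) ⟶ Q) [∀ c, IsOpenImmersion (v c)]
  (hv : ∀ x, ∃ c, x ∈ (v c).opensRange) (π : Q ⟶ U)
  (hπ : ∀ c, v c ≫ π = specMap C ≫ u c.1)
  {w : Q.functionField} (hw : w ≠ 0) {κ : k} (hκ : κ ≠ 0)
  (hX : ∀ c, toK (v c) (C (algebraMap k (B c.1) (if c.2 then κ⁻¹ else κ)) * X) =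
    if c.2 then w⁻¹ else w)

include hu hue hv hπ hw hκ hX in
/-- A scheme over `U` is the product of `U` and the projective line if it has suitable charts. -/
theorem exists_trivialization : ∃ q : Q ⟶ ProjSpace k 1,
    (∀ c, v c ≫ q = specMap (mapRingHom (algebraMap k (B c.1))) ≫
      scaledChart κ c.2) ∧
    ∃ hq : π ≫ e = q ≫ ProjSpace.toSpec k 1,
      IsIso (pullback.lift (f := e) (g := ProjSpace.toSpec k 1) π q hq) := by
  let H : Atlas Q Q.functionField (fun c : I × Bool => (B c.1)[X]) (fun c => toK (v c)) :=
    { chart := v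
      isOpenImmersion := inferInstance
      covers := hv
      pt := Q.fromSpecStalk (genericPoint Q)
      pt_eq := fun c => specMap_toK (v c) }
  have hve (c : I × Bool) : v c ≫ π ≫ e =
      specMap (C.comp (algebraMap k (B c.1))) := by
    rw [← Category.assoc, hπ, Category.assoc, hue, ← Spec.map_comp, ← CommRingCat.ofHom_comp]
  obtain ⟨q, hq⟩ := H.exists_glue (fun c => toK_injective (v c))
    (fun c => specMap (mapRingHom (algebraMap k (B c.1))) ≫
      scaledChart κ c.2)
    (specMap (eval₂RingHom (baseMap (π ≫ e)) w) ≫ lineChart k 0) (fun c => by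
      have h1 : ((toK (v c)).comp (mapRingHom (algebraMap k (B c.1)))).comp
          (scaleHom (if c.2 then κ⁻¹ else κ)) =
            eval₂RingHom (baseMap (π ≫ e)) (if c.2 then w⁻¹ else w) := by
        refine Polynomial.ringHom_ext (fun r => ?_) ?_
        · refine Eq.trans ?_ ((eval₂_C _ _).trans (baseMap_eq_toK (v c) (π ≫ e) _ (hve c) r)).symm
          simp [scaleHom]
        · refine Eq.trans ?_ ((hX c).trans (eval₂_X _ _).symm)
          simp [scaleHom]
      rw [scaledChart, ← Category.assoc, ← Category.assoc, ← Spec.map_comp, ← Spec.map_comp,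
        ← CommRingCat.ofHom_comp, ← CommRingCat.ofHom_comp, h1]
      obtain ⟨i, _ | _⟩ := c
      · rfl
      · exact (lineChart_eq (baseMap (π ≫ e)) hw).symm)
  have hqe : π ≫ e = q ≫ ProjSpace.toSpec k 1 := by
    refine H.hom_ext fun c => ?_
    refine (hve c).trans ?_
    rw [← Category.assoc, hq, Category.assoc, scaledChart_toSpec, ← Spec.map_comp,
      ← CommRingCat.ofHom_comp]
    exact congrArg (fun f => specMap f)
      (RingHom.ext fun r => (Polynomial.map_C _).symm)
  refine ⟨q, hq, hqe, ?_⟩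
  set f := pullback.lift (f := e) (g := ProjSpace.toSpec k 1) π q hqe with hf
  have hsq (c : I × Bool) := (isPullback_specMap_mapRingHom (algebraMap k (B c.1))).flip
  let μ (c : I × Bool) := pullback.map (specMap (algebraMap k (B c.1)))
    (specMap (C : k →+* k[X])) e (ProjSpace.toSpec k 1) (u c.1)
    (scaledChart κ c.2) (𝟙 _) (by rw [hue, Category.comp_id])
    (by rw [scaledChart_toSpec, Category.comp_id])
  have hμ (c) : v c ≫ f = (hsq c).isoPullback.hom ≫ μ c := by
    apply pullback.hom_ext
    · rw [Category.assoc, Category.assoc, pullback.lift_fst, pullback.lift_fst, hπ,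
        IsPullback.isoPullback_hom_fst_assoc]
    · rw [Category.assoc, Category.assoc, pullback.lift_snd, pullback.lift_snd, 
        IsPullback.isoPullback_hom_snd_assoc]
      exact hq c
  have hopen (c) : IsOpenImmersion (v c ≫ f) := by
    have := isOpenImmersion_scaledChart hκ c.2
    rw [hμ]
    infer_instance
  have hsurj (z : ↥(pullback e (ProjSpace.toSpec k 1))) : ∃ c, z ∈ (v c ≫ f).opensRange := by
    obtain ⟨i, hi⟩ := hu (pullback.fst e (ProjSpace.toSpec k 1) z)
    obtain ⟨s, hs⟩ := scaledChart_covers hκ (pullback.snd e (ProjSpace.toSpec k 1) z)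
    have h1 : z ∈ Set.range (μ (i, s)) := by
      rw [Scheme.Pullback.range_map]
      exact ⟨hi, hs⟩
    obtain ⟨t, rfl⟩ := h1
    obtain ⟨t, rfl⟩ := (hsq (i, s)).isoPullback.hom.surjective t
    exact ⟨(i, s), t, by rw [hμ, Scheme.Hom.comp_apply]⟩
  have hsurj' : Function.Surjective f := fun z => by
    obtain ⟨c, t, rfl⟩ := hsurj z
    exact ⟨v c t, (Scheme.Hom.comp_apply _ _ _).symm⟩
  have hint := isIntegral_of_surjective f (fun c : I × Bool => (B c.1)[X]) (fun c => v c ≫ f) hsurj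
    hsurj'
  exact isIso_of_charts f (fun c : I × Bool => (B c.1)[X]) v hv hsurj'

end Product


theorem IsPullbackFunction.div {X Y : Scheme.{u}} [IsIntegral X] [IsIntegral Y] {ν : Y ⟶ X}
    {φ φ' : X.functionField} {ψ ψ' : Y.functionField} (h : IsPullbackFunction ν φ ψ)
    (h' : IsPullbackFunction ν φ' ψ') (h0 : ψ' ≠ 0) : IsPullbackFunction ν (φ / φ') (ψ / ψ') := by
  obtain ⟨a, rfl, rfl⟩ := h
  obtain ⟨b, rfl, rfl⟩ := h'
  have hb : IsUnit b := (isUnit_map_iff (ν.stalkMap (genericPoint Y)).hom b).1 (IsUnit.mk0 _ h0)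
  obtain ⟨b', hb'⟩ := hb.exists_right_inv
  refine ⟨a * b', ?_, ?_⟩
  · rw [map_mul, div_eq_mul_inv]
    congr 1
    refine eq_inv_of_mul_eq_one_right ?_
    rw [← map_mul, hb', map_one]
  · rw [map_mul, div_eq_mul_inv]
    congr 1
    refine eq_inv_of_mul_eq_one_right ?_
    rw [← map_mul, hb', map_one]

theorem IsPullbackFunction.sub {X Y : Scheme.{u}} [IsIntegral X] [IsIntegral Y] {ν : Y ⟶ X}
    {φ φ' : X.functionField} {ψ ψ' : Y.functionField} (h : IsPullbackFunction ν φ ψ)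
    (h' : IsPullbackFunction ν φ' ψ') : IsPullbackFunction ν (φ - φ') (ψ - ψ') := by
  obtain ⟨a, rfl, rfl⟩ := h
  obtain ⟨b, rfl, rfl⟩ := h'
  exact ⟨a - b, map_sub _ _ _, map_sub _ _ _⟩

theorem toK_congr {X : Scheme.{u}} [IsIntegral X] {A : Type u} [CommRing A] [IsDomain A]
    {j j' : Spec (.of A) ⟶ X} [IsOpenImmersion j] [IsOpenImmersion j'] (h : j = j') (a : A) :
    toK j a = toK j' a := by
  subst h
  rfl

section Ruled

variable {p : ℕ} {R M : Type u} [CommRing R] [Field M] [Algebra R M]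
    {B : Fin 2 → Type u} [∀ i, CommRing (B i)] [∀ i, IsDomain (B i)]
    [∀ i, Algebra R (B i)] {D : AtiyahData p R M B}
    {X : Scheme.{u}} [IsIntegral X] {f : X ⟶ Spec (.of R)} (Q : Ruled D f)

theorem Ruled.z_eq (i : Fin 2) : Q.z i = Q.z 0 - Q.Φ (C (D.shift i)) := by
  have h0 : D.shift 0 = 0 := rfl
  simp only [Ruled.z, map_sub, h0, map_zero, sub_zero]

/-- The part of a ruled scheme over a chart of the base is covered by two charts. -/
theorem Ruled.exists_mem_chart [X.IsSeparated] (i : Fin 2) (x : X)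
    (h : ∀ b, RegularAt x (Q.base i b)) : ∃ s, x ∈ (Q.chart (i, s)).opensRange := by
  obtain ⟨⟨i', s'⟩, hx⟩ := Q.covers x
  by_cases hi : i' = i
  · subst hi
    exact ⟨s', hx⟩
  have h' (b) : RegularAt x (Q.base i' b) := by
    have := Q.toK_C (i', s') b
    exact this ▸ regularAt_toK (Q.chart (i', s')) hx (C b)
  have hb (j : Fin 2) (b) : RegularAt x (Q.base j b) := by
    rcases (by omega : j = i ∨ j = i') with rfl | rfl
    exacts [h b, h' b]
  have hs (j : Fin 2) : RegularAt x (Q.Φ (C (D.shift j))) := by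
    rcases (by omega : j = 0 ∨ j = 1) with rfl | rfl
    · have h0 : D.shift 0 = 0 := rfl
      rw [h0, map_zero, map_zero]
      exact RegularAt.zero x
    · have h1 : Q.Φ (C (D.shift 1)) = baseMap f D.τ * (Q.base 0 D.α * Q.base 1 D.β) := by
        have e : D.shift 1 = algebraMap R M D.τ * (D.θ 0 D.α * D.θ 1 D.β) := by
          rw [← D.a_eq]
          rfl
        rw [e, map_mul, map_mul, Q.baseMap_eq, map_mul, map_mul]
        rfl
      rw [h1]
      exact (regularAt_baseMap f x _).mul ((hb 0 _).mul (hb 1 _))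
  obtain ⟨d, hd, hz⟩ : ∃ d, RegularAt x d ∧ Q.z i = Q.z i' + d :=
    ⟨_, (hs i').sub (hs i), by rw [Q.z_eq i, Q.z_eq i']; ring⟩
  have hX := regularAt_toK (Q.chart (i', s')) hx Polynomial.X
  rw [Q.toK_X] at hX
  have key (w : X.functionField) (hw : RegularAt x w) (a : (B i)[X]) :
      RegularAt x (eval₂ (Q.base i) w a) := by
    induction a using Polynomial.induction_on' with
    | add u v hu hv => rw [eval₂_add]; exact hu.add hv
    | monomial n a =>
      rw [eval₂_monomial]
      exact (hb i a).mul (hw.pow n)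
  have hfin (hw : RegularAt x (Q.z i)) : x ∈ (Q.chart (i, false)).opensRange :=
    mem_range_of_regularAt _ _ fun a => by
      rw [Q.toK_fin_eq]
      exact key _ hw a
  have hinf (hw : RegularAt x (Q.z i)⁻¹) : x ∈ (Q.chart (i, true)).opensRange :=
    mem_range_of_regularAt _ _ fun a => by
      rw [Q.toK_inf_eq]
      exact key _ hw a
  cases s' with
  | false => exact ⟨false, hfin (hz ▸ RegularAt.add hX hd)⟩
  | true =>
    replace hX : RegularAt x (Q.z i')⁻¹ := hX
    by_cases hu : UnitAt x (Q.z i')⁻¹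
    · refine ⟨false, hfin (hz ▸ RegularAt.add ?_ hd)⟩
      have := hu.inv.regularAt
      rwa [inv_inv] at this
    · refine ⟨true, hinf ?_⟩
      have h1 : UnitAt x (1 + (Q.z i')⁻¹ * d) := (UnitAt.one x).add_of_not (hX.mul hd)
        fun h => hu (UnitAt.of_mul hd hX (by rwa [mul_comm]))
      have h2 : (Q.z i)⁻¹ = (Q.z i')⁻¹ * (1 + (Q.z i')⁻¹ * d)⁻¹ := by
        rw [hz, ← mul_inv, mul_add, mul_one, mul_inv_cancel_left₀ (Q.z_ne_zero i')]
      rw [h2]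
      exact hX.mul h1.inv.regularAt

end Ruled

section Bundle

variable {p : ℕ} {k : Type u} [Field k] {W : WeierstrassCurve k} {E : Scheme.{u}}
  {e : E ⟶ Spec (.of k)} (H : Atlas E (CurveField W) (fun i => chartRing W i) (chartIncl W))
  (hH : ∀ i, H.chart i ≫ e = specMap (algebraMap k (chartRing W i)))
  {D : AtiyahData p k (CurveField W) (fun i => chartRing W i)}
  {P : Scheme.{u}} [IsIntegral P] [P.IsSeparated] {f : P ⟶ Spec (.of k)} (Q : Ruled D f)
  (π : P ⟶ E)
  (hπ : ∀ c, Q.chart c ≫ π = specMap C ≫ H.chart c.1)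

include hH hπ in
theorem Ruled.exists_iso_product (hτ : D.τ = 0) :
    ∃ φ : P ≅ pullback e (ProjSpace.toSpec k 1),
      φ.hom ≫ pullback.fst e (ProjSpace.toSpec k 1) = π := by
  have hz (i : Fin 2) : Q.z i = Q.z 0 := by
    have h0 : D.shift i = 0 := by
      rcases (by omega : i = 0 ∨ i = 1) with rfl | rfl
      · rfl
      · exact (congrArg (algebraMap k (CurveField W) · * D.a) hτ).trans (by rw [map_zero, zero_mul])
    rw [Q.z_eq, h0, map_zero, map_zero, sub_zero]
  obtain ⟨q, -, hq, h⟩ := exists_trivialization e H.chart H.covers hH Q.chart Q.covers π hπ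
    (w := Q.z 0) (Q.z_ne_zero 0) (one_ne_zero (α := k)) (fun c => by
      rw [inv_one, ite_self, map_one, map_one, one_mul, Q.toK_X, hz])
  exact ⟨asIso (pullback.lift π q hq), pullback.lift_fst _ _ _⟩

omit [P.IsSeparated] in
include hπ in
theorem Ruled.range_chart_subset (i : Fin 2) (s : Bool) :
    Set.range (Q.chart (i, s)) ⊆ Set.range (π ⁻¹ᵁ (H.chart i).opensRange).ι := by
  rintro _ ⟨q, rfl⟩
  rw [Scheme.Opens.range_ι]
  change π (Q.chart (i, s) q) ∈ (H.chart i).opensRange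
  rw [← Scheme.Hom.comp_apply, hπ, Scheme.Hom.comp_apply]
  exact ⟨_, rfl⟩

variable [IsIntegral E]

include hH hπ in
theorem Ruled.exists_coordinate (hτ : D.τ ≠ 0)
    (i : Fin 2) :
    ∃ q : (π ⁻¹ᵁ (H.chart i).opensRange).toScheme ⟶ ProjSpace k 1,
      (∃ hq : (π ∣_ (H.chart i).opensRange) ≫ ((H.chart i).opensRange).ι ≫ e =
          q ≫ ProjSpace.toSpec k 1,
        IsIso (pullback.lift (f := ((H.chart i).opensRange).ι ≫ e) (g := ProjSpace.toSpec k 1)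
          (π ∣_ (H.chart i).opensRange) q hq)) ∧
      IsPullbackOfCoord q (baseMap f D.τ⁻¹ * Q.z i) := by
  set U := (H.chart i).opensRange
  set V := π ⁻¹ᵁ U
  let u : Spec (.of (chartRing W i)) ⟶ U.toScheme :=
    IsOpenImmersion.lift U.ι (H.chart i) (by rw [Scheme.Opens.range_ι]; exact le_rfl)
  have hu : u ≫ U.ι = H.chart i := IsOpenImmersion.lift_fac _ _ _
  let v (c : Unit × Bool) : Spec (.of (chartRing W i)[X]) ⟶ V.toScheme :=
    IsOpenImmersion.lift V.ι (Q.chart (i, c.2)) (Q.range_chart_subset H π hπ i c.2)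
  have hv (c) : v c ≫ V.ι = Q.chart (i, c.2) := IsOpenImmersion.lift_fac _ _ _
  have hu' : IsOpenImmersion u := by
    have : IsOpenImmersion (u ≫ U.ι) := hu ▸ inferInstance
    exact IsOpenImmersion.of_comp u U.ι
  have hv' (c) : IsOpenImmersion (v c) := by
    have : IsOpenImmersion (v c ≫ V.ι) := hv c ▸ inferInstance
    exact IsOpenImmersion.of_comp (v c) V.ι
  have : Nonempty V.toScheme := ⟨v ((), false) (specBot _)⟩
  have : IsIntegral V.toScheme := isIntegral_of_isOpenImmersion V.ι
  have hsep : V.toScheme.IsSeparated := by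
    have : terminal.from V.toScheme = V.ι ≫ terminal.from P := Subsingleton.elim _ _
    exact ⟨this ▸ inferInstance⟩
  have hκ : D.τ⁻¹ ≠ 0 := inv_ne_zero hτ
  have hpull (c a) : IsPullbackFunction V.ι (toK (Q.chart (i, c.2)) a) (toK (v c) a) :=
    isPullbackFunction_toK (Q.chart (i, c.2)) (v c) V.ι (RingHom.id _)
      (by rw [CommRingCat.ofHom_id, Spec.map_id, Category.id_comp, hv]) a
  have hκK (s : Bool) (r : k) : toK (Q.chart (i, s)) (C (algebraMap k (chartRing W i) r) * X) =
      baseMap f r * if s then (Q.z i)⁻¹ else Q.z i := by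
    rw [map_mul, Q.toK_X, baseMap_eq_toK (Q.chart (i, s)) f _ (Q.chart_comp (i, s))]
    rfl
  set w := toK (v ((), false)) (C (algebraMap k (chartRing W i) D.τ⁻¹) * X) with hw
  have hw0 : w ≠ 0 := toK_ne_zero _ (mul_ne_zero (C_ne_zero.2 ((map_ne_zero_iff _
    (algebraMap k (chartRing W i)).injective).2 hκ)) X_ne_zero)
  obtain ⟨q, hq, hqe⟩ := exists_trivialization (B := fun _ : Unit => chartRing W i) (U.ι ≫ e)
    (fun _ => u) (fun x => ⟨(), by
      obtain ⟨y, hy⟩ := x.2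
      refine ⟨y, Subtype.ext ?_⟩
      refine Eq.trans ?_ hy
      rw [← hu]
      exact (Scheme.Hom.comp_apply u U.ι y).symm⟩)
    (fun _ => by rw [← Category.assoc, hu]; exact hH i) v
    (fun x => by
      have hx : x.1 ∈ V := x.2
      obtain ⟨s, y, hy⟩ := Q.exists_mem_chart i x.1 fun b => by
        have h1 := isPullbackFunction_toK (H.chart i) (Q.chart (i, false)) π C (hπ (i, false)) b
        rw [Q.toK_C] at h1
        exact h1.regularAt (regularAt_toK (H.chart i) hx b)
      refine ⟨((), s), y, Subtype.ext ?_⟩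
      refine Eq.trans ?_ hy
      have := hv ((), s)
      change _ = (Q.chart (i, ((), s).2)) y
      rw [← this]
      exact (Scheme.Hom.comp_apply (v ((), s)) V.ι y).symm)
    (π ∣_ U) (fun c => by
      rw [← cancel_mono U.ι, Category.assoc, Category.assoc, morphismRestrict_ι, hu, ← Category.assoc,
        hv]
      exact hπ (i, c.2)) hw0 hκ (fun c => by
      obtain ⟨_, _ | _⟩ := c
      · rfl
      · refine eq_inv_of_mul_eq_one_left ?_
        have h1 := (hpull ((), true) (C (algebraMap k (chartRing W i) D.τ⁻¹⁻¹) * X)).mul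
          (hpull ((), false) (C (algebraMap k (chartRing W i) D.τ⁻¹) * X))
        have h2 := hpull ((), false) 1
        refine h1.unique ?_
        rw [map_one, map_one] at h2
        convert h2 using 1
        rw [hκK, hκK, mul_mul_mul_comm, ← map_mul, inv_mul_cancel₀ hκ, map_one, one_mul]
        exact inv_mul_cancel₀ (Q.z_ne_zero i))
  refine ⟨q, hqe, ?_⟩
  have h1 := isPullbackOfCoord (v ((), false)) q ((mapRingHom (algebraMap k (chartRing W i))).comp
    (scaleHom D.τ⁻¹)) (by
      rw [hq, scaledChart, ← Category.assoc, ← Spec.map_comp, ← CommRingCat.ofHom_comp]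
      rfl)
  have h2 : mapRingHom (algebraMap k (chartRing W i)) (scaleHom D.τ⁻¹ X) =
      C (algebraMap k (chartRing W i) D.τ⁻¹) * X := by
    simp [scaleHom]
  rw [RingHom.comp_apply, h2, toK_congr (hv ((), false)), hκK] at h1
  exact h1

variable (ρ : CurveField W →+* E.functionField)
  (hρ : ∀ i a, ρ (chartIncl W i a) = toK (H.chart i) a)

omit [P.IsSeparated] in
include hπ hρ in
theorem Ruled.isPullbackFunction_base (hθ : ∀ i, D.θ i = (chartRing W i).val) (φ : CurveField W) :
    IsPullbackFunction π (ρ φ) (Q.Φ (C φ)) := by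
  obtain ⟨a, b, hb, h⟩ := exists_div_chartRing W 0 φ
  have key (a : chartRing W 0) : IsPullbackFunction π (ρ (a : CurveField W)) (Q.Φ (C (a : CurveField W))) := by
    have h1 := isPullbackFunction_toK (H.chart 0) (Q.chart (0, false)) π C (hπ (0, false)) a
    rw [Q.toK_C, hθ, ← hρ] at h1
    exact h1
  have h0 : Q.Φ (C (b : CurveField W)) ≠ 0 := by
    rw [map_ne_zero_iff _ Q.inj, Polynomial.C_ne_zero]
    exact hb
  have := (key a).div (key b) h0
  have e1 : Q.Φ (C (a : CurveField W)) / Q.Φ (C (b : CurveField W)) = Q.Φ (C φ) := by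
    rw [div_eq_iff h0, ← map_mul, ← C_mul, h, div_mul_cancel₀ _ hb]
  rw [e1, ← map_div₀, ← h] at this
  exact this

include hH hπ in
theorem Ruled.isProjectivization (hθ : ∀ i, D.θ i = (chartRing W i).val) (hτ : D.τ ≠ 0)
    (ha : D.a = atiyahFun W) : IsProjectivization e (atiyahExtension H ρ hρ) π := by
  choose q hq hy using Q.exists_coordinate H hH π hπ hτ
  refine ⟨q, fun i => baseMap f D.τ⁻¹ * Q.z i, hq, hy, ?_⟩
  intro (i : Fin 2) (j : Fin 2)
  let c : Fin 2 → P.functionField := ![Q.Φ (C (atiyahFun W)), 0]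
  have hc (i : Fin 2) : IsPullbackFunction π (![ρ (atiyahFun W), 0] i) (c i) := by
    rcases (by omega : i = 0 ∨ i = 1) with rfl | rfl
    · exact Q.isPullbackFunction_base H π hπ ρ hρ hθ _
    · exact ⟨0, map_zero _, map_zero _⟩
  refine ⟨c i - c j, (hc i).sub (hc j), ?_⟩
  have h1 (i : Fin 2) : baseMap f D.τ⁻¹ * Q.Φ (C (D.shift i)) = c 0 - c i := by
    rcases (by omega : i = 0 ∨ i = 1) with rfl | rfl
    · have h0 : D.shift 0 = 0 := rfl
      rw [h0, map_zero, map_zero, mul_zero, sub_self]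
    · have h0 : D.shift 1 = algebraMap k (CurveField W) D.τ * atiyahFun W := by
        rw [← ha]
        rfl
      rw [h0, map_mul, map_mul, ← Q.baseMap_eq, ← mul_assoc, ← map_mul, inv_mul_cancel₀ hτ, map_one,
        one_mul]
      exact (sub_zero _).symm
  change baseMap f D.τ⁻¹ * Q.z i = baseMap f D.τ⁻¹ * Q.z j + (c i - c j)
  rw [Q.z_eq i, Q.z_eq j, mul_sub, mul_sub, h1, h1]
  ring

end Bundle


section Restriction

variable {p : ℕ} {k M : Type u} [Field k] [Field M] [Algebra k M]
    {B : Fin 2 → Type u} [∀ i, CommRing (B i)] [∀ i, Algebra k (B i)] (G : AtiyahData p k M B) (t : k)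

theorem restrict_C_algebraMap (c : Fin 2 × Bool) (r : k[X]) :
    restrict B t c (C (algebraMap k[X] (FamilyRing (B c.1)) r)) =
      C (algebraMap k (B c.1) (r.eval t)) := by
  rw [← restrict_algebraMap, Polynomial.algebraMap_apply]

theorem restrict_coeff (c : Fin 2 × Bool) :
    restrict B t c (C (algebraMap k[X] (FamilyRing (B c.1))
      (G.family.lam * G.family.τ ^ (p - 1)))) =
      C (algebraMap k (B c.1) ((G.withParam t).lam * (G.withParam t).τ ^ (p - 1))) ∧
    restrict B t c (C (algebraMap k[X] (FamilyRing (B c.1)) (G.family.τ ^ p) * G.family.b c.1)) =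
      C (algebraMap k (B c.1) ((G.withParam t).τ ^ p) * (G.withParam t).b c.1) := by
  refine ⟨(restrict_C_algebraMap t c _).trans ?_, ?_⟩
  · simp [AtiyahData.family, AtiyahData.withParam]
  · rw [C_mul, map_mul (restrict B t c), restrict_C_algebraMap,
      show G.family.b c.1 = FamilyRing.C (G.b c.1) from rfl, restrict_C_C, C_mul]
    simp [AtiyahData.family, AtiyahData.withParam]

theorem restrict_hFin (i : Fin 2) (s : Bool) :
    restrict B t (i, s) (G.family.hFin i) = (G.withParam t).hFin i := by
  have h := restrict_coeff G t (i, s)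
  have hX : restrict B t (i, s) X = X := restrict_X t (i, s)
  simp only [AtiyahData.hFin, map_sub (restrict B t (i, s)), map_mul (restrict B t (i, s)),
    map_pow (restrict B t (i, s)), hX]
  exact congrArg₂ _ (congrArg (fun f => X ^ p - f * X) h.1) h.2

theorem restrict_hInf (i : Fin 2) (s : Bool) :
    restrict B t (i, s) (G.family.hInf i) = (G.withParam t).hInf i := by
  have h := restrict_coeff G t (i, s)
  have hX : restrict B t (i, s) X = X := restrict_X t (i, s)
  simp only [AtiyahData.hInf, map_sub (restrict B t (i, s)), map_mul (restrict B t (i, s)),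
    map_pow (restrict B t (i, s)), hX, map_one (restrict B t (i, s))]
  exact congrArg₂ _ (congrArg (fun f => 1 - f * X ^ (p - 1)) h.1) (congrArg (· * X ^ p) h.2)

theorem restrict_eqDelta (c : Fin 2 × Bool) :
    restrict B t c (G.family.eqDelta c) = (G.withParam t).eqDelta c := by
  obtain ⟨i, s⟩ := c
  have hX : restrict B t (i, s) X = X := restrict_X t (i, s)
  cases s <;> simp [AtiyahData.eqDelta, restrict_hFin, restrict_hInf, hX]

theorem restrict_eqTheta (c : Fin 2 × Bool) :
    restrict B t c (G.family.eqTheta c) = (G.withParam t).eqTheta c := by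
  obtain ⟨i, s⟩ := c
  have hX : restrict B t (i, s) X = X := restrict_X t (i, s)
  cases s <;> simp [AtiyahData.eqTheta, hX]

variable {G} {t}
variable [∀ i, IsDomain (B i)] {S : Scheme.{u}} {g : S ⟶ AffineLine k} [IsIntegral S]
  [IsLocallyNoetherian S] (Q : Ruled G.family g)
  [IsIntegral (fiber g t)] [IsLocallyNoetherian (fiber g t)]
  (Qt : Ruled (G.withParam t) (fiberToSpec g t))
  (hι : ∀ c, Qt.chart c ≫ fiberι g t = specMap (restrict B t c) ≫ Q.chart c)

include hι in
theorem Ruled.isPullbackDivisor_fiber {N : ℕ} (hN : 0 < N) {D : QDivisor S}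
    {D' : QDivisor (fiber g t)} {a : ∀ c : Fin 2 × Bool, (FamilyRing (B c.1))[X]}
    {a' : ∀ c : Fin 2 × Bool, (B c.1)[X]} (ha : ∀ c, restrict B t c (a c) = a' c)
    (H : IsEquation Q.chart D.1 N (fun c => toK (Q.chart c) (a c)))
    (H' : IsEquation Qt.chart D'.1 N (fun c => toK (Qt.chart c) (a' c))) :
    IsPullbackDivisor (fiberι g t) D.1 D' := by
  refine IsEquation.isPullbackDivisor Qt.covers (fiberι g t) ?_ hN H H' fun c => ?_
  · rintro c _ ⟨q, rfl⟩
    refine ⟨(specMap (restrict B t c)) q, ?_⟩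
    rw [← Scheme.Hom.comp_apply, ← hι, Scheme.Hom.comp_apply]
  · rw [← ha]
    exact isPullbackFunction_toK (Q.chart c) (Qt.chart c) (fiberι g t) (restrict B t c) (hι c) (a c)

end Restriction

theorem isSeparated_fiber {k : Type u} [Field k] {S : Scheme.{u}} [S.IsSeparated]
    (g : S ⟶ AffineLine k) (t : k) : (fiber g t).IsSeparated := by
  have h1 : IsClosedImmersion (AffineLine.point t) :=
    IsClosedImmersion.spec_of_surjective _ fun r => ⟨C r, eval_C⟩
  have h2 : IsSeparated (fiberι g t) :=
    MorphismProperty.of_isPullback (P := @IsSeparated)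
      (IsPullback.of_hasPullback g (AffineLine.point t)).flip inferInstance
  have h3 : terminal.from (fiber g t) = fiberι g t ≫ terminal.from S := Subsingleton.elim _ _
  exact ⟨h3 ▸ inferInstance⟩

theorem exists_projection {k : Type u} [Field k] (p : ℕ) {W : WeierstrassCurve k} {E : Scheme.{u}}
    [E.IsSeparated] {e : E ⟶ Spec (.of k)}
    (A : Atlas E (CurveField W) (fun i => chartRing W i) (chartIncl W))
    (hA : ∀ i, A.chart i ≫ e = specMap (algebraMap k (chartRing W i)))
    {S : Scheme.{u}} {g : S ⟶ AffineLine k}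
    (ℬ : Atlas S (FractionRing (FamilyField (CurveField W))[X])
      (fun c : Fin 2 × Bool => (FamilyRing (chartRing W c.1))[X]) (familyData p W).toFrac)
    (hℬ : ∀ c, ℬ.chart c ≫ g =
      specMap (algebraMap k[X] (FamilyRing (chartRing W c.1))[X])) :
    ∃ π : S ⟶ E, (∀ c, ℬ.chart c ≫ π =
        specMap (chartConst W c) ≫ A.chart c.1) ∧
      π ≫ e = g ≫ AffineLine.toSpec k := by
  obtain ⟨π, hπ⟩ := ℬ.exists_glue (familyData p W).toFrac_injective
    (fun c => specMap (chartConst W c) ≫ A.chart c.1)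
    (specMap (curveIncl W) ≫ A.pt) fun c => by
      rw [← A.pt_eq c.1, ← Category.assoc, ← Category.assoc, ← Spec.map_comp, ← Spec.map_comp,
        ← CommRingCat.ofHom_comp, ← CommRingCat.ofHom_comp]
      congr 3
      exact RingHom.ext fun u => toFrac_chartConst p W c u
  refine ⟨π, hπ, ℬ.hom_ext fun c => ?_⟩
  rw [← Category.assoc, hπ, Category.assoc, hA, ← Category.assoc, hℬ, AffineLine.toSpec,
    ← Spec.map_comp, ← Spec.map_comp, ← CommRingCat.ofHom_comp, ← CommRingCat.ofHom_comp]
  congr 2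
  refine RingHom.ext fun r => ?_
  rw [RingHom.comp_apply, RingHom.comp_apply, Polynomial.algebraMap_apply]
  exact congrArg C (Polynomial.map_C _).symm

theorem exists_ruled_family {k : Type u} [Field k] (p : ℕ) {W : WeierstrassCurve k} {S : Scheme.{u}}
    [IsIntegral S] {g : S ⟶ AffineLine k}
    (ℬ : Atlas S (FractionRing (FamilyField (CurveField W))[X])
      (fun c : Fin 2 × Bool => (FamilyRing (chartRing W c.1))[X]) (familyData p W).toFrac)
    (hℬ : ∀ c, ℬ.chart c ≫ g =
      specMap (algebraMap k[X] (FamilyRing (chartRing W c.1))[X])) :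
    ∃ Q : Ruled (atiyahData p W 1).family g, Q.chart = ℬ.chart := by
  obtain ⟨ρ, hρ⟩ := ℬ.exists_fieldHom (familyData p W).toFrac_injective (c₀ := (0, false))
    ((familyData p W).exists_div_toFrac (AtiyahData.exists_div_family (D := atiyahData p W 1)
      (exists_div_chartRing W 0)))
  exact ⟨(familyData p W).ruledOfCharts ℬ.chart ℬ.isOpenImmersion ℬ.covers hℬ ρ hρ, rfl⟩

theorem Ruled.isLocallyNoetherian_fiber {p : ℕ} {k M : Type u} [Field k] [Field M] [Algebra k M]
    {B : Fin 2 → Type u} [∀ i, CommRing (B i)] [∀ i, Algebra k (B i)] [∀ i, IsDomain (B i)]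
    [∀ i, IsNoetherianRing (B i)] {G : AtiyahData p k M B} {S : Scheme.{u}} [IsIntegral S]
    {g : S ⟶ AffineLine k} (Q : Ruled G.family g) (t : k) : IsLocallyNoetherian (fiber g t) :=
  isLocallyNoetherian_of_charts (fun c : Fin 2 × Bool => (B c.1)[X]) (Q.fiberChart t)
    (fiberChart_covers g Q.chart Q.chart_comp t Q.covers)

theorem Ruled.exists_ruled_fibers {p : ℕ} {k M : Type u} [Field k] [Field M] [Algebra k M]
    {B : Fin 2 → Type u} [∀ i, CommRing (B i)] [∀ i, Algebra k (B i)] [∀ i, IsDomain (B i)]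
    {G : AtiyahData p k M B} {S : Scheme.{u}} [IsIntegral S]
    {g : S ⟶ AffineLine k} [∀ t, IsIntegral (fiber g t)] (Q : Ruled G.family g)
    (hB : ∀ φ : M, ∃ a b : B 0, G.θ 0 b ≠ 0 ∧ φ = G.θ 0 a / G.θ 0 b) :
    ∃ Qt : ∀ t, Ruled (G.withParam t) (fiberToSpec g t), ∀ t c, (Qt t).chart c ≫ fiberι g t =
      specMap (restrict B t c) ≫ Q.chart c := by
  choose Qt hQt using fun t => Q.exists_ruled_fiber t hB
  refine ⟨Qt, fun t c => ?_⟩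
  rw [hQt]
  exact fiberChart_ι g Q.chart Q.chart_comp t c

theorem fiber_chart_projection {k : Type u} [Field k] {W : WeierstrassCurve k} {E S F : Scheme.{u}}
    (t : k) (c : Fin 2 × Bool) {j : Spec (.of (FamilyRing (chartRing W c.1))[X]) ⟶ S} {ι : F ⟶ S}
    {jt : Spec (.of (chartRing W c.1)[X]) ⟶ F} {jE : Spec (.of (chartRing W c.1)) ⟶ E} {π : S ⟶ E}
    (hι : jt ≫ ι = specMap (restrict (fun i => chartRing W i) t c) ≫ j)
    (hπ : j ≫ π = specMap (chartConst W c) ≫ jE) :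
    jt ≫ ι ≫ π = specMap C ≫ jE := by
  rw [← Category.assoc, hι, Category.assoc, hπ, ← Category.assoc, ← Spec.map_comp,
    ← CommRingCat.ofHom_comp]
  congr 3
  exact RingHom.ext fun u => restrict_C_C (B := fun i => chartRing W i) t c u

/-- The numerical properties of the family and its fibers. -/
theorem Ruled.exists_divisors_family {p : ℕ} [Fact p.Prime] {k : Type u} [Field k] [IsAlgClosed k]
    [CharP k p] {W : WeierstrassCurve k} [W.IsElliptic]
    {G : AtiyahData p k (CurveField W) (fun i => chartRing W i)}
    {S : Scheme.{u}} [IsIntegral S] [IsLocallyNoetherian S] {g : S ⟶ AffineLine k}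
    [∀ t, IsIntegral (fiber g t)] [∀ t, IsLocallyNoetherian (fiber g t)]
    (Q : Ruled G.family g) (Qt : ∀ t, Ruled (G.withParam t) (fiberToSpec g t))
    (hι : ∀ t c, (Qt t).chart c ≫ fiberι g t = specMap (restrict (fun i => chartRing W i) t c) ≫ Q.chart c)
    (hθ : ∀ i, G.θ i = (chartRing W i).val) (ha : G.a = atiyahFun W)
    (hg : SmoothOfRelativeDimension 2 g) :
    ∃ (K Δ Θ : QDivisor S) (Kf Δf Θf : ∀ t : k, QDivisor (fiber g t)),
      IsEffective Δ ∧ IsEffective Θ ∧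
      IsCanonicalDivisor (g ≫ AffineLine.toSpec k) 3 K ∧
      (∀ t : k, IsCanonicalDivisor (fiberToSpec g t) 2 (Kf t) ∧
        IsPullbackDivisor (fiberι g t) Δ.1 (Δf t) ∧ IsPullbackDivisor (fiberι g t) Θ.1 (Θf t)) ∧
      (∀ t : k, IsTerminalPair (fiberToSpec g t) 2 (Δf t + Θf t)) ∧
      IsSemiample g (K + Δ) ∧ IsNumericallyTrivial g (K + Δ) ∧
      IsSemiample g (K + Δ + Θ) ∧ HasKodairaDim g (K + Δ + Θ) 1 ∧
      (∀ t : k, HasKodairaDim (fiberToSpec g t) (Kf t + Δf t + Θf t) 1) ∧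
      ∃ m₀ : ℕ, ∀ m : ℕ, m₀ ≤ m → ∀ t : k, t ≠ 0 →
        h0 (fiberToSpec g t) m (Kf t + Δf t + Θf t) <
          h0 (fiberToSpec g 0) m (Kf 0 + Δf 0 + Θf 0) := by
  have hN : 0 < 6 * p := by have := (Fact.out : p.Prime).pos; omega
  have hchar : CharP (CurveField W) p :=
    charP_of_injective_algebraMap (algebraMap k (CurveField W)).injective p
  obtain ⟨K, Δ, Θ, hK, hΔ, hΘ⟩ := Q.exists_divisors
  choose Kf Δf Θf hKf hΔf hΘf using fun t => (Qt t).exists_divisors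
  have hterm (t : k) : IsTerminalPair (fiberToSpec g t) 2 (Δf t + Θf t) ∧
      IsCanonicalDivisor (fiberToSpec g t) 2 (Kf t) := by
    have := smooth_fiber g hg t
    exact (Qt t).isTerminalPair hθ (finrank_kaehlerDifferential _ 2) ha (hKf t) (hΔf t) (hΘf t)
  refine ⟨K, Δ, Θ, Kf, Δf, Θf,
    hΔ.isEffective Q.covers hN fun c x hx => regularAt_toK _ hx _,
    hΘ.isEffective Q.covers hN fun c x hx => regularAt_toK _ hx _, ?_,
    fun t => ⟨(hterm t).2,
      Q.isPullbackDivisor_fiber (Qt t) (hι t) hN (restrict_eqDelta _ t) hΔ (hΔf t),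
      Q.isPullbackDivisor_fiber (Qt t) (hι t) hN (restrict_eqTheta _ t) hΘ (hΘf t)⟩,
    fun t => (hterm t).1, Q.isSemiample_add hK hΔ, Q.isNumericallyTrivial_add hK hΔ g,
    Q.isSemiample_add_add hK hΔ hΘ, Q.hasKodairaDim_one hK hΔ hΘ,
    fun t => (Qt t).hasKodairaDim_one (hKf t) (hΔf t) (hΘf t), 100, fun m hm t ht => ?_⟩
  · have := smooth_comp_affineLine g hg
    refine Q.isCanonicalDivisor_family hθ (finrank_kaehlerDifferential _ 3) hN ?_
    rwa [show 2 * (6 * p) = 12 * p by ring]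
  · refine ((Qt t).h0_le (hKf t) (hΔf t) (hΘf t) ht m).trans_lt
      (lt_of_lt_of_le ?_ ((Qt 0).le_h0 (hKf 0) (hΔf 0) (hΘf 0) rfl m (by omega)))
    exact_mod_cast (by omega : (m / 6 + 1) / 2 + 3 < (m - 8) / 6 + 1)

end
end PlurigeneraJump

theorem mainTheorem4 {k : Type u} [Field k] [IsAlgClosed k] (p : ℕ) [Fact p.Prime] [CharP k p]
    (W : WeierstrassCurve k) [W.IsElliptic] :
    -- the elliptic curve and its Atiyah bundle
    ∃ (E : Scheme.{u}) (_ : IsIntegral E) (e : E ⟶ Spec (.of k)) (F₂ : SelfExtension E),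
      IsSmoothProperModel W e ∧ ¬ F₂.IsSplit ∧
    -- the family of surface pairs, with canonical divisors
    ∃ (S : Scheme.{u}) (_ : IsIntegral S) (_ : IsLocallyNoetherian S) (g : S ⟶ AffineLine k)
      (_ : ∀ t : k, IsIntegral (fiber g t)) (_ : ∀ t : k, IsLocallyNoetherian (fiber g t))
      (π : S ⟶ E) (K Δ Θ : QDivisor S) (Kf Δf Θf : ∀ t : k, QDivisor (fiber g t)),
      SmoothOfRelativeDimension 2 g ∧ IsProjective g ∧
      IsEffective Δ ∧ IsEffective Θ ∧
      IsCanonicalDivisor (g ≫ AffineLine.toSpec k) 3 K ∧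
      (∀ t : k, IsCanonicalDivisor (fiberToSpec g t) 2 (Kf t) ∧
        IsPullbackDivisor (fiberι g t) Δ.1 (Δf t) ∧ IsPullbackDivisor (fiberι g t) Θ.1 (Θf t)) ∧
      -- the fibers are terminal
      (∀ t : k, IsTerminalPair (fiberToSpec g t) 2 (Δf t + Θf t)) ∧
      -- positivity
      IsSemiample g (K + Δ) ∧ IsNumericallyTrivial g (K + Δ) ∧
      IsSemiample g (K + Δ + Θ) ∧ HasKodairaDim g (K + Δ + Θ) 1 ∧
      (∀ t : k, HasKodairaDim (fiberToSpec g t) (Kf t + Δf t + Θf t) 1) ∧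
      -- all large plurigenera jump
      (∃ m₀ : ℕ, ∀ m : ℕ, m₀ ≤ m → ∀ t : k, t ≠ 0 →
        h0 (fiberToSpec g t) m (Kf t + Δf t + Θf t) <
          h0 (fiberToSpec g 0) m (Kf 0 + Δf 0 + Θf 0)) ∧
      -- the family degenerates the projectivized Atiyah bundle to the product
      π ≫ e = g ≫ AffineLine.toSpec k ∧
      (∀ t : k, t ≠ 0 → IsProjectivization e F₂ (fiberι g t ≫ π)) ∧
      ∃ φ : fiber g 0 ≅ pullback e (ProjSpace.toSpec k 1),
        φ.hom ≫ pullback.fst e (ProjSpace.toSpec k 1) = fiberι g 0 ≫ π := by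
  obtain ⟨E, e, 𝒜, hE, hproper, h𝒜⟩ := exists_curve W
  have hEi : IsIntegral E := 𝒜.isIntegral fun _ => Subtype.val_injective
  obtain ⟨ρ, hρ⟩ := 𝒜.exists_fieldHom (fun _ => Subtype.val_injective) (c₀ := 0)
    (exists_div_chartRing W 0)
  obtain ⟨S, g, ℬ, hS, hproj, hℬ⟩ := exists_family p W
  have hSi : IsIntegral S := ℬ.isIntegral (familyData p W).toFrac_injective
  have hchart (c) : IsOpenImmersion (ℬ.chart c) := ℬ.isOpenImmersion c
  have hB : ∀ φ : CurveField W, ∃ a b : chartRing W 0, (atiyahData p W 1).θ 0 b ≠ 0 ∧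
      φ = (atiyahData p W 1).θ 0 a / (atiyahData p W 1).θ 0 b := exists_div_chartRing W 0
  have hSn : IsLocallyNoetherian S := isLocallyNoetherian_of_charts _ ℬ.chart ℬ.covers
  obtain ⟨Q, hQ⟩ := exists_ruled_family p ℬ hℬ
  have hfi (t : k) : IsIntegral (fiber g t) := Q.isIntegral_fiber t hB
  have hfn (t : k) : IsLocallyNoetherian (fiber g t) := Q.isLocallyNoetherian_fiber t
  have hfs (t : k) : (fiber g t).IsSeparated := isSeparated_fiber g t
  obtain ⟨Qt, hι⟩ := Q.exists_ruled_fibers hB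
  have hsmooth : SmoothOfRelativeDimension 2 g :=
    smoothOfRelativeDimension_of_charts g 2 ℬ.chart ℬ.covers fun c => by
      rw [hℬ]
      exact smooth_family (smooth_chartRing W c.1)
  obtain ⟨π, hπ, hπe⟩ := exists_projection p 𝒜 h𝒜 ℬ hℬ
  have hπt (t : k) (c) : (Qt t).chart c ≫ fiberι g t ≫ π =
      Spec.map (CommRingCat.ofHom Polynomial.C) ≫ 𝒜.chart c.1 :=
    fiber_chart_projection t c (hι t c) (hQ ▸ hπ c)
  have hθ (i) : (atiyahData p W 1).θ i = (chartRing W i).val := rfl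
  have ha : (atiyahData p W 1).a = atiyahFun W := rfl
  generalize atiyahData p W 1 = D at *
  obtain ⟨K, Δ, Θ, Kf, Δf, Θf, h₁, h₂, h₃, h₄, h₅, h₆, h₇, h₈, h₉, h₁₀, h₁₁⟩ :=
    Q.exists_divisors_family Qt hι hθ ha hsmooth
  exact ⟨E, hEi, e, atiyahExtension 𝒜 ρ hρ, isSmoothProperModel 𝒜 hproper h𝒜,
    not_isSplit_atiyahExtension 𝒜 ρ hρ, S, hSi, hSn, g, hfi, hfn, π, K, Δ, Θ, Kf, Δf, Θf, hsmooth,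
    hproj, h₁, h₂, h₃, h₄, h₅, h₆, h₇, h₈, h₉, h₁₀, h₁₁, hπe,
    fun t ht => (Qt t).isProjectivization 𝒜 h𝒜 _ (hπt t) ρ hρ hθ ht ha,
    (Qt 0).exists_iso_product 𝒜 h𝒜 _ (hπt 0) rfl⟩
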